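/- Let $M$ be a compact (Hausdorff) smooth manifold with a foliation $\mathcal F$ of codimension $2n$, and let $\omega$ be a transversely symplectic form for $\mathcal F$: a closed 2-form whose kernel at each $x\in M$ is the tangent space at $x$ to the leaf through $x$. Let $$\Omega_{\mathrm{bas}}=\{\alpha\in\Omega(M)\mid \iota(X)\alpha=\mathcal L(X)\alpha=0\text{ for all vector fields }X\text{ tangent to the leaves}\}$$ be the complex of basic forms and $H^*(M,\mathcal F)$ its cohomology with respect to $d$. Assume the transverse hard Lefschetz property: for each $0\le k\le n$ the map $H^{n-k}(M,\mathcal F)\to H^{n+k}(M,\mathcal F)$, $[\alpha]\mapsto[\alpha\wedge\omega^k]$, is an isomorphism. Let $B$ be the bilinear pairing on basic $p$-forms induced by $\omega$ (on 1-forms, $B(\lambda,\mu)=\mu(\lambda^\sharp)$ with $\iota(\lambda^\sharp)\omega=\lambda$, extended to $p$-forms by determinants), let $\star$ be the symplectic Hodge star, defined by $\beta\wedge\star\alpha=B(\alpha,\beta)\,\omega^n/n!$ for basic $p$-forms $\alpha,\beta$, and let $\delta\alpha=(-1)^{p+1}\star d\star\alpha$ for a basic $p$-form $\alpha$. Let $G$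 be a compact connected Lie group with Lie algebra $\mathfrak g$, acting smoothly on $M$ in a Hamiltonian fashion: the action preserves $\omega$, and there is a smooth equivariant map $\Phi:M\to\mathfrak g^*$ with $d\langle\Phi,\xi\rangle=\iota(\xi_M)\omega$ for all $\xi\in\mathfrak g$, where $\xi_M$ is the fundamental vector field induced by $\xi$. Let $$\Omega_{G,\mathrm{bas}}=[S(\mathfrak g^*)\otimes\Omega_{\mathrm{bas}}]^G$$ be the space of equivariant basic forms, regarded as $G$-equivariant polynomial maps $\mathfrak g\to\Omega_{\mathrm{bas}}$, with $(d_G\alpha)(\xi)=d(\alpha(\xi))-\iota(\xi_M)\alpha(\xi)$ and $(\delta\alpha)(\xi)=\delta(\alpha(\xi))$. Let $\alpha\in\Omega_{G,\mathrm{bas}}$ satisfy $d_G\alpha=0$ and $\delta\alpha=0$. If $\alpha$ is $d_G$-exact (that is, $\alpha=d_G\gamma$ for some $\gamma\in\Omega_{G,\mathrm{bas}}$) or $\delta$-exact (that is, $\alpha=\delta\gamma$ for some $\gamma\in\Omega_{G,\mathrm{bas}}$), then there exists $\beta\in\Omega_{G,\mathrm{bas}}$ such that $\alpha=d_G\delta\beta$.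 -/

import Mathlib

open scoped Manifold ContDiff

noncomputable section

/-! ### Exterior algebra on one vector space -/

section Pointwise

variable {V : Type*} [AddCommGroup V] [Module ℝ V] [TopologicalSpace V]

/-- The `(p + q)`-linear map `v ↦ α (v₁, …, v_p) * β (v_{p+1}, …, v_{p+q})`. -/
def tensorForm {p q : ℕ} (α : V [⋀^Fin p]→L[ℝ] ℝ) (β : V [⋀^Fin q]→L[ℝ] ℝ) :
    ContinuousMultilinearMap ℝ (fun _ : Fin (p + q) => V) ℝ where
  toMultilinearMap := (LinearMap.mul' ℝ ℝ).compMultilinearMap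
    ((MultilinearMap.domCoprod α.toMultilinearMap β.toMultilinearMap).domDomCongr finSumFinEquiv)
  cont := by
    have h : Continuous fun v : Fin (p + q) → V =>
        α (fun i => v (Fin.castAdd q i)) * β (fun j => v (Fin.natAdd p j)) :=
      (α.cont.comp (by fun_prop)).mul (β.cont.comp (by fun_prop))
    convert h using 1
    funext v
    simp

/-- The wedge product, normalised so that `(λ ∧ μ) (u, v) = λ u * μ v - λ v * μ u` for covectors:
`(α ∧ β) (v) = (p! q!)⁻¹ ∑_τ sign τ • α (v_{τ 1}, …, v_{τ p}) * β (v_{τ (p+1)}, …, v_{τ (p+q)})`. -/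
def wedge {p q : ℕ} (α : V [⋀^Fin p]→L[ℝ] ℝ) (β : V [⋀^Fin q]→L[ℝ] ℝ) :
    V [⋀^Fin (p + q)]→L[ℝ] ℝ :=
  ((p.factorial * q.factorial : ℝ)⁻¹) •
    ContinuousMultilinearMap.alternatization (tensorForm α β)

/-- The power `w ∧ ⋯ ∧ w` (`n` factors) of a 2-form. -/
def wedgePow (w : V [⋀^Fin 2]→L[ℝ] ℝ) : (n : ℕ) → V [⋀^Fin (2 * n)]→L[ℝ] ℝ
  | 0 => ContinuousAlternatingMap.constOfIsEmpty ℝ V (Fin 0) 1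
  | n + 1 => wedge (wedgePow w n) w

/-- The contraction `ι(u)α = α (u, ·, …, ·)`. -/
def contract {k : ℕ} (u : V) (α : V [⋀^Fin (k + 1)]→L[ℝ] ℝ) : V [⋀^Fin k]→L[ℝ] ℝ where
  toMultilinearMap := (α.toAlternatingMap.curryLeft u).toMultilinearMap
  map_eq_zero_of_eq' := (α.toAlternatingMap.curryLeft u).map_eq_zero_of_eq'
  cont := by
    have h : Continuous fun v : Fin k → V => α (Matrix.vecCons u v) :=
      α.cont.comp (continuous_const.matrixVecCons continuous_id)
    exact h

/-- `α` is horizontal for `w` if it is annihilated by contraction with the kernel of `w`. -/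
def IsHorizontal (w : V [⋀^Fin 2]→L[ℝ] ℝ) : (k : ℕ) → (V [⋀^Fin k]→L[ℝ] ℝ) → Prop
  | 0, _ => True
  | _ + 1, α => ∀ u : V, (∀ v : V, w ![u, v] = 0) → contract u α = 0

/-- Two `2n`-tuples `e`, `e'` with `w (e' i, e j) = δ_ij`. When `w` has rank `2n`, each of them maps
to a basis of `V / ker w`, and `e' i` represents the vector dual under `w` to the `i`-th element of
the basis dual to `e`. -/
def IsDualPair (w : V [⋀^Fin 2]→L[ℝ] ℝ) (n : ℕ) (e e' : Fin (2 * n) → V) : Prop :=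
  ∀ i j, w ![e' i, e j] = if i = j then 1 else 0

open Classical in
/-- The bilinear pairing on horizontal `p`-covectors induced by a 2-form `w` of rank `2n`: on
covectors, `B (λ, μ) = μ (λ♯)`, where `ι(λ♯) w = λ`, and `B` of `λ₁ ∧ ⋯ ∧ λ_p` and `μ₁ ∧ ⋯ ∧ μ_p` is
the determinant of `(B (λ_a, μ_b))`. It is written in any dual pair `e`, `e'`, as
`(p!)⁻¹ ∑ α (e_{i₁}, …, e_{i_p}) β (e'_{i₁}, …, e'_{i_p})`; the value does not depend on the pair. -/
def symplecticPairing (w : V [⋀^Fin 2]→L[ℝ] ℝ) (n p : ℕ) (α β : V [⋀^Fin p]→L[ℝ] ℝ) : ℝ :=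
  if h : ∃ f : (Fin (2 * n) → V) × (Fin (2 * n) → V), IsDualPair w n f.1 f.2 then
    (p.factorial : ℝ)⁻¹ * ∑ i : Fin p → Fin (2 * n),
      α (fun a => h.choose.1 (i a)) * β (fun a => h.choose.2 (i a))
  else 0

/-- `γ` is the symplectic Hodge star of the horizontal `p`-covector `α`: it is horizontal of degree
`q = 2n - p`, and `β ∧ γ = B (α, β) w ^ n / n!` for every horizontal `p`-covector `β`. -/
def IsSymplecticStar (w : V [⋀^Fin 2]→L[ℝ] ℝ) (n : ℕ) {p q : ℕ} (h : p + q = 2 * n)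
    (α : V [⋀^Fin p]→L[ℝ] ℝ) (γ : V [⋀^Fin q]→L[ℝ] ℝ) : Prop :=
  IsHorizontal w q γ ∧ ∀ β : V [⋀^Fin p]→L[ℝ] ℝ, IsHorizontal w p β →
    ∀ v : Fin (2 * n) → V, wedge β γ (fun i => v (Fin.cast h i)) =
      symplecticPairing w n p α β * (wedgePow w n v / (n.factorial : ℝ))

open Classical in
/-- The symplectic Hodge star on horizontal `p`-covectors; the covector characterised by
`IsSymplecticStar` exists and is unique when `w` has rank `2n`. -/
def symplecticStar (w : V [⋀^Fin 2]→L[ℝ] ℝ) (n : ℕ) {p q : ℕ} (h : p + q = 2 * n)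
    (α : V [⋀^Fin p]→L[ℝ] ℝ) : V [⋀^Fin q]→L[ℝ] ℝ :=
  if hγ : ∃ γ : V [⋀^Fin q]→L[ℝ] ℝ, IsSymplecticStar w n h α γ then hγ.choose else 0

end Pointwise

/-! ### Differential forms on a manifold

The manifold `M` is modelled on the finite-dimensional real vector space `E`. -/

section Manifold

variable (E : Type*) [NormedAddCommGroup E] [NormedSpace ℝ E]
  (M : Type*) [TopologicalSpace M] [ChartedSpace E M]

/-- Fields of alternating `k`-linear forms on the tangent spaces (smoothness is `IsSmoothForm`). -/
abbrev KForm (k : ℕ) : Type _ :=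
  (x : M) → (TangentSpace 𝓘(ℝ, E) x) [⋀^Fin k]→L[ℝ] ℝ

/-- Forms of mixed degree: `α k` is the component of degree `k`. The components of degree greater
than `dim E` vanish, so that for finite-dimensional `E` the product is the direct sum. -/
abbrev MForm : Type _ := (k : ℕ) → KForm E M k

instance : AddCommGroup (MForm E M) := Pi.addCommGroup

instance : Module ℝ (MForm E M) := Pi.module _ _ _

/-- Vector fields (smoothness is `IsSmoothField`). -/
abbrev VField : Type _ := (x : M) → TangentSpace 𝓘(ℝ, E) x

variable {E M}

/-- Smooth vector fields. -/
def IsSmoothField [IsManifold 𝓘(ℝ, E) ∞ M] (X : VField E M) : Prop :=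
  ContMDiff 𝓘(ℝ, E) 𝓘(ℝ, E).tangent ∞ (fun x => (⟨x, X x⟩ : TangentBundle 𝓘(ℝ, E) M))

/-- The expression of a `k`-form in the chart at `x₀`, that is, its pull-back along the inverse of
the chart. It is meaningful on the target of the chart. -/
def chartForm {k : ℕ} (α : KForm E M k) (x₀ : M) (y : E) : E [⋀^Fin k]→L[ℝ] ℝ :=
  (α ((chartAt E x₀).symm y)).compContinuousLinearMap
    (mfderiv 𝓘(ℝ, E) 𝓘(ℝ, E) (chartAt E x₀).symm y)

/-- Smooth `k`-forms: smooth in each chart. -/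
def IsSmoothForm {k : ℕ} (α : KForm E M k) : Prop :=
  ∀ x₀ : M, ContDiffOn ℝ ∞ (chartForm α x₀) (chartAt E x₀).target

/-- The exterior derivative of a `k`-form, computed at `x` in the chart at `x`. -/
def extD {k : ℕ} (α : KForm E M k) : KForm E M (k + 1) := fun x =>
  (extDeriv (chartForm α x) (chartAt E x x)).compContinuousLinearMap
    (mfderiv 𝓘(ℝ, E) 𝓘(ℝ, E) (chartAt E x) x)

/-- The pull-back of forms along a map `f : M → M`. -/
def pullbackForm (f : M → M) (α : MForm E M) : MForm E M := fun k x =>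
  (α k (f x)).compContinuousLinearMap (mfderiv 𝓘(ℝ, E) 𝓘(ℝ, E) f x)

/-- The exterior derivative on `Ω(M)`. -/
def extDer (α : MForm E M) : MForm E M
  | 0 => 0
  | k + 1 => extD (α k)

/-- The contraction `ι(X)` on `Ω(M)`. -/
def interior' (X : VField E M) (α : MForm E M) : MForm E M :=
  fun k x => contract (X x) (α (k + 1) x)

/-- The Lie derivative of forms, by the formula of Cartan. -/
def lieDer (X : VField E M) (α : MForm E M) : MForm E M :=
  extDer (interior' X α) + interior' X (extDer α)

/-- `L α = α ∧ σ`. -/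
def lefschetzL (σ : KForm E M 2) (α : MForm E M) : MForm E M
  | 0 => 0
  | 1 => 0
  | k + 2 => fun x => wedge (α k x) (σ x)

/-- The symplectic Hodge star on basic forms, for a 2-form `σ` of constant rank `2n`; basic forms of
degree greater than `2n` vanish. -/
def hodgeStar (n : ℕ) (σ : KForm E M 2) (α : MForm E M) : MForm E M := fun q x =>
  if h : q ≤ 2 * n then
    symplecticStar (σ x) n (p := 2 * n - q) (q := q) (Nat.sub_add_cancel h) (α (2 * n - q) x)
  else 0

/-- `δ α = (-1) ^ (p + 1) ⋆ d ⋆ α` for `α` of degree `p`. The component of degree `k` of `δ α` comes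
from the component of degree `p = k + 1` of `α`. -/
def symplecticDelta (n : ℕ) (σ : KForm E M 2) (α : MForm E M) : MForm E M := fun k =>
  ((-1 : ℝ) ^ ((k + 1) + 1)) • hodgeStar n σ (extDer (hodgeStar n σ α)) k

/-! Linearity facts needed for the spaces of forms below. -/

theorem chartForm_add {k : ℕ} (α β : KForm E M k) (x₀ : M) :
    chartForm (α + β) x₀ = chartForm α x₀ + chartForm β x₀ := by
  funext y; ext v; rfl

theorem chartForm_smul {k : ℕ} (c : ℝ) (α : KForm E M k) (x₀ : M) :
    chartForm (c • α) x₀ = c • chartForm α x₀ := by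
  funext y; ext v; rfl

theorem chartForm_zero {k : ℕ} (x₀ : M) :
    chartForm (0 : KForm E M k) x₀ = 0 := by
  funext y; ext v; rfl

variable (E M) in
/-- The space `Ω(M)` of smooth forms. -/
def smoothForms : Submodule ℝ (MForm E M) where
  carrier := {α | ∀ k, IsSmoothForm (α k)}
  add_mem' {α β} hα hβ k x₀ := by
    rw [Pi.add_apply, chartForm_add]
    exact (hα k x₀).add (hβ k x₀)
  zero_mem' k x₀ := by
    rw [Pi.zero_apply, chartForm_zero]
    exact contDiffOn_const
  smul_mem' c α hα k x₀ := by
    rw [Pi.smul_apply, chartForm_smul]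
    exact (hα k x₀).const_smul c

theorem IsSmoothForm.differentiableAt {k : ℕ} {α : KForm E M k} (h : IsSmoothForm α) (x : M) :
    DifferentiableAt ℝ (chartForm α x) (chartAt E x x) :=
  ((h x).differentiableOn (by simp)).differentiableAt
    ((chartAt E x).open_target.mem_nhds (mem_chart_target E x))

theorem extDer_add {α β : MForm E M} (hα : α ∈ smoothForms E M) (hβ : β ∈ smoothForms E M) :
    extDer (α + β) = extDer α + extDer β := by
  funext k
  cases k with
  | zero => exact (add_zero (0 : KForm E M 0)).symm
  | succ k =>
    funext x
    change (extDeriv (chartForm (α k + β k) x) _).compContinuousLinearMap _ = _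
    rw [chartForm_add, extDeriv_add ((hα k).differentiableAt x) ((hβ k).differentiableAt x)]
    rfl

theorem extDer_smul (c : ℝ) (α : MForm E M) : extDer (c • α) = c • extDer α := by
  funext k
  cases k with
  | zero => exact (smul_zero c).symm
  | succ k =>
    funext x
    change (extDeriv (chartForm (c • α k) x) _).compContinuousLinearMap _ = _
    rw [chartForm_smul, extDeriv_smul]
    rfl

theorem extDer_zero : extDer (0 : MForm E M) = 0 := by
  simpa using extDer_smul (0 : ℝ) (0 : MForm E M)

theorem interior'_add (X : VField E M) (α β : MForm E M) :
    interior' X (α + β) = interior' X α + interior' X β := by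
  funext k x; ext v; rfl

theorem interior'_smul (X : VField E M) (c : ℝ) (α : MForm E M) :
    interior' X (c • α) = c • interior' X α := by
  funext k x; ext v; rfl

theorem interior'_zero (X : VField E M) : interior' X (0 : MForm E M) = 0 := by
  funext k x; ext v; rfl

/-! ### Foliations, basic forms and basic cohomology -/

variable [IsManifold 𝓘(ℝ, E) ∞ M]

variable (E M) in
/-- A foliation of codimension `q` on `M`, given by its tangent distribution `P`, which is required
to be integrable: around each point there is a smooth chart `φ` in which the leaves are the slices
parallel to a fixed linear subspace `K` of codimension `q`. -/
structure Foliation (q : ℕ) where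
  /-- The tangent space to the leaf through `x`. -/
  P : (x : M) → Submodule ℝ (TangentSpace 𝓘(ℝ, E) x)
  integrable : ∀ x₀ : M, ∃ φ ∈ IsManifold.maximalAtlas 𝓘(ℝ, E) ∞ M, x₀ ∈ φ.source ∧
    ∃ K : Submodule ℝ E, Module.finrank ℝ (E ⧸ K) = q ∧
      ∀ x ∈ φ.source, ∀ v : TangentSpace 𝓘(ℝ, E) x,
        v ∈ P x ↔ (mfderiv 𝓘(ℝ, E) 𝓘(ℝ, E) φ x v : E) ∈ K

variable {q : ℕ}

/-- The smooth vector fields tangent to the leaves. -/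
def Foliation.IsTangentField (F : Foliation E M q) (X : VField E M) : Prop :=
  IsSmoothField X ∧ ∀ x, X x ∈ F.P x

/-- The space `Ω(M, F)` of basic forms. -/
def Foliation.basicForms (F : Foliation E M q) : Submodule ℝ (MForm E M) where
  carrier := {α | α ∈ smoothForms E M ∧
    ∀ X : VField E M, F.IsTangentField X → interior' X α = 0 ∧ lieDer X α = 0}
  add_mem' {α β} hα hβ := by
    refine ⟨add_mem hα.1 hβ.1, fun X hX => ?_⟩
    obtain ⟨a1, a2⟩ := hα.2 X hX
    obtain ⟨b1, b2⟩ := hβ.2 X hX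
    have h : interior' X (α + β) = 0 := by rw [interior'_add, a1, b1, add_zero]
    refine ⟨h, ?_⟩
    rw [lieDer, a1, extDer_zero, zero_add] at a2
    rw [lieDer, b1, extDer_zero, zero_add] at b2
    rw [lieDer, h, extDer_zero, zero_add, extDer_add hα.1 hβ.1, interior'_add, a2, b2, add_zero]
  zero_mem' := by
    refine ⟨zero_mem _, fun X _ => ⟨interior'_zero X, ?_⟩⟩
    rw [lieDer, interior'_zero, extDer_zero, interior'_zero, add_zero]
  smul_mem' c α hα := by
    refine ⟨Submodule.smul_mem _ c hα.1, fun X hX => ?_⟩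
    obtain ⟨a1, a2⟩ := hα.2 X hX
    refine ⟨by rw [interior'_smul, a1, smul_zero], ?_⟩
    rw [lieDer, interior'_smul, extDer_smul, extDer_smul, interior'_smul, ← smul_add, ← lieDer, a2,
      smul_zero]

/-- The exterior derivative as a linear map on basic forms. -/
def Foliation.dBasic (F : Foliation E M q) : F.basicForms →ₗ[ℝ] MForm E M where
  toFun α := extDer α.1
  map_add' α β := extDer_add α.2.1 β.2.1
  map_smul' c α := extDer_smul c α.1

/-- The closed basic forms of degree `k`. -/
def Foliation.closedBasic (F : Foliation E M q) (k : ℕ) : Submodule ℝ (MForm E M) where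
  carrier := {α | α ∈ F.basicForms ∧ extDer α = 0 ∧ ∀ j, j ≠ k → α j = 0}
  add_mem' {α β} hα hβ := by
    refine ⟨add_mem hα.1 hβ.1, ?_, fun j hj => ?_⟩
    · rw [extDer_add hα.1.1 hβ.1.1, hα.2.1, hβ.2.1, add_zero]
    · rw [Pi.add_apply, hα.2.2 j hj, hβ.2.2 j hj, add_zero]
  zero_mem' := ⟨zero_mem _, extDer_zero, fun _ _ => rfl⟩
  smul_mem' c α hα := by
    refine ⟨Submodule.smul_mem _ c hα.1, ?_, fun j hj => ?_⟩
    · rw [extDer_smul, hα.2.1, smul_zero]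
    · rw [Pi.smul_apply, hα.2.2 j hj, smul_zero]

/-- The basic cohomology `H^k(M, F)`: closed basic `k`-forms modulo those of the form `d β` with `β`
basic. -/
abbrev Foliation.basicCohomology (F : Foliation E M q) (k : ℕ) : Type _ :=
  F.closedBasic k ⧸ (LinearMap.range F.dBasic).comap (F.closedBasic k).subtype

/-- `σ` is a transversely symplectic form for `F`: a smooth closed 2-form whose kernel at each point
is the tangent space to the leaf. -/
structure Foliation.IsTransverselySymplectic (F : Foliation E M q) (σ : KForm E M 2) : Prop where
  smooth : IsSmoothForm σ
  closed : extD σ = 0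
  ker_eq : ∀ (x : M) (v : TangentSpace 𝓘(ℝ, E) x), v ∈ F.P x ↔ ∀ u, σ x ![v, u] = 0

/-- The transverse hard Lefschetz property: for `0 ≤ k ≤ n`, the map `[α] ↦ [L^k α]` is an
isomorphism from `H^{n-k}(M, F)` to `H^{n+k}(M, F)`. -/
def Foliation.HardLefschetz {n : ℕ} (F : Foliation E M (2 * n)) (σ : KForm E M 2) : Prop :=
  ∀ k ≤ n, ∃ f : F.basicCohomology (n - k) ≃ₗ[ℝ] F.basicCohomology (n + k),
    ∀ α : F.closedBasic (n - k), ∃ h : (lefschetzL σ)^[k] α.1 ∈ F.closedBasic (n + k),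
      f (Submodule.Quotient.mk α) = Submodule.Quotient.mk ⟨(lefschetzL σ)^[k] α.1, h⟩

end Manifold

/-! ### Hamiltonian actions and the Cartan complex -/

section Action

variable {E : Type*} [NormedAddCommGroup E] [NormedSpace ℝ E]
  {M : Type*} [TopologicalSpace M] [ChartedSpace E M]
  {EG : Type*} [NormedAddCommGroup EG] [NormedSpace ℝ EG]
  {G : Type*} [TopologicalSpace G] [ChartedSpace EG G] [Group G] [MulAction G M]

/-- The adjoint action of `g` on the Lie algebra: the derivative at `1` of `h ↦ g h g⁻¹`. -/
def adjointAction (g : G) (ξ : GroupLieAlgebra 𝓘(ℝ, EG) G) : GroupLieAlgebra 𝓘(ℝ, EG) G :=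
  (mfderiv 𝓘(ℝ, EG) 𝓘(ℝ, EG) (fun h : G => g * h * g⁻¹) 1 ξ : EG)

/-- The fundamental vector field induced by `ξ`, with value at `x` the velocity at `t = 0` of
`exp(-tξ) • x`; with this sign `ξ ↦ ξ_M` is a homomorphism of Lie algebras. -/
def fundamentalField (ξ : GroupLieAlgebra 𝓘(ℝ, EG) G) : VField E M := fun x =>
  -(mfderiv 𝓘(ℝ, EG) 𝓘(ℝ, E) (fun g : G => g • x) 1 ξ : E)

/-- The action of `G` on `(M, F, σ)` is Hamiltonian: each `g` preserves `σ`, and there is a smooth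
equivariant moment map `Φ : M → 𝔤*` with `d⟨Φ, ξ⟩ = ι(ξ_M) σ`. -/
def IsHamiltonian (EG : Type*) [NormedAddCommGroup EG] [NormedSpace ℝ EG]
    (G : Type*) [TopologicalSpace G] [ChartedSpace EG G] [Group G] [MulAction G M]
    (σ : KForm E M 2) : Prop :=
  (∀ (g : G) (x : M), (σ (g • x)).compContinuousLinearMap
      (mfderiv 𝓘(ℝ, E) 𝓘(ℝ, E) (fun y : M => g • y) x) = σ x) ∧
  ∃ Φ : M → Module.Dual ℝ (GroupLieAlgebra 𝓘(ℝ, EG) G),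
    (∀ (g : G) (x : M) (ξ : GroupLieAlgebra 𝓘(ℝ, EG) G),
      Φ (g • x) (adjointAction g ξ) = Φ x ξ) ∧
    ∀ ξ : GroupLieAlgebra 𝓘(ℝ, EG) G,
      ContMDiff 𝓘(ℝ, E) 𝓘(ℝ, ℝ) ∞ (fun x => Φ x ξ) ∧
      ∀ (x : M) (v : TangentSpace 𝓘(ℝ, E) x),
        (mfderiv 𝓘(ℝ, E) 𝓘(ℝ, ℝ) (fun y => Φ y ξ) x v : ℝ) =
          σ x ![fundamentalField ξ x, v]

/-- The algebra `S(𝔤*)` of polynomial functions on `𝔤`, generated by the linear functions. -/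
def polyFunctions (𝔤 : Type*) [AddCommGroup 𝔤] [Module ℝ 𝔤] : Subalgebra ℝ (𝔤 → ℝ) :=
  Algebra.adjoin ℝ (Set.range fun l : Module.Dual ℝ 𝔤 => (l : 𝔤 → ℝ))

/-- The equivariant exterior derivative `(d_G α)(ξ) = d (α ξ) - ι(ξ_M) (α ξ)`. -/
def equivariantD (α : GroupLieAlgebra 𝓘(ℝ, EG) G → MForm E M) :
    GroupLieAlgebra 𝓘(ℝ, EG) G → MForm E M := fun ξ =>
  extDer (α ξ) - interior' (fundamentalField ξ) (α ξ)

/-- The operator `1 ⊗ δ` on equivariant basic forms. -/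
def equivariantDelta (n : ℕ) (σ : KForm E M 2) (α : GroupLieAlgebra 𝓘(ℝ, EG) G → MForm E M) :
    GroupLieAlgebra 𝓘(ℝ, EG) G → MForm E M := fun ξ =>
  symplecticDelta n σ (α ξ)

variable [IsManifold 𝓘(ℝ, E) ∞ M] {q : ℕ}

/-- The polynomial maps from `𝔤` to `Ω(M, F)`: the image of `S(𝔤*) ⊗ Ω(M, F)` in the space of all
maps, `p ⊗ β` being the map `ξ ↦ p(ξ) β`. -/
def Foliation.polyBasicForms (F : Foliation E M q) (𝔤 : Type*) [AddCommGroup 𝔤] [Module ℝ 𝔤] :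
    Submodule ℝ (𝔤 → MForm E M) :=
  Submodule.span ℝ {α | ∃ p ∈ polyFunctions 𝔤, ∃ β ∈ F.basicForms, α = fun ξ => p ξ • β}

/-- `α` is an equivariant basic form, that is, an element of `[S(𝔤*) ⊗ Ω(M, F)]^G`: a polynomial map
from `𝔤` to `Ω(M, F)` with `α (Ad_g ξ) = (g⁻¹)^* α (ξ)`, or equivalently `g^* α (Ad_g ξ) = α (ξ)`. -/
def Foliation.IsEquivariantBasic (F : Foliation E M q)
    (α : GroupLieAlgebra 𝓘(ℝ, EG) G → MForm E M) : Prop :=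
  α ∈ F.polyBasicForms (GroupLieAlgebra 𝓘(ℝ, EG) G) ∧
    ∀ (g : G) (ξ : GroupLieAlgebra 𝓘(ℝ, EG) G),
      pullbackForm (fun x : M => g • x) (α (adjointAction g ξ)) = α ξ

end Action

end

/-! The theorem is the equivariant form of the symplectic `dδ`-lemma, for the forms that are basic
for a foliation which is the null foliation of a closed 2-form `σ`. The operator `δ` is replaced
by a commutator, the argument is carried out for abstract representations of `sl₂`, and the group
enters only through a Cartan formula and an averaging argument.

A form is basic if and only if it and its exterior derivative are annihilated by the kernel of `σ`
(`Foliation.mem_basicForms_iff`). In a foliated chart this means that it is horizontal and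
constant along the leaves, so that the operator `Λ`, contraction with the inverse bivector of `σ`,
preserves basic forms although it is only defined pointwise. Pointwise computations show that `Λ`
and the product `L` with `σ` generate an action of `sl₂` on basic forms (`isLefschetz`), that the
symplectic star is an explicit polynomial in `L` and `Λ` up to sign (`IsFrame.symplecticStar_eq`),
and hence that `δ = [Λ, d]` (`delta_val`).

For a differential on an `sl₂`-module that commutes with `L` and has the hard Lefschetz property
in cohomology, every class has a representative closed for `d` and `δ` (`exists_harmonic`), and
elements that are closed for `d` and `δ` and exact for one of the two are `dδ`-exact
(`delta_eq_d_delta`, `d_eq_d_delta`). The key step concerns a `d`-closed `δ`-exact element of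
degree `k ≤ n`: by induction on the degree it may be made primitive by subtracting a `dδ`-exact
element; then `L ^ (n - k)` of it is a multiple of its star and therefore `d`-exact, and the
element itself is `d`-exact by the hard Lefschetz property.

Let `f` be a Hamiltonian function of `ξ_M`. Since `[Λ, df ∧ ·] = -ι(ξ_M)`, the contraction
`ι(ξ_M)` is the commutator `[f, δ]` (`contraction_val`). It follows that contractions anticommute
with `δ` and map `δ`-closed forms to `δ`-exact ones. An equivariant form `α` satisfies
`𝓛(ξ_M) (α ξ) = 0`, because `α ξ` is invariant under the curve in `G` with velocity `ξ`
(`cartan_of_pullbackForm_eq`), so that `d_G` is a differential. The equivariant lemma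
(`exists_eq_cartanD_delta`) is then proved by induction on the top degree. If `α` is `d_G`-closed
and `δ`-exact, its top component is `d`-closed and `δ`-exact, hence of the form `dδβ`, and
`α - d_G δ β` has smaller degree. If `α = d_G γ` and `δα = 0`, then `γ` is changed by `δ`-exact,
`d_G`-closed and `d_G`-exact forms until its top component disappears.

At each step the primitive `β` has to be an equivariant polynomial family. A linear section of
`dδ` yields a polynomial family, and its average over the compact group `G` is equivariant,
polynomial, and has the same image under `dδ` (`exists_equivariant_lift`). -/

set_option linter.unusedSectionVars false

/-! ### Lefschetz modules -/

section Lefschetz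

variable {X : Type*} [AddCommGroup X] [Module ℝ X]

/-- Submodules `H k` of homogeneous elements of degree `k` and operators `L`, `Λ` of degrees `2` and
`-2` which, together with the degree, generate an action of `sl₂`: `[Λ, L] = n - k` on `H k`. The
weights are bounded because `H k = 0` for `k > 2n`; the sum of the `H k` need not be all of `X`. -/
structure IsLefschetz (n : ℕ) (H : ℕ → Submodule ℝ X) (L Λ : X →ₗ[ℝ] X) : Prop where
  L_mem : ∀ {k x}, x ∈ H k → L x ∈ H (k + 2)
  Λ_mem : ∀ {k x}, x ∈ H (k + 2) → Λ x ∈ H k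
  Λ_low : ∀ {k x}, k < 2 → x ∈ H k → Λ x = 0
  comm : ∀ {k x}, x ∈ H k → Λ (L x) = L (Λ x) + ((n : ℝ) - k) • x
  top : ∀ {k x}, 2 * n < k → x ∈ H k → x = 0

namespace IsLefschetz

variable {n : ℕ} {H : ℕ → Submodule ℝ X} {L Λ : X →ₗ[ℝ] X}

theorem Λ_mem' (h : IsLefschetz n H L Λ) {k : ℕ} {x : X} (hx : x ∈ H k) : Λ x ∈ H (k - 2) := by
  rcases Nat.lt_or_ge k 2 with hk | hk
  · rw [h.Λ_low hk hx]; exact zero_mem _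
  · obtain ⟨m, rfl⟩ := Nat.exists_eq_add_of_le' hk
    exact h.Λ_mem hx

theorem L_pow_mem (h : IsLefschetz n H L Λ) {k : ℕ} {x : X} (hx : x ∈ H k) (j : ℕ) :
    (L ^ j) x ∈ H (k + 2 * j) := by
  induction j with
  | zero => simpa using hx
  | succ j ih =>
    rw [pow_succ', Module.End.mul_apply]
    exact h.L_mem ih

theorem Λ_pow_mem (h : IsLefschetz n H L Λ) {k : ℕ} {x : X} (hx : x ∈ H k) (j : ℕ) :
    (Λ ^ j) x ∈ H (k - 2 * j) := by
  induction j with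
  | zero => simpa using hx
  | succ j ih =>
    rw [pow_succ', Module.End.mul_apply]
    exact h.Λ_mem' ih

theorem Λ_pow_eq_zero (h : IsLefschetz n H L Λ) {k : ℕ} {x : X} (hx : x ∈ H k) :
    (Λ ^ (n + 1)) x = 0 := by
  rcases Nat.lt_or_ge (2 * n) k with hk | hk
  · rw [h.top hk hx, map_zero]
  · rw [pow_succ', Module.End.mul_apply]
    exact h.Λ_low (by omega) (h.Λ_pow_mem hx n)

/-- The commutator of `Λ` with a power of `L`. The last coefficient
vanishes at `j = n - k`, which is why the powers of `L` detect primitive elements. -/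
theorem Λ_L_pow (h : IsLefschetz n H L Λ) {k : ℕ} {x : X} (hx : x ∈ H k) (j : ℕ) :
    Λ ((L ^ (j + 1)) x) = (L ^ (j + 1)) (Λ x) + ((j + 1 : ℝ) * (n - k - j)) • (L ^ j) x := by
  induction j with
  | zero => simp [h.comm hx]
  | succ j ih =>
    rw [pow_succ' L (j + 1), Module.End.mul_apply, h.comm (h.L_pow_mem hx (j + 1)), ih, map_add,
      map_smul, ← Module.End.mul_apply L, ← Module.End.mul_apply L, ← pow_succ', ← pow_succ']
    push_cast
    rw [add_assoc, ← add_smul]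
    congr 2
    ring

/-- `L ^ j` is injective in degree `m` as long as it does not pass beyond the mirror image `2n - m`
of `m`. -/
theorem L_pow_injective (h : IsLefschetz n H L Λ) {m : ℕ} :
    ∀ {x : X}, x ∈ H m → ∀ {j : ℕ}, j + m ≤ n → (L ^ j) x = 0 → x = 0 := by
  induction m using Nat.strong_induction_on with
  | _ m ihm =>
    intro x hx j
    induction j with
    | zero => intro _ h0; simpa using h0
    | succ j ihj =>
      intro hj h0
      have h1 := h.Λ_L_pow hx j
      have hz : Λ x = 0 := by
        rcases Nat.lt_or_ge m 2 with hm | hm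
        · exact h.Λ_low hm hx
        · refine ihm (m - 2) (by omega) (h.Λ_mem' hx) (j := j + 2) (by omega) ?_
          have h2 := congrArg L h1
          rw [h0, map_zero, map_zero, map_add, map_smul, ← Module.End.mul_apply L,
            ← Module.End.mul_apply L, ← pow_succ', ← pow_succ', h0, smul_zero, add_zero] at h2
          exact h2.symm
      rw [h0, hz, map_zero, map_zero, zero_add] at h1
      refine ihj (by omega) ((smul_eq_zero.mp h1.symm).resolve_left ?_)
      have : (m : ℝ) + j + 1 ≤ n := by exact_mod_cast (by omega : m + j + 1 ≤ n)
      exact (mul_pos (by positivity) (by linarith)).ne'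

/-- An element annihilated by `L`, that is, a highest weight vector, is recovered from its images
under powers of `Λ`; the exponent goes up to the distance `m - n` to the middle degree. -/
theorem exists_L_pow_eq_of_L_eq_zero (h : IsLefschetz n H L Λ) {m : ℕ} {y : X} (hy : y ∈ H m)
    (hm : m ≤ 2 * n) (hL : L y = 0) {j : ℕ} (hj : n + j ≤ m) :
    ∃ c : ℝ, y = c • (L ^ j) ((Λ ^ j) y) := by
  have key : ∀ i, 2 * i ≤ m →
      L ((Λ ^ (i + 1)) y) = ((i + 1 : ℝ) * (m - n - i)) • (Λ ^ i) y := by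
    intro i
    induction i with
    | zero =>
      intro _
      have := h.comm hy
      rw [hL, map_zero, eq_comm, add_eq_zero_iff_eq_neg] at this
      simp [this, ← neg_smul]
    | succ i ih =>
      intro hi
      have h1 := h.comm (h.Λ_pow_mem hy (i + 1))
      rw [ih (by omega), map_smul, ← Module.End.mul_apply Λ, ← Module.End.mul_apply Λ, ← pow_succ',
        ← pow_succ', ← sub_eq_iff_eq_add, ← sub_smul] at h1
      rw [← h1, Nat.cast_sub hi]
      congr 1
      push_cast
      ring
  induction j with
  | zero => exact ⟨1, by simp⟩
  | succ j ih =>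
    obtain ⟨c, hc⟩ := ih (by omega)
    have h1 := key j (by omega)
    have hne : ((j + 1 : ℝ) * (m - n - j)) ≠ 0 := by
      have : (n : ℝ) + j + 1 ≤ m := by exact_mod_cast (by omega : n + j + 1 ≤ m)
      exact (mul_pos (by positivity) (by linarith)).ne'
    refine ⟨c * ((j + 1 : ℝ) * (m - n - j))⁻¹, ?_⟩
    rw [pow_succ L, Module.End.mul_apply, h1, map_smul, smul_smul, mul_assoc, inv_mul_cancel₀ hne,
      mul_one, ← hc]

/-- `L ^ j` is surjective onto degree `m` as long as `m - 2j` is not below the mirror image `2n - m`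
of `m`. -/
theorem exists_L_pow_eq (h : IsLefschetz n H L Λ) {m : ℕ} {y : X} (hy : y ∈ H m) {j : ℕ}
    (hj : n + j ≤ m) : ∃ z ∈ H (m - 2 * j), (L ^ j) z = y := by
  induction hd : 2 * n + 1 - m using Nat.strong_induction_on generalizing m j y with
  | _ d ih =>
    rcases Nat.lt_or_ge (2 * n) m with hm | hm
    · exact ⟨0, zero_mem _, by rw [map_zero, h.top hm hy]⟩
    -- by downward induction `y` is in the range of `L ^ j` up to an element annihilated by `L`
    obtain ⟨w, hw, hLw⟩ : ∃ w ∈ H (m - 2 * j), L ((L ^ j) w) = L y := by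
      rcases Nat.lt_or_ge (2 * n) (m + 2) with hm' | hm'
      · exact ⟨0, zero_mem _, by rw [map_zero, map_zero, h.top hm' (h.L_mem hy)]⟩
      · obtain ⟨z, hz, hz'⟩ := ih (2 * n + 1 - (m + 2)) (by omega) (h.L_mem hy) (j := j + 2)
          (by omega) rfl
        refine ⟨L z, ?_, ?_⟩
        · have := h.L_mem hz
          rwa [show m + 2 - 2 * (j + 2) + 2 = m - 2 * j by omega] at this
        · rw [← hz', pow_succ', pow_succ, Module.End.mul_apply, Module.End.mul_apply]
    have hmem : y - (L ^ j) w ∈ H m := by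
      refine sub_mem hy ?_
      have := h.L_pow_mem hw j
      rwa [show m - 2 * j + 2 * j = m by omega] at this
    obtain ⟨c, hc⟩ := h.exists_L_pow_eq_of_L_eq_zero hmem hm (by rw [map_sub, hLw, sub_self]) hj
    refine ⟨w + c • (Λ ^ j) (y - (L ^ j) w), add_mem hw
      (Submodule.smul_mem _ _ (h.Λ_pow_mem hmem j)), ?_⟩
    rw [map_add, map_smul, ← hc, add_sub_cancel]

/-- The two descriptions of primitive elements: the kernel of `L ^ (n - m + 1)` in degree `m ≤ n` is
annihilated by `Λ`. -/
theorem Λ_eq_zero_of_L_pow_eq_zero (h : IsLefschetz n H L Λ) {m : ℕ} (hm : m ≤ n) {x : X}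
    (hx : x ∈ H m) (h1 : (L ^ (n - m + 1)) x = 0) : Λ x = 0 := by
  rcases Nat.lt_or_ge m 2 with h2 | h2
  · exact h.Λ_low h2 hx
  refine h.L_pow_injective (h.Λ_mem' hx) (j := n - m + 1) (by omega) ?_
  have h3 := h.Λ_L_pow hx (n - m)
  have h4 : ((n : ℝ) - m - (n - m : ℕ)) = 0 := by
    rw [Nat.cast_sub hm]; ring
  rw [h1, map_zero, h4, mul_zero, zero_smul, add_zero] at h3
  exact h3.symm

/-- The first step of the primitive decomposition. -/
theorem exists_primitive_add (h : IsLefschetz n H L Λ) {m : ℕ} (hm : m ≤ n) {x : X} (hx : x ∈ H m) :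
    ∃ x₀ x' : X, x₀ ∈ H m ∧ Λ x₀ = 0 ∧ (L ^ (n - m + 1)) x₀ = 0 ∧ x = x₀ + L x' ∧
      (x' = 0 ∨ ∃ m', m = m' + 2 ∧ x' ∈ H m') := by
  rcases Nat.lt_or_ge m 2 with h2 | h2
  · exact ⟨x, 0, hx, h.Λ_low h2 hx, h.top (by omega) (h.L_pow_mem hx _), by simp, Or.inl rfl⟩
  obtain ⟨m', rfl⟩ := Nat.exists_eq_add_of_le' h2
  obtain ⟨x', hx', hxx⟩ := h.exists_L_pow_eq (h.L_pow_mem hx (n - (m' + 2) + 1)) (j := n - m')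
    (by omega)
  rw [show m' + 2 + 2 * (n - (m' + 2) + 1) - 2 * (n - m') = m' by omega] at hx'
  have h0 : x - L x' ∈ H (m' + 2) := sub_mem hx (h.L_mem hx')
  have h1 : (L ^ (n - (m' + 2) + 1)) (x - L x') = 0 := by
    rw [map_sub, ← hxx, ← Module.End.mul_apply, ← pow_succ,
      show n - (m' + 2) + 1 + 1 = n - m' by omega, sub_self]
  exact ⟨x - L x', x', h0, h.Λ_eq_zero_of_L_pow_eq_zero hm h0 h1, h1, by abel,
    Or.inr ⟨m', rfl, hx'⟩⟩

/-- Homogeneous elements are sums of elements obtained from primitive ones by applying `L`. -/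
theorem induction_on (h : IsLefschetz n H L Λ) {P : X → Prop}
    (prim : ∀ m ≤ n, ∀ x ∈ H m, Λ x = 0 → (L ^ (n - m + 1)) x = 0 → P x)
    (add : ∀ x y, P x → P y → P (x + y)) (lef : ∀ k, ∀ x ∈ H k, P x → P (L x))
    {k : ℕ} {x : X} (hx : x ∈ H k) : P x := by
  have low : ∀ m, m ≤ n → ∀ x ∈ H m, P x := by
    intro m
    induction m using Nat.strong_induction_on with
    | _ m ih =>
      intro hm x hx
      obtain ⟨x₀, x', h0, h1, h2, rfl, h3⟩ := h.exists_primitive_add hm hx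
      have hp := prim m hm x₀ h0 h1 h2
      rcases h3 with rfl | ⟨m', rfl, hx'⟩
      · simpa using hp
      · exact add _ _ hp (lef m' _ hx' (ih m' (by omega) (by omega) _ hx'))
  rcases Nat.lt_or_ge n k with hk | hk
  · obtain ⟨z, hz, rfl⟩ := h.exists_L_pow_eq hx (j := k - n) (by omega)
    rcases Nat.lt_or_ge (2 * n) k with hk2 | hk2
    · rw [h.top hk2 hx]
      exact low 0 (by omega) 0 (zero_mem _)
    have hPz := low _ (by omega) z hz
    clear hx
    induction k - n with
    | zero => simpa using hPz
    | succ j ih =>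
      rw [pow_succ', Module.End.mul_apply]
      exact lef _ _ (h.L_pow_mem hz j) ih
  · exact low k hk x hx

/-- A map of Lefschetz modules that commutes with `L` and strictly lowers the degree is zero: it
kills a primitive element `x` of degree `m`, because `L ^ (n - m + 1)` kills `x` and is injective in
all degrees below `m`. -/
theorem eq_zero_of_commute {X' : Type*} [AddCommGroup X'] [Module ℝ X'] {H' : ℕ → Submodule ℝ X'}
    {L' Λ' : X' →ₗ[ℝ] X'} (h : IsLefschetz n H L Λ) (h' : IsLefschetz n H' L' Λ') (Y : X →ₗ[ℝ] X')
    (hY : ∀ k, ∀ x ∈ H k, Y (L x) = L' (Y x))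
    (hdeg : ∀ k, ∀ x ∈ H k, Y x = 0 ∨ ∃ j < k, Y x ∈ H' j) {k : ℕ} {x : X} (hx : x ∈ H k) :
    Y x = 0 := by
  refine h.induction_on (P := fun x => Y x = 0) ?_ ?_ ?_ hx
  · intro m hm x hx _ hLx
    rcases hdeg m x hx with h0 | ⟨j, hj, hmem⟩
    · exact h0
    refine h'.L_pow_injective hmem (j := n - m + 1) (by omega) ?_
    have : ∀ i, (L' ^ i) (Y x) = Y ((L ^ i) x) := by
      intro i
      induction i with
      | zero => simp
      | succ i ih =>
        rw [pow_succ', pow_succ', Module.End.mul_apply, Module.End.mul_apply, ih,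
          hY _ _ (h.L_pow_mem hx i)]
    rw [this, hLx, map_zero]
  · intro x y h1 h2
    rw [map_add, h1, h2, add_zero]
  · intro k x hx h1
    rw [hY k x hx, h1, map_zero]

/-- `L Λ + c` is invertible in the degrees where the eigenvalues of `L Λ` are nonnegative. -/
theorem exists_L_Λ_add_smul_eq (h : IsLefschetz n H L Λ) {m : ℕ} :
    ∀ {c : ℝ}, 0 < c → m ≤ n + 2 → ∀ {y : X}, y ∈ H m → ∃ z ∈ H m, L (Λ z) + c • z = y := by
  induction m using Nat.strong_induction_on with
  | _ m ih =>
    intro c hc hm y hy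
    rcases Nat.lt_or_ge m 2 with h2 | h2
    · refine ⟨c⁻¹ • y, Submodule.smul_mem _ _ hy, ?_⟩
      rw [map_smul, h.Λ_low h2 hy, smul_zero, map_zero, zero_add, smul_smul,
        mul_inv_cancel₀ hc.ne', one_smul]
    obtain ⟨m', rfl⟩ := Nat.exists_eq_add_of_le' h2
    have hm' : (m' : ℝ) ≤ n := by exact_mod_cast (by omega : m' ≤ n)
    obtain ⟨u, hu, hu'⟩ := ih m' (by omega) (c := (n - m') + c) (by linarith) (by omega)
      (h.Λ_mem hy)
    refine ⟨c⁻¹ • (y - L u), Submodule.smul_mem _ _ (sub_mem hy (h.L_mem hu)), ?_⟩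
    have e : Λ (y - L u) = c • u := by
      rw [map_sub, h.comm hu, ← hu', add_smul]
      abel
    rw [map_smul, e, smul_smul, inv_mul_cancel₀ hc.ne', one_smul, smul_smul, mul_inv_cancel₀ hc.ne',
      one_smul]
    abel

end IsLefschetz

/-- A pair of operators `a`, `b` of degrees `1` and `-1` spanning a two-dimensional representation
of `sl₂` under commutators. -/
structure IsOddPair (H : ℕ → Submodule ℝ X) (L Λ a b : X →ₗ[ℝ] X) : Prop where
  a_mem : ∀ {k x}, x ∈ H k → a x ∈ H (k + 1)
  b_mem : ∀ {k x}, x ∈ H (k + 1) → b x ∈ H k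
  b_low : ∀ {x}, x ∈ H 0 → b x = 0
  Λ_a : ∀ {k x}, x ∈ H k → Λ (a x) = a (Λ x) + b x
  L_a : ∀ {k x}, x ∈ H k → L (a x) = a (L x)
  Λ_b : ∀ {k x}, x ∈ H k → Λ (b x) = b (Λ x)
  L_b : ∀ {k x}, x ∈ H k → L (b x) = b (L x) + a x

/-- The coefficient of `L ^ (n + j - p) Λ ^ j` in `lefschetzStar`. -/
noncomputable def starCoeff (n p j : ℕ) : ℝ :=
  if p ≤ n + j then (-1) ^ j / (j.factorial * (n + j - p).factorial) else 0

theorem starCoeff_succ_succ (n p j : ℕ) :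
    starCoeff n (p + 1) (j + 1) * (j + 1) = -starCoeff n p j := by
  unfold starCoeff
  by_cases h : p ≤ n + j
  · rw [if_pos h, if_pos (by omega), show n + (j + 1) - (p + 1) = n + j - p by omega,
      Nat.factorial_succ]
    push_cast
    field_simp
    ring
  · rw [if_neg h, if_neg (by omega)]
    simp

theorem starCoeff_mul (n p j : ℕ) :
    starCoeff n p j * ((n + j - p : ℕ) : ℝ) = starCoeff n (p + 1) j := by
  unfold starCoeff
  by_cases h : p + 1 ≤ n + j
  · obtain ⟨r, hr⟩ : ∃ r, n + j - p = r + 1 := ⟨n + j - p - 1, by omega⟩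
    rw [if_pos h, if_pos (by omega), show n + j - (p + 1) = r by omega, hr, Nat.factorial_succ]
    push_cast
    field_simp
  · rw [if_neg h, show n + j - p = 0 by omega]
    simp

/-- The operator `∑ (-1)^j / (j! (n - p + j)!) L^(n - p + j) Λ^j` on elements of degree `p`; the sum
is over `j < N` with `p ≤ n + j`. For `N = n + 1` no nonzero term is lost, because `Λ ^ (n + 1) = 0`
on a Lefschetz module, and up to a sign this is the symplectic star. -/
noncomputable def lefschetzStar (L Λ : X →ₗ[ℝ] X) (N n p : ℕ) : X →ₗ[ℝ] X :=
  ∑ j ∈ Finset.range N, starCoeff n p j • (L ^ (n + j - p) * Λ ^ j)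

theorem lefschetzStar_apply (L Λ : X →ₗ[ℝ] X) (N n p : ℕ) (x : X) :
    lefschetzStar L Λ N n p x =
      ∑ j ∈ Finset.range N, starCoeff n p j • (L ^ (n + j - p)) ((Λ ^ j) x) := by
  simp [lefschetzStar, LinearMap.sum_apply]

namespace IsOddPair

variable {n : ℕ} {H : ℕ → Submodule ℝ X} {L Λ a b : X →ₗ[ℝ] X}

theorem L_pow_a (hab : IsOddPair H L Λ a b) (h : IsLefschetz n H L Λ) {k : ℕ} {x : X}
    (hx : x ∈ H k) (j : ℕ) : (L ^ j) (a x) = a ((L ^ j) x) := by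
  induction j with
  | zero => simp
  | succ j ih =>
    rw [pow_succ', Module.End.mul_apply, Module.End.mul_apply, ih, hab.L_a (h.L_pow_mem hx j)]

theorem Λ_pow_b (hab : IsOddPair H L Λ a b) (h : IsLefschetz n H L Λ) {k : ℕ} {x : X}
    (hx : x ∈ H k) (j : ℕ) : (Λ ^ j) (b x) = b ((Λ ^ j) x) := by
  induction j with
  | zero => simp
  | succ j ih =>
    rw [pow_succ', Module.End.mul_apply, Module.End.mul_apply, ih, hab.Λ_b (h.Λ_pow_mem hx j)]

theorem Λ_pow_a (hab : IsOddPair H L Λ a b) (h : IsLefschetz n H L Λ) {k : ℕ} {x : X}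
    (hx : x ∈ H k) (j : ℕ) :
    (Λ ^ (j + 1)) (a x) = a ((Λ ^ (j + 1)) x) + (j + 1 : ℝ) • b ((Λ ^ j) x) := by
  induction j with
  | zero => simp [hab.Λ_a hx]
  | succ j ih =>
    rw [pow_succ' Λ (j + 1), Module.End.mul_apply, ih, map_add, map_smul,
      hab.Λ_a (h.Λ_pow_mem hx (j + 1)), hab.Λ_b (h.Λ_pow_mem hx j), Module.End.mul_apply,
      ← Module.End.mul_apply Λ, ← pow_succ', ← Module.End.mul_apply Λ, ← pow_succ']
    push_cast
    rw [add_assoc, add_smul (j + 1 : ℝ) 1, one_smul, add_comm (b _)]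

theorem L_pow_b (hab : IsOddPair H L Λ a b) (h : IsLefschetz n H L Λ) {k : ℕ} {x : X}
    (hx : x ∈ H k) (j : ℕ) :
    (L ^ j) (b x) = b ((L ^ j) x) + (j : ℝ) • a ((L ^ (j - 1)) x) := by
  induction j with
  | zero => simp
  | succ j ih =>
    rw [pow_succ', Module.End.mul_apply, ih, map_add, map_smul, hab.L_b (h.L_pow_mem hx j),
      hab.L_a (h.L_pow_mem hx _), Module.End.mul_apply, add_assoc]
    congr 1
    rcases j with _ | j
    · simp
    · rw [Nat.add_sub_cancel, Nat.add_sub_cancel, ← Module.End.mul_apply L, ← pow_succ']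
      push_cast
      rw [add_smul (j + 1 : ℝ) 1, one_smul, add_comm]

/-- The star exchanges the two members of an odd pair. -/
theorem star_a (hab : IsOddPair H L Λ a b) (h : IsLefschetz n H L Λ) (ν : ℕ) {p : ℕ} {x : X}
    (hx : x ∈ H p) :
    lefschetzStar L Λ (n + 1) ν (p + 1) (a x) = -b (lefschetzStar L Λ (n + 1) ν p x) := by
  rw [lefschetzStar_apply, lefschetzStar_apply]
  -- Only powers of `Λ` up to the index of summation occur on both sides; compare partial sums.
  set A : ℕ → X := fun j => starCoeff ν (p + 1) j • a ((L ^ (ν + j - (p + 1))) ((Λ ^ j) x)) with hA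
  have key : ∀ N, ∑ j ∈ Finset.range (N + 1),
      starCoeff ν (p + 1) j • (L ^ (ν + j - (p + 1))) ((Λ ^ j) (a x)) =
      A N - b (∑ j ∈ Finset.range N, starCoeff ν p j • (L ^ (ν + j - p)) ((Λ ^ j) x)) := by
    intro N
    induction N with
    | zero => simp [hA, hab.L_pow_a h hx]
    | succ N ih =>
      rw [Finset.sum_range_succ, ih, Finset.sum_range_succ, map_add, hab.Λ_pow_a h hx, map_add,
        map_smul, hab.L_pow_a h (h.Λ_pow_mem hx _), smul_add, smul_smul,
        starCoeff_succ_succ, show ν + (N + 1) - (p + 1) = ν + N - p by omega,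
        hab.L_pow_b h (h.Λ_pow_mem hx _), smul_add, smul_smul, neg_mul, starCoeff_mul, neg_smul,
        neg_smul, map_smul]
      simp only [hA]
      rw [show ν + (N + 1) - (p + 1) = ν + N - p by omega,
        show ν + N - p - 1 = ν + N - (p + 1) by omega]
      abel
  have h1 := key (n + 1)
  rw [Finset.sum_range_succ, h.Λ_pow_eq_zero (hab.a_mem hx)] at h1
  simp only [hA, h.Λ_pow_eq_zero hx, map_zero, smul_zero, add_zero, zero_sub] at h1
  exact h1

/-- The counterpart of `star_a`. The error term is the star for `n + 1` in place of `n`; it vanishes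
on the horizontal forms of a vector space. -/
theorem star_b (hab : IsOddPair H L Λ a b) (h : IsLefschetz n H L Λ) (ν : ℕ) {p : ℕ} {x : X}
    (hx : x ∈ H (p + 1)) :
    lefschetzStar L Λ (n + 1) ν p (b x) = a (lefschetzStar L Λ (n + 1) ν (p + 1) x) +
      b (lefschetzStar L Λ (n + 1) (ν + 1) (p + 1) x) := by
  simp only [lefschetzStar_apply, map_sum, map_smul]
  rw [← Finset.sum_add_distrib]
  refine Finset.sum_congr rfl fun j _ => ?_
  have e : starCoeff (ν + 1) (p + 1) j = starCoeff ν p j := by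
    unfold starCoeff
    rw [show ν + 1 + j - (p + 1) = ν + j - p by omega]
    by_cases hp : p ≤ ν + j
    · rw [if_pos hp, if_pos (by omega)]
    · rw [if_neg hp, if_neg (by omega)]
  rw [hab.Λ_pow_b h hx, hab.L_pow_b h (h.Λ_pow_mem hx _), smul_add, smul_smul, starCoeff_mul, e,
    show ν + 1 + j - (p + 1) = ν + j - p by omega,
    show ν + j - p - 1 = ν + j - (p + 1) by omega, add_comm]

end IsOddPair

namespace IsLefschetz

variable {n : ℕ} {H : ℕ → Submodule ℝ X} {L Λ : X →ₗ[ℝ] X}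

theorem Λ_pow_eq_zero_of_lt (h : IsLefschetz n H L Λ) {k j : ℕ} (hj : k < 2 * j) {x : X}
    (hx : x ∈ H k) : (Λ ^ j) x = 0 := by
  obtain ⟨i, rfl⟩ : ∃ i, j = i + 1 := ⟨j - 1, by omega⟩
  rw [pow_succ', Module.End.mul_apply]
  exact h.Λ_low (by omega) (h.Λ_pow_mem hx i)

theorem star_mem (h : IsLefschetz n H L Λ) {p : ℕ} {x : X} (hx : x ∈ H p) :
    lefschetzStar L Λ (n + 1) n p x ∈ H (2 * n - p) := by
  rcases Nat.lt_or_ge (2 * n) p with hp | hp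
  · rw [h.top hp hx, map_zero]; exact zero_mem _
  rw [lefschetzStar_apply]
  refine Submodule.sum_mem _ fun j _ => ?_
  rcases Nat.lt_or_ge p (2 * j) with hj | hj
  · rw [h.Λ_pow_eq_zero_of_lt hj hx, map_zero, smul_zero]; exact zero_mem _
  rcases Nat.lt_or_ge (n + j) p with hj' | hj'
  · rw [starCoeff, if_neg (by omega), zero_smul]; exact zero_mem _
  refine Submodule.smul_mem _ _ ?_
  have := h.L_pow_mem (h.Λ_pow_mem hx j) (n + j - p)
  rwa [show p - 2 * j + 2 * (n + j - p) = 2 * n - p by omega] at this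

/-- On primitive elements the star is a multiple of a power of `L`. -/
theorem star_of_Λ_eq_zero {p : ℕ} {x : X} (hp : p ≤ n) (hΛ : Λ x = 0) :
    lefschetzStar L Λ (n + 1) n p x = ((n - p).factorial : ℝ)⁻¹ • (L ^ (n - p)) x := by
  rw [lefschetzStar_apply, Finset.sum_range_succ', Finset.sum_eq_zero]
  · simp [starCoeff, hp]
  · intro j _
    rw [pow_succ, Module.End.mul_apply, hΛ, map_zero, map_zero, smul_zero]

end IsLefschetz

end Lefschetz

/-! ### The `dδ`-lemma -/

section LefschetzComplex

variable {X : Type*} [AddCommGroup X] [Module ℝ X]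

/-- `x` is of the form `d y`, where `y` has degree one less than the degree `k` of `x`. -/
def IsGradedExact (H : ℕ → Submodule ℝ X) (d : X →ₗ[ℝ] X) (k : ℕ) (x : X) : Prop :=
  x = 0 ∨ ∃ j, k = j + 1 ∧ ∃ y ∈ H j, x = d y

theorem IsGradedExact.add {H : ℕ → Submodule ℝ X} {d : X →ₗ[ℝ] X} {k : ℕ} {x y : X}
    (hx : IsGradedExact H d k x) (hy : IsGradedExact H d k y) : IsGradedExact H d k (x + y) := by
  rcases hx with rfl | ⟨j, rfl, u, hu, rfl⟩
  · rwa [zero_add]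
  rcases hy with rfl | ⟨i, hi, v, hv, rfl⟩
  · rw [add_zero]; exact Or.inr ⟨j, rfl, u, hu, rfl⟩
  obtain rfl : j = i := by omega
  exact Or.inr ⟨j, rfl, u + v, add_mem hu hv, (map_add d u v).symm⟩

/-- A Lefschetz module with a differential that commutes with `L`, such that `lefschetzStar` is an
involution up to sign. -/
structure IsLefschetzComplex (n : ℕ) (H : ℕ → Submodule ℝ X) (L Λ d : X →ₗ[ℝ] X) : Prop
    extends IsLefschetz n H L Λ where
  d_mem : ∀ {k x}, x ∈ H k → d x ∈ H (k + 1)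
  d_d : ∀ x, d (d x) = 0
  L_d : ∀ {k x}, x ∈ H k → L (d x) = d (L x)
  star_star : ∀ {p x}, x ∈ H p → p ≤ 2 * n → lefschetzStar L Λ (n + 1) n (2 * n - p)
    (lefschetzStar L Λ (n + 1) n p x) = (-1 : ℝ) ^ (n + p) • x

/-- The operator `δ = [Λ, d]`. -/
def lefschetzDelta (Λ d : X →ₗ[ℝ] X) : X →ₗ[ℝ] X := Λ ∘ₗ d - d ∘ₗ Λ

theorem lefschetzDelta_apply (Λ d : X →ₗ[ℝ] X) (x : X) :
    lefschetzDelta Λ d x = Λ (d x) - d (Λ x) := rfl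

/-- If `d` commutes with `L`, then `d` is a highest weight vector of weight one for the action of
`sl₂` on operators, so that `d` and `[Λ, d]` span a two-dimensional representation. -/
theorem IsLefschetz.isOddPair {n : ℕ} {H : ℕ → Submodule ℝ X} {L Λ d : X →ₗ[ℝ] X}
    (h : IsLefschetz n H L Λ) (d_mem : ∀ {k x}, x ∈ H k → d x ∈ H (k + 1))
    (L_d : ∀ {k x}, x ∈ H k → L (d x) = d (L x)) :
    IsOddPair H L Λ d (lefschetzDelta Λ d) := by
  have b_mem : ∀ {k x}, x ∈ H (k + 1) → lefschetzDelta Λ d x ∈ H k := by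
    intro k x hx
    refine sub_mem (h.Λ_mem (d_mem hx)) ?_
    rcases k with _ | k
    · rw [LinearMap.comp_apply, h.Λ_low (by omega) hx, map_zero]; exact zero_mem _
    · exact d_mem (h.Λ_mem hx)
  have b_low : ∀ {x}, x ∈ H 0 → lefschetzDelta Λ d x = 0 := by
    intro x hx
    rw [lefschetzDelta_apply, h.Λ_low (by omega) hx, h.Λ_low (by omega) (d_mem hx), map_zero,
      sub_zero]
  have L_b : ∀ {k x}, x ∈ H k → L (lefschetzDelta Λ d x) = lefschetzDelta Λ d (L x) + d x := by
    intro k x hx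
    have hΛd : L (d (Λ x)) = d (L (Λ x)) := L_d (h.Λ_mem' hx)
    have h1 := h.comm (d_mem hx)
    rw [lefschetzDelta_apply, lefschetzDelta_apply, ← L_d hx, h1, h.comm hx, map_sub, map_add,
      map_smul, hΛd]
    push_cast
    module
  refine ⟨d_mem, b_mem, b_low, ?_, L_d, ?_, L_b⟩
  · intro k x _
    rw [lefschetzDelta_apply]; abel
  · -- `[Λ, [Λ, d]]` commutes with `L` and has degree `-3`
    intro k x hx
    refine sub_eq_zero.mp (h.eq_zero_of_commute h
      (Λ ∘ₗ lefschetzDelta Λ d - lefschetzDelta Λ d ∘ₗ Λ) ?_ ?_ hx)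
    · intro k x hx
      have hc : Λ (L (lefschetzDelta Λ d x)) =
          L (Λ (lefschetzDelta Λ d x)) + ((n : ℝ) - k + 1) • lefschetzDelta Λ d x := by
        rcases k with _ | k
        · simp [b_low hx]
        · rw [h.comm (b_mem hx)]
          push_cast
          module
      have h2 := L_b (h.Λ_mem' hx)
      simp only [LinearMap.sub_apply, LinearMap.comp_apply, map_sub]
      rw [eq_sub_of_add_eq (L_b hx).symm, map_sub, hc, h.comm hx, map_add, map_smul, h2,
        lefschetzDelta_apply Λ d x]
      module
    · intro k x hx
      simp only [LinearMap.sub_apply, LinearMap.comp_apply]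
      rcases Nat.lt_or_ge k 3 with hk | hk
      · left
        have e1 : Λ (lefschetzDelta Λ d x) = 0 := by
          rcases k with _ | k
          · rw [b_low hx, map_zero]
          · exact h.Λ_low (by omega) (b_mem hx)
        have e2 : lefschetzDelta Λ d (Λ x) = 0 := by
          rcases Nat.lt_or_ge k 2 with hk' | hk'
          · rw [h.Λ_low hk' hx, map_zero]
          · obtain rfl : k = 0 + 2 := by omega
            exact b_low (h.Λ_mem hx)
        rw [e1, e2, sub_zero]
      · obtain ⟨m, rfl⟩ := Nat.exists_eq_add_of_le' hk
        exact Or.inr ⟨m, by omega, sub_mem (h.Λ_mem (b_mem hx)) (b_mem (h.Λ_mem hx))⟩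

namespace IsLefschetzComplex

variable {n : ℕ} {H : ℕ → Submodule ℝ X} {L Λ d : X →ₗ[ℝ] X}

theorem isOddPair (h : IsLefschetzComplex n H L Λ d) : IsOddPair H L Λ d (lefschetzDelta Λ d) :=
  h.toIsLefschetz.isOddPair h.d_mem h.L_d

theorem d_delta (h : IsLefschetzComplex n H L Λ d) (x : X) :
    d (lefschetzDelta Λ d x) = -lefschetzDelta Λ d (d x) := by
  simp [lefschetzDelta_apply, h.d_d]

/-- Both `d δ + δ d = 0` and `[Λ, δ] = 0` are used: they give `δ δ = Λ d δ = -Λ δ d = -δ δ`. -/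
theorem delta_delta (h : IsLefschetzComplex n H L Λ d) {k : ℕ} {x : X} (hx : x ∈ H k) :
    lefschetzDelta Λ d (lefschetzDelta Λ d x) = 0 := by
  have e : ∀ y, lefschetzDelta Λ d (d y) = -d (Λ (d y)) := fun y => by
    simp [lefschetzDelta_apply, h.d_d]
  have h1 : Λ (d (lefschetzDelta Λ d x)) = -Λ (lefschetzDelta Λ d (d x)) := by
    rw [h.d_delta, map_neg]
  have h2 := h.isOddPair.Λ_b (h.d_mem hx)
  have h3 := h.isOddPair.Λ_a hx
  have h5 := h.isOddPair.Λ_b hx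
  have h4 := lefschetzDelta_apply Λ d (lefschetzDelta Λ d x)
  rw [h1, h2, h3, map_add, h5, h.d_delta] at h4
  have h6 : (2 : ℝ) • lefschetzDelta Λ d (lefschetzDelta Λ d x) = 0 := by
    rw [two_smul]
    nth_rewrite 1 [h4]
    abel
  exact (smul_eq_zero.mp h6).resolve_left two_ne_zero

theorem d_L_pow (h : IsLefschetzComplex n H L Λ d) {k : ℕ} {x : X} (hx : x ∈ H k) (j : ℕ) :
    (L ^ j) (d x) = d ((L ^ j) x) :=
  h.isOddPair.L_pow_a h.toIsLefschetz hx j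

theorem star_d (h : IsLefschetzComplex n H L Λ d) {p : ℕ} {x : X} (hx : x ∈ H p) :
    lefschetzStar L Λ (n + 1) n (p + 1) (d x) =
      -lefschetzDelta Λ d (lefschetzStar L Λ (n + 1) n p x) :=
  h.isOddPair.star_a h.toIsLefschetz n hx

theorem star_delta (h : IsLefschetzComplex n H L Λ d) {p : ℕ} {x : X} (hx : x ∈ H (p + 1)) :
    lefschetzStar L Λ (n + 1) n p (lefschetzDelta Λ d x) =
      d (lefschetzStar L Λ (n + 1) n (p + 1) x) := by
  rcases Nat.lt_or_ge (2 * n) (p + 1) with hp | hp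
  · rw [h.top hp hx, map_zero, map_zero, map_zero, map_zero]
  set S := lefschetzStar L Λ (n + 1) n
  have hy : S (p + 1) x ∈ H (2 * n - (p + 1)) := h.star_mem hx
  have h1 := h.star_d hy
  rw [h.star_star hx hp, map_smul] at h1
  have h2 := h.star_star (h.d_mem hy) (by omega)
  rw [h1, map_neg, map_smul, show 2 * n - (2 * n - (p + 1) + 1) = p by omega] at h2
  have e : (-1 : ℝ) ^ (n + (2 * n - (p + 1) + 1)) = -(-1) ^ (n + (p + 1)) := by
    rw [← add_assoc, pow_succ, mul_neg_one]
    congr 1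
    refine neg_one_pow_congr ?_
    simp only [Nat.even_iff]
    omega
  rw [e, neg_smul, neg_inj] at h2
  exact smul_right_injective _ (pow_ne_zero _ (by norm_num : (-1 : ℝ) ≠ 0)) h2

/-- `star_star` solved for the element, without a bound on the degree. -/
theorem star_star' (h : IsLefschetzComplex n H L Λ d) {p : ℕ} {x : X} (hx : x ∈ H p) :
    x = (-1 : ℝ) ^ (n + p) • lefschetzStar L Λ (n + 1) n (2 * n - p)
      (lefschetzStar L Λ (n + 1) n p x) := by
  rcases Nat.lt_or_ge (2 * n) p with hp | hp
  · simp [h.top hp hx]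
  · rw [h.star_star hx hp, smul_smul, ← mul_pow]
    simp

/-- `L` preserves elements annihilated by `d` and `δ`. -/
theorem delta_L_pow (h : IsLefschetzComplex n H L Λ d) {k : ℕ} {x : X} (hx : x ∈ H k)
    (hd : d x = 0) (hδ : lefschetzDelta Λ d x = 0) (j : ℕ) :
    d ((L ^ j) x) = 0 ∧ lefschetzDelta Λ d ((L ^ j) x) = 0 := by
  induction j with
  | zero => simp [hd, hδ]
  | succ j ih =>
    rw [pow_succ', Module.End.mul_apply]
    have hm := h.L_pow_mem hx j
    have h1 : d (L ((L ^ j) x)) = 0 := by rw [← h.L_d hm, ih.1, map_zero]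
    refine ⟨h1, ?_⟩
    have h2 := h.isOddPair.L_b hm
    rw [ih.1, ih.2, map_zero, add_zero] at h2
    exact h2.symm

theorem exact_L_pow (h : IsLefschetzComplex n H L Λ d) {k : ℕ} {x : X}
    (hx : IsGradedExact H d k x) (j : ℕ) : IsGradedExact H d (k + 2 * j) ((L ^ j) x) := by
  rcases hx with rfl | ⟨i, rfl, y, hy, rfl⟩
  · exact Or.inl (map_zero _)
  · exact Or.inr ⟨i + 2 * j, by omega, _, h.L_pow_mem hy j, h.d_L_pow hy j⟩

/-- The hard Lefschetz property of the cohomology: `L ^ (n - k)` is bijective from degree `k` to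
degree `2n - k`. -/
structure HasHardLefschetz (n : ℕ) (H : ℕ → Submodule ℝ X) (L d : X →ₗ[ℝ] X) : Prop where
  inj : ∀ {k x}, k ≤ n → x ∈ H k → d x = 0 → (∃ w, (L ^ (n - k)) x = d w) → IsGradedExact H d k x
  surj : ∀ {k y}, k ≤ n → y ∈ H (2 * n - k) → d y = 0 →
    ∃ x ∈ H k, d x = 0 ∧ IsGradedExact H d (2 * n - k) (y - (L ^ (n - k)) x)

/-- Every class has a representative annihilated by `d` and `δ`. -/
theorem exists_harmonic (h : IsLefschetzComplex n H L Λ d) (hL : HasHardLefschetz n H L d)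
    {m : ℕ} {γ : X} (hγ : γ ∈ H m) (hd : d γ = 0) :
    ∃ η ∈ H m, d η = 0 ∧ lefschetzDelta Λ d η = 0 ∧ IsGradedExact H d m (γ - η) := by
  have low : ∀ m, m ≤ n → ∀ γ ∈ H m, d γ = 0 →
      ∃ η ∈ H m, d η = 0 ∧ lefschetzDelta Λ d η = 0 ∧ IsGradedExact H d m (γ - η) := by
    intro m
    induction m using Nat.strong_induction_on with
    | _ m ih =>
    intro hm γ hγ hd
    -- the case of a class that is primitive in cohomology
    have prim : ∀ γ ∈ H m, d γ = 0 →
        IsGradedExact H d (2 * n - m + 2) ((L ^ (n - m + 1)) γ) →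
        ∃ η ∈ H m, d η = 0 ∧ lefschetzDelta Λ d η = 0 ∧ IsGradedExact H d m (γ - η) := by
      intro γ hγ hd hex
      have fin : ∀ η ∈ H m, d η = 0 → (L ^ (n - m + 1)) η = 0 →
          lefschetzDelta Λ d η = 0 := by
        intro η hη h1 h2
        rw [lefschetzDelta_apply, h1, h.Λ_eq_zero_of_L_pow_eq_zero hm hη h2]; simp
      rcases hex with h0 | ⟨j, hj, w, hw, hw'⟩
      · exact ⟨γ, hγ, hd, fin γ hγ hd h0, Or.inl (sub_self _)⟩
      rcases Nat.eq_zero_or_pos m with rfl | hm0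
      · refine ⟨γ, hγ, hd, fin γ hγ hd ?_, Or.inl (sub_self _)⟩
        exact h.top (by omega) (h.L_pow_mem hγ _)
      obtain ⟨m', rfl⟩ : ∃ m', m = m' + 1 := ⟨m - 1, by omega⟩
      -- the primitive of `L ^ (n - m + 1) γ` is `L ^ (n - m + 1) z`, so `γ - d z` is primitive
      obtain ⟨z, hz, hz'⟩ := h.exists_L_pow_eq hw (j := n - (m' + 1) + 1) (by omega)
      rw [show j - 2 * (n - (m' + 1) + 1) = m' by omega] at hz
      have hmem : γ - d z ∈ H (m' + 1) := sub_mem hγ (h.d_mem hz)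
      have hcl : d (γ - d z) = 0 := by rw [map_sub, hd, h.d_d, sub_zero]
      refine ⟨γ - d z, hmem, hcl, fin _ hmem hcl ?_, Or.inr ⟨m', rfl, z, hz, by abel⟩⟩
      rw [map_sub, hw', h.d_L_pow hz, hz', sub_self]
    -- in general, the hard Lefschetz property provides a class `x` in degree `m - 2` such that the
    -- class of `γ - L x` is primitive
    rcases Nat.lt_or_ge m 2 with h2 | h2
    · exact prim γ hγ hd (Or.inl (h.top (by omega) (h.L_pow_mem hγ _)))
    obtain ⟨m', rfl⟩ := Nat.exists_eq_add_of_le' h2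
    have hmem := h.L_pow_mem hγ (n - (m' + 2) + 1)
    rw [show m' + 2 + 2 * (n - (m' + 2) + 1) = 2 * n - m' by omega] at hmem
    obtain ⟨x, hx, hdx, hex⟩ := hL.surj (by omega) hmem (by rw [← h.d_L_pow hγ, hd, map_zero])
    obtain ⟨η, hη, hdη, hδη, hη'⟩ := ih m' (by omega) (by omega) x hx hdx
    obtain ⟨θ, hθ, hdθ, hδθ, hθ'⟩ := prim (γ - L x) (sub_mem hγ (h.L_mem hx))
      (by rw [map_sub, hd, ← h.L_d hx, hdx, map_zero, sub_zero]) (by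
        rw [show 2 * n - (m' + 2) + 2 = 2 * n - m' by omega, map_sub,
          ← Module.End.mul_apply (L ^ _) L, ← pow_succ,
          show n - (m' + 2) + 1 + 1 = n - m' by omega]
        exact hex)
    have h1 := h.delta_L_pow hη hdη hδη 1
    rw [pow_one] at h1
    refine ⟨θ + L η, add_mem hθ (h.L_mem hη), by rw [map_add, hdθ, h1.1, add_zero],
      by rw [map_add, hδθ, h1.2, add_zero], ?_⟩
    have h3 := hθ'.add (h.exact_L_pow hη' 1)
    rw [pow_one, map_sub] at h3
    convert h3 using 1
    abel
  rcases Nat.lt_or_ge (2 * n) m with hm | hm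
  · exact ⟨0, zero_mem _, map_zero _, map_zero _, Or.inl (by rw [h.top hm hγ, sub_zero])⟩
  -- above the middle degree, apply a power of `L` to a representative below it
  rcases Nat.lt_or_ge n m with hm' | hm'
  · obtain ⟨x, hx, hdx, hex⟩ := hL.surj (k := 2 * n - m) (by omega)
      (by rwa [show 2 * n - (2 * n - m) = m by omega]) hd
    obtain ⟨η, hη, hdη, hδη, hη'⟩ := low _ (by omega) x hx hdx
    have hmem := h.L_pow_mem hη (n - (2 * n - m))
    have h1 := h.delta_L_pow hη hdη hδη (n - (2 * n - m))
    have h3 := h.exact_L_pow hη' (n - (2 * n - m))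
    rw [show 2 * n - m + 2 * (n - (2 * n - m)) = m by omega] at hmem h3
    rw [show 2 * n - (2 * n - m) = m by omega] at hex
    refine ⟨_, hmem, h1.1, h1.2, ?_⟩
    have h4 := hex.add h3
    rw [map_sub] at h4
    convert h4 using 1
    abel
  · exact low m hm' γ hγ hd

/-- The symplectic dual of `exists_harmonic`. -/
theorem exists_coharmonic (h : IsLefschetzComplex n H L Λ d) (hL : HasHardLefschetz n H L d)
    {k : ℕ} {γ : X} (hγ : γ ∈ H k) (hδ : lefschetzDelta Λ d γ = 0) :
    ∃ η ∈ H k, d η = 0 ∧ ∃ β ∈ H (k + 1), γ - η = lefschetzDelta Λ d β := by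
  rcases Nat.lt_or_ge (2 * n) k with hk | hk
  · exact ⟨0, zero_mem _, map_zero _, 0, zero_mem _, by simp [h.top hk hγ]⟩
  set S := lefschetzStar L Λ (n + 1) n with hS
  have dS : ∀ {j : ℕ} {x : X}, x ∈ H j → lefschetzDelta Λ d x = 0 → d (S j x) = 0 := by
    intro j x hx h0
    rcases j with _ | j
    · exact h.top (by omega) (h.d_mem (h.star_mem hx))
    · rw [hS, ← h.star_delta hx, h0, map_zero]
  obtain ⟨η, hη, hdη, hδη, hex⟩ := h.exists_harmonic hL (h.star_mem hγ) (dS hγ hδ)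
  have hSη := h.star_mem hη
  rw [show 2 * n - (2 * n - k) = k by omega] at hSη
  have hγ' := h.star_star' hγ
  have key : γ - (-1 : ℝ) ^ (n + k) • S (2 * n - k) η =
      (-1 : ℝ) ^ (n + k) • S (2 * n - k) (S k γ - η) := by
    rw [map_sub, smul_sub, ← hγ']
  refine ⟨(-1 : ℝ) ^ (n + k) • S (2 * n - k) η, Submodule.smul_mem _ _ hSη,
    by rw [map_smul, dS hη hδη, smul_zero], ?_⟩
  rw [key]
  rcases hex with h0 | ⟨j, hj, y, hy, hy'⟩
  · exact ⟨0, zero_mem _, by rw [h0, map_zero, map_zero, smul_zero]⟩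
  · have hSy := h.star_mem hy
    rw [show 2 * n - j = k + 1 by omega] at hSy
    refine ⟨(-1 : ℝ) ^ (n + k) • -S j y, Submodule.smul_mem _ _ (neg_mem hSy), ?_⟩
    rw [hy', hj, hS, h.star_d hy, map_smul, map_neg]

/-- `d`-exactness implies `dδ`-exactness in degree `k + 1` if `δ`-exactness does so in degree
`k - 1`. -/
theorem d_eq_d_delta_of_lower (h : IsLefschetzComplex n H L Λ d) (hL : HasHardLefschetz n H L d)
    {k : ℕ} (hlow : ∀ j, k = j + 1 → ∀ γ ∈ H (j + 1), d (lefschetzDelta Λ d γ) = 0 →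
      ∃ β ∈ H j, lefschetzDelta Λ d γ = d (lefschetzDelta Λ d β))
    {γ : X} (hγ : γ ∈ H k) (hδ : lefschetzDelta Λ d (d γ) = 0) :
    ∃ β ∈ H (k + 1), d γ = d (lefschetzDelta Λ d β) := by
  obtain ⟨θ, hθ, hdθ, hδθ⟩ : ∃ θ ∈ H k, d θ = d γ ∧ lefschetzDelta Λ d θ = 0 := by
    rcases k with _ | j
    · exact ⟨γ, hγ, rfl, h.isOddPair.b_low hγ⟩
    · obtain ⟨β, hβ, hβ'⟩ := hlow j rfl γ hγ (by rw [h.d_delta, hδ, neg_zero])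
      refine ⟨γ + d β, add_mem hγ (h.d_mem hβ), by rw [map_add, h.d_d, add_zero], ?_⟩
      rw [map_add, hβ', h.d_delta, neg_add_cancel]
  obtain ⟨η, hη, hdη, β, hβ, hβ'⟩ := h.exists_coharmonic hL hθ hδθ
  exact ⟨β, hβ, by rw [← hdθ, ← hβ', map_sub, hdη, sub_zero]⟩

/-- The elements `d δ β`, which form a Lefschetz submodule. -/
theorem isLefschetz_range (h : IsLefschetzComplex n H L Λ d) :
    IsLefschetz n (fun k => (H k).map (d ∘ₗ lefschetzDelta Λ d)) L Λ := by
  have mem : ∀ {k x}, x ∈ (H k).map (d ∘ₗ lefschetzDelta Λ d) → x ∈ H k := by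
    rintro k _ ⟨y, hy, rfl⟩
    rcases k with _ | k
    · simp [h.isOddPair.b_low hy]
    · exact h.d_mem (h.isOddPair.b_mem hy)
  have hL : ∀ {k y}, y ∈ H k → L (d (lefschetzDelta Λ d y)) = d (lefschetzDelta Λ d (L y)) := by
    intro k y hy
    have h1 : L (d (lefschetzDelta Λ d y)) = d (L (lefschetzDelta Λ d y)) := by
      rcases k with _ | k
      · simp [h.isOddPair.b_low hy]
      · exact h.L_d (h.isOddPair.b_mem hy)
    rw [h1, h.isOddPair.L_b hy, map_add, h.d_d, add_zero]
  have hΛ : ∀ {k y}, y ∈ H k → Λ (d (lefschetzDelta Λ d y)) = d (lefschetzDelta Λ d (Λ y)) := by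
    intro k y hy
    have h1 := lefschetzDelta_apply Λ d (lefschetzDelta Λ d y)
    rw [h.delta_delta hy, h.isOddPair.Λ_b hy] at h1
    exact (sub_eq_zero.mp h1.symm)
  refine ⟨?_, ?_, fun hk hx => h.Λ_low hk (mem hx), fun hx => h.comm (mem hx),
    fun hk hx => h.top hk (mem hx)⟩
  · rintro k _ ⟨y, hy, rfl⟩
    exact ⟨L y, h.L_mem hy, (hL hy).symm⟩
  · rintro k _ ⟨y, hy, rfl⟩
    exact ⟨Λ y, h.Λ_mem hy, (hΛ hy).symm⟩

/-- `d`-closed `δ`-exact elements are `dδ`-exact. In degrees `k ≤ n`, subtracting a `dδ`-exact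
element makes the given element `α` primitive; then `L ^ (n - k) α` is a multiple of the star of
`α`, hence `d`-exact, and so is `α` by the hard Lefschetz property. -/
theorem delta_eq_d_delta (h : IsLefschetzComplex n H L Λ d) (hL : HasHardLefschetz n H L d)
    {k : ℕ} {γ : X} (hγ : γ ∈ H (k + 1)) (hd : d (lefschetzDelta Λ d γ) = 0) :
    ∃ β ∈ H k, lefschetzDelta Λ d γ = d (lefschetzDelta Λ d β) := by
  have low : ∀ k, k ≤ n → ∀ γ ∈ H (k + 1), d (lefschetzDelta Λ d γ) = 0 →
      ∃ β ∈ H k, lefschetzDelta Λ d γ = d (lefschetzDelta Λ d β) := by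
    intro k
    induction k using Nat.strong_induction_on with
    | _ k ih =>
    intro hk γ hγ hd
    -- `Λ δ γ = δ Λ γ` is `dδ`-exact by induction, and `L Λ + (n - j)` is invertible on `dδ`-exact
    -- elements; this yields the correction that makes `δ γ` primitive
    obtain ⟨β₁, hβ₁, hΛ⟩ : ∃ β ∈ H k,
        Λ (lefschetzDelta Λ d γ - d (lefschetzDelta Λ d β)) = 0 := by
      rcases Nat.lt_or_ge k 2 with h2 | h2
      · refine ⟨0, zero_mem _, ?_⟩
        rw [map_zero, map_zero, sub_zero]
        exact h.Λ_low h2 (h.isOddPair.b_mem hγ)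
      obtain ⟨j, rfl⟩ := Nat.exists_eq_add_of_le' h2
      have h1 := h.isOddPair.Λ_b hγ
      have h3 := lefschetzDelta_apply Λ d (lefschetzDelta Λ d γ)
      rw [h.delta_delta hγ, hd, map_zero, zero_sub, zero_eq_neg, h1] at h3
      obtain ⟨β, hβ, hβ'⟩ := ih j (by omega) (by omega) (Λ γ)
        (h.Λ_mem (by rwa [show j + 1 + 2 = j + 2 + 1 by omega])) h3
      have hpos : (0 : ℝ) < n - j := by
        have : (j : ℝ) + 2 ≤ n := by exact_mod_cast hk
        linarith
      obtain ⟨_, ⟨θ, hθ, rfl⟩, hθ'⟩ := h.isLefschetz_range.exists_L_Λ_add_smul_eq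
        (m := j) hpos (by omega) ⟨β, hβ, rfl⟩
      simp only [LinearMap.comp_apply] at hθ'
      have hmem : d (lefschetzDelta Λ d θ) ∈ H j := by
        rcases j with _ | j
        · simp [h.isOddPair.b_low hθ]
        · exact h.d_mem (h.isOddPair.b_mem hθ)
      have hLθ : L (d (lefschetzDelta Λ d θ)) = d (lefschetzDelta Λ d (L θ)) := by
        have h4 : L (d (lefschetzDelta Λ d θ)) = d (L (lefschetzDelta Λ d θ)) := by
          rcases j with _ | j
          · simp [h.isOddPair.b_low hθ]
          · exact h.L_d (h.isOddPair.b_mem hθ)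
        rw [h4, h.isOddPair.L_b hθ, map_add, h.d_d, add_zero]
      refine ⟨L θ, h.L_mem hθ, ?_⟩
      rw [map_sub, h1, hβ', ← hLθ, h.comm hmem, hθ', sub_self]
    have hα : lefschetzDelta Λ d γ - d (lefschetzDelta Λ d β₁) =
        lefschetzDelta Λ d (γ + d β₁) := by
      rw [h.d_delta, map_add, sub_neg_eq_add]
    have hγ₀ : γ + d β₁ ∈ H (k + 1) := add_mem hγ (h.d_mem hβ₁)
    have hd₀ : d (lefschetzDelta Λ d (γ + d β₁)) = 0 := by
      rw [← hα, map_sub, hd, h.d_d, sub_zero]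
    rw [hα] at hΛ
    have hstar := IsLefschetz.star_of_Λ_eq_zero (L := L) hk hΛ
    rw [h.star_delta hγ₀] at hstar
    obtain ⟨β₂, hβ₂, hβ₂'⟩ : ∃ β ∈ H k,
        lefschetzDelta Λ d (γ + d β₁) = d (lefschetzDelta Λ d β) := by
      rcases hL.inj hk (h.isOddPair.b_mem hγ₀) hd₀
        ⟨((n - k).factorial : ℝ) • lefschetzStar L Λ (n + 1) n (k + 1) (γ + d β₁), by
          rw [map_smul, hstar, smul_smul, mul_inv_cancel₀ (by positivity), one_smul]⟩ with
        h0 | ⟨j, rfl, y, hy, hy'⟩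
      · exact ⟨0, zero_mem _, by rw [h0, map_zero, map_zero]⟩
      · rw [hy']
        refine h.d_eq_d_delta_of_lower hL (fun i hi γ hγ => ih i (by omega) (by omega) γ hγ) hy ?_
        rw [← hy', h.delta_delta hγ₀]
    refine ⟨β₁ + β₂, add_mem hβ₁ hβ₂, ?_⟩
    rw [map_add, map_add, ← hβ₂', ← hα]
    abel
  rcases Nat.lt_or_ge n k with hk | hk
  swap
  · exact low k hk γ hγ hd
  rcases Nat.lt_or_ge (2 * n) (k + 1) with hk2 | hk2
  · exact ⟨0, zero_mem _, by simp [h.top hk2 hγ]⟩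
  -- in degrees above `n` the star reduces the claim to `d`-exactness in a degree below `n`
  have hα := h.isOddPair.b_mem hγ
  have hSα := h.star_delta hγ
  obtain ⟨β, hβ, hβ'⟩ := h.d_eq_d_delta_of_lower hL
    (fun i hi γ hγ => low i (by omega) γ hγ) (h.star_mem hγ) (by
      rw [← hSα, ← neg_eq_zero, ← h.star_d hα, hd, map_zero])
  have hδβ := h.isOddPair.b_mem hβ
  have hSβ := h.star_mem hβ
  rw [show 2 * n - (2 * n - (k + 1) + 1) = k by omega] at hSβ
  refine ⟨(-1 : ℝ) ^ (n + k) • lefschetzStar L Λ (n + 1) n (2 * n - k) β,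
    Submodule.smul_mem _ _ ?_, ?_⟩
  · rwa [show 2 * n - k = 2 * n - (k + 1) + 1 by omega]
  · rw [h.star_star' hα, hSα, hβ', show 2 * n - k = 2 * n - (k + 1) + 1 by omega, h.star_d hδβ,
      h.star_delta hβ, map_smul, map_smul, h.d_delta]

/-- `δ`-closed `d`-exact elements are `dδ`-exact. -/
theorem d_eq_d_delta (h : IsLefschetzComplex n H L Λ d) (hL : HasHardLefschetz n H L d)
    {k : ℕ} {γ : X} (hγ : γ ∈ H k) (hδ : lefschetzDelta Λ d (d γ) = 0) :
    ∃ β ∈ H (k + 1), d γ = d (lefschetzDelta Λ d β) :=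
  h.d_eq_d_delta_of_lower hL (fun _ _ _ hγ hd => h.delta_eq_d_delta hL hγ hd) hγ hδ

end IsLefschetzComplex

end LefschetzComplex

/-! ### Contraction of wedge products -/

section Wedge

/-- A sum over permutations, split by the position at which the first of the permuted vectors
appears. -/
theorem sum_perm_vecCons {m : ℕ} {V : Type*} (F : (Fin (m + 1) → V) → ℝ) (u : V) (v : Fin m → V) :
    ∑ τ : Equiv.Perm (Fin (m + 1)),
        (Equiv.Perm.sign τ : ℤ) * F (fun i => Matrix.vecCons u v (τ i)) =
      ∑ i : Fin (m + 1), (-1) ^ (i : ℕ) * ∑ e : Equiv.Perm (Fin m), (Equiv.Perm.sign e : ℤ) *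
        F (i.insertNth u (fun j => v (e j))) := by
  -- `τ` is determined by the position `i` of `u` and the order `e` of the other arguments
  let g : Fin (m + 1) × Equiv.Perm (Fin m) → Equiv.Perm (Fin (m + 1)) := fun x =>
    Equiv.Perm.decomposeFin.symm (0, x.2) * x.1.cycleRange
  have g_self : ∀ x, g x x.1 = 0 := fun x => by simp [g]
  have g_succAbove : ∀ x j, g x (x.1.succAbove j) = (x.2 j).succ := fun x j => by
    simp [g, Fin.cycleRange_succAbove]
  have hinj : Function.Injective g := by
    rintro ⟨i, e⟩ ⟨i', e'⟩ h
    have h1 : i = i' := by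
      have h2 := g_self (i, e)
      have h3 := g_self (i', e')
      rw [← h] at h3
      exact (g (i, e)).injective (h2.trans h3.symm)
    subst h1
    refine Prod.ext rfl (Equiv.ext fun j => Fin.succ_injective _ ?_)
    rw [← g_succAbove (i, e) j, ← g_succAbove (i, e') j, h]
  have hbij : Function.Bijective g := by
    rw [Fintype.bijective_iff_injective_and_card]
    refine ⟨hinj, ?_⟩
    simp [Fintype.card_perm, Nat.factorial_succ]
  rw [← hbij.sum_comp, Fintype.sum_prod_type]
  refine Finset.sum_congr rfl fun i _ => ?_
  rw [Finset.mul_sum]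
  refine Finset.sum_congr rfl fun e _ => ?_
  have h1 : (fun j => Matrix.vecCons u v (g (i, e) j)) = i.insertNth u (fun j => v (e j)) := by
    rw [Fin.eq_insertNth_iff]
    refine ⟨by simp [g_self (i, e)], funext fun j => ?_⟩
    simp [Fin.removeNth, g_succAbove (i, e)]
  rw [h1]
  simp only [g, Equiv.Perm.sign_mul, Fin.sign_cycleRange, Equiv.Perm.decomposeFin.symm_sign]
  simp
  ring

variable {V : Type*} [AddCommGroup V] [Module ℝ V] [TopologicalSpace V] {p q m : ℕ}

@[simp]
theorem contract_apply {k : ℕ} (u : V) (α : V [⋀^Fin (k + 1)]→L[ℝ] ℝ) (v : Fin k → V) :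
    contract u α v = α (Matrix.vecCons u v) := rfl

theorem map_insertNth_eq_contract {k : ℕ} (α : V [⋀^Fin (k + 1)]→L[ℝ] ℝ) (i : Fin (k + 1)) (u : V)
    (v : Fin k → V) : α (i.insertNth u v) = (-1) ^ (i : ℕ) * contract u α v := by
  have := α.toAlternatingMap.map_insertNth i u v
  rw [← smul_eq_mul]
  simpa using this

/-- The product of `α` at the first `p` and of `β` at the last `q` of `m = p + q` vectors. -/
def blockProduct (h : p + q = m) (α : V [⋀^Fin p]→L[ℝ] ℝ) (β : V [⋀^Fin q]→L[ℝ] ℝ)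
    (w : Fin m → V) : ℝ :=
  α (fun a => w (Fin.cast h (Fin.castAdd q a))) * β (fun b => w (Fin.cast h (Fin.natAdd p b)))

/-- The wedge product as a sum over all permutations. The casts allow its degree `p + q` to be
written in the form `m`. -/
theorem wedge_cast_apply (h : p + q = m) (α : V [⋀^Fin p]→L[ℝ] ℝ) (β : V [⋀^Fin q]→L[ℝ] ℝ)
    (w : Fin m → V) : wedge α β (fun i => w (Fin.cast h i)) =
      (p.factorial * q.factorial : ℝ)⁻¹ * ∑ τ : Equiv.Perm (Fin m),
        (Equiv.Perm.sign τ : ℤ) * blockProduct h α β (fun i => w (τ i)) := by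
  subst h
  rw [wedge, ContinuousAlternatingMap.smul_apply,
    ContinuousMultilinearMap.alternatization_apply_apply, smul_eq_mul]
  congr 1
  refine Finset.sum_congr rfl fun τ _ => ?_
  rw [Units.smul_def, zsmul_eq_mul]
  rfl

theorem blockProduct_insertNth_left (h : p + 1 + q = m + 1) (h' : p + q = m)
    (α : V [⋀^Fin (p + 1)]→L[ℝ] ℝ) (β : V [⋀^Fin q]→L[ℝ] ℝ) (u : V) (v : Fin m → V)
    (i : Fin (p + 1)) :
    blockProduct h α β ((Fin.cast h (Fin.castAdd q i)).insertNth u v) =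
      (-1) ^ (i : ℕ) * blockProduct h' (contract u α) β v := by
  unfold blockProduct
  have h1 : (fun a => (Fin.cast h (Fin.castAdd q i)).insertNth (α := fun _ => V) u v
      (Fin.cast h (Fin.castAdd q a))) =
      i.insertNth u (fun a => v (Fin.cast h' (Fin.castAdd q a))) := by
    rw [Fin.eq_insertNth_iff]
    refine ⟨by simp, funext fun j => ?_⟩
    have : Fin.cast h (Fin.castAdd q (i.succAbove j)) =
        (Fin.cast h (Fin.castAdd q i)).succAbove (Fin.cast h' (Fin.castAdd q j)) := by
      ext
      simp only [Fin.succAbove, Fin.lt_def, Fin.val_cast, Fin.val_castAdd, Fin.val_castSucc]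
      split_ifs <;> simp
    rw [Fin.removeNth, this, Fin.insertNth_apply_succAbove]
  have h2 : (fun b => (Fin.cast h (Fin.castAdd q i)).insertNth (α := fun _ => V) u v
      (Fin.cast h (Fin.natAdd (p + 1) b))) = fun b => v (Fin.cast h' (Fin.natAdd p b)) := by
    funext b
    have : Fin.cast h (Fin.natAdd (p + 1) b) =
        (Fin.cast h (Fin.castAdd q i)).succAbove (Fin.cast h' (Fin.natAdd p b)) := by
      ext
      simp only [Fin.succAbove, Fin.lt_def, Fin.val_cast, Fin.val_castAdd, Fin.val_castSucc,
        Fin.val_natAdd]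
      split_ifs <;> simp <;> omega
    rw [this, Fin.insertNth_apply_succAbove]
  rw [h1, h2, map_insertNth_eq_contract, mul_assoc]

theorem blockProduct_insertNth_right (h : p + (q + 1) = m + 1) (h' : p + q = m)
    (α : V [⋀^Fin p]→L[ℝ] ℝ) (β : V [⋀^Fin (q + 1)]→L[ℝ] ℝ) (u : V) (v : Fin m → V)
    (i : Fin (q + 1)) :
    blockProduct h α β ((Fin.cast h (Fin.natAdd p i)).insertNth u v) =
      (-1) ^ (i : ℕ) * blockProduct h' α (contract u β) v := by
  unfold blockProduct
  have h1 : (fun a => (Fin.cast h (Fin.natAdd p i)).insertNth (α := fun _ => V) u v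
      (Fin.cast h (Fin.natAdd p a))) =
      i.insertNth u (fun a => v (Fin.cast h' (Fin.natAdd p a))) := by
    rw [Fin.eq_insertNth_iff]
    refine ⟨by simp, funext fun j => ?_⟩
    have : Fin.cast h (Fin.natAdd p (i.succAbove j)) =
        (Fin.cast h (Fin.natAdd p i)).succAbove (Fin.cast h' (Fin.natAdd p j)) := by
      ext
      simp only [Fin.succAbove, Fin.lt_def, Fin.val_cast, Fin.val_natAdd, Fin.val_castSucc]
      split_ifs <;> simp at * <;> omega
    rw [Fin.removeNth, this, Fin.insertNth_apply_succAbove]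
  have h2 : (fun b => (Fin.cast h (Fin.natAdd p i)).insertNth (α := fun _ => V) u v
      (Fin.cast h (Fin.castAdd (q + 1) b))) = fun b => v (Fin.cast h' (Fin.castAdd q b)) := by
    funext b
    have : Fin.cast h (Fin.castAdd (q + 1) b) =
        (Fin.cast h (Fin.natAdd p i)).succAbove (Fin.cast h' (Fin.castAdd q b)) := by
      ext
      simp only [Fin.succAbove, Fin.lt_def, Fin.val_cast, Fin.val_castAdd, Fin.val_castSucc,
        Fin.val_natAdd]
      split_ifs <;> simp at *
      omega
    rw [this, Fin.insertNth_apply_succAbove]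
  rw [h1, h2, map_insertNth_eq_contract]
  ring

/-- The sum for the wedge product, split by whether the first vector is among the arguments of the
first or of the second factor. -/
theorem wedge_cast_vecCons (h : p + q = m + 1) (α : V [⋀^Fin p]→L[ℝ] ℝ) (β : V [⋀^Fin q]→L[ℝ] ℝ)
    (u : V) (v : Fin m → V) :
    wedge α β (fun i => Matrix.vecCons u v (Fin.cast h i)) =
      (p.factorial * q.factorial : ℝ)⁻¹ *
        ((∑ i : Fin p, (-1) ^ (i : ℕ) * ∑ e : Equiv.Perm (Fin m), (Equiv.Perm.sign e : ℤ) *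
          blockProduct h α β ((Fin.cast h (Fin.castAdd q i)).insertNth u (fun j => v (e j)))) +
        ∑ i : Fin q, (-1) ^ (p + i : ℕ) * ∑ e : Equiv.Perm (Fin m), (Equiv.Perm.sign e : ℤ) *
          blockProduct h α β ((Fin.cast h (Fin.natAdd p i)).insertNth u (fun j => v (e j)))) := by
  rw [wedge_cast_apply h, sum_perm_vecCons, ← (finCongr h).sum_comp, Fin.sum_univ_add]
  rfl

theorem sum_blockProduct_left (h : p + 1 + q = m + 1) (h' : p + q = m)
    (α : V [⋀^Fin (p + 1)]→L[ℝ] ℝ) (β : V [⋀^Fin q]→L[ℝ] ℝ) (u : V) (v : Fin m → V) :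
    (((p + 1).factorial * q.factorial : ℝ)⁻¹ *
      ∑ i : Fin (p + 1), (-1) ^ (i : ℕ) * ∑ e : Equiv.Perm (Fin m), (Equiv.Perm.sign e : ℤ) *
          blockProduct h α β ((Fin.cast h (Fin.castAdd q i)).insertNth u (fun j => v (e j)))) =
      wedge (contract u α) β (fun i => v (Fin.cast h' i)) := by
  simp only [blockProduct_insertNth_left h h']
  rw [wedge_cast_apply h']
  have : ∀ i : Fin (p + 1), ((-1 : ℝ) ^ (i : ℕ) * ∑ e : Equiv.Perm (Fin m),
      (Equiv.Perm.sign e : ℤ) * ((-1) ^ (i : ℕ) * blockProduct h' (contract u α) β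
        (fun j => v (e j)))) = ∑ e : Equiv.Perm (Fin m),
      (Equiv.Perm.sign e : ℤ) * blockProduct h' (contract u α) β (fun j => v (e j)) := by
    intro i
    rw [Finset.mul_sum]
    refine Finset.sum_congr rfl fun e _ => ?_
    have : (-1 : ℝ) ^ (i : ℕ) * (-1) ^ (i : ℕ) = 1 := by rw [← mul_pow]; simp
    linear_combination (((Equiv.Perm.sign e : ℤ) : ℝ) *
      blockProduct h' (contract u α) β (fun j => v (e j))) * this
  rw [Finset.sum_congr rfl fun i _ => this i, Finset.sum_const, Finset.card_univ, Fintype.card_fin,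
    nsmul_eq_mul, Nat.factorial_succ]
  push_cast
  field_simp

theorem sum_blockProduct_right (h : p + (q + 1) = m + 1) (h' : p + q = m)
    (α : V [⋀^Fin p]→L[ℝ] ℝ) (β : V [⋀^Fin (q + 1)]→L[ℝ] ℝ) (u : V) (v : Fin m → V) :
    ((p.factorial * (q + 1).factorial : ℝ)⁻¹ *
      ∑ i : Fin (q + 1), (-1) ^ (p + i : ℕ) * ∑ e : Equiv.Perm (Fin m), (Equiv.Perm.sign e : ℤ) *
          blockProduct h α β ((Fin.cast h (Fin.natAdd p i)).insertNth u (fun j => v (e j)))) =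
      (-1) ^ p * wedge α (contract u β) (fun i => v (Fin.cast h' i)) := by
  simp only [blockProduct_insertNth_right h h']
  rw [wedge_cast_apply h']
  have : ∀ i : Fin (q + 1), ((-1 : ℝ) ^ (p + i : ℕ) * ∑ e : Equiv.Perm (Fin m),
      (Equiv.Perm.sign e : ℤ) * ((-1) ^ (i : ℕ) * blockProduct h' α (contract u β)
        (fun j => v (e j)))) = (-1) ^ p * ∑ e : Equiv.Perm (Fin m),
      (Equiv.Perm.sign e : ℤ) * blockProduct h' α (contract u β) (fun j => v (e j)) := by
    intro i
    rw [Finset.mul_sum, Finset.mul_sum]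
    refine Finset.sum_congr rfl fun e _ => ?_
    have : (-1 : ℝ) ^ (i : ℕ) * (-1) ^ (i : ℕ) = 1 := by rw [← mul_pow]; simp
    rw [pow_add]
    linear_combination ((-1) ^ p * ((Equiv.Perm.sign e : ℤ) : ℝ) *
      blockProduct h' α (contract u β) (fun j => v (e j))) * this
  rw [Finset.sum_congr rfl fun i _ => this i, Finset.sum_const, Finset.card_univ, Fintype.card_fin,
    nsmul_eq_mul, Nat.factorial_succ]
  push_cast
  field_simp

/-- Contraction is an antiderivation of the wedge product. -/
theorem wedge_vecCons (h : p + 1 + (q + 1) = m + 1) (α : V [⋀^Fin (p + 1)]→L[ℝ] ℝ)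
    (β : V [⋀^Fin (q + 1)]→L[ℝ] ℝ) (u : V) (v : Fin m → V) :
    wedge α β (fun i => Matrix.vecCons u v (Fin.cast h i)) =
      wedge (contract u α) β (fun i => v (Fin.cast (by omega) i)) +
      (-1) ^ (p + 1) * wedge α (contract u β) (fun i => v (Fin.cast (by omega) i)) := by
  rw [wedge_cast_vecCons, mul_add, sum_blockProduct_left h (by omega),
    sum_blockProduct_right h (by omega)]

theorem wedge_vecCons_zero_right (h : p + 1 + 0 = m + 1) (α : V [⋀^Fin (p + 1)]→L[ℝ] ℝ)
    (β : V [⋀^Fin 0]→L[ℝ] ℝ) (u : V) (v : Fin m → V) :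
    wedge α β (fun i => Matrix.vecCons u v (Fin.cast h i)) =
      wedge (contract u α) β (fun i => v (Fin.cast (by omega) i)) := by
  rw [wedge_cast_vecCons, Fin.sum_univ_zero, add_zero, sum_blockProduct_left h (by omega)]

theorem wedge_vecCons_zero_left (h : 0 + (q + 1) = m + 1) (α : V [⋀^Fin 0]→L[ℝ] ℝ)
    (β : V [⋀^Fin (q + 1)]→L[ℝ] ℝ) (u : V) (v : Fin m → V) :
    wedge α β (fun i => Matrix.vecCons u v (Fin.cast h i)) =
      wedge α (contract u β) (fun i => v (Fin.cast (by omega) i)) := by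
  rw [wedge_cast_vecCons, Fin.sum_univ_zero, zero_add, sum_blockProduct_right h (by omega),
    pow_zero, one_mul]

theorem wedge_zero_zero_apply (α β : V [⋀^Fin 0]→L[ℝ] ℝ) (v : Fin 0 → V) :
    wedge α β (fun i => v (Fin.cast rfl i)) = α ![] * β ![] := by
  rw [wedge_cast_apply rfl]
  simp [blockProduct, Subsingleton.elim _ (![] : Fin 0 → V)]

theorem wedge_degree_zero_right (α : V [⋀^Fin p]→L[ℝ] ℝ) (β : V [⋀^Fin 0]→L[ℝ] ℝ) (v : Fin p → V) :
    wedge α β (fun i => v (Fin.cast rfl i)) = β ![] * α v := by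
  induction p with
  | zero => rw [wedge_zero_zero_apply, mul_comm, Subsingleton.elim v ![]]
  | succ p ih =>
    obtain ⟨u, v, rfl⟩ : ∃ u v', v = Matrix.vecCons u v' := ⟨_, _, (Matrix.cons_head_tail v).symm⟩
    rw [wedge_vecCons_zero_right rfl, ih, contract_apply]

theorem wedge_degree_zero_left (h : 0 + q = m) (α : V [⋀^Fin 0]→L[ℝ] ℝ) (β : V [⋀^Fin q]→L[ℝ] ℝ)
    (v : Fin m → V) :
    wedge α β (fun i => v (Fin.cast h i)) = α ![] * β (fun i => v (Fin.cast (by omega) i)) := by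
  obtain rfl : q = m := by omega
  induction q with
  | zero => rw [wedge_zero_zero_apply]; congr; exact Subsingleton.elim _ _
  | succ q ih =>
    obtain ⟨u, v, rfl⟩ : ∃ u v', v = Matrix.vecCons u v' := ⟨_, _, (Matrix.cons_head_tail v).symm⟩
    rw [wedge_vecCons_zero_left h, ih (contract u β) (by omega), contract_apply]
    rfl

theorem tensorForm_apply (α : V [⋀^Fin p]→L[ℝ] ℝ) (β : V [⋀^Fin q]→L[ℝ] ℝ) (v : Fin (p + q) → V) :
    tensorForm α β v = α (fun i => v (Fin.castAdd q i)) * β (fun i => v (Fin.natAdd p i)) :=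
  rfl

theorem wedge_add_left (α α' : V [⋀^Fin p]→L[ℝ] ℝ) (β : V [⋀^Fin q]→L[ℝ] ℝ) :
    wedge (α + α') β = wedge α β + wedge α' β := by
  have : tensorForm (α + α') β = tensorForm α β + tensorForm α' β := by
    ext v; simp [tensorForm_apply, add_mul]
  rw [wedge, this, map_add, smul_add]; rfl

theorem wedge_smul_left (c : ℝ) (α : V [⋀^Fin p]→L[ℝ] ℝ) (β : V [⋀^Fin q]→L[ℝ] ℝ) :
    wedge (c • α) β = c • wedge α β := by
  ext v
  rw [ContinuousAlternatingMap.smul_apply]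
  have := wedge_cast_apply rfl (c • α) β v
  have h2 := wedge_cast_apply rfl α β v
  simp only [Fin.cast_eq_self] at this h2
  rw [this, h2, smul_eq_mul, Finset.mul_sum, Finset.mul_sum, Finset.mul_sum]
  refine Finset.sum_congr rfl fun τ _ => ?_
  simp [blockProduct]
  ring

theorem wedge_add_right (α : V [⋀^Fin p]→L[ℝ] ℝ) (β β' : V [⋀^Fin q]→L[ℝ] ℝ) :
    wedge α (β + β') = wedge α β + wedge α β' := by
  have : tensorForm α (β + β') = tensorForm α β + tensorForm α β' := by
    ext v; simp [tensorForm_apply, mul_add]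
  rw [wedge, this, map_add, smul_add]; rfl

theorem wedge_smul_right (c : ℝ) (α : V [⋀^Fin p]→L[ℝ] ℝ) (β : V [⋀^Fin q]→L[ℝ] ℝ) :
    wedge α (c • β) = c • wedge α β := by
  ext v
  rw [ContinuousAlternatingMap.smul_apply]
  have := wedge_cast_apply rfl α (c • β) v
  have h2 := wedge_cast_apply rfl α β v
  simp only [Fin.cast_eq_self] at this h2
  rw [this, h2, smul_eq_mul, Finset.mul_sum, Finset.mul_sum, Finset.mul_sum]
  refine Finset.sum_congr rfl fun τ _ => ?_
  simp [blockProduct]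
  ring

end Wedge

/-! ### Operators on exterior forms of mixed degree -/

section GForm

variable {V : Type*} [AddCommGroup V] [Module ℝ V] [TopologicalSpace V]

variable (V) in
/-- Exterior forms of mixed degree on a vector space: `a k` is the component of degree `k`. -/
abbrev GForm : Type _ := (k : ℕ) → V [⋀^Fin k]→L[ℝ] ℝ

instance : AddCommGroup (GForm V) := Pi.addCommGroup

instance : Module ℝ (GForm V) := Pi.module _ _ _

/-- The covector `w (u, ·)`. -/
def flat (w : V [⋀^Fin 2]→L[ℝ] ℝ) (u : V) : V →L[ℝ] ℝ where
  toFun v := w ![u, v]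
  map_add' v v' := by
    have := (contract u w).map_vecCons_add (![] : Fin 0 → V) v v'
    simpa using this
  map_smul' c v := by
    have := (contract u w).map_vecCons_smul (![] : Fin 0 → V) c v
    simpa using this
  cont := w.cont.comp (continuous_const.matrixVecCons
    (continuous_id.matrixVecCons continuous_const))

@[simp]
theorem flat_apply (w : V [⋀^Fin 2]→L[ℝ] ℝ) (u v : V) : flat w u v = w ![u, v] := rfl

theorem form_two_swap (w : V [⋀^Fin 2]→L[ℝ] ℝ) (u v : V) : w ![u, v] = -w ![v, u] := by
  have := w.toAlternatingMap.map_swap ![v, u] (i := 0) (j := 1) (by simp)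
  have e : ![v, u] ∘ Equiv.swap (0 : Fin 2) 1 = ![u, v] := by
    funext i; fin_cases i <;> simp
  rw [e] at this
  exact this

theorem form_two_add_left (w : V [⋀^Fin 2]→L[ℝ] ℝ) (u u' v : V) :
    w ![u + u', v] = w ![u, v] + w ![u', v] := w.toAlternatingMap.map_vecCons_add _ _ _

theorem form_two_smul_left (w : V [⋀^Fin 2]→L[ℝ] ℝ) (c : ℝ) (u v : V) :
    w ![c • u, v] = c * w ![u, v] := w.toAlternatingMap.map_vecCons_smul _ _ _

theorem form_two_sum_left {ι : Type*} (w : V [⋀^Fin 2]→L[ℝ] ℝ) (s : Finset ι) (f : ι → V) (v : V) :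
    w ![∑ i ∈ s, f i, v] = ∑ i ∈ s, w ![f i, v] := by
  rw [form_two_swap, ← flat_apply, map_sum, ← Finset.sum_neg_distrib]
  exact Finset.sum_congr rfl fun i _ => by rw [flat_apply, ← form_two_swap]

/-- The exterior product `l ∧ α` with a covector,
`(l ∧ α) (v) = ∑ (-1)^i l (v_i) α (v_0, …, v_{i-1}, v_{i+1}, …)`. -/
def extMul {k : ℕ} (l : V →L[ℝ] ℝ) (α : V [⋀^Fin k]→L[ℝ] ℝ) : V [⋀^Fin (k + 1)]→L[ℝ] ℝ where
  toMultilinearMap := (AlternatingMap.alternatizeUncurryFin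
    ((l : V →ₗ[ℝ] ℝ).smulRight α.toAlternatingMap)).toMultilinearMap
  map_eq_zero_of_eq' := (AlternatingMap.alternatizeUncurryFin
    ((l : V →ₗ[ℝ] ℝ).smulRight α.toAlternatingMap)).map_eq_zero_of_eq'
  cont := by
    have h : Continuous fun v : Fin (k + 1) → V =>
        ∑ i : Fin (k + 1), (-1 : ℤ) ^ (i : ℕ) • (l (v i) * α (i.removeNth v)) := by
      refine continuous_finsetSum _ fun i _ => ?_
      have h1 : Continuous fun v : Fin (k + 1) → V => l (v i) * α (i.removeNth v) :=
        (l.continuous.comp (continuous_apply i)).mul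
          (α.cont.comp (continuous_pi fun j => continuous_apply _))
      exact h1.const_smul ((-1 : ℤ) ^ (i : ℕ))
    convert h using 1
    funext v
    simp [AlternatingMap.alternatizeUncurryFin_apply]

theorem extMul_apply {k : ℕ} (l : V →L[ℝ] ℝ) (α : V [⋀^Fin k]→L[ℝ] ℝ) (v : Fin (k + 1) → V) :
    extMul l α v = ∑ i : Fin (k + 1), (-1 : ℝ) ^ (i : ℕ) * (l (v i) * α (i.removeNth v)) := by
  change AlternatingMap.alternatizeUncurryFin _ v = _
  simp [AlternatingMap.alternatizeUncurryFin_apply]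

theorem contract_extMul_zero (l : V →L[ℝ] ℝ) (α : V [⋀^Fin 0]→L[ℝ] ℝ) (u : V) :
    contract u (extMul l α) = l u • α := by
  ext v
  simp [extMul_apply, Subsingleton.elim _ v]

theorem contract_extMul {k : ℕ} (l : V →L[ℝ] ℝ) (α : V [⋀^Fin (k + 1)]→L[ℝ] ℝ) (u : V) :
    contract u (extMul l α) = l u • α - extMul l (contract u α) := by
  ext v
  rw [contract_apply, extMul_apply, Fin.sum_univ_succ, ContinuousAlternatingMap.sub_apply,
    extMul_apply, sub_eq_add_neg, ← Finset.sum_neg_distrib]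
  congr 1
  · simp
  · refine Finset.sum_congr rfl fun i _ => ?_
    have : i.succ.removeNth (Matrix.vecCons u v) = Matrix.vecCons u (i.removeNth v) := by
      funext j
      refine Fin.cases ?_ (fun j => ?_) j
      · simp [Fin.removeNth]
      · simp [Fin.removeNth]
    rw [contract_apply, this]
    simp [pow_succ]

/-- Contraction on forms of mixed degree. -/
def gι (u : V) : GForm V →ₗ[ℝ] GForm V where
  toFun a k := contract u (a (k + 1))
  map_add' _ _ := rfl
  map_smul' _ _ := rfl

theorem gι_apply (u : V) (a : GForm V) (k : ℕ) : gι u a k = contract u (a (k + 1)) := rfl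

/-- Exterior multiplication by a covector on forms of mixed degree. -/
def gε (l : V →L[ℝ] ℝ) : GForm V →ₗ[ℝ] GForm V where
  toFun a
    | 0 => 0
    | k + 1 => extMul l (a k)
  map_add' a b := by
    funext k
    cases k with
    | zero => exact (add_zero (0 : V [⋀^Fin 0]→L[ℝ] ℝ)).symm
    | succ k =>
      ext v
      change extMul l (a k + b k) v = extMul l (a k) v + extMul l (b k) v
      simp [extMul_apply, mul_add, Finset.sum_add_distrib]
  map_smul' c a := by
    funext k
    cases k with
    | zero => exact (smul_zero c).symm
    | succ k =>
      ext v
      change extMul l (c • a k) v = c * extMul l (a k) v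
      rw [extMul_apply, extMul_apply, Finset.mul_sum]
      refine Finset.sum_congr rfl fun i _ => ?_
      rw [ContinuousAlternatingMap.smul_apply, smul_eq_mul]
      ring

theorem gε_zero (l : V →L[ℝ] ℝ) (a : GForm V) : gε l a 0 = 0 := rfl

theorem gε_succ (l : V →L[ℝ] ℝ) (a : GForm V) (k : ℕ) : gε l a (k + 1) = extMul l (a k) := rfl

/-- The Lefschetz operator `a ↦ a ∧ w` on forms of mixed degree. -/
noncomputable def gL (w : V [⋀^Fin 2]→L[ℝ] ℝ) : GForm V →ₗ[ℝ] GForm V where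
  toFun a
    | 0 => 0
    | 1 => 0
    | k + 2 => wedge (a k) w
  map_add' a b := by
    funext k
    match k with
    | 0 => exact (add_zero (0 : V [⋀^Fin 0]→L[ℝ] ℝ)).symm
    | 1 => exact (add_zero (0 : V [⋀^Fin 1]→L[ℝ] ℝ)).symm
    | k + 2 => exact wedge_add_left (a k) (b k) w
  map_smul' c a := by
    funext k
    match k with
    | 0 => exact (smul_zero c).symm
    | 1 => exact (smul_zero c).symm
    | k + 2 => exact wedge_smul_left c (a k) w

theorem gL_add_two (w : V [⋀^Fin 2]→L[ℝ] ℝ) (a : GForm V) (k : ℕ) :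
    gL w a (k + 2) = wedge (a k) w := rfl

theorem gform_ext {a b : GForm V} (h0 : a 0 = b 0) (h : ∀ u, gι u a = gι u b) : a = b := by
  funext k
  cases k with
  | zero => exact h0
  | succ k =>
    ext v
    rw [← Matrix.cons_head_tail v]
    exact DFunLike.congr_fun (congrFun (h (Matrix.vecHead v)) k) (Matrix.vecTail v)

/-- A form of positive degree is determined by its contractions, so that identities between
operators on forms can be verified by induction on the degree. -/
theorem gform_induction (F : GForm V → GForm V) (h0 : ∀ a, F a 0 = 0)
    (h : ∀ a u k, (∀ b, F b k = 0) → gι u (F a) k = 0) (a : GForm V) : F a = 0 := by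
  have : ∀ k a, F a k = 0 := by
    intro k
    induction k with
    | zero => exact h0
    | succ k ih =>
      intro a
      ext v
      rw [← Matrix.cons_head_tail v]
      exact DFunLike.congr_fun (h a (Matrix.vecHead v) k ih) (Matrix.vecTail v)
  exact funext fun k => this k a

theorem gι_gι (u v : V) (a : GForm V) : gι u (gι v a) = -gι v (gι u a) := by
  funext k
  ext x
  change a (k + 2) (Matrix.vecCons v (Matrix.vecCons u x)) =
    -(a (k + 2) (Matrix.vecCons u (Matrix.vecCons v x)))
  have := (a (k + 2)).toAlternatingMap.map_swap (Matrix.vecCons u (Matrix.vecCons v x))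
    (i := 0) (j := 1) (by simp)
  rw [← ContinuousAlternatingMap.coe_toAlternatingMap, ← this]
  congr 1
  funext i
  refine Fin.cases ?_ (fun i => Fin.cases ?_ (fun i => ?_) i) i
  · simp
  · simp
  · rw [Function.comp_apply, Equiv.swap_apply_of_ne_of_ne (by simp [Fin.ext_iff])
      (by simp [Fin.ext_iff])]
    simp

theorem gι_self (u : V) (a : GForm V) : gι u (gι u a) = 0 := by
  have h := gι_gι u u a
  have h2 : (2 : ℝ) • gι u (gι u a) = 0 := by
    rw [two_smul]; nth_rewrite 1 [h]; exact neg_add_cancel _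
  exact (smul_eq_zero.mp h2).resolve_left two_ne_zero

theorem gι_add (u v : V) (a : GForm V) : gι (u + v) a = gι u a + gι v a := by
  funext k; ext x
  exact (a (k + 1)).toAlternatingMap.map_vecCons_add _ _ _

theorem gι_smul (c : ℝ) (u : V) (a : GForm V) : gι (c • u) a = c • gι u a := by
  funext k; ext x
  exact (a (k + 1)).toAlternatingMap.map_vecCons_smul _ _ _

/-- Contraction as a linear map of the vector. -/
def gιₗ (a : GForm V) : V →ₗ[ℝ] GForm V where
  toFun u := gι u a
  map_add' u v := gι_add u v a
  map_smul' c u := gι_smul c u a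

theorem gι_sum {ι : Type*} (s : Finset ι) (f : ι → V) (a : GForm V) :
    gι (∑ i ∈ s, f i) a = ∑ i ∈ s, gι (f i) a := map_sum (gιₗ a) f s

theorem gι_gε (u : V) (l : V →L[ℝ] ℝ) (a : GForm V) : gι u (gε l a) = l u • a - gε l (gι u a) := by
  funext k
  cases k with
  | zero =>
    change contract u (extMul l (a 0)) = l u • a 0 - 0
    rw [contract_extMul_zero, sub_zero]
  | succ k => exact contract_extMul l (a (k + 1)) u

theorem extMul_add_left {k : ℕ} (l l' : V →L[ℝ] ℝ) (α : V [⋀^Fin k]→L[ℝ] ℝ) :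
    extMul (l + l') α = extMul l α + extMul l' α := by
  ext v
  simp [extMul_apply, add_mul, mul_add, Finset.sum_add_distrib]

theorem extMul_smul_left {k : ℕ} (c : ℝ) (l : V →L[ℝ] ℝ) (α : V [⋀^Fin k]→L[ℝ] ℝ) :
    extMul (c • l) α = c • extMul l α := by
  ext v
  rw [ContinuousAlternatingMap.smul_apply, extMul_apply, extMul_apply, smul_eq_mul, Finset.mul_sum]
  refine Finset.sum_congr rfl fun i _ => ?_
  rw [smul_apply, smul_eq_mul]
  ring

/-- Exterior multiplication as a linear map of the covector. -/
def gεₗ (a : GForm V) : (V →L[ℝ] ℝ) →ₗ[ℝ] GForm V where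
  toFun l := gε l a
  map_add' l l' := by
    funext k
    cases k with
    | zero => exact (add_zero (0 : V [⋀^Fin 0]→L[ℝ] ℝ)).symm
    | succ k => exact extMul_add_left l l' (a k)
  map_smul' c l := by
    funext k
    cases k with
    | zero => exact (smul_zero c).symm
    | succ k => exact extMul_smul_left c l (a k)

theorem gε_sub_left (l l' : V →L[ℝ] ℝ) (a : GForm V) : gε (l - l') a = gε l a - gε l' a :=
  map_sub (gεₗ a) l l'

theorem gε_smul_left (c : ℝ) (l : V →L[ℝ] ℝ) (a : GForm V) : gε (c • l) a = c • gε l a :=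
  map_smul (gεₗ a) c l

theorem gε_zero_left (a : GForm V) : gε 0 a = 0 := map_zero (gεₗ a)

theorem gε_gε (l l' : V →L[ℝ] ℝ) (a : GForm V) : gε l (gε l' a) = -gε l' (gε l a) := by
  rw [eq_neg_iff_add_eq_zero]
  refine gform_induction (fun a => gε l (gε l' a) + gε l' (gε l a)) (fun a => ?_)
    (fun a u k ih => ?_) a
  · exact add_zero (0 : V [⋀^Fin 0]→L[ℝ] ℝ)
  · have : gι u (gε l (gε l' a) + gε l' (gε l a)) =
        gε l (gε l' (gι u a)) + gε l' (gε l (gι u a)) := by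
      simp only [map_add, gι_gε, map_sub, map_smul]
      abel
    rw [this]
    exact ih _

/-- A one-form regarded as a covector. -/
def oneFormCLM (μ : V [⋀^Fin 1]→L[ℝ] ℝ) : V →L[ℝ] ℝ :=
  (ContinuousAlternatingMap.ofSubsingleton ℝ V ℝ (0 : Fin 1)).symm μ

theorem oneFormCLM_apply (μ : V [⋀^Fin 1]→L[ℝ] ℝ) (v : V) : oneFormCLM μ v = μ ![v] := by
  change μ (fun _ => v) = μ ![v]
  congr 1
  funext i
  fin_cases i
  rfl

theorem wedge_oneForm {p : ℕ} (α : V [⋀^Fin p]→L[ℝ] ℝ) (μ : V [⋀^Fin 1]→L[ℝ] ℝ) :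
    wedge α μ = (-1 : ℝ) ^ p • extMul (oneFormCLM μ) α := by
  induction p with
  | zero =>
    ext v
    rw [show v = fun i => v (Fin.cast rfl i) from rfl, wedge_degree_zero_left]
    simp [extMul_apply, oneFormCLM_apply, Subsingleton.elim _ (![] : Fin 0 → V)]
    rw [mul_comm]
    congr 2
    funext i
    fin_cases i
    rfl
  | succ p ih =>
    ext v
    rw [← Matrix.cons_head_tail v]
    set u := Matrix.vecHead v
    set x := Matrix.vecTail v
    have h1 := wedge_vecCons (p := p) (q := 0) rfl α μ u x
    have h2 := wedge_degree_zero_right α (contract u μ) x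
    have h3 := DFunLike.congr_fun (ih (contract u α)) x
    have h4 := DFunLike.congr_fun (contract_extMul (oneFormCLM μ) α u) x
    simp only [Fin.cast_eq_self] at h1 h2
    rw [h1]
    change wedge (contract u α) μ x + (-1) ^ (p + 1) * wedge α (contract u μ) x = _
    rw [h2, h3, ContinuousAlternatingMap.smul_apply, ContinuousAlternatingMap.smul_apply,
      ← contract_apply, h4, ContinuousAlternatingMap.sub_apply, ContinuousAlternatingMap.smul_apply,
      oneFormCLM_apply, contract_apply]
    simp only [smul_eq_mul]
    ring

theorem gι_gL (u : V) (w : V [⋀^Fin 2]→L[ℝ] ℝ) (a : GForm V) :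
    gι u (gL w a) = gL w (gι u a) + gε (flat w u) a := by
  have hflat : oneFormCLM (contract u w) = flat w u := by
    ext v; exact oneFormCLM_apply _ _
  funext k
  match k with
  | 0 => exact (add_zero (0 : V [⋀^Fin 0]→L[ℝ] ℝ)).symm
  | 1 =>
    change contract (k := 1) u (wedge (p := 0) (q := 2) (a 0) w) = 0 + extMul (flat w u) (a 0)
    ext v
    have h1 := wedge_vecCons_zero_left (q := 1) rfl (a 0) w u v
    have h2 := DFunLike.congr_fun (wedge_oneForm (a 0) (contract u w)) v
    rw [pow_zero, one_smul, hflat] at h2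
    simp only [Fin.cast_eq_self] at h1
    rw [contract_apply, h1, ContinuousAlternatingMap.add_apply]
    exact h2.trans (zero_add _).symm
  | k + 2 =>
    change contract (k := k + 2) u (wedge (p := k + 1) (q := 2) (a (k + 1)) w) =
      wedge (p := k) (q := 2) (contract u (a (k + 1))) w + extMul (flat w u) (a (k + 1))
    ext v
    have h1 := wedge_vecCons (p := k) (q := 1) rfl (a (k + 1)) w u v
    have h2 := DFunLike.congr_fun (wedge_oneForm (a (k + 1)) (contract u w)) v
    rw [hflat, ContinuousAlternatingMap.smul_apply, smul_eq_mul] at h2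
    simp only [Fin.cast_eq_self] at h1
    rw [contract_apply, h1, ContinuousAlternatingMap.add_apply]
    congr 1
    change (-1 : ℝ) ^ (k + 1) * wedge (a (k + 1)) (contract u w) v = _
    rw [h2, ← mul_assoc, ← mul_pow]
    simp

theorem gL_gε (w : V [⋀^Fin 2]→L[ℝ] ℝ) (l : V →L[ℝ] ℝ) (a : GForm V) :
    gL w (gε l a) = gε l (gL w a) := by
  rw [← sub_eq_zero]
  refine gform_induction (fun a => gL w (gε l a) - gε l (gL w a)) (fun a => ?_)
    (fun a u k ih => ?_) a
  · exact sub_zero (0 : V [⋀^Fin 0]→L[ℝ] ℝ)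
  · have : gι u (gL w (gε l a) - gε l (gL w a)) =
        -(gL w (gε l (gι u a)) - gε l (gL w (gι u a))) := by
      simp only [map_add, gι_gε, map_sub, map_smul, gι_gL]
      rw [gε_gε (flat w u) l a]
      abel
    rw [this]
    change -((gL w (gε l (gι u a)) - gε l (gL w (gι u a))) k) = 0
    rw [ih, neg_zero]

theorem gL_add_left (w w' : V [⋀^Fin 2]→L[ℝ] ℝ) (a : GForm V) :
    gL (w + w') a = gL w a + gL w' a := by
  funext k
  match k with
  | 0 => exact (add_zero (0 : V [⋀^Fin 0]→L[ℝ] ℝ)).symm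
  | 1 => exact (add_zero (0 : V [⋀^Fin 1]→L[ℝ] ℝ)).symm
  | k + 2 => exact wedge_add_right (a k) w w'

theorem gL_smul_left (c : ℝ) (w : V [⋀^Fin 2]→L[ℝ] ℝ) (a : GForm V) :
    gL (c • w) a = c • gL w a := by
  funext k
  match k with
  | 0 => exact (smul_zero c).symm
  | 1 => exact (smul_zero c).symm
  | k + 2 => exact wedge_smul_right c (a k) w

end GForm

/-! ### The Lefschetz module of horizontal forms on a vector space -/

section Horizontal

variable {V : Type*} [AddCommGroup V] [Module ℝ V] [TopologicalSpace V]

/-- A dual pair for a 2-form whose rank is `2n`, so that each half of the pair spans a complement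
of the kernel. -/
structure IsFrame (w : V [⋀^Fin 2]→L[ℝ] ℝ) (n : ℕ) (e e' : Fin (2 * n) → V) : Prop where
  dual : IsDualPair w n e e'
  ker : ∀ u, (∀ i, w ![u, e i] = 0) → ∀ v, w ![u, v] = 0

/-- The forms annihilated by contraction with the kernel of `w`. -/
def gHor (w : V [⋀^Fin 2]→L[ℝ] ℝ) : Submodule ℝ (GForm V) where
  carrier := {a | ∀ u, (∀ v, w ![u, v] = 0) → gι u a = 0}
  add_mem' {a b} ha hb u hu := by rw [map_add, ha u hu, hb u hu, add_zero]
  zero_mem' u _ := map_zero _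
  smul_mem' c a ha u hu := by rw [map_smul, ha u hu, smul_zero]

theorem mem_gHor_iff {w : V [⋀^Fin 2]→L[ℝ] ℝ} {a : GForm V} :
    a ∈ gHor w ↔ ∀ k, IsHorizontal w k (a k) := by
  constructor
  · intro h k
    cases k with
    | zero => trivial
    | succ k => exact fun u hu => congrFun (h u hu) k
  · intro h u hu
    funext k
    exact h (k + 1) u hu

/-- The horizontal forms of degree `k`. -/
def gH (w : V [⋀^Fin 2]→L[ℝ] ℝ) (k : ℕ) : Submodule ℝ (GForm V) where
  carrier := {a | a ∈ gHor w ∧ ∀ j, j ≠ k → a j = 0}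
  add_mem' {a b} ha hb := ⟨add_mem ha.1 hb.1, fun j hj => by
    rw [Pi.add_apply, ha.2 j hj, hb.2 j hj, add_zero]⟩
  zero_mem' := ⟨zero_mem _, fun _ _ => rfl⟩
  smul_mem' c a ha := ⟨Submodule.smul_mem _ c ha.1, fun j hj => by
    rw [Pi.smul_apply, ha.2 j hj, smul_zero]⟩

variable {w : V [⋀^Fin 2]→L[ℝ] ℝ} {n : ℕ} {e e' : Fin (2 * n) → V}

theorem flat_eq_zero {u : V} (hu : ∀ v, w ![u, v] = 0) : flat w u = 0 := by
  ext v; exact hu v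

theorem gι_mem_gHor {a : GForm V} (ha : a ∈ gHor w) (u : V) : gι u a ∈ gHor w := by
  intro v hv
  rw [gι_gι, ha v hv, map_zero, neg_zero]

theorem gε_mem_gHor {a : GForm V} (ha : a ∈ gHor w) {l : V →L[ℝ] ℝ}
    (hl : ∀ u, (∀ v, w ![u, v] = 0) → l u = 0) : gε l a ∈ gHor w := by
  intro v hv
  rw [gι_gε, ha v hv, map_zero, hl v hv, zero_smul, sub_zero]

theorem gL_mem_gHor {a : GForm V} (ha : a ∈ gHor w) : gL w a ∈ gHor w := by
  intro v hv
  rw [gι_gL, ha v hv, map_zero, flat_eq_zero hv, gε_zero_left, add_zero]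

theorem flat_ker (u : V) : ∀ v, (∀ x, w ![v, x] = 0) → flat w u v = 0 := by
  intro v hv
  rw [flat_apply, form_two_swap, hv, neg_zero]

theorem gι_mem_gH {a : GForm V} {k : ℕ} (ha : a ∈ gH w (k + 1)) (u : V) : gι u a ∈ gH w k :=
  ⟨gι_mem_gHor ha.1 u, fun j hj => by
    rw [gι_apply, ha.2 (j + 1) (by omega)]; rfl⟩

theorem gι_eq_zero_of_mem {a : GForm V} (ha : a ∈ gH w 0) (u : V) : gι u a = 0 := by
  funext j
  rw [gι_apply, ha.2 (j + 1) (by omega)]; rfl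

theorem extMul_zero_right (l : V →L[ℝ] ℝ) (k : ℕ) : extMul l (0 : V [⋀^Fin k]→L[ℝ] ℝ) = 0 := by
  ext v; simp [extMul_apply]

theorem wedge_zero_left' (p : ℕ) : wedge (0 : V [⋀^Fin p]→L[ℝ] ℝ) w = 0 := by
  have := wedge_smul_left (0 : ℝ) (0 : V [⋀^Fin p]→L[ℝ] ℝ) w
  simpa using this

theorem gε_mem_gH {a : GForm V} {k : ℕ} (ha : a ∈ gH w k) {l : V →L[ℝ] ℝ}
    (hl : ∀ u, (∀ v, w ![u, v] = 0) → l u = 0) : gε l a ∈ gH w (k + 1) := by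
  refine ⟨gε_mem_gHor ha.1 hl, fun j hj => ?_⟩
  cases j with
  | zero => rfl
  | succ j => rw [gε_succ, ha.2 j (by omega), extMul_zero_right]

theorem gL_mem_gH {a : GForm V} {k : ℕ} (ha : a ∈ gH w k) : gL w a ∈ gH w (k + 2) := by
  refine ⟨gL_mem_gHor ha.1, fun j hj => ?_⟩
  match j with
  | 0 => rfl
  | 1 => rfl
  | j + 2 => rw [gL_add_two, ha.2 j (by omega), wedge_zero_left']

theorem gι_congr {a : GForm V} (ha : a ∈ gHor w) {u v : V} (h : ∀ x, w ![u, x] = w ![v, x]) :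
    gι u a = gι v a := by
  have h1 : gι (u + (-1 : ℝ) • v) a = 0 := ha _ fun x => by
    rw [form_two_add_left, form_two_smul_left, h]; ring
  rw [gι_add, gι_smul, neg_one_smul, ← sub_eq_add_neg, sub_eq_zero] at h1
  exact h1

namespace IsFrame

theorem expand (h : IsFrame w n e e') (y v : V) :
    w ![y, v] = ∑ i, w ![y, e i] * w ![e' i, v] := by
  have h1 := h.ker (y + (-1 : ℝ) • ∑ i, w ![y, e i] • e' i) (fun j => by
    rw [form_two_add_left, form_two_smul_left, form_two_sum_left]
    simp [form_two_smul_left, h.dual _ j]) v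
  rw [form_two_add_left, form_two_smul_left, form_two_sum_left] at h1
  simp only [form_two_smul_left] at h1
  linarith

theorem gι_expand_left (h : IsFrame w n e e') {a : GForm V} (ha : a ∈ gHor w) (y : V) :
    gι y a = ∑ i, w ![y, e i] • gι (e' i) a := by
  simp_rw [← gι_smul]
  rw [← gι_sum]
  refine gι_congr ha fun v => ?_
  rw [form_two_sum_left, h.expand y v]
  simp [form_two_smul_left]

theorem gι_expand_right (h : IsFrame w n e e') {a : GForm V} (ha : a ∈ gHor w) (v : V) :
    gι v a = ∑ i, w ![e' i, v] • gι (e i) a := by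
  simp_rw [← gι_smul]
  rw [← gι_sum]
  refine gι_congr ha fun y => ?_
  rw [form_two_swap w v, form_two_sum_left, h.expand y v, ← Finset.sum_neg_distrib]
  refine Finset.sum_congr rfl fun i _ => ?_
  rw [form_two_smul_left, form_two_swap w (e i) y]
  ring

/-- The Euler identity `∑ e'_i ∧ ι(e_i) a = k a`. -/
theorem euler (h : IsFrame w n e e') {k : ℕ} : ∀ {a : GForm V}, a ∈ gH w k →
    ∑ i, gε (flat w (e' i)) (gι (e i) a) = (k : ℝ) • a := by
  induction k with
  | zero =>
    intro a ha
    simp [gι_eq_zero_of_mem ha]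
  | succ k ih =>
    intro a ha
    refine gform_ext ?_ fun u => ?_
    · rw [Finset.sum_apply, Pi.smul_apply, ha.2 0 (by omega), smul_zero]
      exact Finset.sum_eq_zero fun i _ => rfl
    · rw [map_sum, map_smul]
      simp only [gι_gε]
      rw [Finset.sum_sub_distrib]
      simp only [flat_apply, gι_gι u (e _), map_neg, Finset.sum_neg_distrib]
      rw [← h.gι_expand_right ha.1, ih (gι_mem_gH ha u)]
      push_cast
      module

/-- The second Euler identity, in which the two halves of the pair are exchanged. -/
theorem euler' (h : IsFrame w n e e') {k : ℕ} : ∀ {a : GForm V}, a ∈ gH w k →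
    ∑ i, gε (flat w (e i)) (gι (e' i) a) = -(k : ℝ) • a := by
  induction k with
  | zero =>
    intro a ha
    simp [gι_eq_zero_of_mem ha]
  | succ k ih =>
    intro a ha
    refine gform_ext ?_ fun u => ?_
    · rw [Finset.sum_apply, Pi.smul_apply, ha.2 0 (by omega), smul_zero]
      exact Finset.sum_eq_zero fun i _ => rfl
    · rw [map_sum, map_smul]
      simp only [gι_gε]
      rw [Finset.sum_sub_distrib]
      simp only [flat_apply, gι_gι u (e' _), map_neg, Finset.sum_neg_distrib]
      have h1 := h.gι_expand_left ha.1 u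
      simp only [form_two_swap w u, neg_smul, Finset.sum_neg_distrib] at h1
      rw [ih (gι_mem_gH ha u), neg_eq_iff_eq_neg.mp h1.symm]
      push_cast
      module

theorem eq_zero_of_gι (h : IsFrame w n e e') {k : ℕ} {a : GForm V} (ha : a ∈ gH w (k + 1))
    (h0 : ∀ i, gι (e i) a = 0) : a = 0 := by
  have := h.euler ha
  simp only [h0, map_zero, Finset.sum_const_zero] at this
  exact (smul_eq_zero.mp this.symm).resolve_left (by positivity)

theorem eq_zero_of_lt (h : IsFrame w n e e') {k : ℕ} (hk : 2 * n < k) {a : GForm V}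
    (ha : a ∈ gH w k) : a = 0 := by
  have key : ∀ s : Finset (Fin (2 * n)), ∀ k, s.card < k → ∀ a ∈ gH w k,
      (∀ i ∉ s, gι (e i) a = 0) → a = 0 := by
    intro s
    induction s using Finset.induction_on with
    | empty =>
      intro k hk a ha h0
      obtain ⟨k, rfl⟩ : ∃ j, k = j + 1 := ⟨k - 1, by simp at hk; omega⟩
      exact h.eq_zero_of_gι ha fun i => h0 i (by simp)
    | insert i s hi ih =>
      intro k hk a ha h0
      rw [Finset.card_insert_of_notMem hi] at hk
      obtain ⟨k, rfl⟩ : ∃ j, k = j + 1 := ⟨k - 1, by omega⟩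
      have h1 : gι (e i) a = 0 := by
        refine ih k (by omega) _ (gι_mem_gH ha _) fun j hj => ?_
        by_cases hji : j = i
        · rw [hji, gι_self]
        · rw [gι_gι, h0 j (by simp [hji, hj]), map_zero, neg_zero]
      refine ih (k + 1) (by omega) a ha fun j hj => ?_
      by_cases hji : j = i
      · rw [hji, h1]
      · exact h0 j (by simp [hji, hj])
  exact key Finset.univ k (by simpa using hk) a ha fun i hi => absurd (Finset.mem_univ i) hi

end IsFrame

/-- Contraction with the bivector `-½ ∑ e'_i ∧ e_i` inverse to `w`. -/
noncomputable def gΛ (e e' : Fin (2 * n) → V) : GForm V →ₗ[ℝ] GForm V :=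
  (-(1 / 2 : ℝ)) • ∑ i, gι (e' i) ∘ₗ gι (e i)

theorem gΛ_apply (e e' : Fin (2 * n) → V) (a : GForm V) :
    gΛ e e' a = (-(1 / 2 : ℝ)) • ∑ i, gι (e' i) (gι (e i) a) := by
  simp [gΛ, LinearMap.sum_apply]

theorem gΛ_mem_gHor {a : GForm V} (ha : a ∈ gHor w) : gΛ e e' a ∈ gHor w := by
  rw [gΛ_apply]
  exact Submodule.smul_mem _ _ (Submodule.sum_mem _ fun i _ =>
    gι_mem_gHor (gι_mem_gHor ha _) _)

namespace IsFrame

theorem isLefschetz (h : IsFrame w n e e') : IsLefschetz n (gH w) (gL w) (gΛ e e') where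
  L_mem ha := gL_mem_gH ha
  Λ_mem ha := by
    rw [gΛ_apply]
    exact Submodule.smul_mem _ _ (Submodule.sum_mem _ fun i _ => gι_mem_gH (gι_mem_gH ha _) _)
  Λ_low {k x} hk ha := by
    rw [gΛ_apply, Finset.sum_eq_zero, smul_zero]
    intro i _
    rcases k with _ | k
    · rw [gι_eq_zero_of_mem ha, map_zero]
    · obtain rfl : k = 0 := by omega
      exact gι_eq_zero_of_mem (gι_mem_gH ha _) _
  comm {k x} ha := by
    have h1 : ∀ i, gι (e' i) (gι (e i) (gL w x)) = gL w (gι (e' i) (gι (e i) x)) +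
        gε (flat w (e' i)) (gι (e i) x) - x - gε (flat w (e i)) (gι (e' i) x) := by
      intro i
      have h2 : w ![e i, e' i] = -1 := by rw [form_two_swap, h.dual i i, if_pos rfl]
      rw [gι_gL, map_add, gι_gL, gι_gε, flat_apply, h2]
      module
    rw [gΛ_apply, gΛ_apply]
    simp only [h1, map_smul, map_sum]
    rw [Finset.sum_sub_distrib, Finset.sum_sub_distrib, Finset.sum_add_distrib, h.euler ha,
      h.euler' ha, Finset.sum_const, Finset.card_univ, Fintype.card_fin, ← Nat.cast_smul_eq_nsmul ℝ]
    push_cast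
    module
  top hk ha := h.eq_zero_of_lt hk ha

/-- `[Λ, u♭ ∧ ·] = -ι(u)` on horizontal forms. -/
theorem gΛ_gε (h : IsFrame w n e e') (u : V) {x : GForm V} (hx : x ∈ gHor w) :
    gΛ e e' (gε (flat w u) x) = gε (flat w u) (gΛ e e' x) - gι u x := by
  have h1 : ∀ i, gι (e' i) (gι (e i) (gε (flat w u) x)) =
      gε (flat w u) (gι (e' i) (gι (e i) x)) + w ![u, e i] • gι (e' i) x -
        w ![u, e' i] • gι (e i) x := by
    intro i
    rw [gι_gε, map_sub, map_smul, gι_gε, flat_apply, flat_apply]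
    abel
  have h2 := h.gι_expand_left hx u
  have h3 := h.gι_expand_right hx u
  have h4 : ∑ i, w ![u, e' i] • gι (e i) x = -gι u x := by
    rw [h3, ← Finset.sum_neg_distrib]
    exact Finset.sum_congr rfl fun i _ => by rw [form_two_swap, neg_smul]
  rw [gΛ_apply, gΛ_apply]
  simp only [h1, map_smul, map_sum]
  rw [Finset.sum_sub_distrib, Finset.sum_add_distrib, ← h2, h4]
  module

/-- The operators `u♭ ∧ ·` and `-ι(u)` on horizontal forms. -/
theorem isOddPair (h : IsFrame w n e e') (u : V) :
    IsOddPair (gH w) (gL w) (gΛ e e') (gε (flat w u)) (-gι u) where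
  a_mem ha := gε_mem_gH ha (flat_ker u)
  b_mem ha := neg_mem (gι_mem_gH ha u)
  b_low ha := by rw [LinearMap.neg_apply, gι_eq_zero_of_mem ha, neg_zero]
  Λ_a {k x} ha := by rw [h.gΛ_gε u ha.1, LinearMap.neg_apply, sub_eq_add_neg]
  L_a _ := gL_gε _ _ _
  Λ_b {k x} _ := by
    rw [gΛ_apply, gΛ_apply]
    simp only [LinearMap.neg_apply, map_neg, map_smul, map_sum]
    congr 1
    refine Finset.sum_congr rfl fun i _ => ?_
    rw [gι_gι (e i) u, map_neg, gι_gι (e' i) u, neg_neg]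
  L_b {k x} _ := by
    rw [LinearMap.neg_apply, LinearMap.neg_apply, gι_gL, map_neg]
    abel

/-- The contraction with the inverse bivector does not depend on the frame. -/
theorem gΛ_eq (h : IsFrame w n e e') {f f' : Fin (2 * n) → V} (h' : IsFrame w n f f') {a : GForm V}
    (ha : a ∈ gHor w) : gΛ e e' a = gΛ f f' a := by
  rw [gΛ_apply, gΛ_apply]
  congr 1
  have h1 : ∀ i, gι (e' i) (gι (e i) a) =
      ∑ j, w ![f' j, e i] • gι (e' i) (gι (f j) a) := by
    intro i
    rw [h'.gι_expand_right ha (e i), map_sum]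
    simp only [map_smul]
  simp only [h1]
  rw [Finset.sum_comm]
  refine Finset.sum_congr rfl fun j _ => ?_
  exact (h.gι_expand_left (gι_mem_gHor ha _) (f' j)).symm

/-- An induction principle based on the Euler identity. -/
theorem gH_induction (h : IsFrame w n e e') {P : ℕ → GForm V → Prop}
    (zero : ∀ a ∈ gH w 0, P 0 a)
    (mul : ∀ k u, ∀ a ∈ gH w k, P k a → P (k + 1) (gε (flat w u) a))
    (sum : ∀ k (f : Fin (2 * n) → GForm V), (∀ i, P k (f i)) → P k (∑ i, f i))
    (smul : ∀ k (c : ℝ) a, P k a → P k (c • a)) {k : ℕ} :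
    ∀ {a : GForm V}, a ∈ gH w k → P k a := by
  induction k with
  | zero => exact fun ha => zero _ ha
  | succ k ih =>
    intro a ha
    have h1 := h.euler ha
    have h2 : a = ((k + 1 : ℕ) : ℝ)⁻¹ • ∑ i, gε (flat w (e' i)) (gι (e i) a) := by
      rw [h1, smul_smul, inv_mul_cancel₀ (by positivity), one_smul]
    rw [h2]
    exact smul _ _ _ (sum _ _ fun i => mul _ _ _ (gι_mem_gH ha _) (ih (gι_mem_gH ha _)))

/-- The error term of `star_b` vanishes: `lefschetzStar` with `n + 1` in place of `n` is zero on
functions for degree reasons, and it is compatible with multiplication by covectors. -/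
theorem star_shift_eq_zero (h : IsFrame w n e e') {p : ℕ} {a : GForm V} (ha : a ∈ gH w p) :
    lefschetzStar (gL w) (gΛ e e') (n + 1) (n + 1) p a = 0 := by
  refine h.gH_induction (P := fun p a =>
    lefschetzStar (gL w) (gΛ e e') (n + 1) (n + 1) p a = 0) ?_ ?_ ?_ ?_ ha
  · intro a ha
    rw [lefschetzStar_apply]
    refine Finset.sum_eq_zero fun j _ => ?_
    rcases j with _ | j
    · rw [pow_zero, Module.End.one_apply, h.isLefschetz.top _ (h.isLefschetz.L_pow_mem ha _),
        smul_zero]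
      omega
    · rw [h.isLefschetz.Λ_pow_eq_zero_of_lt (by omega) ha, map_zero, smul_zero]
  · intro k u a ha h1
    rw [(h.isOddPair u).star_a h.isLefschetz _ ha, h1, map_zero, neg_zero]
  · intro k f hf
    rw [map_sum]
    exact Finset.sum_eq_zero fun i _ => hf i
  · intro k c a h1
    rw [map_smul, h1, smul_zero]

/-- The star turns contractions into multiplications by covectors. -/
theorem star_gι (h : IsFrame w n e e') {p : ℕ} {a : GForm V} (ha : a ∈ gH w (p + 1)) (u : V) :
    lefschetzStar (gL w) (gΛ e e') (n + 1) n p (gι u a) =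
      -gε (flat w u) (lefschetzStar (gL w) (gΛ e e') (n + 1) n (p + 1) a) := by
  have := (h.isOddPair u).star_b h.isLefschetz n ha
  rw [h.star_shift_eq_zero ha, map_zero, add_zero, LinearMap.neg_apply, map_neg] at this
  rw [← this, neg_neg]

theorem Λ_pow_L_pow (h : IsFrame w n e e') {a : GForm V} (ha : a ∈ gH w 0) {j : ℕ} (hj : j ≤ n) :
    ((n - j).factorial : ℝ) • (gΛ e e' ^ j) ((gL w ^ n) a) =
      (n.factorial * j.factorial : ℝ) • (gL w ^ (n - j)) a := by
  induction j with
  | zero => simp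
  | succ j ih =>
    have h1 := ih (by omega)
    obtain ⟨r, hr⟩ : ∃ r, n - j = r + 1 := ⟨n - j - 1, by omega⟩
    have h2 := h.isLefschetz.Λ_L_pow ha r
    rw [h.isLefschetz.Λ_low (by omega) ha, map_zero, zero_add] at h2
    have h3 := congrArg (gΛ e e') h1
    rw [map_smul, map_smul, ← Module.End.mul_apply, ← pow_succ', hr, h2, Nat.factorial_succ] at h3
    have h4 : ((n : ℝ) - (0 : ℕ) - r) = j + 1 := by
      have : ((n - j : ℕ) : ℝ) = ((r + 1 : ℕ) : ℝ) := by rw [hr]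
      rw [Nat.cast_sub (by omega)] at this
      push_cast at this ⊢
      linarith
    rw [h4] at h3
    rw [show n - (j + 1) = r by omega, Nat.factorial_succ]
    have h5 : ((r : ℝ) + 1) ≠ 0 := by positivity
    refine smul_right_injective _ h5 ?_
    simp only
    push_cast at h3 ⊢
    rw [smul_smul, smul_smul]
    rw [smul_smul] at h3
    rw [h3]
    congr 1
    ring

theorem star_star (h : IsFrame w n e e') {p : ℕ} (hp : p ≤ 2 * n) {a : GForm V} (ha : a ∈ gH w p) :
    lefschetzStar (gL w) (gΛ e e') (n + 1) n (2 * n - p)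
      (lefschetzStar (gL w) (gΛ e e') (n + 1) n p a) = (-1 : ℝ) ^ (n + p) • a := by
  refine h.gH_induction (P := fun p a => p ≤ 2 * n →
    lefschetzStar (gL w) (gΛ e e') (n + 1) n (2 * n - p)
      (lefschetzStar (gL w) (gΛ e e') (n + 1) n p a) = (-1 : ℝ) ^ (n + p) • a) ?_ ?_ ?_ ?_ ha hp
  · intro a ha _
    rw [IsLefschetz.star_of_Λ_eq_zero (Nat.zero_le n) (h.isLefschetz.Λ_low (by omega) ha),
      map_smul, lefschetzStar_apply, Finset.sum_range_succ, Finset.sum_eq_zero]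
    · have h1 := h.Λ_pow_L_pow ha le_rfl
      simp only [Nat.sub_self, Nat.factorial_zero, Nat.cast_one, one_smul, pow_zero,
        Module.End.one_apply] at h1
      rw [zero_add, Nat.sub_zero, Nat.sub_zero, h1, starCoeff, if_pos (by omega),
        show n + n - 2 * n = 0 by omega]
      simp only [pow_zero, Module.End.one_apply, smul_smul, add_zero, Nat.factorial_zero]
      congr 1
      have : (n.factorial : ℝ) ≠ 0 := by positivity
      field_simp
      simp
    · intro j hj
      rw [starCoeff, if_neg (by rw [Finset.mem_range] at hj; omega), zero_smul]
  · intro k u a ha ih hk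
    have h1 := (h.isOddPair u).star_a h.isLefschetz n ha
    rw [LinearMap.neg_apply, neg_neg] at h1
    have h2 := h.isLefschetz.star_mem ha
    obtain ⟨r, hr⟩ : ∃ r, 2 * n - k = r + 1 := ⟨2 * n - k - 1, by omega⟩
    rw [hr] at h2
    have h3 := ih (by omega)
    rw [hr] at h3
    rw [h1, show 2 * n - (k + 1) = r by omega, h.star_gι h2, h3, map_smul, ← add_assoc, pow_succ]
    simp
  · intro k f hf hk
    rw [map_sum, map_sum, Finset.smul_sum]
    exact Finset.sum_congr rfl fun i _ => hf i hk
  · intro k c a h1 hk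
    rw [map_smul, map_smul, h1 hk, smul_comm]

end IsFrame

end Horizontal

/-! ### The symplectic star on a vector space -/

section Star

variable {V : Type*} [AddCommGroup V] [Module ℝ V] [TopologicalSpace V]

/-- A homogeneous form as a form of mixed degree. -/
def gsingle {p : ℕ} (α : V [⋀^Fin p]→L[ℝ] ℝ) : GForm V := Pi.single p α

theorem gsingle_same {p : ℕ} (α : V [⋀^Fin p]→L[ℝ] ℝ) : gsingle α p = α := Pi.single_eq_same _ _

theorem gsingle_zero {p : ℕ} : gsingle (0 : V [⋀^Fin p]→L[ℝ] ℝ) = 0 := by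
  funext k
  by_cases hk : k = p
  · subst hk; exact gsingle_same _
  · exact Pi.single_eq_of_ne hk _

variable {w : V [⋀^Fin 2]→L[ℝ] ℝ} {n : ℕ} {e e' : Fin (2 * n) → V}

theorem gsingle_mem_gH {p : ℕ} {α : V [⋀^Fin p]→L[ℝ] ℝ} (hα : IsHorizontal w p α) :
    gsingle α ∈ gH w p := by
  refine ⟨mem_gHor_iff.mpr fun k => ?_, fun j hj => Pi.single_eq_of_ne hj _⟩
  by_cases hk : k = p
  · subst hk; rwa [gsingle_same]
  · rw [gsingle, Pi.single_eq_of_ne hk]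
    cases k with
    | zero => trivial
    | succ k => exact fun u _ => rfl

theorem gsingle_apply_self {p : ℕ} {a : GForm V} (ha : a ∈ gH w p) : gsingle (a p) = a := by
  funext j
  by_cases hj : j = p
  · subst hj; rw [gsingle_same]
  · rw [gsingle, Pi.single_eq_of_ne hj, ha.2 j hj]

/-- The wedge product as a linear map of its second argument. -/
noncomputable def wedgeRight {p : ℕ} (q : ℕ) (β : V [⋀^Fin p]→L[ℝ] ℝ) :
    (V [⋀^Fin q]→L[ℝ] ℝ) →ₗ[ℝ] V [⋀^Fin (p + q)]→L[ℝ] ℝ where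
  toFun := wedge β
  map_add' := wedge_add_right β
  map_smul' c := wedge_smul_right c β

/-- Horizontal forms of degree greater than `2n` vanish. -/
theorem IsFrame.wedge_eq_zero (h : IsFrame w n e e') {p q : ℕ} {β : V [⋀^Fin (p + 1)]→L[ℝ] ℝ}
    {η : V [⋀^Fin (q + 1)]→L[ℝ] ℝ} (hβ : IsHorizontal w (p + 1) β) (hη : IsHorizontal w (q + 1) η)
    (hd : 2 * n < p + 1 + (q + 1)) : wedge β η = 0 := by
  have h1 : IsHorizontal w (p + 1 + (q + 1)) (wedge β η) := by
    intro u hu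
    ext v
    have h2 := wedge_vecCons (m := p + 1 + q) rfl β η u v
    rw [hβ u hu, hη u hu] at h2
    have h3 : wedge (0 : V [⋀^Fin p]→L[ℝ] ℝ) η = 0 := by
      simpa using wedge_smul_left (0 : ℝ) (0 : V [⋀^Fin p]→L[ℝ] ℝ) η
    have h4 : wedge β (0 : V [⋀^Fin q]→L[ℝ] ℝ) = 0 := map_zero (wedgeRight q β)
    rw [h3, h4] at h2
    exact h2.trans (by simp)
  have h2 := h.eq_zero_of_lt hd (gsingle_mem_gH h1)
  rw [← gsingle_same (wedge β η), h2]
  rfl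

theorem gL_pow_apply (a : GForm V) (n : ℕ) :
    (gL w ^ n) a (2 * n) = a 0 ![] • wedgePow w n := by
  induction n with
  | zero =>
    ext v
    simp [wedgePow, congrArg (a 0) (Subsingleton.elim (α := Fin 0 → V) v ![])]
  | succ n ih =>
    rw [pow_succ', Module.End.mul_apply]
    change wedge ((gL w ^ n) a (2 * n)) w = _
    rw [ih, wedge_smul_left]
    rfl

/-- The pairing on `p`-covectors written in the dual pair `e`, `e'`. -/
noncomputable def framePairing (e e' : Fin (2 * n) → V) (p : ℕ) (α β : V [⋀^Fin p]→L[ℝ] ℝ) : ℝ :=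
  (p.factorial : ℝ)⁻¹ * ∑ i : Fin p → Fin (2 * n), α (fun a => e (i a)) * β (fun a => e' (i a))

/-- Expansion of the pairing along the first argument. -/
theorem framePairing_succ (p : ℕ) (α β : V [⋀^Fin (p + 1)]→L[ℝ] ℝ) :
    framePairing e e' (p + 1) α β =
      ((p + 1 : ℕ) : ℝ)⁻¹ * ∑ i, framePairing e e' p (contract (e i) α) (contract (e' i) β) := by
  unfold framePairing
  rw [← (Fin.consEquiv (fun _ => Fin (2 * n))).sum_comp, Fintype.sum_prod_type, ← Finset.mul_sum,
    ← mul_assoc, Nat.factorial_succ]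
  congr 1
  · push_cast; rw [mul_inv]
  · refine Finset.sum_congr rfl fun i _ => Finset.sum_congr rfl fun j _ => ?_
    have h1 : ∀ f : Fin (2 * n) → V, (fun a => f (Fin.consEquiv (fun _ => Fin (2 * n)) (i, j) a)) =
        Matrix.vecCons (f i) (fun a => f (j a)) := by
      intro f
      funext a
      refine Fin.cases rfl (fun a => rfl) a
    rw [h1 e, h1 e']
    rfl

/-- The defining property of the symplectic star holds for `lefschetzStar` up to sign: by the Euler
identity `a` is a combination of products `λ ∧ b`, and `lefschetzStar (λ ∧ b)` is a contraction of
`lefschetzStar b`, which can be moved to the other factor because forms of degree greater than `2n`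
vanish. -/
theorem IsFrame.wedge_star (h : IsFrame w n e e') {p : ℕ} :
    ∀ {q : ℕ} (hpq : p + q = 2 * n) {a : GForm V} (_ : a ∈ gH w p) {β : V [⋀^Fin p]→L[ℝ] ℝ}
      (_ : IsHorizontal w p β) (v : Fin (2 * n) → V),
      wedge β (lefschetzStar (gL w) (gΛ e e') (n + 1) n p a q) (fun i => v (Fin.cast hpq i)) =
        (-1) ^ (p.choose 2) * framePairing e e' p (a p) β *
          (wedgePow w n v / (n.factorial : ℝ)) := by
  induction p with
  | zero =>
    intro q hpq a ha β _ v
    obtain rfl : q = 2 * n := by omega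
    rw [IsLefschetz.star_of_Λ_eq_zero (Nat.zero_le n) (h.isLefschetz.Λ_low (by omega) ha),
      wedge_degree_zero_left, Nat.sub_zero, Pi.smul_apply, gL_pow_apply]
    simp [framePairing, Subsingleton.elim _ (![] : Fin 0 → V)]
    ring
  | succ p ih =>
    intro q hpq a ha β hβ v
    have hι : ∀ i, gι (e i) a ∈ gH w p := fun i => gι_mem_gH ha _
    have h1 : lefschetzStar (gL w) (gΛ e e') (n + 1) n (p + 1) a =
        ((p + 1 : ℕ) : ℝ)⁻¹ • ∑ i, gι (e' i)
          (lefschetzStar (gL w) (gΛ e e') (n + 1) n p (gι (e i) a)) := by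
      have h2 : a = ((p + 1 : ℕ) : ℝ)⁻¹ • ∑ i, gε (flat w (e' i)) (gι (e i) a) := by
        rw [h.euler ha, smul_smul, inv_mul_cancel₀ (by positivity), one_smul]
      conv_lhs => rw [h2]
      rw [map_smul, map_sum]
      congr 1
      refine Finset.sum_congr rfl fun i _ => ?_
      rw [(h.isOddPair (e' i)).star_a h.isLefschetz n (hι i), LinearMap.neg_apply, neg_neg]
    have h3 : ∀ i, wedge β (contract (e' i)
        (lefschetzStar (gL w) (gΛ e e') (n + 1) n p (gι (e i) a) (q + 1)))
          (fun i => v (Fin.cast hpq i)) = (-1) ^ p * ((-1) ^ (p.choose 2) *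
            framePairing e e' p (contract (e i) (a (p + 1))) (contract (e' i) β) *
            (wedgePow w n v / (n.factorial : ℝ))) := by
      intro i
      have hS := mem_gHor_iff.mp (h.isLefschetz.star_mem (hι i)).1 (q + 1)
      have h4 := wedge_vecCons (m := 2 * n) (by omega) β
        (lefschetzStar (gL w) (gΛ e e') (n + 1) n p (gι (e i) a) (q + 1)) (e' i) v
      rw [h.wedge_eq_zero hβ hS (by omega)] at h4
      have hβ' : IsHorizontal w p (contract (e' i) β) := by
        have := mem_gHor_iff.mp (gι_mem_gHor (gsingle_mem_gH hβ).1 (e' i)) p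
        rwa [gι_apply, gsingle_same] at this
      have h5 := ih (q := q + 1) (by omega) (hι i) hβ' v
      rw [h5, ContinuousAlternatingMap.coe_zero, Pi.zero_apply, pow_succ] at h4
      have h6 : ((-1 : ℝ) ^ p) * (-1) ^ p = 1 := by rw [← mul_pow]; simp
      rw [gι_apply] at h4
      linear_combination (-1 : ℝ) ^ p * h4 + (wedge β (contract (e' i)
        (lefschetzStar (gL w) (gΛ e e') (n + 1) n p (gι (e i) a) (q + 1)))
          (fun i => v (Fin.cast hpq i))) * (-h6)
    have h7 : lefschetzStar (gL w) (gΛ e e') (n + 1) n (p + 1) a q =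
        ((p + 1 : ℕ) : ℝ)⁻¹ • ∑ i, contract (e' i)
          (lefschetzStar (gL w) (gΛ e e') (n + 1) n p (gι (e i) a) (q + 1)) := by
      rw [h1, Pi.smul_apply, Finset.sum_apply]
      rfl
    have h8 : wedge β (lefschetzStar (gL w) (gΛ e e') (n + 1) n (p + 1) a q) =
        ((p + 1 : ℕ) : ℝ)⁻¹ • ∑ i, wedge β (contract (e' i)
          (lefschetzStar (gL w) (gΛ e e') (n + 1) n p (gι (e i) a) (q + 1))) := by
      rw [h7]
      change wedgeRight q β _ = _
      rw [map_smul, map_sum]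
      rfl
    rw [h8, ContinuousAlternatingMap.smul_apply, ContinuousAlternatingMap.sum_apply,
      Finset.sum_congr rfl fun i _ => h3 i, framePairing_succ, ← Finset.mul_sum, ← Finset.sum_mul,
      ← Finset.mul_sum, Nat.choose_succ_succ' p 1, Nat.choose_one_right, pow_add, smul_eq_mul]
    ring

/-- A horizontal form is determined by its values on one half of a frame. -/
theorem IsFrame.eq_zero_of_apply (h : IsFrame w n e e') {p : ℕ} :
    ∀ {a : GForm V}, a ∈ gH w p → (∀ i : Fin p → Fin (2 * n), a p (fun j => e (i j)) = 0) →
      a = 0 := by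
  induction p with
  | zero =>
    intro a ha h0
    funext k
    cases k with
    | zero =>
      ext v
      rw [Subsingleton.elim v (fun j => e ((fun j => j.elim0 : Fin 0 → Fin (2 * n)) j)), h0]
      rfl
    | succ k => exact ha.2 _ (by omega)
  | succ p ih =>
    intro a ha h0
    refine h.eq_zero_of_gι ha fun i => ih (gι_mem_gH ha _) fun j => ?_
    rw [gι_apply, contract_apply, ← h0 (Fin.cons i j)]
    congr 1
    funext k
    refine Fin.cases rfl (fun k => rfl) k

theorem IsFrame.wedgePow_ne_zero (h : IsFrame w n e e') : wedgePow w n ≠ 0 := by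
  intro h0
  set a : GForm V := gsingle (ContinuousAlternatingMap.constOfIsEmpty ℝ V (Fin 0) 1) with ha
  have ha' : a ∈ gH w 0 := gsingle_mem_gH trivial
  have h1 : (gL w ^ n) a = 0 := by
    rw [← gsingle_apply_self (h.isLefschetz.L_pow_mem ha' n), zero_add, gL_pow_apply, h0, smul_zero]
    exact gsingle_zero
  have h2 := h.isLefschetz.L_pow_injective ha' (by omega) h1
  have h3 : a 0 ![] = 1 := by rw [ha, gsingle_same]; rfl
  rw [h2] at h3
  exact zero_ne_one h3

/-- A horizontal form of degree `q` with vanishing wedge product with all horizontal forms of the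
complementary degree is zero. -/
theorem IsFrame.eq_zero_of_wedge [IsTopologicalAddGroup V] [ContinuousSMul ℝ V]
    (h : IsFrame w n e e') {p q : ℕ} (hpq : p + q = 2 * n)
    {γ : V [⋀^Fin q]→L[ℝ] ℝ} (hγ : IsHorizontal w q γ)
    (h0 : ∀ β : V [⋀^Fin p]→L[ℝ] ℝ, IsHorizontal w p β → wedge β γ = 0) : γ = 0 := by
  set S := lefschetzStar (gL w) (gΛ e e') (n + 1) n with hS
  have hc := gsingle_mem_gH hγ
  have hc' : S q (gsingle γ) ∈ gH w p := by
    have := h.isLefschetz.star_mem hc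
    rwa [show 2 * n - q = p by omega] at this
  have hss : S p (S q (gsingle γ)) q = (-1 : ℝ) ^ (n + q) • γ := by
    have := h.star_star (p := q) (by omega) hc
    rw [show 2 * n - q = p by omega] at this
    rw [hS, this, Pi.smul_apply, gsingle_same]
  have hpair : ∀ β : V [⋀^Fin p]→L[ℝ] ℝ, IsHorizontal w p β →
      framePairing e e' p (S q (gsingle γ) p) β = 0 := by
    intro β hβ
    obtain ⟨v, hv⟩ : ∃ v, wedgePow w n v ≠ 0 := by
      by_contra hcon
      push Not at hcon
      exact h.wedgePow_ne_zero (ContinuousAlternatingMap.ext hcon)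
    have h1 := h.wedge_star hpq hc' hβ v
    have h2 : wedge β ((-1 : ℝ) ^ (n + q) • γ) = 0 := by
      rw [wedge_smul_right, h0 β hβ, smul_zero]
    rw [← hS, hss, h2, ContinuousAlternatingMap.coe_zero, Pi.zero_apply, eq_comm, mul_eq_zero,
      mul_eq_zero] at h1
    rcases h1 with (h1 | h1) | h1
    · exact absurd h1 (pow_ne_zero _ (by norm_num))
    · exact h1
    · exact absurd h1 (div_ne_zero hv (by positivity))
  -- pair the form with its image under the linear map `e'_i ↦ e_i`
  have hzero : S q (gsingle γ) = 0 := by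
    let J : V →L[ℝ] V := ∑ i, (-flat w (e i)).smulRight (e i)
    have hJ : ∀ j, J (e' j) = e j := by
      intro j
      have : ∀ i, (-flat w (e i)).smulRight (e i) (e' j) = if j = i then e i else 0 := by
        intro i
        rw [ContinuousLinearMap.smulRight_apply, neg_apply, flat_apply,
          ← form_two_swap, h.dual j i]
        split_ifs <;> simp
      rw [sum_apply, Finset.sum_congr rfl fun i _ => this i]
      simp
    have hJker : ∀ u, (∀ v, w ![u, v] = 0) → J u = 0 := by
      intro u hu
      rw [sum_apply]
      refine Finset.sum_eq_zero fun i _ => ?_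
      rw [ContinuousLinearMap.smulRight_apply, neg_apply, flat_apply,
        ← form_two_swap, hu, zero_smul]
    refine h.eq_zero_of_apply hc' fun i => ?_
    set α := S q (gsingle γ) p
    have hβ : IsHorizontal w p (α.compContinuousLinearMap J) := by
      rcases p with _ | p
      · trivial
      · intro u hu
        ext v
        rw [contract_apply, ContinuousAlternatingMap.compContinuousLinearMap_apply]
        exact α.map_coord_zero 0 (by simp [hJker u hu])
    have h1 := hpair _ hβ
    rw [framePairing, mul_eq_zero, inv_eq_zero] at h1
    have h2 := h1.resolve_left (by positivity)
    have h3 : ∀ i : Fin p → Fin (2 * n), (α.compContinuousLinearMap J) (fun a => e' (i a)) =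
        α (fun a => e (i a)) := by
      intro i
      rw [ContinuousAlternatingMap.compContinuousLinearMap_apply]
      congr 1
      funext a
      exact hJ (i a)
    simp only [h3] at h2
    exact mul_self_eq_zero.mp
      ((Finset.sum_eq_zero_iff_of_nonneg fun i _ => mul_self_nonneg _).mp h2 i (Finset.mem_univ i))
  rw [hzero, map_zero] at hss
  have h4 : (-1 : ℝ) ^ (n + q) • γ = 0 := hss.symm
  exact (smul_eq_zero.mp h4).resolve_left (pow_ne_zero _ (by norm_num))

theorem IsFrame.star_eq (h : IsFrame w n e e') {f f' : Fin (2 * n) → V} (h' : IsFrame w n f f')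
    (p : ℕ) {a : GForm V} (ha : a ∈ gHor w) : lefschetzStar (gL w) (gΛ e e') (n + 1) n p a =
      lefschetzStar (gL w) (gΛ f f') (n + 1) n p a := by
  have hp : ∀ j, (gΛ e e' ^ j) a = (gΛ f f' ^ j) a ∧ (gΛ e e' ^ j) a ∈ gHor w := by
    intro j
    induction j with
    | zero => exact ⟨rfl, ha⟩
    | succ j ih =>
      rw [pow_succ', pow_succ', Module.End.mul_apply, Module.End.mul_apply]
      exact ⟨by rw [← ih.1, h.gΛ_eq h' ih.2], gΛ_mem_gHor ih.2⟩
  rw [lefschetzStar_apply, lefschetzStar_apply]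
  exact Finset.sum_congr rfl fun j _ => by rw [(hp j).1]

/-- On horizontal forms the symplectic star is `lefschetzStar` up to a sign depending on the degree:
the latter has the defining property of the former by `IsFrame.wedge_star`, and this property
determines the star by `IsFrame.eq_zero_of_wedge`. -/
theorem IsFrame.symplecticStar_eq [IsTopologicalAddGroup V] [ContinuousSMul ℝ V]
    (h : IsFrame w n e e') (hall : ∀ f f', IsDualPair w n f f' → IsFrame w n f f')
    {p q : ℕ} (hpq : p + q = 2 * n) {α : V [⋀^Fin p]→L[ℝ] ℝ} (hα : IsHorizontal w p α) :
    symplecticStar w n hpq α =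
      (-1 : ℝ) ^ (p.choose 2) • lefschetzStar (gL w) (gΛ e e') (n + 1) n p (gsingle α) q := by
  have hex : ∃ f : (Fin (2 * n) → V) × (Fin (2 * n) → V), IsDualPair w n f.1 f.2 :=
    ⟨(e, e'), h.dual⟩
  have hf := hall _ _ hex.choose_spec
  rw [h.star_eq hf p (gsingle_mem_gH hα).1]
  have key : IsSymplecticStar w n hpq α ((-1 : ℝ) ^ (p.choose 2) •
      lefschetzStar (gL w) (gΛ hex.choose.1 hex.choose.2) (n + 1) n p (gsingle α) q) := by
    constructor
    · have h1 := mem_gHor_iff.mp (hf.isLefschetz.star_mem (gsingle_mem_gH hα)).1 q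
      have h2 := mem_gHor_iff.mp (Submodule.smul_mem _ ((-1 : ℝ) ^ (p.choose 2))
        (hf.isLefschetz.star_mem (gsingle_mem_gH hα)).1) q
      exact h2
    · intro β hβ v
      rw [wedge_smul_right, ContinuousAlternatingMap.smul_apply,
        hf.wedge_star hpq (gsingle_mem_gH hα) hβ v, gsingle_same, symplecticPairing, dif_pos hex,
        smul_eq_mul, ← mul_assoc, ← mul_assoc, ← mul_pow]
      simp [framePairing]
  rw [symplecticStar, dif_pos ⟨_, key⟩]
  set γ := Exists.choose (⟨_, key⟩ : ∃ γ, IsSymplecticStar w n hpq α γ) with hγ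
  have hspec : IsSymplecticStar w n hpq α γ := Exists.choose_spec (p := fun γ =>
    IsSymplecticStar w n hpq α γ) ⟨_, key⟩
  rw [← sub_eq_zero]
  refine hf.eq_zero_of_wedge hpq ?_ fun β hβ => ?_
  · have h1 := sub_mem (gsingle_mem_gH hspec.1).1 (gsingle_mem_gH key.1).1
    have h2 := mem_gHor_iff.mp h1 q
    rwa [Pi.sub_apply, gsingle_same, gsingle_same] at h2
  · have h1 : ∀ x : Fin (p + q) → V, x = fun i => (fun j => x (Fin.cast hpq.symm j))
      (Fin.cast hpq i) := fun x => rfl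
    change wedgeRight q β _ = 0
    rw [map_sub, sub_eq_zero]
    ext x
    rw [h1 x]
    exact (hspec.2 β hβ fun j => x (Fin.cast hpq.symm j)).trans
      (key.2 β hβ fun j => x (Fin.cast hpq.symm j)).symm

end Star

/-! ### Differential forms in local parametrisations -/

section Expansion

variable {E : Type*} [NormedAddCommGroup E] [NormedSpace ℝ E] [FiniteDimensional ℝ E]

/-- A form is determined by its values on tuples of basis vectors, so these values are the
coefficients of its expansion in finitely many fixed forms. -/
theorem exists_form_expansion (E : Type*) [NormedAddCommGroup E] [NormedSpace ℝ E]
    [FiniteDimensional ℝ E] (k : ℕ) :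
    ∃ q : (Fin k → Fin (Module.finrank ℝ E)) → E [⋀^Fin k]→L[ℝ] ℝ,
      ∀ α : E [⋀^Fin k]→L[ℝ] ℝ,
        α = ∑ I, α (fun j => Module.finBasis ℝ E (I j)) • q I := by
  let T : (E [⋀^Fin k]→L[ℝ] ℝ) →ₗ[ℝ] (Fin k → Fin (Module.finrank ℝ E)) → ℝ :=
    { toFun := fun α I => α (fun j => Module.finBasis ℝ E (I j))
      map_add' := fun _ _ => rfl
      map_smul' := fun _ _ => rfl }
  have hT : LinearMap.ker T = ⊥ := by
    rw [LinearMap.ker_eq_bot']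
    intro α hα
    have h : α.toAlternatingMap.toMultilinearMap = 0 :=
      Module.Basis.ext_multilinear (fun _ => Module.finBasis ℝ E) fun I => congrFun hα I
    ext v
    exact DFunLike.congr_fun h v
  obtain ⟨g, hg⟩ := T.exists_leftInverse_of_injective hT
  refine ⟨fun I => g (Pi.single I 1), fun α => ?_⟩
  have h1 : g (T α) = α := LinearMap.congr_fun hg α
  conv_lhs => rw [← h1, pi_eq_sum_univ' (T α), map_sum]
  refine Finset.sum_congr rfl fun I _ => ?_
  rw [map_smul]
  rfl

variable {F : Type*} [NormedAddCommGroup F] [NormedSpace ℝ F]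

/-- A field of forms is smooth if its values on all constant tuples are. -/
theorem contDiffAt_form {k : ℕ} {m : WithTop ℕ∞} {f : F → E [⋀^Fin k]→L[ℝ] ℝ} {y : F}
    (h : ∀ v, ContDiffAt ℝ m (fun z => f z v) y) : ContDiffAt ℝ m f y := by
  obtain ⟨q, hq⟩ := exists_form_expansion E k
  have : f = fun z => ∑ I, f z (fun j => Module.finBasis ℝ E (I j)) • q I := funext fun z => hq _
  rw [this]
  exact ContDiffAt.sum fun I _ => (h _).smul contDiffAt_const

theorem ContDiffAt.form_apply {k : ℕ} {m : WithTop ℕ∞} {f : F → E [⋀^Fin k]→L[ℝ] ℝ} {y : F}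
    (h : ContDiffAt ℝ m f y) {v : F → Fin k → E} (hv : ContDiffAt ℝ m v y) :
    ContDiffAt ℝ m (fun z => f z (v z)) y := by
  obtain ⟨q, hq⟩ := exists_form_expansion E k
  have h1 : ∀ w, ContDiffAt ℝ m (fun z => f z w) y := fun w =>
    (ContinuousAlternatingMap.apply ℝ E ℝ w).contDiff.contDiffAt.comp y h
  have : (fun z => f z (v z)) = fun z => ∑ I, f z (fun j => Module.finBasis ℝ E (I j)) *
      q I (v z) := by
    funext z
    conv_lhs => rw [hq (f z)]
    simp
  rw [this]
  exact ContDiffAt.sum fun I _ => (h1 _).mul ((q I).contDiff.contDiffAt.comp y hv)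

end Expansion

section LocForm

theorem minSmoothness_two_le : minSmoothness ℝ 2 ≤ ∞ := by
  rw [minSmoothness_of_isRCLikeNormedField]
  exact WithTop.coe_le_coe.mpr (le_top : (2 : ℕ∞) ≤ ⊤)

variable {E : Type*} [NormedAddCommGroup E] [NormedSpace ℝ E]
  {M : Type*} [TopologicalSpace M] [ChartedSpace E M]
  {E' : Type*} [NormedAddCommGroup E'] [NormedSpace ℝ E']

/-- The pull-back of a form along a map `ψ` from a normed space to the manifold. -/
noncomputable def locForm (ψ : E' → M) {k : ℕ} (α : KForm E M k) (y : E') : E' [⋀^Fin k]→L[ℝ] ℝ :=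
  (α (ψ y)).compContinuousLinearMap (mfderiv 𝓘(ℝ, E') 𝓘(ℝ, E) ψ y)

theorem chartForm_eq_locForm {k : ℕ} (α : KForm E M k) (x₀ : M) :
    chartForm α x₀ = locForm (chartAt E x₀).symm α := rfl

/-- A map into the manifold which is smooth near a point. -/
def SmoothNear (E : Type*) [NormedAddCommGroup E] [NormedSpace ℝ E] {M : Type*}
    [TopologicalSpace M] [ChartedSpace E M] (ψ : E' → M) (y : E') : Prop :=
  ∀ᶠ z in nhds y, ContMDiffAt 𝓘(ℝ, E') 𝓘(ℝ, E) ∞ ψ z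

variable [IsManifold 𝓘(ℝ, E) ∞ M]

theorem smoothNear_chart_symm (x₀ : M) {y : E} (hy : y ∈ (chartAt E x₀).target) :
    SmoothNear E (chartAt E x₀).symm y := by
  filter_upwards [(chartAt E x₀).open_target.mem_nhds hy] with z hz
  exact (contMDiffOn_chart_symm (I := 𝓘(ℝ, E)) (n := ∞)).contMDiffAt
    ((chartAt E x₀).open_target.mem_nhds hz)

theorem SmoothNear.chart_comp {ψ : E' → M} {y : E'} (h : SmoothNear E ψ y) {p : M}
    (hp : ψ y ∈ (chartAt E p).source) :
    ∀ᶠ z in nhds y, ψ z ∈ (chartAt E p).source ∧ ContMDiffAt 𝓘(ℝ, E') 𝓘(ℝ, E) ∞ ψ z ∧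
      ContDiffAt ℝ ∞ (fun z => chartAt E p (ψ z)) z := by
  have h1 : ∀ᶠ z in nhds y, ψ z ∈ (chartAt E p).source :=
    h.self_of_nhds.continuousAt.preimage_mem_nhds ((chartAt E p).open_source.mem_nhds hp)
  filter_upwards [h, h1] with z hz hz1
  refine ⟨hz1, hz, ?_⟩
  rw [← contMDiffAt_iff_contDiffAt]
  exact (contMDiffAt_of_mem_maximalAtlas (IsManifold.chart_mem_maximalAtlas p) hz1).comp z hz

/-- The pull-back along any parametrisation factors through a fixed chart. -/
theorem locForm_eq_chartForm {k : ℕ} (α : KForm E M k) {ψ : E' → M} {y : E'} {p : M}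
    (h : ContMDiffAt 𝓘(ℝ, E') 𝓘(ℝ, E) ∞ ψ y) (hp : ψ y ∈ (chartAt E p).source) :
    locForm ψ α y = (chartForm α p (chartAt E p (ψ y))).compContinuousLinearMap
      (fderiv ℝ (fun z => chartAt E p (ψ z)) y) := by
  have h1 : ContMDiffAt 𝓘(ℝ, E') 𝓘(ℝ, E) ∞ (fun z => chartAt E p (ψ z)) y :=
    (contMDiffAt_of_mem_maximalAtlas (IsManifold.chart_mem_maximalAtlas p) hp).comp y h
  have h2 : ContMDiffAt 𝓘(ℝ, E) 𝓘(ℝ, E) ∞ (chartAt E p).symm (chartAt E p (ψ y)) :=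
    (contMDiffOn_chart_symm (I := 𝓘(ℝ, E)) (n := ∞)).contMDiffAt
      ((chartAt E p).open_target.mem_nhds ((chartAt E p).map_source hp))
  have h3 : (fun z => (chartAt E p).symm (chartAt E p (ψ z))) =ᶠ[nhds y] ψ := by
    filter_upwards [h.continuousAt.preimage_mem_nhds ((chartAt E p).open_source.mem_nhds hp)]
      with z hz
    exact (chartAt E p).left_inv hz
  have h4 : ∀ v : E', (mfderiv 𝓘(ℝ, E) 𝓘(ℝ, E) (chartAt E p).symm (chartAt E p (ψ y))
      (fderiv ℝ (fun z => chartAt E p (ψ z)) y v) : E) = mfderiv 𝓘(ℝ, E') 𝓘(ℝ, E) ψ y v := by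
    intro v
    have h5 := mfderiv_comp y (h2.mdifferentiableAt (by simp)) (h1.mdifferentiableAt (by simp))
    have h6 := h3.mfderiv_eq (I := 𝓘(ℝ, E')) (I' := 𝓘(ℝ, E))
    rw [mfderiv_eq_fderiv (f := fun z => chartAt E p (ψ z))] at h5
    have h7 := DFunLike.congr_fun (h5.symm.trans h6) v
    exact h7
  have h8 : ∀ x : M, x = ψ y → ∀ v : Fin k → E,
      (show E [⋀^Fin k]→L[ℝ] ℝ from α x) v = (show E [⋀^Fin k]→L[ℝ] ℝ from α (ψ y)) v := by
    rintro x rfl v; rfl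
  ext v
  refine Eq.trans ?_ (h8 _ ((chartAt E p).left_inv hp) _).symm
  exact congrArg (show E [⋀^Fin k]→L[ℝ] ℝ from α (ψ y)) (funext fun i => (h4 (v i)).symm)

variable [FiniteDimensional ℝ E]

theorem contDiffAt_comp_form {k : ℕ} {m : WithTop ℕ∞} [FiniteDimensional ℝ E']
    {P : Type*} [NormedAddCommGroup P] [NormedSpace ℝ P] {f : P → E [⋀^Fin k]→L[ℝ] ℝ}
    {T : P → E' →L[ℝ] E} {y : P} (hf : ContDiffAt ℝ m f y) (hT : ContDiffAt ℝ m T y) :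
    ContDiffAt ℝ m (fun z => (f z).compContinuousLinearMap (T z)) y := by
  refine contDiffAt_form fun v => ?_
  exact hf.form_apply (contDiffAt_pi.mpr fun i => hT.clm_apply contDiffAt_const)

theorem IsSmoothForm.contDiffAt {k : ℕ} {α : KForm E M k} (hα : IsSmoothForm α) {x₀ : M} {y : E}
    (hy : y ∈ (chartAt E x₀).target) : ContDiffAt ℝ ∞ (chartForm α x₀) y :=
  (hα x₀).contDiffAt ((chartAt E x₀).open_target.mem_nhds hy)

theorem contDiffAt_locForm_of_chart [FiniteDimensional ℝ E'] {k : ℕ} {α : KForm E M k}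
    {ψ : E' → M} {y : E'} {p : M} (h : SmoothNear E ψ y) (hp : ψ y ∈ (chartAt E p).source)
    (hα : ContDiffAt ℝ ∞ (chartForm α p) (chartAt E p (ψ y))) :
    ContDiffAt ℝ ∞ (locForm ψ α) y := by
  have h1 := h.chart_comp hp
  have h2 : locForm ψ α =ᶠ[nhds y] fun z => (chartForm α p
      (chartAt E p (ψ z))).compContinuousLinearMap (fderiv ℝ (fun z => chartAt E p (ψ z)) z) :=
    h1.mono fun z hz => locForm_eq_chartForm α hz.2.1 hz.1
  refine ContDiffAt.congr_of_eventuallyEq ?_ h2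
  have h3 := h1.self_of_nhds.2.2
  exact contDiffAt_comp_form (f := fun z => chartForm α p (chartAt E p (ψ z)))
    (ContDiffAt.comp y (f := fun z => chartAt E p (ψ z)) hα h3) (h3.fderiv_right (m := ∞) (by simp))

theorem IsSmoothForm.contDiffAt_locForm [FiniteDimensional ℝ E'] {k : ℕ} {α : KForm E M k}
    (hα : IsSmoothForm α) {ψ : E' → M} {y : E'} (h : SmoothNear E ψ y) :
    ContDiffAt ℝ ∞ (locForm ψ α) y :=
  contDiffAt_locForm_of_chart h (mem_chart_source E (ψ y))
    (hα.contDiffAt (mem_chart_target E (ψ y)))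

/-- Smoothness of a form can be checked at each point in a chart at that point. -/
theorem isSmoothForm_of_contDiffAt {k : ℕ} {α : KForm E M k}
    (h : ∀ x : M, ContDiffAt ℝ ∞ (chartForm α x) (chartAt E x x)) : IsSmoothForm α := by
  intro x₀ y hy
  refine ContDiffAt.contDiffWithinAt ?_
  rw [chartForm_eq_locForm]
  exact contDiffAt_locForm_of_chart (smoothNear_chart_symm x₀ hy) (mem_chart_source E _) (h _)

/-- The exterior derivative is natural for smooth parametrisations. -/
theorem IsSmoothForm.locForm_extD {k : ℕ} {α : KForm E M k} (hα : IsSmoothForm α) {ψ : E' → M}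
    {y : E'} (h : SmoothNear E ψ y) : locForm ψ (extD α) y = extDeriv (locForm ψ α) y := by
  set p := ψ y with hp
  have hps := mem_chart_source E p
  have h1 := h.chart_comp (p := p) hps
  have h2 : locForm ψ α =ᶠ[nhds y] fun z => (chartForm α p
      (chartAt E p (ψ z))).compContinuousLinearMap (fderiv ℝ (fun z => chartAt E p (ψ z)) z) :=
    h1.mono fun z hz => locForm_eq_chartForm α hz.2.1 hz.1
  have h3 := h1.self_of_nhds.2.2
  rw [h2.extDeriv_eq, extDeriv_pullback (f := fun z => chartAt E p (ψ z))
    (hα.differentiableAt p) h3 minSmoothness_two_le]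
  have h4 : mfderiv 𝓘(ℝ, E') 𝓘(ℝ, E) (fun z => chartAt E p (ψ z)) y =
      (mfderiv 𝓘(ℝ, E) 𝓘(ℝ, E) (chartAt E p) (ψ y)).comp (mfderiv 𝓘(ℝ, E') 𝓘(ℝ, E) ψ y) :=
    mfderiv_comp y ((contMDiffAt_of_mem_maximalAtlas (n := ∞)
      (IsManifold.chart_mem_maximalAtlas p) hps).mdifferentiableAt (by simp))
      (h.self_of_nhds.mdifferentiableAt (by simp))
  rw [← mfderiv_eq_fderiv, h4]
  rfl

end LocForm

/-! ### Pull-back of exterior forms along a linear map -/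

section GPull

variable {V W : Type*} [AddCommGroup V] [Module ℝ V] [TopologicalSpace V]
  [AddCommGroup W] [Module ℝ W] [TopologicalSpace W]

/-- The pull-back of forms of mixed degree along a linear map. -/
def gpull (T : V →L[ℝ] W) : GForm W →ₗ[ℝ] GForm V where
  toFun a k := (a k).compContinuousLinearMap T
  map_add' _ _ := rfl
  map_smul' _ _ := rfl

theorem comp_vecCons (T : V →L[ℝ] W) {k : ℕ} (u : V) (v : Fin k → V) :
    (fun i => T (Matrix.vecCons u v i)) = Matrix.vecCons (T u) (fun i => T (v i)) := by
  funext i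
  exact Fin.cases rfl (fun _ => rfl) i

theorem gι_gpull (T : V →L[ℝ] W) (u : V) (a : GForm W) :
    gι u (gpull T a) = gpull T (gι (T u) a) := by
  funext k
  ext v
  exact congrArg (a (k + 1)) (comp_vecCons T u v)

theorem gpull_gε (T : V →L[ℝ] W) (l : W →L[ℝ] ℝ) (a : GForm W) :
    gpull T (gε l a) = gε (l.comp T) (gpull T a) := by
  funext k
  cases k with
  | zero => rfl
  | succ k =>
    ext v
    exact (extMul_apply _ _ _).trans (extMul_apply (l.comp T) (gpull T a k) v).symm

theorem wedge_comp (T : V →L[ℝ] W) {p q : ℕ} (α : W [⋀^Fin p]→L[ℝ] ℝ) (β : W [⋀^Fin q]→L[ℝ] ℝ) :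
    (wedge α β).compContinuousLinearMap T =
      wedge (α.compContinuousLinearMap T) (β.compContinuousLinearMap T) := by
  ext v
  simp only [ContinuousAlternatingMap.compContinuousLinearMap_apply, wedge,
    ContinuousAlternatingMap.smul_apply, ContinuousMultilinearMap.alternatization_apply_apply]
  rfl

theorem gpull_gL (T : V →L[ℝ] W) (w : W [⋀^Fin 2]→L[ℝ] ℝ) (a : GForm W) :
    gpull T (gL w a) = gL (w.compContinuousLinearMap T) (gpull T a) := by
  funext k
  match k with
  | 0 => rfl
  | 1 => rfl
  | k + 2 => exact wedge_comp T (a k) w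

theorem gpull_gΛ (T : V →L[ℝ] W) {n : ℕ} (e e' : Fin (2 * n) → V) (a : GForm W) :
    gpull T (gΛ (fun i => T (e i)) (fun i => T (e' i)) a) = gΛ e e' (gpull T a) := by
  simp only [gΛ_apply, map_smul, map_sum, gι_gpull]

theorem gpull_comp {U : Type*} [AddCommGroup U] [Module ℝ U] [TopologicalSpace U]
    (T : V →L[ℝ] W) (S : U →L[ℝ] V) (a : GForm W) : gpull S (gpull T a) = gpull (T.comp S) a := rfl

theorem gpull_injective {T : V →L[ℝ] W} (hT : Function.Surjective T) :
    Function.Injective (gpull T) := by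
  intro a b hab
  funext k
  ext v
  choose s hs using hT
  have := DFunLike.congr_fun (congrFun hab k) (fun i => s (v i))
  have hv : (T ∘ fun i => s (v i)) = v := funext fun i => hs _
  change a k (T ∘ fun i => s (v i)) = b k (T ∘ fun i => s (v i)) at this
  rwa [hv] at this

theorem comp_two (T : V →L[ℝ] W) (w : W [⋀^Fin 2]→L[ℝ] ℝ) (u v : V) :
    w.compContinuousLinearMap T ![u, v] = w ![T u, T v] := by
  rw [ContinuousAlternatingMap.compContinuousLinearMap_apply]
  congr 1
  funext i
  fin_cases i <;> rfl

theorem isDualPair_comp (T : V →L[ℝ] W) (w : W [⋀^Fin 2]→L[ℝ] ℝ) {n : ℕ} (e e' : Fin (2 * n) → V) :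
    IsDualPair (w.compContinuousLinearMap T) n e e' ↔
      IsDualPair w n (fun i => T (e i)) (fun i => T (e' i)) := by
  simp only [IsDualPair, comp_two]

theorem isFrame_comp {T : V →L[ℝ] W} (hT : Function.Surjective T) (w : W [⋀^Fin 2]→L[ℝ] ℝ) {n : ℕ}
    (e e' : Fin (2 * n) → V) : IsFrame (w.compContinuousLinearMap T) n e e' ↔
      IsFrame w n (fun i => T (e i)) (fun i => T (e' i)) := by
  constructor
  · rintro ⟨h1, h2⟩
    refine ⟨(isDualPair_comp T w e e').mp h1, fun u hu v => ?_⟩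
    obtain ⟨u, rfl⟩ := hT u
    obtain ⟨v, rfl⟩ := hT v
    rw [← comp_two]
    exact h2 u (fun i => by rw [comp_two]; exact hu i) v
  · rintro ⟨h1, h2⟩
    refine ⟨(isDualPair_comp T w e e').mpr h1, fun u hu v => ?_⟩
    rw [comp_two]
    exact h2 (T u) (fun i => by rw [← comp_two]; exact hu i) (T v)

theorem gpull_mem_gHor {T : V →L[ℝ] W} (hT : Function.Surjective T) (w : W [⋀^Fin 2]→L[ℝ] ℝ)
    {a : GForm W} : gpull T a ∈ gHor (w.compContinuousLinearMap T) ↔ a ∈ gHor w := by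
  constructor
  · intro h u hu
    obtain ⟨u, rfl⟩ := hT u
    apply gpull_injective hT
    rw [← gι_gpull, map_zero]
    exact h u fun v => by rw [comp_two]; exact hu _
  · intro h u hu
    rw [gι_gpull, h, map_zero]
    intro v
    obtain ⟨v, rfl⟩ := hT v
    rw [← comp_two]
    exact hu v

end GPull

section Rank

variable {V : Type*} [AddCommGroup V] [Module ℝ V] [TopologicalSpace V] [FiniteDimensional ℝ V]
  {w : V [⋀^Fin 2]→L[ℝ] ℝ} {n : ℕ} {K : Submodule ℝ V}

/-- For a 2-form of rank `2n`, every dual pair with `2n` elements is a frame: the common kernel of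
the covectors `w(·, e_i)` contains the kernel of `w` and has the same dimension. -/
theorem isFrame_of_isDualPair (hK : ∀ u, u ∈ K ↔ ∀ v, w ![u, v] = 0)
    (hn : Module.finrank ℝ (V ⧸ K) = 2 * n) {e e' : Fin (2 * n) → V} (h : IsDualPair w n e e') :
    IsFrame w n e e' := by
  refine ⟨h, ?_⟩
  let f : V →ₗ[ℝ] Fin (2 * n) → ℝ := LinearMap.pi fun i => -(flat w (e i) : V →ₗ[ℝ] ℝ)
  have hf : ∀ u i, f u i = w ![u, e i] := fun u i => (form_two_swap w u (e i)).symm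
  have hle : K ≤ LinearMap.ker f := fun u hu => by
    rw [LinearMap.mem_ker]
    funext i
    rw [hf]
    exact (hK u).mp hu _
  have hsurj : LinearMap.range f = ⊤ := by
    rw [LinearMap.range_eq_top]
    intro c
    refine ⟨∑ i, c i • e' i, ?_⟩
    funext j
    rw [hf, form_two_sum_left]
    simp [form_two_smul_left, h _ j]
  have h1 := LinearMap.finrank_range_add_finrank_ker f
  rw [hsurj, finrank_top, Module.finrank_fin_fun] at h1
  have h2 := Submodule.finrank_quotient_add_finrank K
  have heq : K = LinearMap.ker f := Submodule.eq_of_le_of_finrank_eq hle (by omega)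
  intro u hu
  rw [← hK, heq, LinearMap.mem_ker]
  funext i
  rw [hf, hu]
  rfl

/-- A 2-form of rank `2n` has a dual pair: lift a basis of the quotient by the kernel, and lift the
dual basis along the map `u ↦ w(u, e_i)`, which is onto by a dimension count. -/
theorem exists_isDualPair (hK : ∀ u, u ∈ K ↔ ∀ v, w ![u, v] = 0)
    (hn : Module.finrank ℝ (V ⧸ K) = 2 * n) :
    ∃ f : (Fin (2 * n) → V) × (Fin (2 * n) → V), IsDualPair w n f.1 f.2 := by
  let b := Module.finBasisOfFinrankEq ℝ (V ⧸ K) hn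
  choose e he using fun i => Submodule.mkQ_surjective K (b i)
  let f : V →ₗ[ℝ] Fin (2 * n) → ℝ := LinearMap.pi fun i => -(flat w (e i) : V →ₗ[ℝ] ℝ)
  have hf : ∀ u i, f u i = w ![u, e i] := fun u i => (form_two_swap w u (e i)).symm
  have hker : LinearMap.ker f = K := by
    ext u
    rw [LinearMap.mem_ker, hK]
    constructor
    · intro h0 v
      have h1 : v - ∑ i, b.repr (K.mkQ v) i • e i ∈ K := by
        rw [← Submodule.Quotient.mk_eq_zero, ← Submodule.mkQ_apply, map_sub, map_sum]
        simp only [map_smul, he]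
        rw [b.sum_repr, sub_self]
      have h2 := (hK _).mp h1 u
      rw [sub_eq_add_neg, form_two_add_left, ← neg_one_smul ℝ, form_two_smul_left,
        form_two_sum_left] at h2
      have h3 : ∀ i, w ![b.repr (K.mkQ v) i • e i, u] = 0 := by
        intro i
        rw [form_two_smul_left, form_two_swap, ← hf, h0]
        simp
      rw [Finset.sum_eq_zero fun i _ => h3 i, mul_zero, add_zero] at h2
      rw [form_two_swap, h2, neg_zero]
    · intro h0
      funext i
      rw [hf, h0]
      rfl
  have hsurj : LinearMap.range f = ⊤ := by
    refine Submodule.eq_top_of_finrank_eq ?_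
    have h1 := LinearMap.finrank_range_add_finrank_ker f
    have h2 := Submodule.finrank_quotient_add_finrank K
    rw [hker] at h1
    rw [Module.finrank_fin_fun]
    omega
  rw [LinearMap.range_eq_top] at hsurj
  choose e' he' using fun i => hsurj (Pi.single i 1)
  refine ⟨(e, e'), fun i j => ?_⟩
  rw [← hf, he', Pi.single_apply]
  simp [eq_comm]

end Rank

/-! ### Calculus of forms of mixed degree on a vector space -/

section BilinearOps

variable {E : Type*} [NormedAddCommGroup E] [NormedSpace ℝ E] [FiniteDimensional ℝ E]

instance finiteDimensional_form (k : ℕ) : FiniteDimensional ℝ (E [⋀^Fin k]→L[ℝ] ℝ) := by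
  obtain ⟨q, hq⟩ := exists_form_expansion E k
  refine Module.Finite.of_surjective (Fintype.linearCombination ℝ q) fun α => ?_
  refine ⟨fun I => α (fun j => Module.finBasis ℝ E (I j)), ?_⟩
  rw [Fintype.linearCombination_apply]
  exact (hq α).symm

/-- A bilinear map between finite-dimensional spaces as a continuous bilinear map. -/
noncomputable def bilinCLM {X Y Z : Type*} [NormedAddCommGroup X] [NormedSpace ℝ X]
    [FiniteDimensional ℝ X] [NormedAddCommGroup Y] [NormedSpace ℝ Y] [FiniteDimensional ℝ Y]
    [NormedAddCommGroup Z] [NormedSpace ℝ Z] (B : X →ₗ[ℝ] Y →ₗ[ℝ] Z) : X →L[ℝ] Y →L[ℝ] Z :=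
  LinearMap.toContinuousLinearMap
    ((LinearMap.toContinuousLinearMap : (Y →ₗ[ℝ] Z) ≃ₗ[ℝ] Y →L[ℝ] Z).toLinearMap ∘ₗ B)

variable (E) in
/-- The wedge product as a continuous bilinear map. -/
noncomputable def wedgeCLM (p q : ℕ) :
    (E [⋀^Fin p]→L[ℝ] ℝ) →L[ℝ] (E [⋀^Fin q]→L[ℝ] ℝ) →L[ℝ] E [⋀^Fin (p + q)]→L[ℝ] ℝ :=
  bilinCLM (LinearMap.mk₂ ℝ wedge wedge_add_left wedge_smul_left wedge_add_right
    (fun c α β => wedge_smul_right c α β))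

theorem wedgeCLM_apply {p q : ℕ} (α : E [⋀^Fin p]→L[ℝ] ℝ) (β : E [⋀^Fin q]→L[ℝ] ℝ) :
    wedgeCLM E p q α β = wedge α β := rfl

variable (E) in
/-- The contraction as a continuous bilinear map. -/
noncomputable def contractCLM (k : ℕ) :
    E →L[ℝ] (E [⋀^Fin (k + 1)]→L[ℝ] ℝ) →L[ℝ] E [⋀^Fin k]→L[ℝ] ℝ :=
  bilinCLM (LinearMap.mk₂ ℝ contract
    (fun u v α => by ext x; exact α.toAlternatingMap.map_vecCons_add _ _ _)
    (fun c u α => by ext x; exact α.toAlternatingMap.map_vecCons_smul _ _ _)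
    (fun _ _ _ => rfl) (fun _ _ _ => rfl))

theorem contractCLM_apply {k : ℕ} (u : E) (α : E [⋀^Fin (k + 1)]→L[ℝ] ℝ) :
    contractCLM E k u α = contract u α := rfl

theorem ContDiffAt.wedge {F : Type*} [NormedAddCommGroup F] [NormedSpace ℝ F] {m : WithTop ℕ∞}
    {p q : ℕ} {f : F → E [⋀^Fin p]→L[ℝ] ℝ} {g : F → E [⋀^Fin q]→L[ℝ] ℝ} {y : F}
    (hf : ContDiffAt ℝ m f y) (hg : ContDiffAt ℝ m g y) :
    ContDiffAt ℝ m (fun z => _root_.wedge (f z) (g z)) y := by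
  simp only [← wedgeCLM_apply]
  exact ContDiffAt.comp (f := fun z => (f z, g z)) (g := fun x => wedgeCLM E p q x.1 x.2) y
    (wedgeCLM E p q).isBoundedBilinearMap.contDiff.contDiffAt (hf.prodMk hg)

theorem ContDiffAt.contract {F : Type*} [NormedAddCommGroup F] [NormedSpace ℝ F] {m : WithTop ℕ∞}
    {k : ℕ} {u : F → E} {g : F → E [⋀^Fin (k + 1)]→L[ℝ] ℝ} {y : F}
    (hu : ContDiffAt ℝ m u y) (hg : ContDiffAt ℝ m g y) :
    ContDiffAt ℝ m (fun z => _root_.contract (u z) (g z)) y := by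
  simp only [← contractCLM_apply]
  exact ContDiffAt.comp (f := fun z => (u z, g z)) (g := fun x => contractCLM E k x.1 x.2) y
    (contractCLM E k).isBoundedBilinearMap.contDiff.contDiffAt (hu.prodMk hg)

end BilinearOps

section WedgeTwo

variable {V : Type*} [AddCommGroup V] [Module ℝ V] [TopologicalSpace V]

theorem flat_extMul (l : V →L[ℝ] ℝ) (μ : V [⋀^Fin 1]→L[ℝ] ℝ) (u : V) :
    flat (extMul l μ) u = l u • oneFormCLM μ - oneFormCLM μ u • l := by
  ext v
  rw [flat_apply, extMul_apply, Fin.sum_univ_two]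
  have h1 : (1 : Fin 2).removeNth ![u, v] = ![u] := by
    funext i; fin_cases i; rfl
  have h0 : (0 : Fin 2).removeNth ![u, v] = ![v] := by
    funext i; fin_cases i; rfl
  simp only [h0, h1, ← oneFormCLM_apply]
  simp
  ring

theorem gL_extMul (l : V →L[ℝ] ℝ) (μ : V [⋀^Fin 1]→L[ℝ] ℝ) (a : GForm V) :
    gL (extMul l μ) a = gε l (gε (oneFormCLM μ) a) := by
  rw [← sub_eq_zero]
  refine gform_induction (fun a => gL (extMul l μ) a - gε l (gε (oneFormCLM μ) a)) (fun a => ?_)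
    (fun a u k ih => ?_) a
  · exact sub_zero (0 : V [⋀^Fin 0]→L[ℝ] ℝ)
  · have : gι u (gL (extMul l μ) a - gε l (gε (oneFormCLM μ) a)) =
        gL (extMul l μ) (gι u a) - gε l (gε (oneFormCLM μ) (gι u a)) := by
      simp only [gι_gε, map_sub, map_smul, gι_gL, flat_extMul, gε_sub_left, gε_smul_left]
      abel
    rw [this]
    exact ih _

/-- The wedge product of forms `s i` with covectors `x i` annihilates everything as soon as it
annihilates the constants. -/
theorem sum_gε_gL_eq_zero {ι : Type*} [Fintype ι] (x : ι → V →L[ℝ] ℝ) (s : ι → V [⋀^Fin 2]→L[ℝ] ℝ)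
    (h : ∑ i, extMul (x i) (s i) = 0) (a : GForm V) : ∑ i, gε (x i) (gL (s i) a) = 0 := by
  refine gform_induction (fun a => ∑ i, gε (x i) (gL (s i) a)) (fun a => ?_) (fun a u k ih => ?_) a
  · simp [Finset.sum_apply, gε_zero]
  · have h1 : ∀ i, gι u (gε (x i) (gL (s i) a)) =
        gL (contract u (extMul (x i) (s i))) a - gε (x i) (gL (s i) (gι u a)) := by
      intro i
      have hflat : oneFormCLM (contract u (s i)) = flat (s i) u := by
        ext v; exact oneFormCLM_apply _ _
      rw [gι_gε, gι_gL, map_add, contract_extMul,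
        show x i u • s i - extMul (x i) (contract u (s i)) =
          x i u • s i + (-1 : ℝ) • extMul (x i) (contract u (s i)) by
            ext v; simp [sub_eq_add_neg],
        gL_add_left, gL_smul_left, gL_smul_left, gL_extMul, hflat, neg_one_smul]
      abel
    have h2 : ∑ i, gL (contract u (extMul (x i) (s i))) a = 0 := by
      let f : (V [⋀^Fin 3]→L[ℝ] ℝ) →+ GForm V :=
        { toFun := fun t => gL (contract u t) a
          map_zero' := by
            have := gL_smul_left (0 : ℝ) (0 : V [⋀^Fin 2]→L[ℝ] ℝ) a
            rw [zero_smul, zero_smul] at this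
            exact this
          map_add' := fun s t => gL_add_left (contract u s) (contract u t) a }
      have h3 := map_sum f (fun i => extMul (x i) (s i)) Finset.univ
      rw [h, map_zero] at h3
      exact h3.symm
    change gι u (∑ i, gε (x i) (gL (s i) a)) k = 0
    rw [map_sum, Finset.sum_congr rfl fun i _ => h1 i, Finset.sum_sub_distrib, h2, zero_sub]
    change -((∑ i, gε (x i) (gL (s i) (gι u a))) k) = 0
    rw [ih, neg_zero]

end WedgeTwo

section Calculus

variable {E : Type*} [NormedAddCommGroup E] [NormedSpace ℝ E]

/-- The exterior derivative of a field of forms of mixed degree. -/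
noncomputable def gd (f : E → GForm E) (y : E) : GForm E
  | 0 => 0
  | k + 1 => extDeriv (fun z => f z k) y

theorem gd_zero (f : E → GForm E) (y : E) : gd f y 0 = 0 := rfl

theorem gd_succ (f : E → GForm E) (y : E) (k : ℕ) :
    gd f y (k + 1) = extDeriv (fun z => f z k) y := rfl

/-- The componentwise derivative of a field of forms of mixed degree in the direction `v`. -/
noncomputable def gdir (f : E → GForm E) (y v : E) : GForm E := fun k =>
  fderiv ℝ (fun z => f z k) y v

variable [FiniteDimensional ℝ E]

variable (E) in
/-- The coordinate covectors of a basis. -/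
noncomputable def coordCLM (i : Fin (Module.finrank ℝ E)) : E →L[ℝ] ℝ :=
  LinearMap.toContinuousLinearMap ((Module.finBasis ℝ E).coord i)

theorem sum_coordCLM {Z : Type*} [NormedAddCommGroup Z] [NormedSpace ℝ Z] (f : E →L[ℝ] Z) (v : E) :
    ∑ i, coordCLM E i v • f (Module.finBasis ℝ E i) = f v := by
  conv_rhs => rw [← (Module.finBasis ℝ E).sum_repr v, map_sum]
  refine Finset.sum_congr rfl fun i _ => ?_
  rw [map_smul]
  rfl

/-- The exterior derivative is `∑ dx_i ∧ ∂_i`. -/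
theorem alternatizeUncurryFin_eq_sum {k : ℕ} (D : E →L[ℝ] E [⋀^Fin k]→L[ℝ] ℝ) :
    ContinuousAlternatingMap.alternatizeUncurryFin D =
      ∑ i, extMul (coordCLM E i) (D (Module.finBasis ℝ E i)) := by
  ext v
  rw [ContinuousAlternatingMap.alternatizeUncurryFin_apply, ContinuousAlternatingMap.sum_apply]
  simp only [extMul_apply]
  rw [Finset.sum_comm]
  refine Finset.sum_congr rfl fun j _ => ?_
  rw [← sum_coordCLM D (v j), ContinuousAlternatingMap.sum_apply, ← Finset.mul_sum]
  simp

theorem gd_eq_sum (f : E → GForm E) (y : E) :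
    gd f y = ∑ i, gε (coordCLM E i) (gdir f y (Module.finBasis ℝ E i)) := by
  funext k
  rw [Finset.sum_apply]
  cases k with
  | zero => exact (Finset.sum_eq_zero fun i _ => rfl).symm
  | succ k => exact alternatizeUncurryFin_eq_sum _

theorem sum_coordCLM_gdir (f : E → GForm E) (y v : E) :
    ∑ i, coordCLM E i v • gdir f y (Module.finBasis ℝ E i) = gdir f y v := by
  funext k
  rw [Finset.sum_apply]
  exact sum_coordCLM (fderiv ℝ (fun z => f z k) y) v

theorem gdir_gL {s : E → E [⋀^Fin 2]→L[ℝ] ℝ} {f : E → GForm E} {y : E}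
    (hs : DifferentiableAt ℝ s y) (hf : ∀ k, DifferentiableAt ℝ (fun z => f z k) y) (v : E) :
    gdir (fun z => gL (s z) (f z)) y v =
      gL (fderiv ℝ s y v) (f y) + gL (s y) (gdir f y v) := by
  funext k
  match k with
  | 0 =>
    change fderiv ℝ (fun _ => (0 : E [⋀^Fin 0]→L[ℝ] ℝ)) y v = 0 + 0
    simp
  | 1 =>
    change fderiv ℝ (fun _ => (0 : E [⋀^Fin 1]→L[ℝ] ℝ)) y v = 0 + 0
    simp
  | k + 2 =>
    change fderiv ℝ (fun z => wedgeCLM E k 2 (f z k) (s z)) y v = _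
    rw [ContinuousLinearMap.fderiv_of_bilinear _ (hf k) hs]
    rfl

/-- `d (a ∧ s) = d a ∧ s` for a closed 2-form `s`. -/
theorem gd_gL {s : E → E [⋀^Fin 2]→L[ℝ] ℝ} {f : E → GForm E} {y : E}
    (hs : DifferentiableAt ℝ s y) (hf : ∀ k, DifferentiableAt ℝ (fun z => f z k) y)
    (hclosed : extDeriv s y = 0) : gd (fun z => gL (s z) (f z)) y = gL (s y) (gd f y) := by
  have h1 : ∑ i, extMul (coordCLM E i) (fderiv ℝ s y (Module.finBasis ℝ E i)) = 0 := by
    rw [← alternatizeUncurryFin_eq_sum]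
    exact hclosed
  rw [gd_eq_sum, gd_eq_sum]
  simp only [gdir_gL hs hf, map_add, Finset.sum_add_distrib, map_sum, gL_gε]
  rw [sum_gε_gL_eq_zero _ _ h1, zero_add]

theorem gd_smul {g : E → ℝ} {f : E → GForm E} {y : E} (hg : DifferentiableAt ℝ g y)
    (hf : ∀ k, DifferentiableAt ℝ (fun z => f z k) y) :
    gd (fun z => g z • f z) y = gε (fderiv ℝ g y) (f y) + g y • gd f y := by
  have h1 : ∀ v, gdir (fun z => g z • f z) y v = fderiv ℝ g y v • f y + g y • gdir f y v := by
    intro v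
    funext k
    change fderiv ℝ (fun z => g z • f z k) y v = _
    rw [fderiv_fun_smul hg (hf k), add_comm]
    rfl
  have h2 : ∑ i, fderiv ℝ g y (Module.finBasis ℝ E i) • coordCLM E i = fderiv ℝ g y := by
    ext v
    rw [sum_apply, ← sum_coordCLM (fderiv ℝ g y) v]
    refine Finset.sum_congr rfl fun i _ => ?_
    simp [mul_comm]
  rw [gd_eq_sum, gd_eq_sum, Finset.smul_sum]
  simp only [h1, map_add, Finset.sum_add_distrib, map_smul]
  congr 1
  conv_rhs => rw [← h2]
  change _ = gεₗ (f y) _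
  rw [map_sum]
  refine Finset.sum_congr rfl fun i _ => ?_
  rw [map_smul]
  rfl

theorem gdir_gι {f : E → GForm E} {y : E} (hf : ∀ k, DifferentiableAt ℝ (fun z => f z k) y)
    (u v : E) : gdir (fun z => gι u (f z)) y v = gι u (gdir f y v) := by
  funext k
  change fderiv ℝ (fun z => contractCLM E k u (f z (k + 1))) y v = _
  have h := (contractCLM E k u).hasFDerivAt.comp y (hf (k + 1)).hasFDerivAt
  exact DFunLike.congr_fun h.fderiv v

/-- Cartan's formula for a constant vector field on a vector space. -/
theorem gι_gd {f : E → GForm E} {y : E} (hf : ∀ k, DifferentiableAt ℝ (fun z => f z k) y) (u : E) :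
    gι u (gd f y) = gdir f y u - gd (fun z => gι u (f z)) y := by
  rw [gd_eq_sum, gd_eq_sum, map_sum, ← sum_coordCLM_gdir f y u, ← Finset.sum_sub_distrib]
  refine Finset.sum_congr rfl fun i _ => ?_
  rw [gι_gε, gdir_gι hf]

end Calculus

/-! ### Transversely symplectic foliations in local charts -/

section GAt

variable {E : Type*} [NormedAddCommGroup E] [NormedSpace ℝ E]
  {M : Type*} [TopologicalSpace M] [ChartedSpace E M]
  {E' : Type*} [NormedAddCommGroup E'] [NormedSpace ℝ E']

/-- The value of a form of mixed degree at a point. -/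
def gAt (α : MForm E M) (x : M) : GForm (TangentSpace 𝓘(ℝ, E) x) := fun k => α k x

/-- The pull-back of a form of mixed degree along a map from a normed space to the manifold. -/
noncomputable def gLoc (ψ : E' → M) (α : MForm E M) (y : E') : GForm E' :=
  fun k => locForm ψ (α k) y

theorem gLoc_eq (ψ : E' → M) (α : MForm E M) (y : E') :
    gLoc ψ α y = gpull (mfderiv 𝓘(ℝ, E') 𝓘(ℝ, E) ψ y) (gAt α (ψ y)) := rfl

theorem mform_ext {α β : MForm E M} (h : ∀ x, gAt α x = gAt β x) : α = β :=
  funext fun k => funext fun x => congrFun (h x) k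

theorem gAt_add (α β : MForm E M) (x : M) : gAt (α + β) x = gAt α x + gAt β x := rfl

theorem gAt_smul (c : ℝ) (α : MForm E M) (x : M) : gAt (c • α) x = c • gAt α x := rfl

theorem gAt_interior' (X : VField E M) (α : MForm E M) (x : M) :
    gAt (interior' X α) x = gι (X x) (gAt α x) := rfl

theorem gAt_lefschetzL (σ : KForm E M 2) (α : MForm E M) (x : M) :
    gAt (lefschetzL σ α) x = gL (σ x) (gAt α x) := by
  funext k
  match k with
  | 0 => rfl
  | 1 => rfl
  | k + 2 => rfl

theorem gLoc_lefschetzL (ψ : E' → M) (σ : KForm E M 2) (α : MForm E M) (y : E') :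
    gLoc ψ (lefschetzL σ α) y = gL (locForm ψ σ y) (gLoc ψ α y) := by
  rw [gLoc_eq, gAt_lefschetzL, gpull_gL]
  rfl

variable [IsManifold 𝓘(ℝ, E) ∞ M]

theorem mdifferentiable_of_mem_maximalAtlas {φ : OpenPartialHomeomorph M E}
    (hφ : φ ∈ IsManifold.maximalAtlas 𝓘(ℝ, E) ∞ M) : φ.MDifferentiable 𝓘(ℝ, E) 𝓘(ℝ, E) :=
  ⟨(contMDiffOn_of_mem_maximalAtlas hφ).mdifferentiableOn (by simp),
    (contMDiffOn_symm_of_mem_maximalAtlas hφ).mdifferentiableOn (by simp)⟩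

theorem surjective_mfderiv_symm {φ : OpenPartialHomeomorph M E}
    (hφ : φ ∈ IsManifold.maximalAtlas 𝓘(ℝ, E) ∞ M) {y : E} (hy : y ∈ φ.target) :
    Function.Surjective (mfderiv 𝓘(ℝ, E) 𝓘(ℝ, E) φ.symm y) :=
  (mdifferentiable_of_mem_maximalAtlas hφ).symm.mfderiv_surjective hy

theorem smoothNear_symm {φ : OpenPartialHomeomorph M E}
    (hφ : φ ∈ IsManifold.maximalAtlas 𝓘(ℝ, E) ∞ M) {y : E} (hy : y ∈ φ.target) :
    SmoothNear E φ.symm y := by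
  filter_upwards [φ.open_target.mem_nhds hy] with z hz
  exact contMDiffAt_symm_of_mem_maximalAtlas hφ hz

variable [FiniteDimensional ℝ E] [FiniteDimensional ℝ E']

theorem gLoc_extDer {α : MForm E M} (hα : α ∈ smoothForms E M) {ψ : E' → M} {y : E'}
    (h : SmoothNear E ψ y) : gLoc ψ (extDer α) y = gd (gLoc ψ α) y := by
  funext k
  cases k with
  | zero => rfl
  | succ k => exact (hα k).locForm_extD h

theorem contDiffAt_gLoc {α : MForm E M} (hα : α ∈ smoothForms E M) {ψ : E' → M} {y : E'}
    (h : SmoothNear E ψ y) (k : ℕ) : ContDiffAt ℝ ∞ (fun z => gLoc ψ α z k) y :=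
  (hα k).contDiffAt_locForm h

theorem differentiableAt_gLoc {α : MForm E M} (hα : α ∈ smoothForms E M) {ψ : E' → M} {y : E'}
    (h : SmoothNear E ψ y) (k : ℕ) : DifferentiableAt ℝ (fun z => gLoc ψ α z k) y :=
  (contDiffAt_gLoc hα h k).differentiableAt (by simp)

/-- Smoothness of a form of mixed degree can be checked at each point in a chart. -/
theorem mem_smoothForms_of_contDiffAt {α : MForm E M}
    (h : ∀ x k, ContDiffAt ℝ ∞ (fun z => gLoc (chartAt E x).symm α z k) (chartAt E x x)) :
    α ∈ smoothForms E M := fun k => isSmoothForm_of_contDiffAt fun x => h x k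

theorem gAt_eq_of_chart {α β : MForm E M} {x : M}
    (h : gLoc (chartAt E x).symm α (chartAt E x x) = gLoc (chartAt E x).symm β (chartAt E x x)) :
    gAt α x = gAt β x := by
  have h1 : gAt α ((chartAt E x).symm (chartAt E x x)) =
      gAt β ((chartAt E x).symm (chartAt E x x)) :=
    gpull_injective (surjective_mfderiv_symm (IsManifold.chart_mem_maximalAtlas x)
      (mem_chart_target E x)) h
  rwa [(chartAt E x).left_inv (mem_chart_source E x)] at h1

theorem smoothNear_chartAt (x : M) : SmoothNear E (chartAt E x).symm (chartAt E x x) :=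
  smoothNear_chart_symm x (mem_chart_target E x)

theorem extDer_mem_smoothForms {α : MForm E M} (hα : α ∈ smoothForms E M) :
    extDer α ∈ smoothForms E M := by
  refine mem_smoothForms_of_contDiffAt fun x k => ?_
  cases k with
  | zero => exact contDiffAt_const (c := (0 : E [⋀^Fin 0]→L[ℝ] ℝ))
  | succ k =>
    have h1 : (fun z => gLoc (chartAt E x).symm (extDer α) z (k + 1)) =ᶠ[nhds (chartAt E x x)]
        fun z => extDeriv (fun z => gLoc (chartAt E x).symm α z k) z := by
      filter_upwards [(chartAt E x).open_target.mem_nhds (mem_chart_target E x)] with z hz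
      exact congrFun (gLoc_extDer hα (smoothNear_chart_symm x hz)) (k + 1)
    refine ContDiffAt.congr_of_eventuallyEq ?_ h1
    exact (ContinuousAlternatingMap.alternatizeUncurryFinCLM ℝ E ℝ).contDiff.contDiffAt.comp _
      ((contDiffAt_gLoc hα (smoothNear_chartAt x) k).fderiv_right (m := ∞) (by simp))

theorem extDer_extDer {α : MForm E M} (hα : α ∈ smoothForms E M) : extDer (extDer α) = 0 := by
  refine mform_ext fun x => gAt_eq_of_chart ?_
  have hx := smoothNear_chartAt (E := E) x
  rw [gLoc_extDer (extDer_mem_smoothForms hα) hx]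
  funext k
  match k with
  | 0 => rfl
  | 1 =>
    change extDeriv (fun _ => (0 : E [⋀^Fin 0]→L[ℝ] ℝ)) _ = 0
    rw [extDeriv, fderiv_fun_const]
    exact map_zero (ContinuousAlternatingMap.alternatizeUncurryFinCLM ℝ E ℝ)
  | k + 2 =>
    have h1 : (fun z => gLoc (chartAt E x).symm (extDer α) z (k + 1)) =ᶠ[nhds (chartAt E x x)]
        extDeriv (fun z => gLoc (chartAt E x).symm α z k) := by
      filter_upwards [(chartAt E x).open_target.mem_nhds (mem_chart_target E x)] with z hz
      exact congrFun (gLoc_extDer hα (smoothNear_chart_symm x hz)) (k + 1)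
    rw [gd_succ, h1.extDeriv_eq, extDeriv_extDeriv_apply (contDiffAt_gLoc hα hx k)
      minSmoothness_two_le]
    rfl

theorem lefschetzL_mem_smoothForms {σ : KForm E M 2} (hσ : IsSmoothForm σ) {α : MForm E M}
    (hα : α ∈ smoothForms E M) : lefschetzL σ α ∈ smoothForms E M := by
  refine mem_smoothForms_of_contDiffAt fun x k => ?_
  match k with
  | 0 => exact contDiffAt_const (c := (0 : E [⋀^Fin 0]→L[ℝ] ℝ))
  | 1 => exact contDiffAt_const (c := (0 : E [⋀^Fin 1]→L[ℝ] ℝ))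
  | k + 2 =>
    simp only [gLoc_lefschetzL, gL_add_two]
    exact (contDiffAt_gLoc hα (smoothNear_chartAt x) k).wedge
      (hσ.contDiffAt_locForm (smoothNear_chartAt x))

theorem extDer_lefschetzL {σ : KForm E M 2} (hσ : IsSmoothForm σ) (hc : extD σ = 0) {α : MForm E M}
    (hα : α ∈ smoothForms E M) : extDer (lefschetzL σ α) = lefschetzL σ (extDer α) := by
  refine mform_ext fun x => gAt_eq_of_chart ?_
  have hx := smoothNear_chartAt (E := E) x
  have hs := hσ.contDiffAt_locForm hx
  rw [gLoc_extDer (lefschetzL_mem_smoothForms hσ hα) hx, gLoc_lefschetzL, gLoc_extDer hα hx,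
    funext (gLoc_lefschetzL (chartAt E x).symm σ α)]
  refine gd_gL (hs.differentiableAt (by simp)) (fun k => differentiableAt_gLoc hα hx k) ?_
  rw [← hσ.locForm_extD hx, hc]
  rfl

end GAt

section Foliated

variable {E : Type*} [NormedAddCommGroup E] [NormedSpace ℝ E] [FiniteDimensional ℝ E]
  {M : Type*} [TopologicalSpace M] [ChartedSpace E M] [IsManifold 𝓘(ℝ, E) ∞ M] {n : ℕ}

/-- A chart `φ` is foliated for the 2-form `σ`, with slices parallel to `K`, if `K` has codimension
`2n` and is the kernel of the expression of `σ` in the chart. -/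
structure IsFoliatedChart (n : ℕ) (σ : KForm E M 2) (φ : OpenPartialHomeomorph M E)
    (K : Submodule ℝ E) : Prop where
  mem : φ ∈ IsManifold.maximalAtlas 𝓘(ℝ, E) ∞ M
  finrank : Module.finrank ℝ (E ⧸ K) = 2 * n
  ker : ∀ y ∈ φ.target, ∀ u, u ∈ K ↔ ∀ v, locForm φ.symm σ y ![u, v] = 0

/-- A chart in which the leaves are slices is foliated for `σ`, because the kernel of `σ` is tangent
to the leaves. -/
theorem Foliation.IsTransverselySymplectic.exists_isFoliatedChart {F : Foliation E M (2 * n)}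
    {σ : KForm E M 2} (hσ : F.IsTransverselySymplectic σ) (x₀ : M) :
    ∃ φ K, x₀ ∈ φ.source ∧ IsFoliatedChart n σ φ K := by
  obtain ⟨φ, hφ, hx, K, hK, h⟩ := F.integrable x₀
  refine ⟨φ, K, hx, hφ, hK, fun y hy u => ?_⟩
  have hmd := mdifferentiable_of_mem_maximalAtlas hφ
  have h1 := h (φ.symm y) (φ.map_target hy) (mfderiv 𝓘(ℝ, E) 𝓘(ℝ, E) φ.symm y u)
  have h2 : (mfderiv 𝓘(ℝ, E) 𝓘(ℝ, E) φ (φ.symm y) (mfderiv 𝓘(ℝ, E) 𝓘(ℝ, E) φ.symm y u) : E) = u :=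
    DFunLike.congr_fun (hmd.comp_symm_deriv hy) u
  rw [h2, hσ.ker_eq] at h1
  refine Iff.trans h1.symm ?_
  have h3 : ∀ v, locForm φ.symm σ y ![u, v] = σ (φ.symm y)
      ![mfderiv 𝓘(ℝ, E) 𝓘(ℝ, E) φ.symm y u, mfderiv 𝓘(ℝ, E) 𝓘(ℝ, E) φ.symm y v] :=
    fun v => comp_two _ _ _ _
  constructor
  · intro h4 v
    rw [h3, h4]
  · intro h4 v
    obtain ⟨v, rfl⟩ := surjective_mfderiv_symm hφ hy v
    exact (h3 v).symm.trans (h4 v)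

/-- The 2-form `σ` has rank `2n` at each point: `2n`-element dual pairs exist and are frames. -/
structure HasRank (n : ℕ) (σ : KForm E M 2) (x : M) : Prop where
  exists_pair : ∃ f : (Fin (2 * n) → TangentSpace 𝓘(ℝ, E) x) ×
    (Fin (2 * n) → TangentSpace 𝓘(ℝ, E) x), IsDualPair (σ x) n f.1 f.2
  isFrame : ∀ f f', IsDualPair (σ x) n f f' → IsFrame (σ x) n f f'

theorem IsFoliatedChart.hasRank {σ : KForm E M 2} {φ : OpenPartialHomeomorph M E}
    {K : Submodule ℝ E} (h : IsFoliatedChart n σ φ K) {x : M} (hx : x ∈ φ.source) :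
    HasRank n σ x := by
  have key : ∀ y ∈ φ.target, HasRank n σ (φ.symm y) := by
    intro y hy
    have hsurj := surjective_mfderiv_symm h.mem hy
    constructor
    · obtain ⟨f, hf⟩ := exists_isDualPair (h.ker y hy) h.finrank
      exact ⟨(fun i => mfderiv 𝓘(ℝ, E) 𝓘(ℝ, E) φ.symm y (f.1 i),
        fun i => mfderiv 𝓘(ℝ, E) 𝓘(ℝ, E) φ.symm y (f.2 i)), (isDualPair_comp _ _ _ _).mp hf⟩
    · intro f f' hf
      choose g hg using fun i => hsurj (f i)
      choose g' hg' using fun i => hsurj (f' i)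
      obtain rfl : (fun i => mfderiv 𝓘(ℝ, E) 𝓘(ℝ, E) φ.symm y (g i)) = f := funext hg
      obtain rfl : (fun i => mfderiv 𝓘(ℝ, E) 𝓘(ℝ, E) φ.symm y (g' i)) = f' := funext hg'
      exact (isFrame_comp hsurj _ _ _).mp (isFrame_of_isDualPair (h.ker y hy) h.finrank
        ((isDualPair_comp _ _ _ _).mpr hf))
  have := key (φ x) (φ.map_source hx)
  rwa [φ.left_inv hx] at this

theorem Foliation.IsTransverselySymplectic.hasRank {F : Foliation E M (2 * n)}
    {σ : KForm E M 2} (hσ : F.IsTransverselySymplectic σ) (x : M) : HasRank n σ x := by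
  obtain ⟨φ, K, hx, h⟩ := hσ.exists_isFoliatedChart x
  exact h.hasRank hx

/-- A vector tangent to the leaves extends to a smooth vector field tangent to the leaves: a
constant field in a foliated chart, cut off by a bump function. -/
theorem Foliation.exists_isTangentField [T2Space M] {q : ℕ} (F : Foliation E M q) {x₀ : M}
    {u : TangentSpace 𝓘(ℝ, E) x₀} (hu : u ∈ F.P x₀) :
    ∃ X : VField E M, F.IsTangentField X ∧ X x₀ = u := by
  obtain ⟨φ, hφ, hx, K, -, h⟩ := F.integrable x₀
  have hmd := mdifferentiable_of_mem_maximalAtlas hφ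
  obtain ⟨f, -, hf⟩ := (SmoothBumpFunction.nhds_basis_tsupport (I := 𝓘(ℝ, E)) x₀).mem_iff.mp
    (φ.open_source.mem_nhds hx)
  let k : E := mfderiv 𝓘(ℝ, E) 𝓘(ℝ, E) φ x₀ u
  have hk : k ∈ K := (h x₀ hx u).mp hu
  let V : (x : E) → TangentSpace 𝓘(ℝ, E) x := fun _ => k
  let Y : VField E M := VectorField.mpullback 𝓘(ℝ, E) 𝓘(ℝ, E) φ V
  have hinv : ∀ x ∈ φ.source, (mfderiv 𝓘(ℝ, E) 𝓘(ℝ, E) φ x).IsInvertible :=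
    fun x hx => ⟨hmd.mfderiv hx, rfl⟩
  have hYφ : ∀ x ∈ φ.source, mfderiv 𝓘(ℝ, E) 𝓘(ℝ, E) φ x (Y x) = k := by
    intro x hx
    obtain ⟨T, hT⟩ := hinv x hx
    change mfderiv 𝓘(ℝ, E) 𝓘(ℝ, E) φ x ((mfderiv 𝓘(ℝ, E) 𝓘(ℝ, E) φ x).inverse k) = k
    rw [← hT, ContinuousLinearMap.inverse_equiv]
    exact T.apply_symm_apply k
  have hYs : ContMDiffOn 𝓘(ℝ, E) 𝓘(ℝ, E).tangent ∞
      (fun x => (⟨x, Y x⟩ : TangentBundle 𝓘(ℝ, E) M)) φ.source := by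
    intro x hx
    refine ContMDiffAt.contMDiffWithinAt ?_
    refine ContMDiffAt.mpullback_vectorField_preimage (n := ∞) ?_
      (contMDiffAt_of_mem_maximalAtlas hφ hx) (hinv x hx) (by simp)
    rw [contMDiffAt_vectorSpace_iff_contDiffAt]
    exact contDiffAt_const
  refine ⟨fun x => f x • Y x, ⟨?_, fun x => ?_⟩, ?_⟩
  · exact ContMDiffOn.smul_section_of_tsupport f.contMDiff.contMDiffOn φ.open_source hf hYs
  · by_cases hxs : x ∈ φ.source
    · refine Submodule.smul_mem _ _ ((h x hxs _).mpr ?_)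
      rw [hYφ x hxs]
      exact hk
    · have : f x = 0 := image_eq_zero_of_notMem_tsupport fun h' => hxs (hf h')
      change f x • Y x ∈ F.P x
      rw [this, zero_smul]
      exact zero_mem _
  · change f x₀ • Y x₀ = u
    rw [f.eq_one, one_smul]
    exact hmd.mfderiv_injective hx (hYφ x₀ hx)

end Foliated

/-! ### Basic forms and the operator `Λ` -/

section LocalFrame

variable {E : Type*} [NormedAddCommGroup E] [NormedSpace ℝ E] [FiniteDimensional ℝ E]

/-- The operator `gΛ` as a function of the 2-form is smooth: in a neighbourhood of a form `w₀` with
a dual pair `e`, `e₀'`, a dual pair is obtained from `e`, `e₀'` by inverting the matrix of the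
values `w (e₀' i, e j)`. -/
theorem exists_smooth_isDualPair {n : ℕ} {w₀ : E [⋀^Fin 2]→L[ℝ] ℝ} {e e₀' : Fin (2 * n) → E}
    (h : IsDualPair w₀ n e e₀') :
    ∃ g : (E [⋀^Fin 2]→L[ℝ] ℝ) → Fin (2 * n) → E, (∀ i, ContDiffAt ℝ ∞ (fun w => g w i) w₀) ∧
      ∀ᶠ w in nhds w₀, IsDualPair w n e (g w) := by
  let B₀ : (E [⋀^Fin 2]→L[ℝ] ℝ) →ₗ[ℝ] (Fin (2 * n) → ℝ) →ₗ[ℝ] (Fin (2 * n) → ℝ) :=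
    LinearMap.mk₂ ℝ (fun w c j => w ![∑ i, c i • e₀' i, e j])
      (fun _ _ _ => rfl) (fun _ _ _ => rfl)
      (fun w c c' => by
        funext j
        simp [form_two_sum_left, form_two_smul_left, add_mul, Finset.sum_add_distrib])
      (fun r w c => by
        funext j
        simp [form_two_sum_left, form_two_smul_left, mul_assoc, Finset.mul_sum])
  let B := bilinCLM B₀
  have hB : ∀ w c j, B w c j = w ![∑ i, c i • e₀' i, e j] := fun _ _ _ => rfl
  have hB1 : B w₀ = (ContinuousLinearEquiv.refl ℝ (Fin (2 * n) → ℝ) :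
      (Fin (2 * n) → ℝ) →L[ℝ] (Fin (2 * n) → ℝ)) := by
    ext c j
    simp [hB, form_two_sum_left, form_two_smul_left, h _ _]
  have hinv : ContDiffAt ℝ ∞ ContinuousLinearMap.inverse (B w₀) := by
    rw [hB1]
    exact contDiffAt_map_inverse _
  have hBinv : ContDiffAt ℝ ∞ (fun w => (B w).inverse) w₀ :=
    ContDiffAt.comp w₀ (f := B) hinv B.contDiff.contDiffAt
  refine ⟨fun w i => ∑ j, (B w).inverse (Pi.single i 1) j • e₀' j, fun i => ?_, ?_⟩
  · refine ContDiffAt.sum fun j _ => ContDiffAt.smul ?_ contDiffAt_const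
    have h1 : ContDiffAt ℝ ∞ (fun w => (B w).inverse (Pi.single i 1)) w₀ :=
      hBinv.clm_apply contDiffAt_const
    exact contDiffAt_pi.mp h1 j
  · have h2 : ∀ᶠ w in nhds w₀, B w ∈ Set.range ((↑) : ((Fin (2 * n) → ℝ) ≃L[ℝ] (Fin (2 * n) → ℝ)) →
        (Fin (2 * n) → ℝ) →L[ℝ] (Fin (2 * n) → ℝ)) := by
      refine B.continuous.continuousAt.preimage_mem_nhds ?_
      rw [hB1]
      exact ContinuousLinearEquiv.nhds _
    filter_upwards [h2] with w hw
    obtain ⟨T, hT⟩ := hw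
    intro i j
    change w ![∑ k, (B w).inverse (Pi.single i 1) k • e₀' k, e j] = _
    rw [← hB, ← hT, ContinuousLinearMap.inverse_equiv]
    simp [Pi.single_apply, eq_comm]

end LocalFrame

section Basic

variable {E : Type*} [NormedAddCommGroup E] [NormedSpace ℝ E] [FiniteDimensional ℝ E]
  {M : Type*} [TopologicalSpace M] [ChartedSpace E M] [IsManifold 𝓘(ℝ, E) ∞ M] {n : ℕ}

/-- A form is transverse for `σ` if it is smooth and annihilated, as is its exterior derivative, by
contraction with the kernel of `σ`. -/
structure IsTransverse (σ : KForm E M 2) (α : MForm E M) : Prop where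
  smooth : α ∈ smoothForms E M
  hor : ∀ x, gAt α x ∈ gHor (σ x)
  dhor : ∀ x, gAt (extDer α) x ∈ gHor (σ x)

/-- The basic forms are the transverse forms: given horizontality, `𝓛(X)α = 0` amounts to
`ι(X)dα = 0`, and both conditions become pointwise because each vector tangent to a leaf extends to
a tangent vector field. -/
theorem Foliation.mem_basicForms_iff [T2Space M] {F : Foliation E M (2 * n)} {σ : KForm E M 2}
    (hσ : F.IsTransverselySymplectic σ) {α : MForm E M} :
    α ∈ F.basicForms ↔ IsTransverse σ α := by
  constructor
  · intro h
    refine ⟨h.1, fun x u hu => ?_, fun x u hu => ?_⟩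
    · obtain ⟨X, hX, rfl⟩ := F.exists_isTangentField ((hσ.ker_eq x u).mpr hu)
      have := (h.2 X hX).1
      rw [← gAt_interior', this]
      rfl
    · obtain ⟨X, hX, rfl⟩ := F.exists_isTangentField ((hσ.ker_eq x u).mpr hu)
      obtain ⟨h1, h2⟩ := h.2 X hX
      rw [lieDer, h1, extDer_zero, zero_add] at h2
      rw [← gAt_interior', h2]
      rfl
  · intro h
    refine ⟨h.smooth, fun X hX => ?_⟩
    have hker : ∀ x v, σ x ![X x, v] = 0 := fun x => (hσ.ker_eq x _).mp (hX.2 x)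
    have h1 : interior' X α = 0 := mform_ext fun x => h.hor x _ (hker x)
    have h2 : interior' X (extDer α) = 0 := mform_ext fun x => h.dhor x _ (hker x)
    exact ⟨h1, by rw [lieDer, h1, h2, extDer_zero, add_zero]⟩

/-- A 2-form as a form of mixed degree. -/
noncomputable def twoForm (σ : KForm E M 2) : MForm E M := Pi.single 2 σ

theorem extDer_twoForm {σ : KForm E M 2} (hc : extD σ = 0) : extDer (twoForm σ) = 0 := by
  funext k
  cases k with
  | zero => rfl
  | succ k =>
    change extD (twoForm σ k) = 0
    by_cases hk : k = 2
    · subst hk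
      rw [twoForm, Pi.single_eq_same, hc]
    · rw [twoForm, Pi.single_eq_of_ne hk]
      exact congrFun (extDer_zero (E := E) (M := M)) (k + 1)

theorem isTransverse_twoForm {σ : KForm E M 2} (hσ : IsSmoothForm σ) (hc : extD σ = 0) :
    IsTransverse σ (twoForm σ) := by
  refine ⟨fun k => ?_, fun x => mem_gHor_iff.mpr fun k => ?_, fun x => ?_⟩
  · by_cases hk : k = 2
    · subst hk
      rw [twoForm, Pi.single_eq_same]
      exact hσ
    · rw [twoForm, Pi.single_eq_of_ne hk]
      exact (smoothForms E M).zero_mem k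
  · change IsHorizontal (σ x) k (twoForm σ k x)
    by_cases hk : k = 2
    · subst hk
      rw [twoForm, Pi.single_eq_same]
      intro u hu
      ext v
      have hv : v = ![v 0] := by funext i; fin_cases i; rfl
      rw [hv]
      exact hu (v 0)
    · rw [twoForm, Pi.single_eq_of_ne hk]
      cases k with
      | zero => trivial
      | succ k => exact fun u _ => rfl
  · rw [extDer_twoForm hc]
    exact zero_mem _

/-- Transverse forms are constant in the leaf directions of a foliated chart. -/
theorem IsTransverse.gdir_eq_zero {σ : KForm E M 2} {α : MForm E M} (hα : IsTransverse σ α)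
    {φ : OpenPartialHomeomorph M E} {K : Submodule ℝ E} (h : IsFoliatedChart n σ φ K) {y u : E}
    (hy : y ∈ φ.target) (hu : u ∈ K) : gdir (gLoc φ.symm α) y u = 0 := by
  have h1 := gι_gd (fun k => differentiableAt_gLoc hα.smooth (smoothNear_symm h.mem hy) k) u
  have h2 : gι u (gd (gLoc φ.symm α) y) = 0 := by
    rw [← gLoc_extDer hα.smooth (smoothNear_symm h.mem hy)]
    exact (gpull_mem_gHor (surjective_mfderiv_symm h.mem hy) _).mpr (hα.dhor _) u
      ((h.ker y hy u).mp hu)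
  have h3 : ∀ᶠ z in nhds y, gι u (gLoc φ.symm α z) = 0 := by
    filter_upwards [φ.open_target.mem_nhds hy] with z hz
    exact (gpull_mem_gHor (surjective_mfderiv_symm h.mem hz) _).mpr (hα.hor _) u
      ((h.ker z hz u).mp hu)
  have h4 : gd (fun z => gι u (gLoc φ.symm α z)) y = 0 := by
    funext k
    cases k with
    | zero => rfl
    | succ k =>
      have h5 : (fun z => gι u (gLoc φ.symm α z) k) =ᶠ[nhds y] fun _ => 0 :=
        h3.mono fun z hz => congrFun hz k
      rw [gd_succ, h5.extDeriv_eq, extDeriv, fderiv_fun_const]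
      exact map_zero (ContinuousAlternatingMap.alternatizeUncurryFinCLM ℝ E ℝ)
  rw [h2, h4, sub_zero] at h1
  exact h1.symm

/-- The converse of `IsTransverse.gdir_eq_zero`, which makes transversality accessible to operators
that are only defined pointwise, such as `Λ`. -/
theorem isTransverse_of_gdir {σ : KForm E M 2} (hσ : ∀ x, ∃ φ K, x ∈ φ.source ∧
      IsFoliatedChart n σ φ K) {α : MForm E M} (hs : α ∈ smoothForms E M)
    (hor : ∀ x, gAt α x ∈ gHor (σ x))
    (hdir : ∀ φ K, IsFoliatedChart n σ φ K → ∀ y ∈ φ.target, ∀ u ∈ K,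
      gdir (gLoc φ.symm α) y u = 0) : IsTransverse σ α := by
  refine ⟨hs, hor, fun x => ?_⟩
  obtain ⟨φ, K, hx, h⟩ := hσ x
  have key : ∀ y ∈ φ.target, gAt (extDer α) (φ.symm y) ∈ gHor (σ (φ.symm y)) := by
    intro y hy
    suffices hι : ∀ u ∈ K, gι u (gd (gLoc φ.symm α) y) = 0 by
      refine (gpull_mem_gHor (surjective_mfderiv_symm h.mem hy) _).mp fun u hu => ?_
      have := hι u ((h.ker y hy u).mpr hu)
      rw [← gLoc_extDer hs (smoothNear_symm h.mem hy)] at this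
      exact this
    intro u huK
    rw [gι_gd (fun k => differentiableAt_gLoc hs (smoothNear_symm h.mem hy) k) u,
      hdir φ K h y hy u huK, zero_sub, neg_eq_zero]
    funext k
    cases k with
    | zero => rfl
    | succ k =>
      have h5 : (fun z => gι u (gLoc φ.symm α z) k) =ᶠ[nhds y] fun _ => 0 := by
        filter_upwards [φ.open_target.mem_nhds hy] with z hz
        exact congrFun ((gpull_mem_gHor (surjective_mfderiv_symm h.mem hz) _).mpr (hor _) u
          ((h.ker z hz u).mp huK)) k
      rw [gd_succ, h5.extDeriv_eq, extDeriv, fderiv_fun_const]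
      exact map_zero (ContinuousAlternatingMap.alternatizeUncurryFinCLM ℝ E ℝ)
  have := key (φ x) (φ.map_source hx)
  rwa [φ.left_inv hx] at this

open Classical in
/-- The dual Lefschetz operator, given at each point by `gΛ` for a chosen dual pair. -/
noncomputable def lefschetzΛ (n : ℕ) (σ : KForm E M 2) : MForm E M →ₗ[ℝ] MForm E M where
  toFun α k x := if h : ∃ f : (Fin (2 * n) → TangentSpace 𝓘(ℝ, E) x) ×
    (Fin (2 * n) → TangentSpace 𝓘(ℝ, E) x), IsDualPair (σ x) n f.1 f.2 then
      gΛ h.choose.1 h.choose.2 (gAt α x) k else 0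
  map_add' α β := by
    funext k x
    rw [Pi.add_apply, Pi.add_apply]
    split_ifs with h
    · rw [gAt_add, map_add]; rfl
    · exact (add_zero _).symm
  map_smul' c α := by
    funext k x
    rw [Pi.smul_apply, Pi.smul_apply]
    split_ifs with h
    · rw [gAt_smul, map_smul]; rfl
    · exact (smul_zero _).symm

theorem gAt_lefschetzΛ {σ : KForm E M 2} {x : M} (hx : HasRank n σ x) {α : MForm E M}
    (hα : gAt α x ∈ gHor (σ x)) {e e'} (h : IsDualPair (σ x) n e e') :
    gAt (lefschetzΛ n σ α) x = gΛ e e' (gAt α x) := by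
  have h1 : gAt (lefschetzΛ n σ α) x =
      gΛ hx.exists_pair.choose.1 hx.exists_pair.choose.2 (gAt α x) := by
    funext k
    exact dif_pos hx.exists_pair
  rw [h1]
  exact (hx.isFrame _ _ hx.exists_pair.choose_spec).gΛ_eq (hx.isFrame _ _ h) hα

theorem gLoc_lefschetzΛ {σ : KForm E M 2} {ψ : E → M} {y : E} (hx : HasRank n σ (ψ y))
    {α : MForm E M} (hα : gAt α (ψ y) ∈ gHor (σ (ψ y))) {e e' : Fin (2 * n) → E}
    (h : IsDualPair (locForm ψ σ y) n e e') :
    gLoc ψ (lefschetzΛ n σ α) y = gΛ e e' (gLoc ψ α y) := by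
  rw [gLoc_eq, gAt_lefschetzΛ hx hα ((isDualPair_comp _ _ _ _).mp h)]
  exact gpull_gΛ _ _ _ _

theorem exists_isDualPair_locForm {σ : KForm E M 2} {ψ : E → M} {y : E} (hx : HasRank n σ (ψ y))
    (hs : Function.Surjective (mfderiv 𝓘(ℝ, E) 𝓘(ℝ, E) ψ y)) :
    ∃ e e' : Fin (2 * n) → E, IsDualPair (locForm ψ σ y) n e e' := by
  obtain ⟨⟨f, f'⟩, hf⟩ := hx.exists_pair
  choose g hg using fun i => hs (f i)
  choose g' hg' using fun i => hs (f' i)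
  obtain rfl : (fun i => mfderiv 𝓘(ℝ, E) 𝓘(ℝ, E) ψ y (g i)) = f := funext hg
  obtain rfl : (fun i => mfderiv 𝓘(ℝ, E) 𝓘(ℝ, E) ψ y (g' i)) = f' := funext hg'
  exact ⟨g, g', (isDualPair_comp _ _ _ _).mpr hf⟩

/-- Locally, a component of `Λα` is a smooth function of `σ` and of a component of `α`. -/
theorem exists_gLoc_lefschetzΛ_eq {σ : KForm E M 2} (hσ : IsSmoothForm σ)
    (hr : ∀ x, HasRank n σ x)
    {α : MForm E M} (hα : ∀ x, gAt α x ∈ gHor (σ x)) {φ : OpenPartialHomeomorph M E}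
    (hφ : φ ∈ IsManifold.maximalAtlas 𝓘(ℝ, E) ∞ M) {y : E} (hy : y ∈ φ.target) (k : ℕ) :
    ∃ Q : (E [⋀^Fin 2]→L[ℝ] ℝ) × (E [⋀^Fin (k + 2)]→L[ℝ] ℝ) → E [⋀^Fin k]→L[ℝ] ℝ,
      ContDiffAt ℝ ∞ Q (locForm φ.symm σ y, gLoc φ.symm α y (k + 2)) ∧
      (fun z => gLoc φ.symm (lefschetzΛ n σ α) z k) =ᶠ[nhds y]
        fun z => Q (locForm φ.symm σ z, gLoc φ.symm α z (k + 2)) := by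
  obtain ⟨e, e', he⟩ := exists_isDualPair_locForm (hr (φ.symm y)) (surjective_mfderiv_symm hφ hy)
  obtain ⟨g, hg, hd⟩ := exists_smooth_isDualPair he
  refine ⟨fun p => (-(1 / 2 : ℝ)) • ∑ i, contract (g p.1 i) (contract (e i) p.2), ?_, ?_⟩
  · refine ContDiffAt.const_smul _ (ContDiffAt.sum fun i _ => ContDiffAt.contract ?_ ?_)
    · exact ContDiffAt.comp (g := fun w => g w i)
        (f := fun p : (E [⋀^Fin 2]→L[ℝ] ℝ) × (E [⋀^Fin (k + 2)]→L[ℝ] ℝ) => p.1) _ (hg i)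
        contDiffAt_fst
    · exact contDiffAt_const.contract contDiffAt_snd
  · have h1 : ContinuousAt (locForm φ.symm σ) y :=
      (hσ.contDiffAt_locForm (smoothNear_symm hφ hy)).continuousAt
    filter_upwards [h1.eventually hd] with z hz
    rw [gLoc_lefschetzΛ (hr _) (hα _) hz, gΛ_apply, Pi.smul_apply, Finset.sum_apply]
    rfl

theorem lefschetzΛ_mem_smoothForms {σ : KForm E M 2} (hσ : IsSmoothForm σ)
    (hr : ∀ x, HasRank n σ x) {α : MForm E M} (hs : α ∈ smoothForms E M)
    (hα : ∀ x, gAt α x ∈ gHor (σ x)) : lefschetzΛ n σ α ∈ smoothForms E M := by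
  refine mem_smoothForms_of_contDiffAt fun x k => ?_
  obtain ⟨Q, hQ, h⟩ := exists_gLoc_lefschetzΛ_eq hσ hr hα (IsManifold.chart_mem_maximalAtlas x)
    (mem_chart_target E x) k
  refine ContDiffAt.congr_of_eventuallyEq ?_ h
  have hx := smoothNear_chartAt (E := E) x
  exact ContDiffAt.comp (f := fun z => (locForm (chartAt E x).symm σ z,
    gLoc (chartAt E x).symm α z (k + 2))) _ hQ
    ((hσ.contDiffAt_locForm hx).prodMk (contDiffAt_gLoc hs hx (k + 2)))

theorem gAt_lefschetzΛ_mem_gHor {σ : KForm E M 2} {x : M} (hr : HasRank n σ x) {α : MForm E M}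
    (hα : gAt α x ∈ gHor (σ x)) : gAt (lefschetzΛ n σ α) x ∈ gHor (σ x) := by
  obtain ⟨f, hf⟩ := hr.exists_pair
  rw [gAt_lefschetzΛ hr hα hf]
  exact gΛ_mem_gHor hα

variable {F : Foliation E M (2 * n)} {σ : KForm E M 2}

/-- In a foliated chart `Λα` is a smooth function of `σ` and `α`, neither of which varies along the
slices, so `Λα` does not vary along them either. -/
theorem Foliation.IsTransverselySymplectic.isTransverse_lefschetzΛ
    (hσ : F.IsTransverselySymplectic σ) {α : MForm E M} (hα : IsTransverse σ α) :
    IsTransverse σ (lefschetzΛ n σ α) := by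
  refine isTransverse_of_gdir hσ.exists_isFoliatedChart
    (lefschetzΛ_mem_smoothForms hσ.smooth hσ.hasRank hα.smooth hα.hor)
    (fun x => gAt_lefschetzΛ_mem_gHor (hσ.hasRank x) (hα.hor x)) fun φ K h y hy u hu => ?_
  funext k
  obtain ⟨Q, hQ, heq⟩ := exists_gLoc_lefschetzΛ_eq hσ.smooth hσ.hasRank hα.hor h.mem hy k
  have hx := smoothNear_symm h.mem hy
  have h1 : HasFDerivAt (locForm φ.symm σ) (fderiv ℝ (locForm φ.symm σ) y) y :=
    ((hσ.smooth.contDiffAt_locForm hx).differentiableAt (by simp)).hasFDerivAt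
  have h2 := (differentiableAt_gLoc hα.smooth hx (k + 2)).hasFDerivAt
  have h3 := (hQ.differentiableAt (by simp)).hasFDerivAt
  have h4 : fderiv ℝ (locForm φ.symm σ) y u = 0 := by
    have := congrFun ((isTransverse_twoForm hσ.smooth hσ.closed).gdir_eq_zero h hy hu) 2
    change fderiv ℝ (fun z => locForm φ.symm (twoForm σ 2) z) y u = 0 at this
    rwa [twoForm, Pi.single_eq_same] at this
  have h5 : fderiv ℝ (fun z => gLoc φ.symm α z (k + 2)) y u = 0 :=
    congrFun (hα.gdir_eq_zero h hy hu) (k + 2)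
  change fderiv ℝ (fun z => gLoc φ.symm (lefschetzΛ n σ α) z k) y u = 0
  rw [heq.fderiv_eq]
  have h6 := (HasFDerivAt.comp y h3 (h1.prodMk h2)).fderiv
  refine (DFunLike.congr_fun h6 u).trans ?_
  rw [ContinuousLinearMap.comp_apply, ContinuousLinearMap.prod_apply, h4, h5]
  exact map_zero _

theorem Foliation.IsTransverselySymplectic.isTransverse_lefschetzL
    (hσ : F.IsTransverselySymplectic σ) {α : MForm E M} (hα : IsTransverse σ α) :
    IsTransverse σ (lefschetzL σ α) where
  smooth := lefschetzL_mem_smoothForms hσ.smooth hα.smooth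
  hor x := by rw [gAt_lefschetzL]; exact gL_mem_gHor (hα.hor x)
  dhor x := by
    rw [extDer_lefschetzL hσ.smooth hσ.closed hα.smooth, gAt_lefschetzL]
    exact gL_mem_gHor (hα.dhor x)

theorem IsTransverse.extDer {α : MForm E M} (hα : IsTransverse σ α) :
    IsTransverse σ (extDer α) where
  smooth := extDer_mem_smoothForms hα.smooth
  hor := hα.dhor
  dhor x := by rw [extDer_extDer hα.smooth]; exact zero_mem _

/-- The functions whose differential is `ι(X)σ` for some `X` act on transverse forms. -/
theorem IsTransverse.smul {α : MForm E M} (hα : IsTransverse σ α) {f : M → ℝ}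
    (hf : ContMDiff 𝓘(ℝ, E) 𝓘(ℝ, ℝ) ∞ f) {X : VField E M}
    (hX : ∀ x v, (mfderiv 𝓘(ℝ, E) 𝓘(ℝ, ℝ) f x v : ℝ) = σ x ![X x, v]) :
    IsTransverse σ (fun k x => f x • α k x) ∧
      ∀ x, gAt (_root_.extDer fun k x => f x • α k x) x =
        gε (flat (σ x) (X x)) (gAt α x) + f x • gAt (_root_.extDer α) x := by
  have hs : (fun k x => f x • α k x) ∈ smoothForms E M := by
    refine mem_smoothForms_of_contDiffAt fun x k => ?_
    have h1 : ContDiffAt ℝ ∞ (fun z => f ((chartAt E x).symm z)) (chartAt E x x) := by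
      rw [← contMDiffAt_iff_contDiffAt]
      exact hf.contMDiffAt.comp _ (smoothNear_chartAt (E := E) x).self_of_nhds
    exact h1.smul (contDiffAt_gLoc hα.smooth (smoothNear_chartAt x) k)
  have hd : ∀ x, gAt (_root_.extDer fun k x => f x • α k x) x =
        gε (flat (σ x) (X x)) (gAt α x) + f x • gAt (_root_.extDer α) x := by
    intro x
    have key : ∀ y ∈ (chartAt E x).target, gAt (_root_.extDer fun k x => f x • α k x)
        ((chartAt E x).symm y) = gε (flat (σ ((chartAt E x).symm y)) (X ((chartAt E x).symm y)))
          (gAt α ((chartAt E x).symm y)) + f ((chartAt E x).symm y) •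
            gAt (_root_.extDer α) ((chartAt E x).symm y) := by
      intro y hy
      have hn := smoothNear_chart_symm (E := E) x hy
      apply gpull_injective (surjective_mfderiv_symm (IsManifold.chart_mem_maximalAtlas x) hy)
      rw [← gLoc_eq, gLoc_extDer hs hn, map_add, gpull_gε, map_smul, ← gLoc_eq, ← gLoc_eq,
        gLoc_extDer hα.smooth hn]
      have h1 : ContDiffAt ℝ ∞ (fun z => f ((chartAt E x).symm z)) y := by
        rw [← contMDiffAt_iff_contDiffAt]
        exact hf.contMDiffAt.comp _ hn.self_of_nhds
      have h2 := gd_smul (h1.differentiableAt (by simp))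
        (fun k => differentiableAt_gLoc hα.smooth hn k)
      refine h2.trans ?_
      congr 3
      have h3 := mfderiv_comp y ((hf.contMDiffAt (x := (chartAt E x).symm y)).mdifferentiableAt
        (by simp)) (hn.self_of_nhds.mdifferentiableAt (by simp))
      ext v
      have h4 := DFunLike.congr_fun h3 v
      rw [mfderiv_eq_fderiv] at h4
      exact h4.trans (hX _ _)
    have := key _ (mem_chart_target E x)
    rwa [(chartAt E x).left_inv (mem_chart_source E x)] at this
  refine ⟨⟨hs, fun x => Submodule.smul_mem _ _ (hα.hor x), fun x => ?_⟩, hd⟩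
  rw [hd]
  exact add_mem (gε_mem_gHor (hα.hor x) (flat_ker _)) (Submodule.smul_mem _ _ (hα.dhor x))

end Basic

/-! ### The Lefschetz complex of basic forms -/

section BasicComplex

variable {E : Type*} [NormedAddCommGroup E] [NormedSpace ℝ E] [FiniteDimensional ℝ E]
  {M : Type*} [TopologicalSpace M] [ChartedSpace E M] [IsManifold 𝓘(ℝ, E) ∞ M] [T2Space M] {n : ℕ}
  {F : Foliation E M (2 * n)} {σ : KForm E M 2}

/-- The component of degree `k` of a form. -/
noncomputable def degreePart (k : ℕ) (α : MForm E M) : MForm E M := Pi.single k (α k)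

theorem degreePart_same (k : ℕ) (α : MForm E M) : degreePart k α k = α k := Pi.single_eq_same _ _

theorem degreePart_of_ne {k j : ℕ} (h : j ≠ k) (α : MForm E M) : degreePart k α j = 0 :=
  Pi.single_eq_of_ne h _

theorem degreePart_eq_self {k : ℕ} {α : MForm E M} (h : ∀ j, j ≠ k → α j = 0) :
    degreePart k α = α := by
  funext j
  by_cases hj : j = k
  · subst hj; exact degreePart_same _ _
  · rw [degreePart_of_ne hj, h j hj]

theorem extD_zero (k : ℕ) : extD (0 : KForm E M k) = 0 :=
  congrFun (extDer_zero (E := E) (M := M)) (k + 1)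

theorem extDer_degreePart (k : ℕ) (α : MForm E M) :
    extDer (degreePart k α) = degreePart (k + 1) (extDer α) := by
  funext j
  cases j with
  | zero => rw [degreePart_of_ne (by omega)]; rfl
  | succ j =>
    change extD (degreePart k α j) = _
    by_cases hj : j = k
    · subst hj; rw [degreePart_same, degreePart_same]; rfl
    · rw [degreePart_of_ne hj, degreePart_of_ne (by omega), extD_zero]

theorem gAt_degreePart_mem_gHor {α : MForm E M} {x : M} (h : gAt α x ∈ gHor (σ x)) (k : ℕ) :
    gAt (degreePart k α) x ∈ gHor (σ x) := by
  rw [mem_gHor_iff] at h ⊢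
  intro j
  change IsHorizontal (σ x) j (degreePart k α j x)
  by_cases hj : j = k
  · subst hj; rw [degreePart_same]; exact h j
  · rw [degreePart_of_ne hj]
    cases j with
    | zero => trivial
    | succ j => exact fun u _ => rfl

theorem IsTransverse.degreePart {α : MForm E M} (h : IsTransverse σ α) (k : ℕ) :
    IsTransverse σ (degreePart k α) where
  smooth j := by
    by_cases hj : j = k
    · subst hj; rw [degreePart_same]; exact h.smooth j
    · rw [degreePart_of_ne hj]; exact (smoothForms E M).zero_mem j
  hor x := gAt_degreePart_mem_gHor (h.hor x) k
  dhor x := by rw [extDer_degreePart]; exact gAt_degreePart_mem_gHor (h.dhor x) (k + 1)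

variable (F) in
/-- The basic forms of degree `k`. -/
def Foliation.basicDegree (k : ℕ) : Submodule ℝ F.basicForms where
  carrier := {a | ∀ j, j ≠ k → a.1 j = 0}
  add_mem' {a b} ha hb j hj := by
    change a.1 j + b.1 j = 0
    rw [ha j hj, hb j hj, add_zero]
  zero_mem' _ _ := rfl
  smul_mem' c a ha j hj := by
    change c • a.1 j = 0
    rw [ha j hj, smul_zero]

namespace Foliation.IsTransverselySymplectic

theorem isTransverse (hσ : F.IsTransverselySymplectic σ) (a : F.basicForms) :
    IsTransverse σ a.1 :=
  (mem_basicForms_iff hσ).mp a.2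

/-- The exterior derivative on basic forms. -/
noncomputable def d (hσ : F.IsTransverselySymplectic σ) : F.basicForms →ₗ[ℝ] F.basicForms :=
  F.dBasic.codRestrict _ fun a => (mem_basicForms_iff hσ).mpr (hσ.isTransverse a).extDer

theorem d_val (hσ : F.IsTransverselySymplectic σ) (a : F.basicForms) :
    (hσ.d a).1 = extDer a.1 :=
  rfl

/-- The Lefschetz operator on basic forms. -/
noncomputable def L (hσ : F.IsTransverselySymplectic σ) : F.basicForms →ₗ[ℝ] F.basicForms where
  toFun a := ⟨lefschetzL σ a.1,
    (mem_basicForms_iff hσ).mpr (hσ.isTransverse_lefschetzL (hσ.isTransverse a))⟩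
  map_add' a b := Subtype.ext <| mform_ext fun x => by
    simp only [Submodule.coe_add, gAt_add, gAt_lefschetzL, map_add]
  map_smul' c a := Subtype.ext <| mform_ext fun x => by
    simp only [Submodule.coe_smul, gAt_smul, gAt_lefschetzL, map_smul, RingHom.id_apply]

/-- The dual Lefschetz operator on basic forms. -/
noncomputable def Λ (hσ : F.IsTransverselySymplectic σ) : F.basicForms →ₗ[ℝ] F.basicForms :=
  ((lefschetzΛ n σ).comp F.basicForms.subtype).codRestrict _
    fun a => (mem_basicForms_iff hσ).mpr (hσ.isTransverse_lefschetzΛ (hσ.isTransverse a))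

/-- The component of degree `k` of a basic form. -/
noncomputable def part (hσ : F.IsTransverselySymplectic σ) (k : ℕ) :
    F.basicForms →ₗ[ℝ] F.basicForms where
  toFun a := ⟨degreePart k a.1, (mem_basicForms_iff hσ).mpr ((hσ.isTransverse a).degreePart k)⟩
  map_add' a b := Subtype.ext (Pi.single_add k (a.1 k) (b.1 k))
  map_smul' c a := Subtype.ext (Pi.single_smul k c (a.1 k))

theorem part_val (hσ : F.IsTransverselySymplectic σ) (k : ℕ) (a : F.basicForms) :
    (hσ.part k a).1 = degreePart k a.1 :=
  rfl

theorem part_mem (hσ : F.IsTransverselySymplectic σ) (k : ℕ) (a : F.basicForms) :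
    hσ.part k a ∈ F.basicDegree k :=
  fun _ hj => degreePart_of_ne hj _

theorem part_eq_self (hσ : F.IsTransverselySymplectic σ) {k : ℕ} {a : F.basicForms}
    (h : a ∈ F.basicDegree k) :
    hσ.part k a = a :=
  Subtype.ext (degreePart_eq_self h)

theorem part_d (hσ : F.IsTransverselySymplectic σ) (k : ℕ) (a : F.basicForms) :
    hσ.part (k + 1) (hσ.d a) = hσ.d (hσ.part k a) :=
  Subtype.ext (extDer_degreePart k a.1).symm

theorem gAt_mem_gH (hσ : F.IsTransverselySymplectic σ) {k : ℕ} {a : F.basicForms}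
    (h : a ∈ F.basicDegree k) (x : M) :
    gAt a.1 x ∈ gH (σ x) k :=
  ⟨(hσ.isTransverse a).hor x, fun j hj => congrFun (h j hj) x⟩

theorem gAt_L (hσ : F.IsTransverselySymplectic σ) (a : F.basicForms) (x : M) :
    gAt (hσ.L a).1 x = gL (σ x) (gAt a.1 x) :=
  gAt_lefschetzL σ a.1 x

theorem gAt_Λ (hσ : F.IsTransverselySymplectic σ) (a : F.basicForms) (x : M) {e e'}
    (h : IsDualPair (σ x) n e e') :
    gAt (hσ.Λ a).1 x = gΛ e e' (gAt a.1 x) :=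
  gAt_lefschetzΛ (hσ.hasRank x) ((hσ.isTransverse a).hor x) h

theorem exists_isFrame (hσ : F.IsTransverselySymplectic σ) (x : M) :
    ∃ e e', IsFrame (σ x) n e e' := by
  obtain ⟨f, hf⟩ := (hσ.hasRank x).exists_pair
  exact ⟨f.1, f.2, (hσ.hasRank x).isFrame _ _ hf⟩

theorem basic_ext {a b : F.basicForms} (h : ∀ x, gAt a.1 x = gAt b.1 x) : a = b :=
  Subtype.ext (mform_ext h)

/-- The identities between `L` and `Λ` hold because they hold at each point. -/
theorem isLefschetz (hσ : F.IsTransverselySymplectic σ) :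
    IsLefschetz n F.basicDegree hσ.L hσ.Λ where
  L_mem {k a} ha j hj := by
    funext x
    exact (congrFun (hσ.gAt_L a x) j).trans ((gL_mem_gH (hσ.gAt_mem_gH ha x)).2 j hj)
  Λ_mem {k a} ha j hj := by
    funext x
    obtain ⟨e, e', h⟩ := hσ.exists_isFrame x
    exact (congrFun (hσ.gAt_Λ a x h.dual) j).trans
      ((h.isLefschetz.Λ_mem (hσ.gAt_mem_gH ha x)).2 j hj)
  Λ_low {k a} hk ha := by
    refine basic_ext fun x => ?_
    obtain ⟨e, e', h⟩ := hσ.exists_isFrame x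
    rw [hσ.gAt_Λ a x h.dual, h.isLefschetz.Λ_low hk (hσ.gAt_mem_gH ha x)]
    rfl
  comm {k a} ha := by
    refine basic_ext fun x => ?_
    obtain ⟨e, e', h⟩ := hσ.exists_isFrame x
    rw [hσ.gAt_Λ _ x h.dual, hσ.gAt_L, h.isLefschetz.comm (hσ.gAt_mem_gH ha x),
      Submodule.coe_add, gAt_add, hσ.gAt_L, hσ.gAt_Λ _ x h.dual, Submodule.coe_smul, gAt_smul]
  top {k a} hk ha := by
    refine basic_ext fun x => ?_
    obtain ⟨e, e', h⟩ := hσ.exists_isFrame x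
    exact h.isLefschetz.top hk (hσ.gAt_mem_gH ha x)

theorem gAt_sum {ι : Type*} (s : Finset ι) (f : ι → F.basicForms) (x : M) :
    gAt (∑ i ∈ s, f i : F.basicForms).1 x = ∑ i ∈ s, gAt (f i).1 x := by
  classical
  induction s using Finset.induction_on with
  | empty => rfl
  | insert i s hi ih =>
    rw [Finset.sum_insert hi, Finset.sum_insert hi, ← ih]
    rfl

theorem gAt_L_pow (hσ : F.IsTransverselySymplectic σ) (a : F.basicForms) (x : M) (j : ℕ) :
    gAt ((hσ.L ^ j) a).1 x = (gL (σ x) ^ j) (gAt a.1 x) := by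
  induction j with
  | zero => rfl
  | succ j ih => rw [pow_succ', pow_succ', Module.End.mul_apply, Module.End.mul_apply, gAt_L, ih]

theorem gAt_Λ_pow (hσ : F.IsTransverselySymplectic σ) (a : F.basicForms) (x : M) {e e'}
    (h : IsDualPair (σ x) n e e') (j : ℕ) :
    gAt ((hσ.Λ ^ j) a).1 x = (gΛ e e' ^ j) (gAt a.1 x) := by
  induction j with
  | zero => rfl
  | succ j ih =>
    rw [pow_succ', pow_succ', Module.End.mul_apply, Module.End.mul_apply, hσ.gAt_Λ _ x h, ih]

theorem gAt_star (hσ : F.IsTransverselySymplectic σ) (a : F.basicForms) (x : M) {e e'}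
    (h : IsDualPair (σ x) n e e') (N p : ℕ) :
    gAt (lefschetzStar hσ.L hσ.Λ N n p a).1 x =
      lefschetzStar (gL (σ x)) (gΛ e e') N n p (gAt a.1 x) := by
  rw [lefschetzStar_apply, lefschetzStar_apply, gAt_sum]
  refine Finset.sum_congr rfl fun j _ => ?_
  rw [Submodule.coe_smul, gAt_smul, gAt_L_pow, hσ.gAt_Λ_pow _ x h]

theorem isLefschetzComplex (hσ : F.IsTransverselySymplectic σ) :
    IsLefschetzComplex n F.basicDegree hσ.L hσ.Λ hσ.d where
  toIsLefschetz := hσ.isLefschetz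
  d_mem {k a} ha := by
    have := hσ.part_d k a
    rw [hσ.part_eq_self ha] at this
    rw [← this]
    exact hσ.part_mem _ _
  d_d a := Subtype.ext (extDer_extDer (hσ.isTransverse a).smooth)
  L_d {k a} _ := Subtype.ext
    (extDer_lefschetzL hσ.smooth hσ.closed (hσ.isTransverse a).smooth).symm
  star_star {p a} ha hp := by
    refine basic_ext fun x => ?_
    obtain ⟨e, e', h⟩ := hσ.exists_isFrame x
    rw [hσ.gAt_star _ x h.dual, hσ.gAt_star _ x h.dual, h.star_star hp (hσ.gAt_mem_gH ha x),
      Submodule.coe_smul, gAt_smul]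

/-- A homogeneous exact form has a homogeneous primitive. -/
theorem isGradedExact (hσ : F.IsTransverselySymplectic σ) {k : ℕ} {a : F.basicForms}
    (ha : a ∈ F.basicDegree k) {β : F.basicForms}
    (h : a = hσ.d β) : IsGradedExact F.basicDegree hσ.d k a := by
  cases k with
  | zero =>
    refine Or.inl (Subtype.ext (funext fun j => ?_))
    cases j with
    | zero => rw [h]; rfl
    | succ j => exact ha (j + 1) (by omega)
  | succ k =>
    refine Or.inr ⟨k, rfl, hσ.part k β, hσ.part_mem _ _, ?_⟩
    rw [← hσ.part_d, ← h, hσ.part_eq_self ha]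

theorem iterate_lefschetzL (hσ : F.IsTransverselySymplectic σ) (a : F.basicForms) (k : ℕ) :
    (lefschetzL σ)^[k] a.1 = ((hσ.L ^ k) a).1 := by
  induction k with
  | zero => rfl
  | succ k ih => rw [Function.iterate_succ_apply', ih, pow_succ', Module.End.mul_apply]; rfl

/-- Translation of the isomorphisms in basic cohomology into a statement about closed and exact
forms. -/
theorem hasHardLefschetz (hσ : F.IsTransverselySymplectic σ) (hL : F.HardLefschetz σ) :
    IsLefschetzComplex.HasHardLefschetz n F.basicDegree hσ.L hσ.d where
  inj {k x} hk hx hdx := by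
    rintro ⟨w, hw⟩
    obtain ⟨j, hj, rfl⟩ : ∃ j ≤ n, k = n - j := ⟨n - k, by omega, by omega⟩
    rw [show n - (n - j) = j by omega] at hw
    obtain ⟨f, hf⟩ := hL j hj
    let α : F.closedBasic (n - j) := ⟨x.1, x.2, congrArg Subtype.val hdx, hx⟩
    obtain ⟨h, h'⟩ := hf α
    have h0 : f (Submodule.Quotient.mk α) = 0 := by
      rw [h', Submodule.Quotient.mk_eq_zero]
      refine ⟨w, ?_⟩
      change extDer w.1 = (lefschetzL σ)^[j] x.1
      rw [hσ.iterate_lefschetzL, hw]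
      rfl
    rw [EmbeddingLike.map_eq_zero_iff, Submodule.Quotient.mk_eq_zero] at h0
    obtain ⟨β, hβ⟩ := h0
    exact hσ.isGradedExact hx (β := β) (Subtype.ext hβ.symm)
  surj {k y} hk hy hdy := by
    obtain ⟨j, hj, rfl⟩ : ∃ j ≤ n, k = n - j := ⟨n - k, by omega, by omega⟩
    rw [show n - (n - j) = j by omega]
    rw [show 2 * n - (n - j) = n + j by omega] at hy ⊢
    obtain ⟨f, hf⟩ := hL j hj
    let y' : F.closedBasic (n + j) := ⟨y.1, y.2, congrArg Subtype.val hdy, hy⟩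
    obtain ⟨c, hc⟩ := f.surjective (Submodule.Quotient.mk y')
    obtain ⟨α, rfl⟩ := Submodule.Quotient.mk_surjective _ c
    obtain ⟨h, h'⟩ := hf α
    rw [h', eq_comm, Submodule.Quotient.eq] at hc
    obtain ⟨β, hβ⟩ := hc
    let x : F.basicForms := ⟨α.1, α.2.1⟩
    have hx : x ∈ F.basicDegree (n - j) := α.2.2.2
    refine ⟨x, hx, Subtype.ext α.2.2.1, hσ.isGradedExact (β := β) ?_ ?_⟩
    · have := hσ.isLefschetz.L_pow_mem hx j
      rw [show n - j + 2 * j = n + j by omega] at this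
      exact sub_mem hy this
    · refine Subtype.ext ?_
      change y.1 - ((hσ.L ^ j) x).1 = extDer β.1
      rw [← hσ.iterate_lefschetzL]
      exact hβ.symm

end Foliation.IsTransverselySymplectic

end BasicComplex

/-! ### The equivariant `dδ`-lemma for families of elements of a Lefschetz complex -/

section EquivariantComplex

variable {X : Type*} [AddCommGroup X] [Module ℝ X]

/-- `part k` is the projection to the summand `H k` of a direct sum decomposition with
`H k = 0` for `k ≥ N`. -/
structure IsGrading (N : ℕ) (H : ℕ → Submodule ℝ X) (part : ℕ → X →ₗ[ℝ] X) : Prop where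
  part_mem : ∀ k x, part k x ∈ H k
  part_self : ∀ {k x}, x ∈ H k → part k x = x
  part_ne : ∀ {j k x}, x ∈ H k → j ≠ k → part j x = 0
  sum_part : ∀ x, ∑ k ∈ Finset.range N, part k x = x

namespace IsGrading

variable {N : ℕ} {H : ℕ → Submodule ℝ X} {part : ℕ → X →ₗ[ℝ] X}

theorem ext (h : IsGrading N H part) {x : X} (hx : ∀ k, part k x = 0) : x = 0 := by
  rw [← h.sum_part x]
  exact Finset.sum_eq_zero fun k _ => hx k

theorem part_of_le (h : IsGrading N H part) {k : ℕ} (hk : N ≤ k) (x : X) : part k x = 0 := by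
  rw [← h.sum_part x, map_sum]
  refine Finset.sum_eq_zero fun j hj => h.part_ne (h.part_mem j x) ?_
  have := Finset.mem_range.mp hj
  omega

/-- A map of degree `1` commutes with the projections. -/
theorem part_up (h : IsGrading N H part) {T : X →ₗ[ℝ] X}
    (hT : ∀ {k x}, x ∈ H k → T x ∈ H (k + 1)) (k : ℕ) (x : X) :
    part (k + 1) (T x) = T (part k x) := by
  by_cases hk : k < N
  · conv_lhs => rw [← h.sum_part x, map_sum, map_sum]
    rw [Finset.sum_eq_single k]
    · exact h.part_self (hT (h.part_mem k x))
    · intro j _ hj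
      exact h.part_ne (hT (h.part_mem j x)) (by omega)
    · intro hk'
      exact absurd (Finset.mem_range.mpr hk) hk'
  · rw [h.part_of_le (by omega), h.part_of_le (by omega), map_zero]

theorem part_zero_up (h : IsGrading N H part) {T : X →ₗ[ℝ] X}
    (hT : ∀ {k x}, x ∈ H k → T x ∈ H (k + 1)) (x : X) : part 0 (T x) = 0 := by
  rw [← h.sum_part x, map_sum, map_sum]
  exact Finset.sum_eq_zero fun j _ => h.part_ne (hT (h.part_mem j x)) (by omega)

/-- A map of degree `-1` commutes with the projections. -/
theorem part_down (h : IsGrading N H part) {T : X →ₗ[ℝ] X}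
    (hT : ∀ {k x}, x ∈ H (k + 1) → T x ∈ H k) (h0 : ∀ {x}, x ∈ H 0 → T x = 0) (k : ℕ) (x : X) :
    part k (T x) = T (part (k + 1) x) := by
  have key : ∀ j, j ≠ k + 1 → part k (T (part j x)) = 0 := by
    intro j hj
    rcases j with _ | j
    · rw [h0 (h.part_mem 0 x), map_zero]
    · exact h.part_ne (hT (h.part_mem (j + 1) x)) (by omega)
  by_cases hk : k + 1 < N
  · conv_lhs => rw [← h.sum_part x, map_sum, map_sum]
    rw [Finset.sum_eq_single (k + 1)]
    · exact h.part_self (hT (h.part_mem (k + 1) x))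
    · exact fun j _ hj => key j hj
    · intro hk'
      exact absurd (Finset.mem_range.mpr hk) hk'
  · rw [h.part_of_le (k := k + 1) (by omega), map_zero, ← h.sum_part x, map_sum, map_sum]
    refine Finset.sum_eq_zero fun j hj => key j ?_
    have := Finset.mem_range.mp hj
    omega

end IsGrading

variable {𝔤 : Type*} {n : ℕ} {H : ℕ → Submodule ℝ X} {L Λ d : X →ₗ[ℝ] X} {part : ℕ → X →ₗ[ℝ] X}
  {ι : 𝔤 → X →ₗ[ℝ] X} {C : Submodule ℝ (𝔤 → X)}

/-- A space `C` of families `α : 𝔤 → X` on which `d - ι` is a differential, in a situation where the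
contractions `ι ξ` anticommute with `δ = [Λ, d]` and map elements annihilated by `δ` to `δ`-exact
ones, and where a family in `C` with values in the image of `d δ` is the image of a family in
`C`. -/
structure IsEquivariantComplex (n : ℕ) (H : ℕ → Submodule ℝ X) (L Λ d : X →ₗ[ℝ] X)
    (part : ℕ → X →ₗ[ℝ] X) (ι : 𝔤 → X →ₗ[ℝ] X) (C : Submodule ℝ (𝔤 → X)) : Prop where
  complex : IsLefschetzComplex n H L Λ d
  hardLefschetz : IsLefschetzComplex.HasHardLefschetz n H L d
  grading : IsGrading (2 * n + 1) H part
  d_mem : ∀ {α}, α ∈ C → (fun ξ => d (α ξ)) ∈ C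
  delta_mem : ∀ {α}, α ∈ C → (fun ξ => lefschetzDelta Λ d (α ξ)) ∈ C
  part_mem : ∀ {α} k, α ∈ C → (fun ξ => part k (α ξ)) ∈ C
  ι_mem : ∀ {α}, α ∈ C → (fun ξ => ι ξ (α ξ)) ∈ C
  ι_deg : ∀ {ξ k x}, x ∈ H (k + 1) → ι ξ x ∈ H k
  ι_low : ∀ {ξ x}, x ∈ H 0 → ι ξ x = 0
  ι_exact : ∀ {ξ x}, lefschetzDelta Λ d x = 0 → ∃ y, ι ξ x = lefschetzDelta Λ d y
  delta_ι : ∀ ξ x, lefschetzDelta Λ d (ι ξ x) = -ι ξ (lefschetzDelta Λ d x)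
  cartan : ∀ {α}, α ∈ C → ∀ ξ, d (ι ξ (α ξ)) + ι ξ (d (α ξ)) = 0
  lift : ∀ {α}, α ∈ C → (∀ ξ, ∃ x, α ξ = d (lefschetzDelta Λ d x)) →
    ∃ β ∈ C, ∀ ξ, α ξ = d (lefschetzDelta Λ d (β ξ))

/-- The equivariant differential `d - ι`. -/
def cartanD (d : X →ₗ[ℝ] X) (ι : 𝔤 → X →ₗ[ℝ] X) : (𝔤 → X) →ₗ[ℝ] 𝔤 → X where
  toFun α ξ := d (α ξ) - ι ξ (α ξ)
  map_add' α β := by funext ξ; simp only [Pi.add_apply, map_add]; abel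
  map_smul' c α := by
    funext ξ; simp only [Pi.smul_apply, map_smul, RingHom.id_apply, smul_sub]

theorem cartanD_apply (d : X →ₗ[ℝ] X) (ι : 𝔤 → X →ₗ[ℝ] X) (α : 𝔤 → X) (ξ : 𝔤) :
    cartanD d ι α ξ = d (α ξ) - ι ξ (α ξ) := rfl

namespace IsEquivariantComplex

/-- The components of degree at least `m` vanish. -/
def LowDegree (part : ℕ → X →ₗ[ℝ] X) (m : ℕ) (α : 𝔤 → X) : Prop := ∀ ξ, ∀ j ≥ m, part j (α ξ) = 0

theorem part_delta (h : IsEquivariantComplex n H L Λ d part ι C) (k : ℕ) (x : X) :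
    part k (lefschetzDelta Λ d x) = lefschetzDelta Λ d (part (k + 1) x) :=
  h.grading.part_down h.complex.isOddPair.b_mem h.complex.isOddPair.b_low k x

theorem part_d (h : IsEquivariantComplex n H L Λ d part ι C) (k : ℕ) (x : X) :
    part (k + 1) (d x) = d (part k x) := h.grading.part_up h.complex.d_mem k x

theorem part_ι (h : IsEquivariantComplex n H L Λ d part ι C) (ξ : 𝔤) (k : ℕ) (x : X) :
    part k (ι ξ x) = ι ξ (part (k + 1) x) := h.grading.part_down h.ι_deg h.ι_low k x

theorem delta_delta (h : IsEquivariantComplex n H L Λ d part ι C) (x : X) :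
    lefschetzDelta Λ d (lefschetzDelta Λ d x) = 0 := by
  refine h.grading.ext fun k => ?_
  rw [h.part_delta, h.part_delta, h.complex.delta_delta (h.grading.part_mem _ x)]

theorem cartanD_mem (h : IsEquivariantComplex n H L Λ d part ι C) {α : 𝔤 → X} (hα : α ∈ C) :
    cartanD d ι α ∈ C := sub_mem (h.d_mem hα) (h.ι_mem hα)

theorem cartanD_cartanD (h : IsEquivariantComplex n H L Λ d part ι C) {α : 𝔤 → X} (hα : α ∈ C)
    (hιι : ∀ ξ x, ι ξ (ι ξ x) = 0) : cartanD d ι (cartanD d ι α) = 0 := by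
  funext ξ
  rw [cartanD_apply, cartanD_apply, map_sub, map_sub, h.complex.d_d, hιι, sub_zero, zero_sub,
    ← neg_add', h.cartan hα, neg_zero]
  rfl

/-- The case of a form which is `δ`-exact at each `ξ`: its top component is `d δ`-exact. -/
theorem eq_cartanD_delta_of_delta (h : IsEquivariantComplex n H L Λ d part ι C)
    (hιι : ∀ ξ x, ι ξ (ι ξ x) = 0) (m : ℕ) :
    ∀ α ∈ C, cartanD d ι α = 0 → (∀ ξ, ∃ y, α ξ = lefschetzDelta Λ d y) → LowDegree part m α →
      ∃ β ∈ C, LowDegree part m β ∧ α = cartanD d ι fun ξ => lefschetzDelta Λ d (β ξ) := by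
  induction m with
  | zero =>
    intro α _ _ _ hlow
    have h0 : α = 0 := funext fun ξ => h.grading.ext fun k => hlow ξ k (Nat.zero_le k)
    refine ⟨0, zero_mem _, fun ξ j _ => map_zero _, ?_⟩
    rw [h0]
    funext ξ
    simp [cartanD_apply]
  | succ m ih =>
    intro α hα hd hex hlow
    -- the top component is closed, because the contractions lower the degree
    have h1 : ∀ ξ, ∃ x, part m (α ξ) = d (lefschetzDelta Λ d x) := by
      intro ξ
      obtain ⟨y, hy⟩ := hex ξ
      have hpd : d (part m (α ξ)) = 0 := by
        have h2 := congrArg (part (m + 1)) (congrFun hd ξ)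
        rw [cartanD_apply, map_sub, h.part_d, h.part_ι, hlow ξ (m + 1 + 1) (by omega), map_zero,
          sub_zero] at h2
        rw [h2]
        exact map_zero _
      rw [hy, h.part_delta] at hpd ⊢
      obtain ⟨β, -, hβ⟩ := h.complex.delta_eq_d_delta h.hardLefschetz (h.grading.part_mem _ y) hpd
      exact ⟨β, hβ⟩
    obtain ⟨β₀, hβ₀, hβ₀'⟩ := h.lift (h.part_mem m hα) h1
    let β : 𝔤 → X := fun ξ => part m (β₀ ξ)
    have hβ : β ∈ C := h.part_mem m hβ₀
    have hβd : ∀ ξ, part m (α ξ) = d (lefschetzDelta Λ d (β ξ)) := by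
      intro ξ
      have h2 := congrArg (part m) (hβ₀' ξ)
      rw [h.grading.part_self (h.grading.part_mem _ _)] at h2
      rw [h2]
      rcases m with _ | m
      · rw [h.grading.part_zero_up h.complex.d_mem,
          h.complex.isOddPair.b_low (h.grading.part_mem 0 _), map_zero]
      · rw [h.part_d, h.part_delta]
    have hβm : ∀ ξ, β ξ ∈ H m := fun ξ => h.grading.part_mem _ _
    have hlowδ : ∀ ξ, ∀ j ≥ m, part j (lefschetzDelta Λ d (β ξ)) = 0 := by
      intro ξ j hj
      rw [h.part_delta, h.grading.part_ne (hβm ξ) (by omega), map_zero]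
    have hdd := h.delta_mem hβ
    obtain ⟨β', hβ', hlow', heq⟩ := ih (α - cartanD d ι fun ξ => lefschetzDelta Λ d (β ξ))
      (sub_mem hα (h.cartanD_mem hdd))
      (by rw [map_sub, hd, h.cartanD_cartanD hdd hιι, sub_zero])
      (fun ξ => by
        obtain ⟨y, hy⟩ := hex ξ
        refine ⟨y + d (β ξ) - ι ξ (β ξ), ?_⟩
        rw [Pi.sub_apply, cartanD_apply, hy, map_sub, map_add, h.delta_ι, h.complex.d_delta]
        abel)
      (fun ξ j hj => by
        rw [Pi.sub_apply, cartanD_apply, map_sub, map_sub, h.part_ι, hlowδ ξ (j + 1) (by omega),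
          map_zero, sub_zero]
        rcases Nat.lt_or_ge m j with hmj | hmj
        · obtain ⟨i, rfl⟩ : ∃ i, j = i + 1 := ⟨j - 1, by omega⟩
          rw [hlow ξ _ (by omega), h.part_d, hlowδ ξ i (by omega), map_zero, sub_zero]
        · obtain rfl : j = m := by omega
          rw [← hβd ξ, h.grading.part_self (h.grading.part_mem _ _), sub_self])
    refine ⟨β + β', add_mem hβ hβ', fun ξ j hj => ?_, ?_⟩
    · rw [Pi.add_apply, map_add, hlow' ξ j (by omega), h.grading.part_ne (hβm ξ) (by omega),
        add_zero]
    · rw [sub_eq_iff_eq_add] at heq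
      rw [heq]
      funext ξ
      simp only [Pi.add_apply, cartanD_apply, map_add]
      abel

/-- The case of a `d_G`-exact form: a primitive is changed by `δ`-exact, `d_G`-closed and
`d_G`-exact families until its top component vanishes. -/
theorem eq_cartanD_delta_of_cartanD (h : IsEquivariantComplex n H L Λ d part ι C)
    (hιι : ∀ ξ x, ι ξ (ι ξ x) = 0) (m : ℕ) :
    ∀ γ ∈ C, (∀ ξ, lefschetzDelta Λ d (cartanD d ι γ ξ) = 0) → LowDegree part m γ →
      ∃ β ∈ C, cartanD d ι γ = cartanD d ι fun ξ => lefschetzDelta Λ d (β ξ) := by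
  induction m with
  | zero =>
    intro γ _ _ hlow
    have h0 : γ = 0 := funext fun ξ => h.grading.ext fun k => hlow ξ k (Nat.zero_le k)
    refine ⟨0, zero_mem _, ?_⟩
    rw [h0]
    funext ξ
    simp [cartanD_apply]
  | succ m ih =>
    intro γ hγ hδ hlow
    -- make the top component of the primitive closed
    have h1 : ∀ ξ, ∃ x, d (part m (γ ξ)) = d (lefschetzDelta Λ d x) := by
      intro ξ
      have h2 := congrArg (part m) (hδ ξ)
      rw [h.part_delta, cartanD_apply, map_sub, h.part_d, h.part_ι, hlow ξ (m + 1 + 1) (by omega),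
        map_zero, sub_zero, map_zero] at h2
      obtain ⟨β, -, hβ⟩ := h.complex.d_eq_d_delta h.hardLefschetz (h.grading.part_mem m (γ ξ)) h2
      exact ⟨β, hβ⟩
    obtain ⟨β₀, hβ₀, hβ₀'⟩ := h.lift (h.d_mem (h.part_mem m hγ)) h1
    let β : 𝔤 → X := fun ξ => part (m + 1) (β₀ ξ)
    have hβ : β ∈ C := h.part_mem (m + 1) hβ₀
    have hβm : ∀ ξ, β ξ ∈ H (m + 1) := fun ξ => h.grading.part_mem _ _
    have hβd : ∀ ξ, d (part m (γ ξ)) = d (lefschetzDelta Λ d (β ξ)) := by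
      intro ξ
      have h2 := congrArg (part (m + 1)) (hβ₀' ξ)
      rwa [h.part_d, h.part_d, h.part_delta,
        h.grading.part_self (h.grading.part_mem _ _)] at h2
    let γ₁ : 𝔤 → X := γ - fun ξ => lefschetzDelta Λ d (β ξ)
    have hγ₁ : γ₁ ∈ C := sub_mem hγ (h.delta_mem hβ)
    have hlow₁ : LowDegree part (m + 1) γ₁ := by
      intro ξ j hj
      change part j (γ ξ - lefschetzDelta Λ d (β ξ)) = 0
      rw [map_sub, hlow ξ j hj, h.part_delta, h.grading.part_ne (hβm ξ) (by omega), map_zero,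
        sub_zero]
    have hcl : ∀ ξ, d (part m (γ₁ ξ)) = 0 := by
      intro ξ
      change d (part m (γ ξ - lefschetzDelta Λ d (β ξ))) = 0
      rw [map_sub, h.part_delta, h.grading.part_self (hβm ξ), map_sub, hβd, sub_self]
    -- the top component is the sum of a harmonic and an exact family
    have h3 : ∀ ξ, ∃ x, lefschetzDelta Λ d (part m (γ₁ ξ)) = d (lefschetzDelta Λ d x) := by
      intro ξ
      obtain ⟨η, -, -, hδη, hex⟩ := h.complex.exists_harmonic h.hardLefschetz
        (h.grading.part_mem m (γ₁ ξ)) (hcl ξ)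
      rcases hex with hex | ⟨i, -, y, -, hy⟩
      · refine ⟨0, ?_⟩
        rw [sub_eq_zero.mp hex, hδη, map_zero, map_zero]
      · refine ⟨-y, ?_⟩
        rw [sub_eq_iff_eq_add.mp hy, map_add, hδη, add_zero, map_neg, map_neg, h.complex.d_delta,
          neg_neg]
    obtain ⟨θ, hθ, hθd, hθm⟩ : ∃ θ ∈ C, (∀ ξ, lefschetzDelta Λ d (part m (γ₁ ξ)) =
        lefschetzDelta Λ d (part m (d (θ ξ)))) ∧ ∀ ξ j, j + 1 ≠ m → part j (θ ξ) = 0 := by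
      rcases m with _ | m
      · refine ⟨0, zero_mem _, fun ξ => ?_, fun ξ j _ => map_zero _⟩
        rw [h.complex.isOddPair.b_low (h.grading.part_mem 0 _),
          h.complex.isOddPair.b_low (h.grading.part_mem 0 _)]
      · obtain ⟨θ₀, hθ₀, hθ₀'⟩ := h.lift (h.delta_mem (h.part_mem (m + 1) hγ₁)) h3
        refine ⟨fun ξ => -part m (θ₀ ξ), neg_mem (h.part_mem m hθ₀), fun ξ => ?_, fun ξ j hj => ?_⟩
        · have h4 := congrArg (part m) (hθ₀' ξ)
          rw [h.part_delta, h.grading.part_self (h.grading.part_mem _ _), h.complex.d_delta,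
            map_neg, h.part_delta, h.part_d] at h4
          rw [h4, h.part_d, map_neg, h.grading.part_self (h.grading.part_mem _ _), map_neg, map_neg]
        · rw [map_neg, h.grading.part_ne (h.grading.part_mem m _) (by omega), neg_zero]
    let η : 𝔤 → X := fun ξ => part m (γ₁ ξ) - part m (d (θ ξ))
    have hη : η ∈ C := sub_mem (h.part_mem m hγ₁) (h.part_mem m (h.d_mem hθ))
    have hηm : ∀ ξ, η ξ ∈ H m := fun ξ => sub_mem (h.grading.part_mem _ _) (h.grading.part_mem _ _)
    have hdη : ∀ ξ, d (η ξ) = 0 := by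
      intro ξ
      change d (part m (γ₁ ξ) - part m (d (θ ξ))) = 0
      rw [map_sub, hcl, ← h.part_d, h.complex.d_d, map_zero, sub_zero]
    have hδη : ∀ ξ, lefschetzDelta Λ d (η ξ) = 0 := by
      intro ξ
      change lefschetzDelta Λ d (part m (γ₁ ξ) - part m (d (θ ξ))) = 0
      rw [map_sub, hθd, sub_self]
    -- `d_G η = -ι η` is `δ`-exact because `η` is annihilated by `δ`
    obtain ⟨β', hβ', hlow', heq'⟩ := h.eq_cartanD_delta_of_delta hιι m (cartanD d ι η)
      (h.cartanD_mem hη) (h.cartanD_cartanD hη hιι)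
      (fun ξ => by
        obtain ⟨y, hy⟩ := h.ι_exact (ξ := ξ) (hδη ξ)
        exact ⟨-y, by rw [cartanD_apply, hdη, hy, map_neg, zero_sub]⟩)
      (fun ξ j hj => by
        rw [cartanD_apply, hdη, zero_sub, map_neg, h.part_ι, h.grading.part_ne (hηm ξ) (by omega),
          map_zero, neg_zero])
    let γ₂ : 𝔤 → X := γ₁ - η + (fun ξ => lefschetzDelta Λ d (β' ξ)) - cartanD d ι θ
    have hγ₂ : γ₂ ∈ C :=
      sub_mem (add_mem (sub_mem hγ₁ hη) (h.delta_mem hβ')) (h.cartanD_mem hθ)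
    have hcd : cartanD d ι γ₂ = cartanD d ι γ - cartanD d ι fun ξ => lefschetzDelta Λ d (β ξ) := by
      simp only [γ₂, γ₁, map_sub, map_add, ← heq', h.cartanD_cartanD hθ hιι]
      abel
    obtain ⟨β'', hβ'', heq''⟩ := ih γ₂ hγ₂
      (fun ξ => by
        rw [hcd, Pi.sub_apply, map_sub, hδ, cartanD_apply, map_sub, h.delta_ι, h.delta_delta,
          map_zero, neg_zero, sub_zero, h.complex.d_delta, map_neg, h.delta_delta]
        simp)
      (fun ξ j hj => by
        change part j (γ₁ ξ - η ξ + lefschetzDelta Λ d (β' ξ) - (d (θ ξ) - ι ξ (θ ξ))) = 0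
        have hθι : part j (ι ξ (θ ξ)) = 0 := by
          rw [h.part_ι, hθm ξ (j + 1) (by omega), map_zero]
        have hη' : part j (η ξ) = part j (part m (γ₁ ξ)) - part j (part m (d (θ ξ))) :=
          map_sub _ _ _
        rw [map_sub, map_add, map_sub, hη', map_sub _ (d (θ ξ)) (ι ξ (θ ξ)), hθι, h.part_delta,
          hlow' ξ (j + 1) (by omega), map_zero, add_zero, sub_zero]
        rcases Nat.lt_or_ge m j with hmj | hmj
        · have hθj : part j (d (θ ξ)) = 0 := by
            obtain ⟨i, rfl⟩ : ∃ i, j = i + 1 := ⟨j - 1, by omega⟩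
            rw [h.part_d, hθm ξ i (by omega), map_zero]
          rw [hlow₁ ξ j hmj, h.grading.part_ne (h.grading.part_mem m _) hmj.ne',
            h.grading.part_ne (h.grading.part_mem m (d (θ ξ))) hmj.ne', hθj]
          simp
        · obtain rfl : j = m := by omega
          rw [h.grading.part_self (h.grading.part_mem _ _),
            h.grading.part_self (h.grading.part_mem _ _)]
          abel)
    refine ⟨β + β'', add_mem hβ hβ'', ?_⟩
    rw [hcd, sub_eq_iff_eq_add] at heq''
    rw [heq'']
    funext ξ
    simp only [Pi.add_apply, cartanD_apply, map_add]
    abel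

/-- The equivariant `dδ`-lemma. -/
theorem exists_eq_cartanD_delta (h : IsEquivariantComplex n H L Λ d part ι C)
    (hιι : ∀ ξ x, ι ξ (ι ξ x) = 0) {α : 𝔤 → X} (hα : α ∈ C) (hd : cartanD d ι α = 0)
    (hδ : ∀ ξ, lefschetzDelta Λ d (α ξ) = 0)
    (hex : (∃ γ ∈ C, α = cartanD d ι γ) ∨ ∀ ξ, ∃ y, α ξ = lefschetzDelta Λ d y) :
    ∃ β ∈ C, α = cartanD d ι fun ξ => lefschetzDelta Λ d (β ξ) := by
  have hlow : ∀ γ : 𝔤 → X, LowDegree part (2 * n + 1) γ := fun γ ξ j hj =>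
    h.grading.part_of_le hj _
  rcases hex with ⟨γ, hγ, rfl⟩ | hex
  · exact h.eq_cartanD_delta_of_cartanD hιι _ γ hγ hδ (hlow γ)
  · obtain ⟨β, hβ, -, heq⟩ := h.eq_cartanD_delta_of_delta hιι _ α hα hd hex (hlow α)
    exact ⟨β, hβ, heq⟩

end IsEquivariantComplex

end EquivariantComplex

/-! ### The symplectic codifferential and contractions on basic forms -/

section BasicOperators

variable {E : Type*} [NormedAddCommGroup E] [NormedSpace ℝ E] [FiniteDimensional ℝ E]
  {M : Type*} [TopologicalSpace M] [ChartedSpace E M] [IsManifold 𝓘(ℝ, E) ∞ M] [T2Space M] {n : ℕ}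
  {F : Foliation E M (2 * n)} {σ : KForm E M 2}

/-- `f` is a Hamiltonian function of the vector field `X`: `df = ι(X)σ`. -/
structure IsHamiltonianFunction (σ : KForm E M 2) (f : M → ℝ) (X : VField E M) : Prop where
  smooth : ContMDiff 𝓘(ℝ, E) 𝓘(ℝ, ℝ) ∞ f
  mfderiv_eq : ∀ x v, (mfderiv 𝓘(ℝ, E) 𝓘(ℝ, ℝ) f x v : ℝ) = σ x ![X x, v]

/-- The signs in `δ = ±⋆d⋆` cancel those relating `⋆` to `lefschetzStar`. -/
theorem even_choose_two_add {n : ℕ} : ∀ {k m : ℕ}, m + k = 2 * n →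
    Even (m.choose 2 + (k + 1).choose 2 + n)
  | 0, m, h => by
    obtain rfl : m = 2 * n := h
    induction n with
    | zero => simp
    | succ n ih =>
      have h1 : (2 * (n + 1)).choose 2 = 2 * n + ((2 * n).choose 1 + (2 * n).choose 2) + 1 := by
        rw [show 2 * (n + 1) = (2 * n + 1) + 1 by ring, Nat.choose_succ_succ' _ 1,
          Nat.choose_succ_succ' _ 1, Nat.choose_one_right]
        ring
      rw [Nat.choose_one_right] at h1
      rw [h1]
      rw [Nat.even_iff] at ih ⊢
      simp only [zero_add] at ih ⊢
      omega
  | k + 1, m, h => by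
    have ih := even_choose_two_add (n := n) (k := k) (m := m + 1) (by omega)
    have h1 : (m + 1).choose 2 = m + m.choose 2 := by
      rw [Nat.choose_succ_succ' _ 1, Nat.choose_one_right]
    have h2 : (k + 1 + 1).choose 2 = (k + 1) + (k + 1).choose 2 := by
      rw [Nat.choose_succ_succ' _ 1, Nat.choose_one_right]
    rw [Nat.even_iff] at ih ⊢
    omega

namespace Foliation.IsTransverselySymplectic

theorem part_of_ne (hσ : F.IsTransverselySymplectic σ) {j k : ℕ} {a : F.basicForms}
    (ha : a ∈ F.basicDegree k) (hj : j ≠ k) : hσ.part j a = 0 :=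
  Subtype.ext <| funext fun i => by
    by_cases hi : i = j
    · subst hi
      exact (degreePart_same i a.1).trans (ha i hj)
    · exact degreePart_of_ne hi _

theorem isGrading (hσ : F.IsTransverselySymplectic σ) :
    IsGrading (2 * n + 1) F.basicDegree hσ.part where
  part_mem := hσ.part_mem
  part_self := hσ.part_eq_self
  part_ne := hσ.part_of_ne
  sum_part a := by
    refine basic_ext fun x => ?_
    rw [gAt_sum]
    funext j
    rw [Finset.sum_apply]
    rcases Nat.lt_or_ge j (2 * n + 1) with hj | hj
    · rw [Finset.sum_eq_single j]
      · exact congrFun (degreePart_same j a.1) x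
      · exact fun i _ hi => congrFun (degreePart_of_ne hi.symm a.1) x
      · exact fun h => absurd (Finset.mem_range.mpr hj) h
    · rw [Finset.sum_eq_zero]
      · have h1 := hσ.isLefschetz.top (by omega) (hσ.part_mem j a)
        have h2 := congrFun (congrArg Subtype.val h1) j
        rw [hσ.part_val, degreePart_same] at h2
        exact (congrFun h2 x).symm
      · intro i hi
        have := Finset.mem_range.mp hi
        exact congrFun (degreePart_of_ne (by omega) a.1) x

/-- The symplectic Hodge star on basic forms. -/
noncomputable def star (hσ : F.IsTransverselySymplectic σ) : F.basicForms →ₗ[ℝ] F.basicForms :=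
  ∑ p ∈ Finset.range (2 * n + 1),
    ((-1 : ℝ) ^ (p.choose 2)) • lefschetzStar hσ.L hσ.Λ (n + 1) n p ∘ₗ hσ.part p

/-- The star exchanges the degrees `p` and `2n - p`. -/
theorem part_star (hσ : F.IsTransverselySymplectic σ) {p q : ℕ} (h : p + q = 2 * n)
    (a : F.basicForms) : hσ.part q (hσ.star a) =
      (-1 : ℝ) ^ (p.choose 2) • lefschetzStar hσ.L hσ.Λ (n + 1) n p (hσ.part p a) := by
  rw [star, LinearMap.sum_apply, map_sum, Finset.sum_eq_single p]
  · rw [LinearMap.smul_apply, map_smul, LinearMap.comp_apply]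
    congr 1
    apply hσ.part_eq_self
    have h1 := hσ.isLefschetz.star_mem (hσ.part_mem p a)
    rwa [show 2 * n - p = q by omega] at h1
  · intro j hj hjp
    have := Finset.mem_range.mp hj
    rw [LinearMap.smul_apply, map_smul, LinearMap.comp_apply,
      hσ.part_of_ne (hσ.isLefschetz.star_mem (hσ.part_mem j a)) (by omega), smul_zero]
  · intro hp
    exact absurd (Finset.mem_range.mpr (by omega)) hp

/-- The operator `star` is the pointwise symplectic Hodge star. -/
theorem star_val (hσ : F.IsTransverselySymplectic σ) (a : F.basicForms) :
    (hσ.star a).1 = hodgeStar n σ a.1 := by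
  funext q x
  by_cases hq : q ≤ 2 * n
  · have h1 := hσ.part_star (Nat.sub_add_cancel hq) a
    have h2 := congrFun (congrFun (congrArg Subtype.val h1) q) x
    rw [hσ.part_val, degreePart_same] at h2
    rw [hodgeStar, dif_pos hq, h2]
    obtain ⟨e, e', h⟩ := hσ.exists_isFrame x
    have h3 : IsHorizontal (σ x) (2 * n - q) (a.1 (2 * n - q) x) :=
      mem_gHor_iff.mp ((hσ.isTransverse a).hor x) (2 * n - q)
    rw [h.symplecticStar_eq ((hσ.hasRank x).isFrame) (Nat.sub_add_cancel hq) h3]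
    have h4 := hσ.gAt_star (hσ.part (2 * n - q) a) x h.dual (n + 1) (2 * n - q)
    have h5 : gAt (hσ.part (2 * n - q) a).1 x = gsingle (a.1 (2 * n - q) x) := by
      rw [← gsingle_apply_self (hσ.gAt_mem_gH (hσ.part_mem (2 * n - q) a) x)]
      congr 1
      exact congrFun (degreePart_same (2 * n - q) a.1) x
    rw [h5] at h4
    exact congrArg (fun b => (-1 : ℝ) ^ ((2 * n - q).choose 2) • b) (congrFun h4 q)
  · have h1 := hσ.isGrading.part_of_le (k := q) (by omega) (hσ.star a)
    have h2 := congrFun (congrFun (congrArg Subtype.val h1) q) x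
    rw [hσ.part_val, degreePart_same] at h2
    rw [hodgeStar, dif_neg hq, h2]
    rfl

/-- The codifferential `±⋆d⋆` is the commutator of `Λ` and `d`. -/
theorem delta_val (hσ : F.IsTransverselySymplectic σ) (a : F.basicForms) :
    (lefschetzDelta hσ.Λ hσ.d a).1 = symplecticDelta n σ a.1 := by
  have hc := hσ.isLefschetzComplex
  funext k
  rw [symplecticDelta, ← hσ.star_val, ← hσ.d_val, ← hσ.star_val]
  have h0 : ∀ b : F.basicForms, b.1 k = (hσ.part k b).1 k := fun b =>
    (degreePart_same k b.1).symm
  rw [h0 (lefschetzDelta hσ.Λ hσ.d a)]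
  refine Eq.trans ?_ (congrArg (fun b => (-1 : ℝ) ^ (k + 1 + 1) • b)
    (h0 (hσ.star (hσ.d (hσ.star a))))).symm
  suffices h : hσ.part k (lefschetzDelta hσ.Λ hσ.d a) =
      (-1 : ℝ) ^ (k + 1 + 1) • hσ.part k (hσ.star (hσ.d (hσ.star a))) from
    congrFun (congrArg Subtype.val h) k
  have hδ : hσ.part k (lefschetzDelta hσ.Λ hσ.d a) =
      lefschetzDelta hσ.Λ hσ.d (hσ.part (k + 1) a) :=
    hσ.isGrading.part_down hc.isOddPair.b_mem hc.isOddPair.b_low k a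
  rcases Nat.lt_or_ge k (2 * n) with hk | hk
  · obtain ⟨j, hj⟩ : ∃ j, j + 1 + k = 2 * n := ⟨2 * n - k - 1, by omega⟩
    rw [hσ.part_star hj, hσ.part_d, hσ.part_star (show k + 1 + j = 2 * n by omega), map_smul,
      ← hc.star_delta (hσ.part_mem (k + 1) a), map_smul, ← hδ,
      show j + 1 = 2 * n - k by omega,
      hc.star_star (hσ.part_mem k _) hk.le, smul_smul, smul_smul, smul_smul]
    have h1 := even_choose_two_add (n := n) (k := k) (m := 2 * n - k) (by omega)
    rw [← pow_add, ← pow_add, ← pow_add, Even.neg_one_pow, one_smul]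
    rw [Nat.even_iff] at h1 ⊢
    omega
  · have h1 : hσ.part k (hσ.star (hσ.d (hσ.star a))) = 0 := by
      rcases hk.eq_or_lt with rfl | hk
      · rw [hσ.part_star (zero_add _), hσ.isGrading.part_zero_up hc.d_mem, map_zero, smul_zero]
      · exact hσ.isGrading.part_of_le hk _
    rw [h1, hδ, hσ.isGrading.part_of_le (by omega), map_zero, smul_zero]

/-- Multiplication by a Hamiltonian function. -/
noncomputable def mul (hσ : F.IsTransverselySymplectic σ) {f : M → ℝ} {X : VField E M}
    (h : IsHamiltonianFunction σ f X) : F.basicForms →ₗ[ℝ] F.basicForms where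
  toFun a := ⟨fun k x => f x • a.1 k x,
    (mem_basicForms_iff hσ).mpr ((hσ.isTransverse a).smul h.smooth h.mfderiv_eq).1⟩
  map_add' a b := Subtype.ext <| funext fun k => funext fun x => smul_add (f x) (a.1 k x) (b.1 k x)
  map_smul' c a := Subtype.ext <| funext fun k => funext fun x => smul_comm (f x) c (a.1 k x)

theorem gAt_mul (hσ : F.IsTransverselySymplectic σ) {f : M → ℝ} {X : VField E M}
    (h : IsHamiltonianFunction σ f X) (a : F.basicForms) (x : M) :
    gAt (hσ.mul h a).1 x = f x • gAt a.1 x := rfl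

theorem gAt_d_mul (hσ : F.IsTransverselySymplectic σ) {f : M → ℝ} {X : VField E M}
    (h : IsHamiltonianFunction σ f X) (a : F.basicForms) (x : M) :
    gAt (hσ.d (hσ.mul h a)).1 x =
      gε (flat (σ x) (X x)) (gAt a.1 x) + f x • gAt (hσ.d a).1 x :=
  ((hσ.isTransverse a).smul h.smooth h.mfderiv_eq).2 x

/-- The contraction with a vector field which has a Hamiltonian function `f`, defined as the
commutator of multiplication by `f` with `δ`. This definition shows at once that it preserves basic
forms and how it interacts with `δ`. -/
noncomputable def contraction (hσ : F.IsTransverselySymplectic σ) {f : M → ℝ} {X : VField E M}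
    (h : IsHamiltonianFunction σ f X) : F.basicForms →ₗ[ℝ] F.basicForms :=
  hσ.mul h ∘ₗ lefschetzDelta hσ.Λ hσ.d - lefschetzDelta hσ.Λ hσ.d ∘ₗ hσ.mul h

/-- In the commutator of `f` with `δ = [Λ, d]` only `[Λ, df ∧ ·] = -ι(X)` survives, because `Λ` is
linear over functions. -/
theorem contraction_val (hσ : F.IsTransverselySymplectic σ) {f : M → ℝ} {X : VField E M}
    (h : IsHamiltonianFunction σ f X) (a : F.basicForms) :
    (hσ.contraction h a).1 = interior' X a.1 := by
  refine mform_ext fun x => ?_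
  obtain ⟨e, e', hf⟩ := hσ.exists_isFrame x
  have hΛ : hσ.Λ (hσ.mul h a) = hσ.mul h (hσ.Λ a) := by
    refine basic_ext fun y => ?_
    obtain ⟨e, e', hf⟩ := hσ.exists_isFrame y
    rw [hσ.gAt_Λ _ y hf.dual, gAt_mul, gAt_mul, hσ.gAt_Λ _ y hf.dual, map_smul]
  have hsub : ∀ b c : F.basicForms, gAt (b - c).1 x = gAt b.1 x - gAt c.1 x := fun _ _ => rfl
  have h1 := hf.gΛ_gε (X x) ((hσ.isTransverse a).hor x)
  rw [contraction, LinearMap.sub_apply, LinearMap.comp_apply, LinearMap.comp_apply,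
    lefschetzDelta_apply, lefschetzDelta_apply, hΛ, hsub, hsub, gAt_mul, hsub, gAt_d_mul,
    hσ.gAt_Λ _ x hf.dual, hσ.gAt_Λ _ x hf.dual, gAt_d_mul, map_add, map_smul, h1,
    hσ.gAt_Λ _ x hf.dual, gAt_interior']
  rw [smul_sub]
  abel

theorem delta_delta (hσ : F.IsTransverselySymplectic σ) (a : F.basicForms) :
    lefschetzDelta hσ.Λ hσ.d (lefschetzDelta hσ.Λ hσ.d a) = 0 := by
  have hc := hσ.isLefschetzComplex
  have h1 := hσ.isGrading.part_down hc.isOddPair.b_mem hc.isOddPair.b_low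
  refine hσ.isGrading.ext fun k => ?_
  rw [h1, h1, hc.delta_delta (hσ.part_mem _ a)]

theorem delta_contraction (hσ : F.IsTransverselySymplectic σ) {f : M → ℝ} {X : VField E M}
    (h : IsHamiltonianFunction σ f X) (a : F.basicForms) :
    lefschetzDelta hσ.Λ hσ.d (hσ.contraction h a) =
      -hσ.contraction h (lefschetzDelta hσ.Λ hσ.d a) := by
  simp only [contraction, LinearMap.sub_apply, LinearMap.comp_apply, map_sub, hσ.delta_delta,
    map_zero]
  abel

/-- The commutator formula shows that contraction maps `δ`-closed forms to `δ`-exact ones. -/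
theorem exists_contraction_eq_delta (hσ : F.IsTransverselySymplectic σ) {f : M → ℝ}
    {X : VField E M} (h : IsHamiltonianFunction σ f X) {a : F.basicForms}
    (ha : lefschetzDelta hσ.Λ hσ.d a = 0) :
    ∃ b, hσ.contraction h a = lefschetzDelta hσ.Λ hσ.d b := by
  refine ⟨-hσ.mul h a, ?_⟩
  simp only [contraction, LinearMap.sub_apply, LinearMap.comp_apply, ha, map_zero, zero_sub,
    map_neg]

theorem contraction_mem (hσ : F.IsTransverselySymplectic σ) {f : M → ℝ} {X : VField E M}
    (h : IsHamiltonianFunction σ f X) {k : ℕ} {a : F.basicForms}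
    (ha : a ∈ F.basicDegree (k + 1)) : hσ.contraction h a ∈ F.basicDegree k := by
  intro j hj
  rw [contraction_val]
  funext x
  exact congrArg (contract (X x)) (congrFun (ha (j + 1) (by omega)) x)

theorem contraction_eq_zero (hσ : F.IsTransverselySymplectic σ) {f : M → ℝ} {X : VField E M}
    (h : IsHamiltonianFunction σ f X) {a : F.basicForms} (ha : a ∈ F.basicDegree 0) :
    hσ.contraction h a = 0 := by
  refine Subtype.ext ?_
  rw [contraction_val]
  funext j x
  exact congrArg (contract (X x)) (congrFun (ha (j + 1) (by omega)) x)

theorem contraction_contraction (hσ : F.IsTransverselySymplectic σ) {f : M → ℝ} {X : VField E M}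
    (h : IsHamiltonianFunction σ f X) (a : F.basicForms) :
    hσ.contraction h (hσ.contraction h a) = 0 := by
  refine basic_ext fun x => ?_
  rw [contraction_val, gAt_interior', contraction_val, gAt_interior']
  exact gι_self _ _

end Foliation.IsTransverselySymplectic

end BasicOperators

/-! ### Pull-backs of basic forms -/

section Pullback

variable {E : Type*} [NormedAddCommGroup E] [NormedSpace ℝ E] [FiniteDimensional ℝ E]
  {M : Type*} [TopologicalSpace M] [ChartedSpace E M] [IsManifold 𝓘(ℝ, E) ∞ M]
  {E' : Type*} [NormedAddCommGroup E'] [NormedSpace ℝ E']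

theorem gAt_pullbackForm (f : M → M) (α : MForm E M) (x : M) :
    gAt (pullbackForm f α) x = gpull (mfderiv 𝓘(ℝ, E) 𝓘(ℝ, E) f x) (gAt α (f x)) := rfl

theorem gLoc_pullbackForm {f : M → M} (hf : ContMDiff 𝓘(ℝ, E) 𝓘(ℝ, E) ∞ f) (α : MForm E M)
    {ψ : E' → M} {y : E'} (h : SmoothNear E ψ y) :
    gLoc ψ (pullbackForm f α) y = gLoc (fun z => f (ψ z)) α y := by
  have h1 : mfderiv 𝓘(ℝ, E') 𝓘(ℝ, E) (fun z => f (ψ z)) y =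
      (mfderiv 𝓘(ℝ, E) 𝓘(ℝ, E) f (ψ y)).comp (mfderiv 𝓘(ℝ, E') 𝓘(ℝ, E) ψ y) :=
    mfderiv_comp y (hf.mdifferentiable (by simp) _) (h.self_of_nhds.mdifferentiableAt (by simp))
  rw [gLoc_eq, gAt_pullbackForm, gpull_comp, gLoc_eq, h1]

theorem SmoothNear.comp {f : M → M} (hf : ContMDiff 𝓘(ℝ, E) 𝓘(ℝ, E) ∞ f) {ψ : E' → M} {y : E'}
    (h : SmoothNear E ψ y) : SmoothNear E (fun z => f (ψ z)) y :=
  h.mono fun z hz => hf.contMDiffAt.comp z hz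

theorem pullbackForm_mem_smoothForms {f : M → M} (hf : ContMDiff 𝓘(ℝ, E) 𝓘(ℝ, E) ∞ f)
    {α : MForm E M} (hα : α ∈ smoothForms E M) : pullbackForm f α ∈ smoothForms E M := by
  refine mem_smoothForms_of_contDiffAt fun x k => ?_
  refine (contDiffAt_gLoc hα ((smoothNear_chartAt x).comp hf) k).congr_of_eventuallyEq ?_
  filter_upwards [(chartAt E x).open_target.mem_nhds (mem_chart_target E x)] with z hz
  exact congrFun (gLoc_pullbackForm hf α (smoothNear_chart_symm x hz)) k

theorem extDer_pullbackForm {f : M → M} (hf : ContMDiff 𝓘(ℝ, E) 𝓘(ℝ, E) ∞ f)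
    {α : MForm E M} (hα : α ∈ smoothForms E M) :
    extDer (pullbackForm f α) = pullbackForm f (extDer α) := by
  refine mform_ext fun x => gAt_eq_of_chart ?_
  have hx := smoothNear_chartAt (E := E) x
  rw [gLoc_extDer (pullbackForm_mem_smoothForms hf hα) hx, gLoc_pullbackForm hf _ hx,
    gLoc_extDer hα (hx.comp hf)]
  funext k
  cases k with
  | zero => rfl
  | succ k =>
    refine Filter.EventuallyEq.extDeriv_eq ?_
    filter_upwards [(chartAt E x).open_target.mem_nhds (mem_chart_target E x)] with z hz
    exact congrFun (gLoc_pullbackForm hf α (smoothNear_chart_symm x hz)) k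

/-- A smooth map with surjective derivatives which preserves the 2-form `σ`. -/
structure IsSymplecticMap (σ : KForm E M 2) (f : M → M) : Prop where
  smooth : ContMDiff 𝓘(ℝ, E) 𝓘(ℝ, E) ∞ f
  surjective : ∀ x, Function.Surjective (mfderiv 𝓘(ℝ, E) 𝓘(ℝ, E) f x)
  comp_eq : ∀ x, (σ (f x)).compContinuousLinearMap (mfderiv 𝓘(ℝ, E) 𝓘(ℝ, E) f x) = σ x

variable {n : ℕ} {σ : KForm E M 2}

theorem IsTransverse.pullbackForm {f : M → M} (hf : IsSymplecticMap σ f) {α : MForm E M}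
    (hα : IsTransverse σ α) : IsTransverse σ (pullbackForm f α) where
  smooth := pullbackForm_mem_smoothForms hf.smooth hα.smooth
  hor x := by
    rw [gAt_pullbackForm, ← hf.comp_eq x, gpull_mem_gHor (hf.surjective x)]
    exact hα.hor _
  dhor x := by
    rw [extDer_pullbackForm hf.smooth hα.smooth, gAt_pullbackForm, ← hf.comp_eq x,
      gpull_mem_gHor (hf.surjective x)]
    exact hα.dhor _

namespace Foliation.IsTransverselySymplectic

variable [T2Space M] {F : Foliation E M (2 * n)} {f : M → M}

/-- The pull-back of basic forms along a map preserving `σ`. -/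
noncomputable def pull (hσ : F.IsTransverselySymplectic σ) (hf : IsSymplecticMap σ f) :
    F.basicForms →ₗ[ℝ] F.basicForms where
  toFun a := ⟨pullbackForm f a.1, (mem_basicForms_iff hσ).mpr ((hσ.isTransverse a).pullbackForm hf)⟩
  map_add' _ _ := rfl
  map_smul' _ _ := rfl

theorem gAt_pull (hσ : F.IsTransverselySymplectic σ) (hf : IsSymplecticMap σ f) (a : F.basicForms)
    (x : M) :
    gAt (hσ.pull hf a).1 x = gpull (mfderiv 𝓘(ℝ, E) 𝓘(ℝ, E) f x) (gAt a.1 (f x)) := rfl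

theorem pull_d (hσ : F.IsTransverselySymplectic σ) (hf : IsSymplecticMap σ f) (a : F.basicForms) :
    hσ.pull hf (hσ.d a) = hσ.d (hσ.pull hf a) :=
  Subtype.ext (extDer_pullbackForm hf.smooth (hσ.isTransverse a).smooth).symm

/-- A map preserving `σ` takes dual pairs to dual pairs, so pulling back commutes with `Λ`. -/
theorem pull_Λ (hσ : F.IsTransverselySymplectic σ) (hf : IsSymplecticMap σ f) (a : F.basicForms) :
    hσ.pull hf (hσ.Λ a) = hσ.Λ (hσ.pull hf a) := by
  refine basic_ext fun x => ?_
  obtain ⟨e, e', h⟩ := hσ.exists_isFrame x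
  have h1 := h.dual
  rw [← hf.comp_eq x, isDualPair_comp] at h1
  rw [hσ.gAt_Λ _ x h.dual, gAt_pull, gAt_pull, hσ.gAt_Λ _ (f x) h1, gpull_gΛ]

theorem pull_delta (hσ : F.IsTransverselySymplectic σ) (hf : IsSymplecticMap σ f)
    (a : F.basicForms) : hσ.pull hf (lefschetzDelta hσ.Λ hσ.d a) =
      lefschetzDelta hσ.Λ hσ.d (hσ.pull hf a) := by
  rw [lefschetzDelta_apply, lefschetzDelta_apply, map_sub, pull_Λ, pull_d, pull_d, pull_Λ]

theorem pull_part (hσ : F.IsTransverselySymplectic σ) (hf : IsSymplecticMap σ f) (k : ℕ)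
    (a : F.basicForms) : hσ.pull hf (hσ.part k a) = hσ.part k (hσ.pull hf a) := by
  refine Subtype.ext (funext fun j => ?_)
  change (fun x => (degreePart k a.1 j (f x)).compContinuousLinearMap _) = degreePart k _ j
  by_cases hj : j = k
  · subst hj
    rw [degreePart_same, degreePart_same]
    rfl
  · rw [degreePart_of_ne hj, degreePart_of_ne hj]
    rfl

end Foliation.IsTransverselySymplectic

end Pullback

/-! ### Polynomial families -/

section PolyFamilies

variable {𝔤 : Type*} [AddCommGroup 𝔤] [Module ℝ 𝔤] {X : Type*} [AddCommGroup X] [Module ℝ X]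

variable (𝔤 X) in
/-- The polynomial maps from `𝔤` to `X`, that is, the image of `S(𝔤*) ⊗ X`. -/
def polyFamilies : Submodule ℝ (𝔤 → X) :=
  Submodule.span ℝ {α | ∃ p ∈ polyFunctions 𝔤, ∃ b : X, α = fun ξ => p ξ • b}

theorem smul_mem_polyFamilies {p : 𝔤 → ℝ} (hp : p ∈ polyFunctions 𝔤) (b : X) :
    (fun ξ => p ξ • b) ∈ polyFamilies 𝔤 X := Submodule.subset_span ⟨p, hp, b, rfl⟩

theorem polyFamilies_induction {P : (𝔤 → X) → Prop} {α : 𝔤 → X} (hα : α ∈ polyFamilies 𝔤 X)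
    (smul : ∀ p ∈ polyFunctions 𝔤, ∀ b, P fun ξ => p ξ • b)
    (add : ∀ α β, P α → P β → P (α + β)) : P α := by
  suffices h : ∀ c : ℝ, P (c • α) by simpa using h 1
  refine Submodule.span_induction (p := fun α _ => ∀ c : ℝ, P (c • α)) ?_ ?_ ?_ ?_ hα
  · rintro _ ⟨p, hp, b, rfl⟩ c
    have := smul (c • p) (Subalgebra.smul_mem _ hp c) b
    convert this using 1
    funext ξ
    simp [smul_smul]
  · intro c
    have := smul 0 (zero_mem _) 0
    convert this using 1
    funext ξ
    simp
  · intro α β _ _ h1 h2 c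
    rw [smul_add]
    exact add _ _ (h1 c) (h2 c)
  · intro a α _ h c
    rw [smul_smul]
    exact h _

theorem map_mem_polyFamilies {α : 𝔤 → X} (hα : α ∈ polyFamilies 𝔤 X) {Y : Type*} [AddCommGroup Y]
    [Module ℝ Y] (T : X →ₗ[ℝ] Y) : (fun ξ => T (α ξ)) ∈ polyFamilies 𝔤 Y := by
  refine polyFamilies_induction (P := fun α => (fun ξ => T (α ξ)) ∈ polyFamilies 𝔤 Y) hα ?_ ?_
  · intro p hp b
    simp only [map_smul]
    exact smul_mem_polyFamilies hp _
  · intro α β h1 h2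
    simp only [Pi.add_apply, map_add]
    exact add_mem h1 h2

/-- A family of linear maps which depends linearly on `ξ` acts on polynomial families. -/
theorem apply_mem_polyFamilies [FiniteDimensional ℝ 𝔤] {α : 𝔤 → X} (hα : α ∈ polyFamilies 𝔤 X)
    (T : 𝔤 →ₗ[ℝ] X →ₗ[ℝ] X) : (fun ξ => T ξ (α ξ)) ∈ polyFamilies 𝔤 X := by
  refine polyFamilies_induction (P := fun α => (fun ξ => T ξ (α ξ)) ∈ polyFamilies 𝔤 X) hα ?_ ?_
  · intro p hp b
    let e := Module.finBasis ℝ 𝔤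
    have h1 : (fun ξ => T ξ (p ξ • b)) = ∑ i, fun ξ => (p * (e.coord i : 𝔤 → ℝ)) ξ • T (e i) b := by
      funext ξ
      have h2 : T ξ b = ∑ i, e.coord i ξ • T (e i) b := by
        conv_lhs => rw [← e.sum_repr ξ, map_sum, LinearMap.sum_apply]
        exact Finset.sum_congr rfl fun i _ => by rw [map_smul, LinearMap.smul_apply]; rfl
      rw [map_smul, h2, Finset.smul_sum, Finset.sum_apply]
      exact Finset.sum_congr rfl fun i _ => smul_smul _ _ _
    rw [h1]
    refine Submodule.sum_mem _ fun i _ => smul_mem_polyFamilies (mul_mem hp ?_) _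
    exact Algebra.subset_adjoin ⟨_, rfl⟩
  · intro α β h1 h2
    simp only [Pi.add_apply, map_add]
    exact add_mem h1 h2

variable {E : Type*} [NormedAddCommGroup E] [NormedSpace ℝ E]
  {M : Type*} [TopologicalSpace M] [ChartedSpace E M] [IsManifold 𝓘(ℝ, E) ∞ M] {q : ℕ}

theorem Foliation.mem_polyBasicForms_iff {F : Foliation E M q} {f : 𝔤 → MForm E M} :
    f ∈ F.polyBasicForms 𝔤 ↔ ∃ α ∈ polyFamilies 𝔤 F.basicForms, f = fun ξ => (α ξ).1 := by
  constructor
  · intro hf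
    refine Submodule.span_induction
      (p := fun f _ => ∃ α ∈ polyFamilies 𝔤 F.basicForms, f = fun ξ => (α ξ).1) ?_ ?_ ?_ ?_ hf
    · rintro _ ⟨p, hp, b, hb, rfl⟩
      exact ⟨_, smul_mem_polyFamilies hp (⟨b, hb⟩ : F.basicForms), rfl⟩
    · exact ⟨0, zero_mem _, rfl⟩
    · rintro _ _ _ _ ⟨α, hα, rfl⟩ ⟨β, hβ, rfl⟩
      exact ⟨α + β, add_mem hα hβ, rfl⟩
    · rintro c _ _ ⟨α, hα, rfl⟩
      exact ⟨c • α, Submodule.smul_mem _ c hα, rfl⟩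
  · rintro ⟨α, hα, rfl⟩
    refine polyFamilies_induction
      (P := fun α => (fun ξ => (α ξ).1) ∈ F.polyBasicForms 𝔤) hα ?_ ?_
    · intro p hp b
      exact Submodule.subset_span ⟨p, hp, b.1, b.2, rfl⟩
    · intro α β h1 h2
      exact add_mem h1 h2

/-- A polynomial function on `𝔤` composed with a family of endomorphisms `A t` is a combination of
polynomial functions whose coefficients are polynomials in the matrix coefficients of `A t`. -/
theorem exists_polyFunctions_comp [FiniteDimensional ℝ 𝔤] {T : Type*} [TopologicalSpace T]
    {A : T → 𝔤 →ₗ[ℝ] 𝔤} (hA : ∀ (l : Module.Dual ℝ 𝔤) (v : 𝔤), Continuous fun t => l (A t v))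
    {p : 𝔤 → ℝ} (hp : p ∈ polyFunctions 𝔤) :
    ∃ (N : ℕ) (c : Fin N → T → ℝ) (r : Fin N → 𝔤 → ℝ), (∀ j, Continuous (c j)) ∧
      (∀ j, r j ∈ polyFunctions 𝔤) ∧ ∀ t ξ, p (A t ξ) = ∑ j, c j t * r j ξ := by
  suffices h : ∃ (ι : Type) (_ : Fintype ι) (c : ι → T → ℝ) (r : ι → 𝔤 → ℝ),
      (∀ j, Continuous (c j)) ∧ (∀ j, r j ∈ polyFunctions 𝔤) ∧
        ∀ t ξ, p (A t ξ) = ∑ j, c j t * r j ξ by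
    obtain ⟨ι, _, c, r, hc, hr, h⟩ := h
    let e := Fintype.equivFin ι
    refine ⟨Fintype.card ι, fun j => c (e.symm j), fun j => r (e.symm j), fun j => hc _,
      fun j => hr _, fun t ξ => ?_⟩
    rw [h, ← e.symm.sum_comp]
  refine Algebra.adjoin_induction (p := fun p _ => ∃ (ι : Type) (_ : Fintype ι) (c : ι → T → ℝ)
      (r : ι → 𝔤 → ℝ), (∀ j, Continuous (c j)) ∧ (∀ j, r j ∈ polyFunctions 𝔤) ∧
        ∀ t ξ, p (A t ξ) = ∑ j, c j t * r j ξ) ?_ ?_ ?_ ?_ hp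
  · rintro _ ⟨l, rfl⟩
    let e := Module.finBasis ℝ 𝔤
    refine ⟨_, inferInstance, fun i t => l (A t (e i)), fun i => e.coord i, fun i => hA l _,
      fun i => Algebra.subset_adjoin ⟨_, rfl⟩, fun t ξ => ?_⟩
    change l (A t ξ) = _
    conv_lhs => rw [← e.sum_repr ξ, map_sum, map_sum]
    refine Finset.sum_congr rfl fun i _ => ?_
    rw [map_smul, map_smul, smul_eq_mul, mul_comm]
    rfl
  · intro a
    refine ⟨Unit, inferInstance, fun _ _ => a, fun _ => 1, fun _ => continuous_const,
      fun _ => one_mem _, fun t ξ => ?_⟩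
    simp [Pi.algebraMap_apply]
  · rintro p q - - ⟨ι, _, c, r, hc, hr, h⟩ ⟨κ, _, c', r', hc', hr', h'⟩
    refine ⟨ι ⊕ κ, inferInstance, Sum.elim c c', Sum.elim r r', ?_, ?_, fun t ξ => ?_⟩
    · rintro (j | j)
      · exact hc j
      · exact hc' j
    · rintro (j | j)
      · exact hr j
      · exact hr' j
    · rw [Pi.add_apply, h, h', Fintype.sum_sum_type]
      rfl
  · rintro p q - - ⟨ι, _, c, r, hc, hr, h⟩ ⟨κ, _, c', r', hc', hr', h'⟩
    refine ⟨ι × κ, inferInstance, fun j => c j.1 * c' j.2, fun j => r j.1 * r' j.2, fun j =>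
      (hc _).mul (hc' _), fun j => mul_mem (hr _) (hr' _), fun t ξ => ?_⟩
    rw [Pi.mul_apply, h, h', Finset.sum_mul_sum, Fintype.sum_prod_type]
    refine Finset.sum_congr rfl fun i _ => Finset.sum_congr rfl fun j _ => ?_
    simp only [Pi.mul_apply]
    ring

end PolyFamilies

/-! ### The adjoint action and fundamental vector fields -/

section Adjoint

variable {EG : Type*} [NormedAddCommGroup EG] [NormedSpace ℝ EG]
  {G : Type*} [TopologicalSpace G] [ChartedSpace EG G] [Group G] [LieGroup 𝓘(ℝ, EG) ∞ G]
  {E : Type*} [NormedAddCommGroup E] [NormedSpace ℝ E]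
  {M : Type*} [TopologicalSpace M] [ChartedSpace E M]
  [MulAction G M] [ContMDiffSMul 𝓘(ℝ, EG) 𝓘(ℝ, E) ∞ G M]

instance [FiniteDimensional ℝ EG] : FiniteDimensional ℝ (GroupLieAlgebra 𝓘(ℝ, EG) G) :=
  inferInstanceAs (FiniteDimensional ℝ EG)

theorem contMDiff_conj (g : G) :
    ContMDiff 𝓘(ℝ, EG) 𝓘(ℝ, EG) ∞ (fun h : G => g * h * g⁻¹) :=
  (contMDiff_const.mul contMDiff_id).mul contMDiff_const

/-- The adjoint action as a linear map. -/
noncomputable def adjointLinear (g : G) :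
    GroupLieAlgebra 𝓘(ℝ, EG) G →ₗ[ℝ] GroupLieAlgebra 𝓘(ℝ, EG) G where
  toFun := adjointAction g
  map_add' := (show EG →L[ℝ] EG from mfderiv 𝓘(ℝ, EG) 𝓘(ℝ, EG) (fun h : G => g * h * g⁻¹) 1).map_add
  map_smul' :=
    (show EG →L[ℝ] EG from mfderiv 𝓘(ℝ, EG) 𝓘(ℝ, EG) (fun h : G => g * h * g⁻¹) 1).map_smul

theorem adjointAction_mul (g h : G) (ξ : GroupLieAlgebra 𝓘(ℝ, EG) G) :
    adjointAction (g * h) ξ = adjointAction g (adjointAction h ξ) := by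
  have h1 : (fun k : G => g * h * k * (g * h)⁻¹) =
      (fun k : G => g * k * g⁻¹) ∘ fun k : G => h * k * h⁻¹ := by
    funext k
    simp only [Function.comp_apply, mul_inv_rev, mul_assoc]
  have h2 := mfderiv_comp (I := 𝓘(ℝ, EG)) (I' := 𝓘(ℝ, EG)) (I'' := 𝓘(ℝ, EG)) (1 : G)
    ((contMDiff_conj g).mdifferentiable (by simp) (h * 1 * h⁻¹))
    ((contMDiff_conj h).mdifferentiable (by simp) 1)
  rw [← h1] at h2
  have h3 : ∀ k : G, k = 1 → ∀ v : EG,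
      (mfderiv 𝓘(ℝ, EG) 𝓘(ℝ, EG) (fun l : G => g * l * g⁻¹) k v : EG) =
        (mfderiv 𝓘(ℝ, EG) 𝓘(ℝ, EG) (fun l : G => g * l * g⁻¹) 1 v : EG) := by
    rintro k rfl v; rfl
  exact (DFunLike.congr_fun h2 ξ).trans (h3 _ (by group) _)

theorem contMDiff_smul_left (x : M) :
    ContMDiff 𝓘(ℝ, EG) 𝓘(ℝ, E) ∞ (fun g : G => g • x) :=
  contMDiff_id.smul (I := 𝓘(ℝ, EG)) contMDiff_const

theorem contMDiff_smul_right (EG : Type*) [NormedAddCommGroup EG] [NormedSpace ℝ EG]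
    {G : Type*} [TopologicalSpace G] [ChartedSpace EG G] [Group G]
    {E : Type*} [NormedAddCommGroup E] [NormedSpace ℝ E]
    {M : Type*} [TopologicalSpace M] [ChartedSpace E M]
    [MulAction G M] [ContMDiffSMul 𝓘(ℝ, EG) 𝓘(ℝ, E) ∞ G M] (g : G) :
    ContMDiff 𝓘(ℝ, E) 𝓘(ℝ, E) ∞ (fun x : M => g • x) :=
  ContMDiffSMul.contMDiff_const_smul (I := 𝓘(ℝ, EG)) g

theorem surjective_mfderiv_smul (EG : Type*) [NormedAddCommGroup EG] [NormedSpace ℝ EG]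
    {G : Type*} [TopologicalSpace G] [ChartedSpace EG G] [Group G]
    {E : Type*} [NormedAddCommGroup E] [NormedSpace ℝ E]
    {M : Type*} [TopologicalSpace M] [ChartedSpace E M]
    [MulAction G M] [ContMDiffSMul 𝓘(ℝ, EG) 𝓘(ℝ, E) ∞ G M] (g : G) (x : M) :
    Function.Surjective (mfderiv 𝓘(ℝ, E) 𝓘(ℝ, E) (fun x : M => g • x) x) := by
  intro v
  have h1 : (fun x : M => g • x) ∘ (fun x : M => g⁻¹ • x) = id := by
    funext y
    simp
  have h2 := mfderiv_comp (I := 𝓘(ℝ, E)) (I' := 𝓘(ℝ, E)) (I'' := 𝓘(ℝ, E)) (g • x)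
    ((contMDiff_smul_right EG g).mdifferentiable (by simp) (g⁻¹ • g • x))
    ((contMDiff_smul_right EG g⁻¹).mdifferentiable (by simp) (g • x))
  rw [h1, mfderiv_id] at h2
  have h3 : ∀ y : M, y = x → ∀ u : E,
      (mfderiv 𝓘(ℝ, E) 𝓘(ℝ, E) (fun x : M => g • x) y u : E) =
        (mfderiv 𝓘(ℝ, E) 𝓘(ℝ, E) (fun x : M => g • x) x u : E) := by
    rintro y rfl u; rfl
  refine ⟨(mfderiv 𝓘(ℝ, E) 𝓘(ℝ, E) (fun x : M => g⁻¹ • x) (g • x) v : E), ?_⟩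
  exact (h3 (g⁻¹ • g • x) (inv_smul_smul g x) _).symm.trans (DFunLike.congr_fun h2 v).symm

theorem fundamentalField_add (ξ η : GroupLieAlgebra 𝓘(ℝ, EG) G) (x : M) :
    (fundamentalField (ξ + η) x : TangentSpace 𝓘(ℝ, E) x) =
      fundamentalField ξ x + fundamentalField η x := by
  have h := (show EG →L[ℝ] E from
    mfderiv 𝓘(ℝ, EG) 𝓘(ℝ, E) (fun g : G => g • x) 1).map_add ξ η
  exact (congrArg (fun v : E => -v) h).trans (neg_add _ _)

theorem fundamentalField_smul (c : ℝ) (ξ : GroupLieAlgebra 𝓘(ℝ, EG) G) (x : M) :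
    (fundamentalField (c • ξ) x : TangentSpace 𝓘(ℝ, E) x) = c • fundamentalField ξ x := by
  have h := (show EG →L[ℝ] E from
    mfderiv 𝓘(ℝ, EG) 𝓘(ℝ, E) (fun g : G => g • x) 1).map_smul c ξ
  exact (congrArg (fun v : E => -v) h).trans (smul_neg c _).symm

/-- The map `x ↦ g • x` takes `ξ_M` to `(Ad_g ξ)_M`. -/
theorem mfderiv_smul_fundamentalField (g : G) (ξ : GroupLieAlgebra 𝓘(ℝ, EG) G) (x : M) :
    (mfderiv 𝓘(ℝ, E) 𝓘(ℝ, E) (fun y : M => g • y) x (fundamentalField ξ x) : E) =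
      fundamentalField (adjointAction g ξ) (g • x) := by
  have h1 : (fun y : M => g • y) ∘ (fun h : G => h • x) =
      (fun k : G => k • (g • x)) ∘ fun h : G => g * h * g⁻¹ := by
    funext h
    simp only [Function.comp_apply, smul_smul, inv_mul_cancel_right]
  have h2 := mfderiv_comp (I := 𝓘(ℝ, EG)) (I' := 𝓘(ℝ, E)) (I'' := 𝓘(ℝ, E)) (1 : G)
    ((contMDiff_smul_right EG g).mdifferentiable (by simp) ((1 : G) • x))
    ((contMDiff_smul_left (EG := EG) (G := G) x).mdifferentiable (by simp) 1)
  have h3 := mfderiv_comp (I := 𝓘(ℝ, EG)) (I' := 𝓘(ℝ, EG)) (I'' := 𝓘(ℝ, E)) (1 : G)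
    ((contMDiff_smul_left (EG := EG) (G := G) (g • x)).mdifferentiable (by simp) (g * 1 * g⁻¹))
    ((contMDiff_conj g).mdifferentiable (by simp) 1)
  rw [← h1] at h3
  have h4 : ∀ y : M, y = x → ∀ u : E,
      (mfderiv 𝓘(ℝ, E) 𝓘(ℝ, E) (fun x : M => g • x) y u : E) =
        (mfderiv 𝓘(ℝ, E) 𝓘(ℝ, E) (fun x : M => g • x) x u : E) := by
    rintro y rfl u; rfl
  have h5 : ∀ k : G, k = 1 → ∀ v : EG,
      (mfderiv 𝓘(ℝ, EG) 𝓘(ℝ, E) (fun k : G => k • (g • x)) k v : E) =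
        (mfderiv 𝓘(ℝ, EG) 𝓘(ℝ, E) (fun k : G => k • (g • x)) 1 v : E) := by
    rintro k rfl v; rfl
  have h6 := DFunLike.congr_fun (h2.symm.trans h3) ξ
  have h7 := (h4 _ (one_smul G x) _).symm.trans (h6.trans (h5 _ (by group) _))
  refine ((show E →L[ℝ] E from
    mfderiv 𝓘(ℝ, E) 𝓘(ℝ, E) (fun y : M => g • y) x).map_neg _).trans ?_
  exact congrArg (fun v : E => -v) h7

end Adjoint

/-! ### Equivariant families of basic forms -/

section Equivariant

variable {E : Type*} [NormedAddCommGroup E] [NormedSpace ℝ E] [FiniteDimensional ℝ E]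
  {M : Type*} [TopologicalSpace M] [ChartedSpace E M] [IsManifold 𝓘(ℝ, E) ∞ M] [T2Space M]
  {EG : Type*} [NormedAddCommGroup EG] [NormedSpace ℝ EG] [FiniteDimensional ℝ EG]
  {G : Type*} [TopologicalSpace G] [ChartedSpace EG G] [Group G] [LieGroup 𝓘(ℝ, EG) ∞ G]
  [MulAction G M] [ContMDiffSMul 𝓘(ℝ, EG) 𝓘(ℝ, E) ∞ G M]
  {n : ℕ} {F : Foliation E M (2 * n)} {σ : KForm E M 2}

/-- The equivariant polynomial maps from `𝔤` to the basic forms. -/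
noncomputable def equivariantFamilies (EG : Type*) [NormedAddCommGroup EG] [NormedSpace ℝ EG]
    {G : Type*} [TopologicalSpace G] [ChartedSpace EG G] [Group G] [LieGroup 𝓘(ℝ, EG) ∞ G]
    [MulAction G M] (hσ : F.IsTransverselySymplectic σ)
    (hg : ∀ g : G, IsSymplecticMap σ (fun x : M => g • x)) :
    Submodule ℝ (GroupLieAlgebra 𝓘(ℝ, EG) G → F.basicForms) where
  carrier := {α | α ∈ polyFamilies _ F.basicForms ∧
    ∀ (g : G) ξ, hσ.pull (hg g) (α (adjointAction g ξ)) = α ξ}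
  add_mem' {α β} hα hβ := by
    refine ⟨add_mem hα.1 hβ.1, fun g ξ => ?_⟩
    rw [Pi.add_apply, map_add, hα.2, hβ.2, Pi.add_apply]
  zero_mem' := ⟨zero_mem _, fun g ξ => map_zero _⟩
  smul_mem' c α hα := by
    refine ⟨Submodule.smul_mem _ c hα.1, fun g ξ => ?_⟩
    rw [Pi.smul_apply, map_smul, hα.2, Pi.smul_apply]

variable {hσ : F.IsTransverselySymplectic σ} {hg : ∀ g : G, IsSymplecticMap σ (fun x : M => g • x)}

theorem Foliation.isEquivariantBasic_iff {f : GroupLieAlgebra 𝓘(ℝ, EG) G → MForm E M} :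
    F.IsEquivariantBasic f ↔ ∃ α ∈ equivariantFamilies EG hσ hg, f = fun ξ => (α ξ).1 := by
  constructor
  · rintro ⟨h1, h2⟩
    obtain ⟨α, hα, rfl⟩ := mem_polyBasicForms_iff.mp h1
    exact ⟨α, ⟨hα, fun g ξ => Subtype.ext (h2 g ξ)⟩, rfl⟩
  · rintro ⟨α, hα, rfl⟩
    exact ⟨mem_polyBasicForms_iff.mpr ⟨α, hα.1, rfl⟩,
      fun g ξ => congrArg Subtype.val (hα.2 g ξ)⟩

theorem map_mem_equivariantFamilies {α : GroupLieAlgebra 𝓘(ℝ, EG) G → F.basicForms}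
    (hα : α ∈ equivariantFamilies EG hσ hg) (T : F.basicForms →ₗ[ℝ] F.basicForms)
    (hT : ∀ g a, hσ.pull (hg g) (T a) = T (hσ.pull (hg g) a)) :
    (fun ξ => T (α ξ)) ∈ equivariantFamilies EG hσ hg :=
  ⟨map_mem_polyFamilies hα.1 T, fun g ξ => by rw [hT, hα.2]⟩

/-- The contraction with `ξ_M` is linear in `ξ` and compatible with the action, as `g` takes `ξ_M`
to `(Ad_g ξ)_M`. -/
theorem contraction_mem_equivariantFamilies
    {α : GroupLieAlgebra 𝓘(ℝ, EG) G → F.basicForms} (hα : α ∈ equivariantFamilies EG hσ hg)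
    {f : GroupLieAlgebra 𝓘(ℝ, EG) G → M → ℝ}
    (hf : ∀ ξ, IsHamiltonianFunction σ (f ξ) (fundamentalField ξ)) :
    (fun ξ => hσ.contraction (hf ξ) (α ξ)) ∈ equivariantFamilies EG hσ hg := by
  constructor
  · refine apply_mem_polyFamilies hα.1 (LinearMap.mk₂ ℝ (fun ξ => hσ.contraction (hf ξ))
      (fun ξ η a => ?_) (fun c ξ a => ?_) (fun ξ a b => map_add _ a b)
      (fun c ξ a => map_smul _ c a))
    · refine Foliation.IsTransverselySymplectic.basic_ext fun x => ?_
      rw [hσ.contraction_val, gAt_interior', fundamentalField_add, gι_add, Submodule.coe_add,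
        gAt_add, hσ.contraction_val, hσ.contraction_val, gAt_interior', gAt_interior']
    · refine Foliation.IsTransverselySymplectic.basic_ext fun x => ?_
      rw [hσ.contraction_val, gAt_interior', fundamentalField_smul, gι_smul, Submodule.coe_smul,
        gAt_smul, hσ.contraction_val, gAt_interior']
  · intro g ξ
    refine Foliation.IsTransverselySymplectic.basic_ext fun x => ?_
    have h1 := mfderiv_smul_fundamentalField (E := E) g ξ x
    rw [hσ.gAt_pull, hσ.contraction_val, hσ.contraction_val, gAt_interior', gAt_interior',
      ← hα.2 g ξ, hσ.gAt_pull, gι_gpull]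
    exact congrArg (fun v : E => gpull (mfderiv 𝓘(ℝ, E) 𝓘(ℝ, E) (fun x : M => g • x) x)
      (gι (show TangentSpace 𝓘(ℝ, E) (g • x) from v)
        (gAt (α (adjointAction g ξ)).1 (g • x)))) h1.symm

theorem Foliation.IsTransverselySymplectic.pull_pull (g h : G) (a : F.basicForms) :
    hσ.pull (hg h) (hσ.pull (hg g) a) = hσ.pull (hg (g * h)) a := by
  have h1 : (fun x : M => (g * h) • x) = (fun x => g • x) ∘ fun x => h • x := by
    funext x
    simp [mul_smul]
  refine Subtype.ext ?_
  change pullbackForm (fun x : M => h • x) (pullbackForm (fun x : M => g • x) a.1) =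
    pullbackForm (fun x : M => (g * h) • x) a.1
  rw [h1]
  refine mform_ext fun x => ?_
  rw [gAt_pullbackForm, gAt_pullbackForm, gAt_pullbackForm, gpull_comp]
  have h2 := mfderiv_comp (I := 𝓘(ℝ, E)) (I' := 𝓘(ℝ, E)) (I'' := 𝓘(ℝ, E)) x
    ((hg g).smooth.mdifferentiable (by simp) (h • x))
    ((hg h).smooth.mdifferentiable (by simp) x)
  rw [h2]
  rfl

end Equivariant

/-! ### Families of forms depending on a parameter in a manifold -/

section ParametricDerivative

variable {E : Type*} [NormedAddCommGroup E] [NormedSpace ℝ E]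
  {EG : Type*} [NormedAddCommGroup EG] [NormedSpace ℝ EG]
  {N : Type*} [TopologicalSpace N] [ChartedSpace EG N] [IsManifold 𝓘(ℝ, EG) ∞ N]

/-- The partial derivative in a vector space variable of a smooth map is smooth in all variables. -/
theorem ContMDiffAt.fderiv_snd {Z : Type*} [NormedAddCommGroup Z] [NormedSpace ℝ Z]
    {f : N → E → Z} {p : N × E}
    (hf : ContMDiffAt (𝓘(ℝ, EG).prod 𝓘(ℝ, E)) 𝓘(ℝ, Z) ∞ (Function.uncurry f) p) :
    ContMDiffAt (𝓘(ℝ, EG).prod 𝓘(ℝ, E)) 𝓘(ℝ, E →L[ℝ] Z) ∞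
      (fun q : N × E => fderiv ℝ (f q.1) q.2) p := by
  have h1 : ContMDiffAt ((𝓘(ℝ, EG).prod 𝓘(ℝ, E)).prod 𝓘(ℝ, E)) 𝓘(ℝ, Z) ∞
      (Function.uncurry fun (q : N × E) (y : E) => f q.1 y) (p, p.2) := by
    have h2 : ContMDiffAt ((𝓘(ℝ, EG).prod 𝓘(ℝ, E)).prod 𝓘(ℝ, E)) (𝓘(ℝ, EG).prod 𝓘(ℝ, E)) ∞
        (fun r : (N × E) × E => (r.1.1, r.2)) (p, p.2) :=
      (contMDiffAt_fst.comp _ contMDiffAt_fst).prodMk contMDiffAt_snd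
    exact ContMDiffAt.comp (p, p.2) (g := Function.uncurry f) hf h2
  have h3 := ContMDiffAt.mfderiv (m := ∞) (fun (q : N × E) (y : E) => f q.1 y) Prod.snd h1
    contMDiffAt_snd (by simp)
  have h4 := inTangentCoordinates_model_space (I := 𝓘(ℝ, E)) (I' := 𝓘(ℝ, Z))
    (Prod.snd : N × E → E) (fun q : N × E => f q.1 q.2)
    (fun q : N × E => fderiv ℝ (f q.1) q.2) p
  refine Eq.mp (congrArg (ContMDiffAt _ _ _ · p) h4) ?_
  simpa only [mfderiv_eq_fderiv] using h3

variable [FiniteDimensional ℝ E] {M : Type*} [TopologicalSpace M] [ChartedSpace E M]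
  [IsManifold 𝓘(ℝ, E) ∞ M] {E' : Type*} [NormedAddCommGroup E'] [NormedSpace ℝ E']
  [FiniteDimensional ℝ E']

/-- The pull-backs of a smooth form along the maps of a smooth family depend smoothly on the
parameter of the family. -/
theorem contMDiffAt_gLoc_family {α : MForm E M} (hα : α ∈ smoothForms E M) {Ψ : N → E' → M}
    {p : N × E'}
    (h : ∀ᶠ q in nhds p, ContMDiffAt (𝓘(ℝ, EG).prod 𝓘(ℝ, E')) 𝓘(ℝ, E) ∞ (Function.uncurry Ψ) q)
    (k : ℕ) : ContMDiffAt (𝓘(ℝ, EG).prod 𝓘(ℝ, E')) 𝓘(ℝ, E' [⋀^Fin k]→L[ℝ] ℝ) ∞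
      (fun q : N × E' => gLoc (Ψ q.1) α q.2 k) p := by
  set x := Ψ p.1 p.2 with hx
  have h0 := h.self_of_nhds
  have hs : ∀ᶠ q in nhds p, Ψ q.1 q.2 ∈ (chartAt E x).source :=
    h0.continuousAt.preimage_mem_nhds ((chartAt E x).open_source.mem_nhds (mem_chart_source E x))
  have hu : ContMDiffAt (𝓘(ℝ, EG).prod 𝓘(ℝ, E')) 𝓘(ℝ, E) ∞
      (Function.uncurry fun t y => chartAt E x (Ψ t y)) p :=
    (contMDiffAt_of_mem_maximalAtlas (IsManifold.chart_mem_maximalAtlas x)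
      (mem_chart_source E x)).comp p h0
  have h1 : (fun q : N × E' => gLoc (Ψ q.1) α q.2 k) =ᶠ[nhds p] fun q =>
      (chartForm (α k) x (chartAt E x (Ψ q.1 q.2))).compContinuousLinearMap
        (fderiv ℝ (fun z => chartAt E x (Ψ q.1 z)) q.2) := by
    filter_upwards [h, hs] with q hq hqs
    exact locForm_eq_chartForm (α k) hq.curry_right hqs
  refine ContMDiffAt.congr_of_eventuallyEq ?_ h1
  have h2 : ContMDiffAt (𝓘(ℝ, EG).prod 𝓘(ℝ, E')) 𝓘(ℝ, E [⋀^Fin k]→L[ℝ] ℝ) ∞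
      (fun q : N × E' => chartForm (α k) x (chartAt E x (Ψ q.1 q.2))) p :=
    ContDiffAt.comp_contMDiffAt (g := chartForm (α k) x)
      ((hα k).contDiffAt (mem_chart_target E x)) hu
  have h3 := h2.prodMk_space (ContMDiffAt.fderiv_snd (f := fun t y => chartAt E x (Ψ t y)) hu)
  exact ContDiffAt.comp_contMDiffAt (contDiffAt_comp_form contDiffAt_fst contDiffAt_snd) h3

end ParametricDerivative

/-! ### Integrals depending on a parameter -/

section ParametricIntegral

open MeasureTheory

variable {EG : Type*} [NormedAddCommGroup EG] [NormedSpace ℝ EG]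
  {N : Type*} [TopologicalSpace N] [ChartedSpace EG N] [IsManifold 𝓘(ℝ, EG) ∞ N] [CompactSpace N]
  [MeasurableSpace N] [BorelSpace N] {μ : Measure N} [IsFiniteMeasure μ]

theorem Continuous.integrable_of_compactSpace {Z : Type*} [NormedAddCommGroup Z] {f : N → Z}
    (hf : Continuous f) : Integrable f μ :=
  hf.integrable_of_hasCompactSupport (HasCompactSupport.of_compactSpace f)

/-- Differentiation under the integral over a compact manifold. -/
theorem hasFDerivAt_integral_of_contMDiffAt {E : Type*} [NormedAddCommGroup E] [NormedSpace ℝ E]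
    [FiniteDimensional ℝ E] {Z : Type*} [NormedAddCommGroup Z]
    [NormedSpace ℝ Z] {c : N → ℝ} (hc : Continuous c) {f : N → E → Z} {U : Set E} (hU : IsOpen U)
    (hf : ∀ t, ∀ y ∈ U,
      ContMDiffAt (𝓘(ℝ, EG).prod 𝓘(ℝ, E)) 𝓘(ℝ, Z) ∞ (Function.uncurry f) (t, y))
    {y : E} (hy : y ∈ U) :
    HasFDerivAt (fun z => ∫ t, c t • f t z ∂μ) (∫ t, c t • fderiv ℝ (f t) y ∂μ) y := by
  have hcont : ∀ z ∈ U, Continuous fun t => f t z := fun z hz => by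
    refine continuous_iff_continuousAt.mpr fun t => ?_
    exact (hf t z hz).continuousAt.comp (f := fun s => (s, z)) (by fun_prop)
  have hcont' : ∀ t, ∀ z ∈ U, ContinuousAt (fun q : N × E => fderiv ℝ (f q.1) q.2) (t, z) :=
    fun t z hz => (hf t z hz).fderiv_snd.continuousAt
  have hcont'' : Continuous fun t => fderiv ℝ (f t) y := by
    refine continuous_iff_continuousAt.mpr fun t => ?_
    exact (hcont' t y hy).comp (f := fun s => (s, y)) (by fun_prop)
  obtain ⟨ε, hε, hball⟩ := Metric.nhds_basis_closedBall.mem_iff.mp (hU.mem_nhds hy)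
  obtain ⟨B, hB⟩ := (isCompact_univ.prod (isCompact_closedBall y ε)).exists_bound_of_continuousOn
    (f := fun q : N × E => c q.1 • fderiv ℝ (f q.1) q.2) (fun q hq =>
      (((hc.comp continuous_fst).continuousAt).smul
        (hcont' q.1 q.2 (hball hq.2))).continuousWithinAt)
  refine hasFDerivAt_integral_of_dominated_of_fderiv_le
    (F := fun z t => c t • f t z) (F' := fun z t => c t • fderiv ℝ (f t) z)
    (Metric.closedBall_mem_nhds y hε) ?_ ?_ ?_ (bound := fun _ => B) ?_ (integrable_const B) ?_
  · filter_upwards [hU.mem_nhds hy] with z hz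
    exact (hc.smul (hcont z hz)).integrable_of_compactSpace.1
  · exact (hc.smul (hcont y hy)).integrable_of_compactSpace
  · exact (hc.smul hcont'').integrable_of_compactSpace.1
  · exact Filter.Eventually.of_forall fun t z hz => hB (t, z) ⟨Set.mem_univ _, hz⟩
  · refine Filter.Eventually.of_forall fun t z hz => ?_
    have h1 : ContMDiffAt 𝓘(ℝ, E) 𝓘(ℝ, Z) ∞ (f t) z :=
      ContMDiffAt.comp z (g := Function.uncurry f) (f := fun z => (t, z)) (hf t z (hball hz))
        (contMDiffAt_const.prodMk contMDiffAt_id)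
    exact ((contMDiffAt_iff_contDiffAt.mp h1).differentiableAt (by simp)).hasFDerivAt.const_smul _

universe u

/-- Integrals over a compact manifold depend smoothly on parameters. The spaces `E` and `Z` share a
universe because the induction on the order of differentiability replaces `Z` by `E →L[ℝ] Z`. -/
theorem contDiffOn_integral_of_contMDiffAt {E : Type u} [NormedAddCommGroup E] [NormedSpace ℝ E]
    [FiniteDimensional ℝ E] {Z : Type u} [NormedAddCommGroup Z]
    [NormedSpace ℝ Z] {c : N → ℝ} (hc : Continuous c) {f : N → E → Z} {U : Set E} (hU : IsOpen U)
    (hf : ∀ t, ∀ y ∈ U,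
      ContMDiffAt (𝓘(ℝ, EG).prod 𝓘(ℝ, E)) 𝓘(ℝ, Z) ∞ (Function.uncurry f) (t, y)) :
    ContDiffOn ℝ ∞ (fun z => ∫ t, c t • f t z ∂μ) U := by
  refine contDiffOn_infty.mpr fun m => ?_
  induction m generalizing Z with
  | zero =>
    refine contDiffOn_zero.mpr fun y hy => ?_
    exact (hasFDerivAt_integral_of_contMDiffAt hc hU hf hy).continuousAt.continuousWithinAt
  | succ m ih =>
    rw [Nat.cast_succ, contDiffOn_succ_iff_fderiv_of_isOpen hU]
    refine ⟨fun y hy => ?_, fun h => ?_, ?_⟩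
    · exact (hasFDerivAt_integral_of_contMDiffAt hc hU hf
        hy).differentiableAt.differentiableWithinAt
    · exact absurd h (WithTop.natCast_ne_top m)
    · refine (ih (f := fun t y => fderiv ℝ (f t) y) fun t y hy => (hf t y hy).fderiv_snd).congr ?_
      exact fun y hy => (hasFDerivAt_integral_of_contMDiffAt hc hU hf hy).fderiv

end ParametricIntegral

/-! ### One-parameter subgroups -/

section OneParameter

variable {EG : Type*} [NormedAddCommGroup EG] [NormedSpace ℝ EG] [FiniteDimensional ℝ EG]
  {G : Type*} [TopologicalSpace G] [ChartedSpace EG G] [Group G] [LieGroup 𝓘(ℝ, EG) ∞ G]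
  [T2Space G]

/-- Left translation by `g` takes the left-invariant field of `ξ` to itself. -/
theorem mfderiv_mul_left_invariantField (ξ : GroupLieAlgebra 𝓘(ℝ, EG) G) (g h : G) :
    (mfderiv 𝓘(ℝ, EG) 𝓘(ℝ, EG) (g * ·) h (mulInvariantVectorField ξ h) : EG) =
      mulInvariantVectorField ξ (g * h) := by
  have h1 : (fun k : G => g * h * k) = (fun k => g * k) ∘ fun k => h * k := by
    funext k
    simp [mul_assoc]
  have hL : ∀ g : G, ContMDiff 𝓘(ℝ, EG) 𝓘(ℝ, EG) ∞ (g * ·) := fun g => contMDiff_mul_left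
  have h2 := mfderiv_comp (I := 𝓘(ℝ, EG)) (I' := 𝓘(ℝ, EG)) (I'' := 𝓘(ℝ, EG)) (1 : G)
    ((hL g).mdifferentiable (by simp) (h * 1)) ((hL h).mdifferentiable (by simp) 1)
  have h3 : ∀ k : G, k = h → ∀ v : EG, (mfderiv 𝓘(ℝ, EG) 𝓘(ℝ, EG) (g * ·) k v : EG) =
      (mfderiv 𝓘(ℝ, EG) 𝓘(ℝ, EG) (g * ·) h v : EG) := by
    rintro k rfl v; rfl
  rw [mulInvariantVectorField, mulInvariantVectorField, h1, h2]
  exact (h3 (h * 1) (mul_one h) _).symm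

/-- There is a curve in `G` with initial velocity `ξ` whose values fix `ξ` under the adjoint action:
an integral curve `c` of the left-invariant field of `ξ` satisfies `c s * c t = c (s + t)`, so that
its values commute. -/
theorem exists_curve_adjointAction_eq (ξ : GroupLieAlgebra 𝓘(ℝ, EG) G) :
    ∃ c : ℝ → G, c 0 = 1 ∧
      (∃ D : ℝ →L[ℝ] EG, HasMFDerivAt 𝓘(ℝ, ℝ) 𝓘(ℝ, EG) c 0 D ∧ D 1 = ξ) ∧
      ∀ᶠ s in nhds 0, adjointAction (c s) ξ = ξ := by
  have : CompleteSpace EG := FiniteDimensional.complete ℝ EG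
  have : LieGroup 𝓘(ℝ, EG) (minSmoothness ℝ 3) G := by
    rw [minSmoothness_of_isRCLikeNormedField]
    exact LieGroup.of_le (n := ∞) (WithTop.coe_le_coe.mpr (le_top : (3 : ℕ∞) ≤ ⊤))
  let v := mulInvariantVectorField (I := 𝓘(ℝ, EG)) ξ
  have hv : ContMDiff 𝓘(ℝ, EG) 𝓘(ℝ, EG).tangent 1
      (fun g => (⟨g, v g⟩ : TangentBundle 𝓘(ℝ, EG) G)) := by
    refine (contMDiff_mulInvariantVectorField ξ).of_le ?_
    rw [minSmoothness_of_isRCLikeNormedField]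
    exact one_le_two
  obtain ⟨c, hc0, hc⟩ := exists_isMIntegralCurveAt_of_contMDiffAt_boundaryless (t₀ := 0)
    (hv.contMDiffAt (x := 1))
  obtain ⟨ε, hε, hc'⟩ := isMIntegralCurveAt_iff'.mp hc
  rw [Real.ball_eq_Ioo, zero_sub, zero_add] at hc'
  have hv1 : (v 1 : EG) = ξ := by
    have h1 : ((1 : G) * ·) = id := funext fun g => one_mul g
    change (mfderiv 𝓘(ℝ, EG) 𝓘(ℝ, EG) ((1 : G) * ·) 1 ξ : EG) = ξ
    rw [h1, mfderiv_id]
    rfl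
  -- `t ↦ c s * c t` and `t ↦ c (t + s)` are integral curves with the same value at `0`
  have hadd : ∀ s ∈ Set.Ioo (-(ε / 2)) (ε / 2), ∀ t ∈ Set.Ioo (-(ε / 2)) (ε / 2),
      c s * c t = c (t + s) := by
    intro s hs
    refine isMIntegralCurveOn_Ioo_eqOn_of_contMDiff_boundaryless (t₀ := 0) (v := v)
      (γ := fun t => c s * c t) (γ' := fun t => c (t + s)) ⟨by linarith, by linarith⟩ hv ?_ ?_ ?_
    · intro t ht
      have h1 : HasMFDerivAt 𝓘(ℝ, EG) 𝓘(ℝ, EG) (c s * ·) (c t)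
          (mfderiv 𝓘(ℝ, EG) 𝓘(ℝ, EG) (c s * ·) (c t)) :=
        ((contMDiff_mul_left (n := ∞)).mdifferentiable (by simp) _).hasMFDerivAt
      have h2 := h1.comp_hasMFDerivWithinAt t
        ((hc' t ⟨by linarith [ht.1], by linarith [ht.2]⟩).mono
          (show Set.Ioo (-(ε / 2)) (ε / 2) ⊆ Set.Ioo (-ε) ε from
            Set.Ioo_subset_Ioo (by linarith) (by linarith)))
      have h3 := mfderiv_mul_left_invariantField ξ (c s) (c t)
      have h4 : (mfderiv 𝓘(ℝ, EG) 𝓘(ℝ, EG) (c s * ·) (c t)).comp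
          ((1 : ℝ →L[ℝ] ℝ).smulRight (v (c t) : EG)) =
            ((1 : ℝ →L[ℝ] ℝ).smulRight (v (c s * c t) : EG)) := by
        refine ContinuousLinearMap.ext fun r => ?_
        refine ((show EG →L[ℝ] EG from
          mfderiv 𝓘(ℝ, EG) 𝓘(ℝ, EG) (c s * ·) (c t)).map_smul r (v (c t))).trans ?_
        exact congrArg (fun w : EG => r • w) h3
      exact h4 ▸ h2
    · refine (hc'.comp_add s).mono fun t ht => ?_
      exact ⟨by linarith [ht.1, hs.1], by linarith [ht.2, hs.2]⟩
    · rw [hc0, mul_one, zero_add]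
  have h0 : HasMFDerivAt 𝓘(ℝ, ℝ) 𝓘(ℝ, EG) c 0 ((1 : ℝ →L[ℝ] ℝ).smulRight (v (c 0))) :=
    hc.self_of_nhds
  have hvc : (v (c 0) : EG) = ξ := by
    rw [← hv1, hc0]
  refine ⟨c, hc0, ⟨_, h0, ?_⟩, ?_⟩
  · change (1 : ℝ) • (v (c 0) : EG) = ξ
    rw [one_smul, hvc]
  · filter_upwards [Ioo_mem_nhds (show -(ε / 2) < 0 by linarith) (show 0 < ε / 2 by linarith)]
      with s hs
    have h1 : (fun t => c s * c t * (c s)⁻¹) =ᶠ[nhds 0] c := by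
      filter_upwards [Ioo_mem_nhds (show -(ε / 2) < 0 by linarith) (show 0 < ε / 2 by linarith)]
        with t ht
      rw [hadd s hs t ht, add_comm, ← hadd t ht s hs, mul_inv_cancel_right]
    have h2 : HasMFDerivAt 𝓘(ℝ, EG) 𝓘(ℝ, EG) (fun k => c s * k * (c s)⁻¹) (c 0)
        (mfderiv 𝓘(ℝ, EG) 𝓘(ℝ, EG) (fun k => c s * k * (c s)⁻¹) (c 0)) :=
      ((contMDiff_conj (c s)).mdifferentiable (by simp) _).hasMFDerivAt
    have h3 := (h2.comp 0 h0).mfderiv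
    have h4 := h1.mfderiv_eq (I := 𝓘(ℝ, ℝ)) (I' := 𝓘(ℝ, EG))
    have h5 : (mfderiv 𝓘(ℝ, ℝ) 𝓘(ℝ, EG) (fun t => c s * c t * (c s)⁻¹) 0 (1 : ℝ) : EG) =
        mfderiv 𝓘(ℝ, EG) 𝓘(ℝ, EG) (fun k => c s * k * (c s)⁻¹) (c 0) ((1 : ℝ) • (v (c 0) : EG)) :=
      DFunLike.congr_fun h3 (1 : ℝ)
    have h6 : (mfderiv 𝓘(ℝ, ℝ) 𝓘(ℝ, EG) (fun t => c s * c t * (c s)⁻¹) 0 (1 : ℝ) : EG) =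
        (1 : ℝ) • (v (c 0) : EG) :=
      (DFunLike.congr_fun h4 (1 : ℝ)).trans (DFunLike.congr_fun h0.mfderiv (1 : ℝ))
    rw [one_smul, hvc] at h5 h6
    have h7 : ∀ k : G, k = 1 → ∀ u : EG,
        (mfderiv 𝓘(ℝ, EG) 𝓘(ℝ, EG) (fun l : G => c s * l * (c s)⁻¹) k u : EG) =
          (mfderiv 𝓘(ℝ, EG) 𝓘(ℝ, EG) (fun l : G => c s * l * (c s)⁻¹) 1 u : EG) := by
      rintro k rfl u; rfl
    exact (h7 _ hc0 _).symm.trans (h5.symm.trans h6)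

end OneParameter

/-! ### The Lie derivative of equivariant forms -/

section LieDerivative

variable {E : Type*} [NormedAddCommGroup E] [NormedSpace ℝ E] [FiniteDimensional ℝ E]
  {M : Type*} [TopologicalSpace M] [ChartedSpace E M] [IsManifold 𝓘(ℝ, E) ∞ M]
  {E' : Type*} [NormedAddCommGroup E'] [NormedSpace ℝ E']
  {E'' : Type*} [NormedAddCommGroup E''] [NormedSpace ℝ E'']

/-- Naturality of the pull-back to a parametrisation. -/
theorem gLoc_comp {ψ : E' → M} {f : E'' → E'} {y : E''} (h : SmoothNear E ψ (f y))
    (hf : DifferentiableAt ℝ f y) (α : MForm E M) :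
    gpull (fderiv ℝ f y) (gLoc ψ α (f y)) = gLoc (fun z => ψ (f z)) α y := by
  have h1 := mfderiv_comp (I := 𝓘(ℝ, E'')) (I' := 𝓘(ℝ, E')) (I'' := 𝓘(ℝ, E)) y
    (h.self_of_nhds.mdifferentiableAt (by simp)) hf.mdifferentiableAt
  rw [mfderiv_eq_fderiv] at h1
  exact congrArg (fun T : E'' →L[ℝ] E => gpull T (show GForm E from gAt α (ψ (f y)))) h1.symm

/-- Naturality of the exterior derivative for maps with constant derivative. -/
theorem gd_gpull {a : E' → GForm E'} {f : E'' → E'} {y : E''}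
    (ha : ∀ k, DifferentiableAt ℝ (fun z => a z k) (f y)) {T : E'' →L[ℝ] E'}
    (hf : ∀ z, HasFDerivAt f T z) :
    gd (fun z => gpull T (a (f z))) y = gpull T (gd a (f y)) := by
  funext k
  cases k with
  | zero => rfl
  | succ k =>
    have h1 : HasFDerivAt (fun z => (a (f z) k).compContinuousLinearMap T)
        ((ContinuousAlternatingMap.compContinuousLinearMapCLM T).comp
          ((fderiv ℝ (fun z => a z k) (f y)).comp T)) y :=
      HasFDerivAt.comp y (g := ContinuousAlternatingMap.compContinuousLinearMapCLM T)
        (ContinuousLinearMap.hasFDerivAt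
          (ContinuousAlternatingMap.compContinuousLinearMapCLM (F := ℝ) (ι := Fin k) T))
        ((ha k).hasFDerivAt.comp y (hf y))
    change ContinuousAlternatingMap.alternatizeUncurryFin
      (fderiv ℝ (fun z => (a (f z) k).compContinuousLinearMap T) y) = _
    rw [h1.fderiv]
    ext v
    change _ = ContinuousAlternatingMap.alternatizeUncurryFin (fderiv ℝ (fun z => a z k) (f y)) _
    rw [ContinuousAlternatingMap.alternatizeUncurryFin_apply,
      ContinuousAlternatingMap.alternatizeUncurryFin_apply]
    rfl

variable {EG : Type*} [NormedAddCommGroup EG] [NormedSpace ℝ EG] [FiniteDimensional ℝ EG]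
  {G : Type*} [TopologicalSpace G] [ChartedSpace EG G] [Group G] [LieGroup 𝓘(ℝ, EG) ∞ G]
  [T2Space G] [MulAction G M] [ContMDiffSMul 𝓘(ℝ, EG) 𝓘(ℝ, E) ∞ G M]

/-- A form which is invariant under the stabiliser of `ξ` for the adjoint action is annihilated by
the Lie derivative along `ξ_M`. In coordinates `(z, y)` on `G × M`, the derivative in the direction
of `ξ` of the pull-back of the form along `(g, x) ↦ g • x` vanishes on `1 × M`, and the formula of
Cartan for constant vector fields applies to this pull-back. -/
theorem cartan_of_pullbackForm_eq {b : MForm E M} (hb : b ∈ smoothForms E M)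
    {ξ : GroupLieAlgebra 𝓘(ℝ, EG) G}
    (hι : interior' (fundamentalField ξ) b ∈ smoothForms E M)
    (hinv : ∀ g : G, adjointAction g ξ = ξ → pullbackForm (fun x : M => g • x) b = b) :
    extDer (interior' (fundamentalField ξ) b) + interior' (fundamentalField ξ) (extDer b) = 0 := by
  obtain ⟨c, hc0, ⟨D, hD, hDξ⟩, hc⟩ := exists_curve_adjointAction_eq ξ
  refine mform_ext fun x => gAt_eq_of_chart ?_
  set φ := chartAt E x with hφ
  set y₀ := φ x with hy₀
  set κ := chartAt EG (1 : G) with hκ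
  set z₀ := κ 1 with hz₀
  have hz₀t : z₀ ∈ κ.target := mem_chart_target EG (1 : G)
  have hκm : κ.MDifferentiable 𝓘(ℝ, EG) 𝓘(ℝ, EG) :=
    mdifferentiable_of_mem_maximalAtlas (IsManifold.chart_mem_maximalAtlas (1 : G))
  have hκz : κ.symm z₀ = 1 := κ.left_inv (mem_chart_source EG (1 : G))
  let Ψ : EG × E → M := fun p => κ.symm p.1 • φ.symm p.2
  have hΨ : ∀ z ∈ κ.target, ∀ y ∈ φ.target, SmoothNear E Ψ (z, y) := by
    intro z hz y hy
    filter_upwards [(κ.open_target.prod φ.open_target).mem_nhds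
      (show (z, y) ∈ κ.target ×ˢ φ.target from ⟨hz, hy⟩)] with p hp
    have h1 : ContMDiffAt 𝓘(ℝ, EG × E) 𝓘(ℝ, EG) ∞ (fun p : EG × E => κ.symm p.1) p :=
      (contMDiffAt_symm_of_mem_maximalAtlas (IsManifold.chart_mem_maximalAtlas (1 : G))
        hp.1).comp p contDiff_fst.contMDiff.contMDiffAt
    have h2 : ContMDiffAt 𝓘(ℝ, EG × E) 𝓘(ℝ, E) ∞ (fun p : EG × E => φ.symm p.2) p :=
      (contMDiffAt_symm_of_mem_maximalAtlas (IsManifold.chart_mem_maximalAtlas x)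
        hp.2).comp p contDiff_snd.contMDiff.contMDiffAt
    exact h1.smul h2
  -- the chart expression of the initial velocity of the curve
  have hu : ∃ ξ' : EG, HasFDerivAt (fun s => κ (c s)) ((1 : ℝ →L[ℝ] ℝ).smulRight ξ') 0 ∧
      (mfderiv 𝓘(ℝ, EG) 𝓘(ℝ, EG) κ.symm z₀ ξ' : EG) = ξ := by
    have hκc : ∀ g : G, g = 1 → ∀ v : EG, (mfderiv 𝓘(ℝ, EG) 𝓘(ℝ, EG) κ.symm (κ g)
        (mfderiv 𝓘(ℝ, EG) 𝓘(ℝ, EG) κ g v) : EG) = v := by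
      rintro g rfl v
      exact DFunLike.congr_fun (hκm.symm_comp_deriv (mem_chart_source EG (1 : G))) v
    have h1 : HasMFDerivAt 𝓘(ℝ, EG) 𝓘(ℝ, EG) κ (c 0) (mfderiv 𝓘(ℝ, EG) 𝓘(ℝ, EG) κ (c 0)) := by
      rw [hc0]
      exact (hκm.mdifferentiableAt (mem_chart_source EG (1 : G))).hasMFDerivAt
    have h2 := (h1.comp 0 hD).hasFDerivAt
    refine ⟨(mfderiv 𝓘(ℝ, EG) 𝓘(ℝ, EG) κ (c 0) (D 1) : EG), ?_, ?_⟩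
    · refine HasFDerivAt.congr_fderiv h2 (ContinuousLinearMap.ext fun (r : ℝ) => ?_)
      have h3 : D r = r • D 1 := by rw [← map_smul, smul_eq_mul, mul_one]
      exact (congrArg (show EG →L[ℝ] EG from mfderiv 𝓘(ℝ, EG) 𝓘(ℝ, EG) κ (c 0)) h3).trans
        ((show EG →L[ℝ] EG from mfderiv 𝓘(ℝ, EG) 𝓘(ℝ, EG) κ (c 0)).map_smul r (D 1))
    · have h4 := hκc (c 0) hc0 (D 1)
      rw [hc0, ← hz₀] at h4
      rw [hc0]
      exact h4.trans hDξ
  obtain ⟨ξ', hξ', hξ⟩ := hu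
  -- the fundamental field carries the opposite sign of the velocity of `s ↦ c s • x`, so it comes
  -- from the constant field `-ξ'` on the first factor
  have hΨξ : ∀ y ∈ φ.target, (mfderiv 𝓘(ℝ, EG × E) 𝓘(ℝ, E) Ψ (z₀, y) (-ξ', 0) : E) =
      fundamentalField ξ (Ψ (z₀, y)) := by
    intro y hy
    have h1 := mfderiv_comp (I := 𝓘(ℝ, EG)) (I' := 𝓘(ℝ, EG × E)) (I'' := 𝓘(ℝ, E)) z₀
      (g := Ψ) (f := fun z => (z, y))
      ((hΨ z₀ hz₀t y hy).self_of_nhds.mdifferentiableAt (by simp))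
      (hasFDerivAt_prodMk_left z₀ y).differentiableAt.mdifferentiableAt
    rw [mfderiv_eq_fderiv (f := fun z => (z, y)), (hasFDerivAt_prodMk_left z₀ y).fderiv] at h1
    have h2 := mfderiv_comp (I := 𝓘(ℝ, EG)) (I' := 𝓘(ℝ, EG)) (I'' := 𝓘(ℝ, E)) z₀
      (g := fun g : G => g • φ.symm y) (f := κ.symm)
      ((contMDiff_smul_left (φ.symm y)).mdifferentiable (by simp) _)
      (hκm.symm.mdifferentiableAt hz₀t)
    have h3 : ∀ g : G, g = 1 → ∀ v : EG,
        (mfderiv 𝓘(ℝ, EG) 𝓘(ℝ, E) (fun g : G => g • φ.symm y) g v : E) =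
          mfderiv 𝓘(ℝ, EG) 𝓘(ℝ, E) (fun g : G => g • φ.symm y) 1 v := by
      rintro g rfl v; rfl
    have h4 : ∀ p : M, p = φ.symm y → (fundamentalField ξ p : E) =
        -(mfderiv 𝓘(ℝ, EG) 𝓘(ℝ, E) (fun g : G => g • φ.symm y) 1 ξ : E) := by
      rintro p rfl; rfl
    have h5 : Ψ (z₀, y) = φ.symm y := by
      change κ.symm z₀ • φ.symm y = φ.symm y
      rw [hκz, one_smul]
    have h6 : (mfderiv 𝓘(ℝ, EG × E) 𝓘(ℝ, E) Ψ (z₀, y) (ξ', 0) : E) =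
        mfderiv 𝓘(ℝ, EG) 𝓘(ℝ, E) (fun g : G => g • φ.symm y) 1 ξ :=
      (DFunLike.congr_fun (h1.symm.trans h2) ξ').trans ((h3 _ hκz _).trans
        (congrArg (show EG →L[ℝ] E from
          mfderiv 𝓘(ℝ, EG) 𝓘(ℝ, E) (fun g : G => g • φ.symm y) 1) hξ))
    have h7 : ((-ξ', 0) : EG × E) = -(ξ', 0) := by simp
    rw [h7]
    refine ((show EG × E →L[ℝ] E from
      mfderiv 𝓘(ℝ, EG × E) 𝓘(ℝ, E) Ψ (z₀, y)).map_neg (ξ', 0)).trans ?_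
    exact (congrArg (fun v : E => -v) h6).trans (h4 _ h5).symm
  have hj : ∀ z y, HasFDerivAt (fun y : E => (z, y)) (ContinuousLinearMap.inr ℝ EG E) y :=
    fun z y => hasFDerivAt_prodMk_right z y
  have hpull : ∀ z ∈ κ.target, ∀ y ∈ φ.target, ∀ a : MForm E M,
      gpull (ContinuousLinearMap.inr ℝ EG E) (gLoc Ψ a (z, y)) =
        gLoc (fun y => κ.symm z • φ.symm y) a y := by
    intro z hz y hy a
    have h1 := gLoc_comp (f := fun y : E => (z, y)) (hΨ z hz y hy) (hj z y).differentiableAt a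
    rwa [(hj z y).fderiv] at h1
  have hone : (fun y => κ.symm z₀ • φ.symm y) = φ.symm := by
    funext y
    rw [hκz, one_smul]
  have hιpull : ∀ y ∈ φ.target, ∀ a : MForm E M,
      gι (-ξ', 0) (gLoc Ψ a (z₀, y)) = gLoc Ψ (interior' (fundamentalField ξ) a) (z₀, y) := by
    intro y hy a
    refine (gι_gpull (show EG × E →L[ℝ] E from mfderiv 𝓘(ℝ, EG × E) 𝓘(ℝ, E) Ψ (z₀, y)) (-ξ', 0)
      (show GForm E from gAt a (Ψ (z₀, y)))).trans ?_
    exact congrArg (fun v : E => gpull (show EG × E →L[ℝ] E from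
      mfderiv 𝓘(ℝ, EG × E) 𝓘(ℝ, E) Ψ (z₀, y)) (gι v (show GForm E from gAt a (Ψ (z₀, y)))))
      (hΨξ y hy)
  have hy₀t : y₀ ∈ φ.target := mem_chart_target E x
  have hx := smoothNear_chartAt (E := E) x
  have hdiff := differentiableAt_gLoc hb (hΨ z₀ hz₀t y₀ hy₀t)
  -- along the curve `c` the form is unchanged by pull-back, so the directional derivative vanishes
  have hdir : gpull (ContinuousLinearMap.inr ℝ EG E) (gdir (gLoc Ψ b) (z₀, y₀) (-ξ', 0)) = 0 := by
    funext k
    let K : EG → E [⋀^Fin k]→L[ℝ] ℝ := fun z =>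
      ContinuousAlternatingMap.compContinuousLinearMapCLM (ContinuousLinearMap.inr ℝ EG E)
        (gLoc Ψ b (z, y₀) k)
    have hK : HasFDerivAt K ((ContinuousAlternatingMap.compContinuousLinearMapCLM
        (ContinuousLinearMap.inr ℝ EG E)).comp ((fderiv ℝ (fun p => gLoc Ψ b p k) (z₀, y₀)).comp
          (ContinuousLinearMap.inl ℝ EG E))) z₀ :=
      HasFDerivAt.comp z₀ (g := ContinuousAlternatingMap.compContinuousLinearMapCLM
          (ContinuousLinearMap.inr ℝ EG E))
        (ContinuousLinearMap.hasFDerivAt (ContinuousAlternatingMap.compContinuousLinearMapCLM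
          (F := ℝ) (ι := Fin k) (ContinuousLinearMap.inr ℝ EG E)))
        (HasFDerivAt.comp (f := fun z : EG => (z, y₀)) z₀ (hdiff k).hasFDerivAt
          (hasFDerivAt_prodMk_left z₀ y₀))
    have hcκ : κ (c 0) = z₀ := by rw [hc0]
    have hKc : (fun s => K (κ (c s))) =ᶠ[nhds 0] fun _ => gLoc φ.symm b y₀ k := by
      have h1 : ∀ᶠ s in nhds 0, c s ∈ κ.source :=
        hD.continuousAt.preimage_mem_nhds (by
          rw [hc0]
          exact κ.open_source.mem_nhds (mem_chart_source EG (1 : G)))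
      filter_upwards [h1, hc] with s hs hs'
      have h2 := congrFun (hpull (κ (c s)) (κ.map_source hs) y₀ hy₀t b) k
      rw [κ.left_inv hs] at h2
      refine h2.trans ?_
      rw [← gLoc_pullbackForm (contMDiff_smul_right EG (c s)) b hx, hinv _ hs']
    have hK' : HasFDerivAt K ((ContinuousAlternatingMap.compContinuousLinearMapCLM
        (ContinuousLinearMap.inr ℝ EG E)).comp ((fderiv ℝ (fun p => gLoc Ψ b p k) (z₀, y₀)).comp
          (ContinuousLinearMap.inl ℝ EG E))) (κ (c 0)) := by
      rw [hcκ]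
      exact hK
    have h3 := (hK'.comp (f := fun s => κ (c s)) 0 hξ').unique
      ((hasFDerivAt_const (gLoc φ.symm b y₀ k) (0 : ℝ)).congr_of_eventuallyEq hKc)
    have h4 := DFunLike.congr_fun h3 (-1)
    have h5 : ((-1 : ℝ) • ξ', (0 : E)) = (-ξ', 0) := by simp
    rw [← h5]
    exact h4
  have hA : ∀ k, DifferentiableAt ℝ (fun p => gι (-ξ', (0 : E)) (gLoc Ψ b p) k) (z₀, y₀) :=
    fun k => (contractCLM (EG × E) k (-ξ', 0)).differentiableAt.comp _ (hdiff (k + 1))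
  -- restrict the formula of Cartan for the constant field `-ξ'` to the slice through `1`
  have h1 := congrArg (gpull (ContinuousLinearMap.inr ℝ EG E)) (gι_gd hdiff (-ξ', (0 : E)))
  rw [map_sub, hdir, zero_sub, ← gd_gpull hA (hj z₀), ← gLoc_extDer hb (hΨ z₀ hz₀t y₀ hy₀t),
    hιpull y₀ hy₀t, hpull z₀ hz₀t y₀ hy₀t, hone] at h1
  have h2 : gd (fun y => gpull (ContinuousLinearMap.inr ℝ EG E)
      (gι (-ξ', 0) (gLoc Ψ b (z₀, y)))) y₀ =
        gLoc φ.symm (extDer (interior' (fundamentalField ξ) b)) y₀ := by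
    rw [gLoc_extDer hι hx]
    funext k
    cases k with
    | zero => rfl
    | succ k =>
      refine Filter.EventuallyEq.extDeriv_eq ?_
      filter_upwards [φ.open_target.mem_nhds hy₀t] with y hy
      rw [hιpull y hy, hpull z₀ hz₀t y hy, hone]
  rw [h2] at h1
  have h3 : gLoc φ.symm (extDer (interior' (fundamentalField ξ) b) +
      interior' (fundamentalField ξ) (extDer b)) y₀ =
      gLoc φ.symm (extDer (interior' (fundamentalField ξ) b)) y₀ +
        gLoc φ.symm (interior' (fundamentalField ξ) (extDer b)) y₀ := by
    rw [gLoc_eq, gAt_add, map_add]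
    rfl
  rw [h3, h1, add_neg_cancel]
  exact (map_zero (gpull (mfderiv 𝓘(ℝ, E) 𝓘(ℝ, E) φ.symm y₀))).symm

end LieDerivative

/-! ### Averages of forms over a compact group -/

section GIntegral

open MeasureTheory

variable {N : Type*} [MeasurableSpace N] {μ : Measure N}
  {E : Type*} [NormedAddCommGroup E] [NormedSpace ℝ E]
  {E' : Type*} [NormedAddCommGroup E'] [NormedSpace ℝ E']

/-- The form of mixed degree `a` is the integral of the integrable family `f`. -/
def HasGIntegral (μ : Measure N) (f : N → GForm E) (a : GForm E) : Prop :=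
  ∀ k, Integrable (fun t => f t k) μ ∧ a k = ∫ t, f t k ∂μ

theorem HasGIntegral.unique {f : N → GForm E} {a b : GForm E} (ha : HasGIntegral μ f a)
    (hb : HasGIntegral μ f b) : a = b :=
  funext fun k => (ha k).2.trans (hb k).2.symm

theorem hasGIntegral_const [IsProbabilityMeasure μ] [FiniteDimensional ℝ E] (a : GForm E) :
    HasGIntegral μ (fun _ => a) a := fun k => by
  have : CompleteSpace (E [⋀^Fin k]→L[ℝ] ℝ) := FiniteDimensional.complete ℝ _
  exact ⟨integrable_const _, by simp⟩

theorem HasGIntegral.add {f g : N → GForm E} {a b : GForm E} (ha : HasGIntegral μ f a)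
    (hb : HasGIntegral μ g b) : HasGIntegral μ (fun t => f t + g t) (a + b) := fun k => by
  refine ⟨Integrable.add (f := fun t => f t k) (g := fun t => g t k) (ha k).1 (hb k).1, ?_⟩
  change a k + b k = ∫ t, f t k + g t k ∂μ
  rw [integral_add (ha k).1 (hb k).1, (ha k).2, (hb k).2]

theorem HasGIntegral.smul {f : N → GForm E} {a : GForm E} (ha : HasGIntegral μ f a) (r : ℝ) :
    HasGIntegral μ (fun t => r • f t) (r • a) := fun k => by
  refine ⟨(ha k).1.smul r, ?_⟩
  change r • a k = ∫ t, r • f t k ∂μ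
  rw [integral_smul, (ha k).2]

theorem HasGIntegral.sum {ι : Type*} {s : Finset ι} {f : ι → N → GForm E} {a : ι → GForm E}
    (h : ∀ i, HasGIntegral μ (f i) (a i)) :
    HasGIntegral μ (fun t => ∑ i ∈ s, f i t) (∑ i ∈ s, a i) := by
  classical
  induction s using Finset.induction_on with
  | empty =>
    simp only [Finset.sum_empty]
    exact fun k => ⟨integrable_zero N (E [⋀^Fin k]→L[ℝ] ℝ) μ, (integral_zero N _).symm⟩
  | insert i s hi ih =>
    simp only [Finset.sum_insert hi]
    exact (h i).add ih

variable [FiniteDimensional ℝ E] [FiniteDimensional ℝ E']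

theorem HasGIntegral.gι {f : N → GForm E} {a : GForm E} (ha : HasGIntegral μ f a) (u : E) :
    HasGIntegral μ (fun t => gι u (f t)) (gι u a) := fun k => by
  have : CompleteSpace (E [⋀^Fin k]→L[ℝ] ℝ) := FiniteDimensional.complete ℝ _
  have : CompleteSpace (E [⋀^Fin (k + 1)]→L[ℝ] ℝ) := FiniteDimensional.complete ℝ _
  refine ⟨(contractCLM E k u).integrable_comp (ha (k + 1)).1, ?_⟩
  refine Eq.trans ?_ ((contractCLM E k u).integral_comp_comm (ha (k + 1)).1).symm
  exact congrArg (contractCLM E k u) (ha (k + 1)).2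

theorem HasGIntegral.gpull {f : N → GForm E} {a : GForm E} (ha : HasGIntegral μ f a)
    (T : E' →L[ℝ] E) : HasGIntegral μ (fun t => gpull T (f t)) (gpull T a) := fun k => by
  have : CompleteSpace (E [⋀^Fin k]→L[ℝ] ℝ) := FiniteDimensional.complete ℝ _
  have : CompleteSpace (E' [⋀^Fin k]→L[ℝ] ℝ) := FiniteDimensional.complete ℝ _
  let S : (E [⋀^Fin k]→L[ℝ] ℝ) →L[ℝ] E' [⋀^Fin k]→L[ℝ] ℝ :=
    ContinuousAlternatingMap.compContinuousLinearMapCLM T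
  refine ⟨S.integrable_comp (ha k).1, ?_⟩
  refine Eq.trans ?_ (S.integral_comp_comm (ha k).1).symm
  exact congrArg S (ha k).2

theorem HasGIntegral.gΛ {n : ℕ} {f : N → GForm E} {a : GForm E} (ha : HasGIntegral μ f a)
    (e e' : Fin (2 * n) → E) : HasGIntegral μ (fun t => gΛ e e' (f t)) (gΛ e e' a) := by
  simp only [gΛ_apply]
  exact (HasGIntegral.sum fun i => (ha.gι (e i)).gι (e' i)).smul _

end GIntegral

section Average

open MeasureTheory

variable {E : Type*} [NormedAddCommGroup E] [NormedSpace ℝ E] [FiniteDimensional ℝ E]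
  {M : Type*} [TopologicalSpace M] [ChartedSpace E M] [IsManifold 𝓘(ℝ, E) ∞ M]
  {E' : Type*} [NormedAddCommGroup E'] [NormedSpace ℝ E'] [FiniteDimensional ℝ E']

/-- The value of a form of mixed degree at a point, the tangent space being identified with `E`. -/
def gVal (α : MForm E M) (x : M) : GForm E := gAt α x

/-- The form `b` is the pointwise integral of the family `f`. -/
def IsAverage {N : Type*} [MeasurableSpace N] (μ : Measure N) (f : N → MForm E M)
    (b : MForm E M) : Prop :=
  ∀ x, HasGIntegral μ (fun t => gVal (f t) x) (gVal b x)

/-- The value at a point, recovered from the expression in the chart at that point. -/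
theorem gVal_eq_gpull (α : MForm E M) (x : M) :
    gVal α x = gpull (show E →L[ℝ] E from mfderiv 𝓘(ℝ, E) 𝓘(ℝ, E) (chartAt E x) x)
      (gLoc (chartAt E x).symm α (chartAt E x x)) := by
  have h1 : ∀ z : M, z = x → ∀ (v : E), gVal α z = gVal α x := by
    rintro z rfl v; rfl
  have h2 := (mdifferentiable_of_mem_maximalAtlas
    (IsManifold.chart_mem_maximalAtlas x)).symm_comp_deriv (mem_chart_source E x)
  funext k
  ext v
  have h3 : gVal α ((chartAt E x).symm (chartAt E x x)) k v = gVal α x k v := by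
    rw [(chartAt E x).left_inv (mem_chart_source E x)]
  refine h3.symm.trans ?_
  refine congrArg (gVal α ((chartAt E x).symm (chartAt E x x)) k) (funext fun i => ?_)
  exact (DFunLike.congr_fun h2 (v i)).symm

variable {EG : Type*} [NormedAddCommGroup EG] [NormedSpace ℝ EG]
  {G : Type*} [TopologicalSpace G] [ChartedSpace EG G] [Group G] [LieGroup 𝓘(ℝ, EG) ∞ G]
  [MulAction G M] [ContMDiffSMul 𝓘(ℝ, EG) 𝓘(ℝ, E) ∞ G M]

/-- In a chart of `M`, the pull-back `g^* b` depends smoothly on `g` and on the point. -/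
theorem contMDiffAt_gLoc_smul {b : MForm E M} (hb : b ∈ smoothForms E M) (x : M) {y : E}
    (hy : y ∈ (chartAt E x).target) (g : G) (k : ℕ) :
    ContMDiffAt (𝓘(ℝ, EG).prod 𝓘(ℝ, E)) 𝓘(ℝ, E [⋀^Fin k]→L[ℝ] ℝ) ∞
      (fun q : G × E => gLoc (fun z => q.1 • (chartAt E x).symm z) b q.2 k) (g, y) := by
  refine contMDiffAt_gLoc_family hb (Ψ := fun (g : G) z => g • (chartAt E x).symm z) ?_ k
  filter_upwards [continuousAt_snd.preimage_mem_nhds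
    ((chartAt E x).open_target.mem_nhds (show (g, y).2 ∈ _ from hy))] with q hq
  have h1 : ContMDiffAt (𝓘(ℝ, EG).prod 𝓘(ℝ, E)) 𝓘(ℝ, E) ∞
      (fun q : G × E => (chartAt E x).symm q.2) q :=
    (contMDiffAt_symm_of_mem_maximalAtlas (IsManifold.chart_mem_maximalAtlas x) hq).comp q
      contMDiffAt_snd
  exact contMDiffAt_fst.smul h1

variable [CompactSpace G] [MeasurableSpace G] [BorelSpace G] (μ : Measure G) [IsFiniteMeasure μ]

/-- The integral of the forms `c g • g^* b`. -/
noncomputable def averageForm (c : G → ℝ) (b : MForm E M) : MForm E M := fun k x =>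
  (show E [⋀^Fin k]→L[ℝ] ℝ from
    ∫ g, c g • gVal (pullbackForm (fun x : M => g • x) b) x k ∂μ)

variable {c : G → ℝ} {b : MForm E M}

theorem isAverage_averageForm (EG : Type*) [NormedAddCommGroup EG] [NormedSpace ℝ EG]
    [ChartedSpace EG G] [LieGroup 𝓘(ℝ, EG) ∞ G] [ContMDiffSMul 𝓘(ℝ, EG) 𝓘(ℝ, E) ∞ G M]
    (hc : Continuous c) (hb : b ∈ smoothForms E M) :
    IsAverage μ (fun g => c g • pullbackForm (fun x : M => g • x) b) (averageForm μ c b) := by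
  refine fun x k => ⟨?_, rfl⟩
  refine Continuous.integrable_of_compactSpace ?_
  refine hc.smul (f := c) (g := fun g => gVal (pullbackForm (fun x : M => g • x) b) x k) ?_
  let S : (E [⋀^Fin k]→L[ℝ] ℝ) →L[ℝ] E [⋀^Fin k]→L[ℝ] ℝ :=
    ContinuousAlternatingMap.compContinuousLinearMapCLM
      (show E →L[ℝ] E from mfderiv 𝓘(ℝ, E) 𝓘(ℝ, E) (chartAt E x) x)
  have h1 : ∀ g : G, gVal (pullbackForm (fun x : M => g • x) b) x k =
      S (gLoc (fun z => g • (chartAt E x).symm z) b (chartAt E x x) k) := by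
    intro g
    rw [gVal_eq_gpull, gLoc_pullbackForm (contMDiff_smul_right EG g) b (smoothNear_chartAt x)]
    rfl
  simp only [h1]
  refine S.continuous.comp (continuous_iff_continuousAt.mpr fun g => ?_)
  exact (contMDiffAt_gLoc_smul (EG := EG) hb x (mem_chart_target E x) g
    k).continuousAt.comp (f := fun g => (g, chartAt E x x)) (by fun_prop)

theorem IsAverage.gLoc {N : Type*} [MeasurableSpace N] {ν : Measure N} {f : N → MForm E M}
    (h : IsAverage ν f b) (ψ : E' → M) (y : E') :
    HasGIntegral ν (fun t => gLoc ψ (f t) y) (gLoc ψ b y) :=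
  (h (ψ y)).gpull (show E' →L[ℝ] E from mfderiv 𝓘(ℝ, E') 𝓘(ℝ, E) ψ y)

theorem gLoc_averageForm (EG : Type*) [NormedAddCommGroup EG] [NormedSpace ℝ EG]
    [ChartedSpace EG G] [LieGroup 𝓘(ℝ, EG) ∞ G] [ContMDiffSMul 𝓘(ℝ, EG) 𝓘(ℝ, E) ∞ G M]
    (hc : Continuous c) (hb : b ∈ smoothForms E M) (x : M) {y : E}
    (hy : y ∈ (chartAt E x).target) (k : ℕ) :
    gLoc (chartAt E x).symm (averageForm μ c b) y k =
      ∫ g, c g • gLoc (fun z => g • (chartAt E x).symm z) b y k ∂μ := by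
  refine ((isAverage_averageForm μ EG hc hb).gLoc (chartAt E x).symm y k).2.trans ?_
  refine integral_congr_ae (Filter.Eventually.of_forall fun g => ?_)
  exact congrArg (fun a : GForm E => c g • a k) (gLoc_pullbackForm (contMDiff_smul_right EG g) b
    (smoothNear_chart_symm x hy))

theorem averageForm_mem_smoothForms (EG : Type*) [NormedAddCommGroup EG] [NormedSpace ℝ EG]
    [ChartedSpace EG G] [LieGroup 𝓘(ℝ, EG) ∞ G] [ContMDiffSMul 𝓘(ℝ, EG) 𝓘(ℝ, E) ∞ G M]
    (hc : Continuous c) (hb : b ∈ smoothForms E M) : averageForm μ c b ∈ smoothForms E M := by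
  refine fun k x => ?_
  refine (contDiffOn_integral_of_contMDiffAt (EG := EG) (μ := μ) hc (chartAt E x).open_target
    (f := fun (g : G) y => gLoc (fun z => g • (chartAt E x).symm z) b y k)
    fun g y hy => contMDiffAt_gLoc_smul hb x hy g k).congr fun y hy => ?_
  exact gLoc_averageForm μ EG hc hb x hy k

/-- The exterior derivative may be taken under the integral. -/
theorem extDer_averageForm (EG : Type*) [NormedAddCommGroup EG] [NormedSpace ℝ EG]
    [ChartedSpace EG G] [LieGroup 𝓘(ℝ, EG) ∞ G] [ContMDiffSMul 𝓘(ℝ, EG) 𝓘(ℝ, E) ∞ G M]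
    (hc : Continuous c) (hb : b ∈ smoothForms E M) :
    extDer (averageForm μ c b) = averageForm μ c (extDer b) := by
  refine mform_ext fun x => gAt_eq_of_chart ?_
  have hx := smoothNear_chartAt (E := E) x
  rw [gLoc_extDer (averageForm_mem_smoothForms μ EG hc hb) hx]
  funext k
  rw [gLoc_averageForm μ EG hc (extDer_mem_smoothForms hb) x (mem_chart_target E x)]
  have h1 : ∀ g : G, gLoc (fun z => g • (chartAt E x).symm z) (extDer b) (chartAt E x x) =
      gd (gLoc (fun z => g • (chartAt E x).symm z) b) (chartAt E x x) := fun g =>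
    gLoc_extDer hb (hx.comp (contMDiff_smul_right EG g))
  simp only [h1]
  cases k with
  | zero =>
    simp only [gd_zero, smul_zero, integral_zero]
  | succ k =>
    have : CompleteSpace (E [⋀^Fin (k + 1)]→L[ℝ] ℝ) := FiniteDimensional.complete ℝ _
    simp only [gd_succ]
    have h2 : (gLoc (chartAt E x).symm (averageForm μ c b) · k) =ᶠ[nhds (chartAt E x x)]
        fun y => ∫ g, c g • gLoc (fun z => g • (chartAt E x).symm z) b y k ∂μ := by
      filter_upwards [(chartAt E x).open_target.mem_nhds (mem_chart_target E x)] with y hy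
      exact gLoc_averageForm μ EG hc hb x hy k
    have hf := fun (g : G) (y : E) (hy : y ∈ (chartAt E x).target) =>
      contMDiffAt_gLoc_smul (EG := EG) hb x hy g k
    have h3 := hasFDerivAt_integral_of_contMDiffAt (μ := μ) hc (chartAt E x).open_target
      (f := fun (g : G) y => gLoc (fun z => g • (chartAt E x).symm z) b y k) hf
      (mem_chart_target E x)
    rw [h2.extDeriv_eq, extDeriv, h3.fderiv]
    let A : (E →L[ℝ] E [⋀^Fin k]→L[ℝ] ℝ) →L[ℝ] E [⋀^Fin (k + 1)]→L[ℝ] ℝ :=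
      ContinuousAlternatingMap.alternatizeUncurryFinCLM ℝ E ℝ
    have h4 : Continuous fun g : G => c g •
        fderiv ℝ (fun y => gLoc (fun z => g • (chartAt E x).symm z) b y k) (chartAt E x x) := by
      refine hc.smul (continuous_iff_continuousAt.mpr fun g => ?_)
      exact (ContMDiffAt.fderiv_snd (f := fun (g : G) y =>
        gLoc (fun z => g • (chartAt E x).symm z) b y k) (hf g _ (mem_chart_target E
          x))).continuousAt.comp (f := fun g : G => (g, chartAt E x x)) (by fun_prop)
    refine (ContinuousLinearMap.integral_comp_comm (𝕜 := ℝ)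
      (Fₗ := E [⋀^Fin (k + 1)]→L[ℝ] ℝ) (μ := μ) A (Continuous.integrable_of_compactSpace
        (Z := E →L[ℝ] E [⋀^Fin k]→L[ℝ] ℝ) h4)).symm.trans ?_
    refine integral_congr_ae (Filter.Eventually.of_forall fun g => ?_)
    exact map_smul A _ _

end Average

/-! ### Lifting polynomial families equivariantly -/

section AdjointContinuity

variable {EG : Type*} [NormedAddCommGroup EG] [NormedSpace ℝ EG] [FiniteDimensional ℝ EG]
  {G : Type*} [TopologicalSpace G] [ChartedSpace EG G] [Group G] [LieGroup 𝓘(ℝ, EG) ∞ G]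

/-- In a chart `κ` at `1`, the derivative at `κ 1` of `z ↦ κ (g κ⁻¹(z) g⁻¹)` depends smoothly on
`g`. -/
theorem continuous_adjointAction (ξ : GroupLieAlgebra 𝓘(ℝ, EG) G) :
    Continuous fun g : G => (adjointAction g ξ : EG) := by
  set κ := chartAt EG (1 : G) with hκ
  set z₀ := κ 1 with hz₀
  have hz₀t : z₀ ∈ κ.target := mem_chart_target EG (1 : G)
  have hκs : (1 : G) ∈ κ.source := mem_chart_source EG (1 : G)
  have hκm : κ.MDifferentiable 𝓘(ℝ, EG) 𝓘(ℝ, EG) :=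
    mdifferentiable_of_mem_maximalAtlas (IsManifold.chart_mem_maximalAtlas (1 : G))
  have hκz : κ.symm z₀ = 1 := κ.left_inv hκs
  let f : G → EG → EG := fun g z => κ (g * κ.symm z * g⁻¹)
  have hf : ∀ g, ContMDiffAt (𝓘(ℝ, EG).prod 𝓘(ℝ, EG)) 𝓘(ℝ, EG) ∞ (Function.uncurry f) (g, z₀) := by
    intro g
    have h1 : ContMDiffAt (𝓘(ℝ, EG).prod 𝓘(ℝ, EG)) 𝓘(ℝ, EG) ∞
        (fun q : G × EG => κ.symm q.2) (g, z₀) :=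
      (contMDiffAt_symm_of_mem_maximalAtlas (IsManifold.chart_mem_maximalAtlas (1 : G))
        hz₀t).comp (g, z₀) contMDiffAt_snd
    have h2 : ContMDiffAt (𝓘(ℝ, EG).prod 𝓘(ℝ, EG)) 𝓘(ℝ, EG) ∞
        (fun q : G × EG => q.1 * κ.symm q.2 * q.1⁻¹) (g, z₀) :=
      (contMDiffAt_fst.mul h1).mul contMDiffAt_fst.inv
    refine ContMDiffAt.comp (g, z₀) (g := κ) (f := fun q : G × EG => q.1 * κ.symm q.2 * q.1⁻¹)
      (contMDiffAt_of_mem_maximalAtlas (IsManifold.chart_mem_maximalAtlas (1 : G)) ?_) h2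
    change g * κ.symm z₀ * g⁻¹ ∈ κ.source
    rw [hκz, mul_one, mul_inv_cancel]
    exact hκs
  have h1 : ∀ g : G, (adjointAction g ξ : EG) =
      (show EG →L[ℝ] EG from mfderiv 𝓘(ℝ, EG) 𝓘(ℝ, EG) κ.symm z₀) (fderiv ℝ (f g) z₀
        (show EG from mfderiv 𝓘(ℝ, EG) 𝓘(ℝ, EG) κ 1 ξ)) := by
    intro g
    have h2 := mfderiv_comp (I := 𝓘(ℝ, EG)) (I' := 𝓘(ℝ, EG)) (I'' := 𝓘(ℝ, EG)) z₀
      (g := fun h : G => g * h * g⁻¹) (f := κ.symm)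
      ((contMDiff_conj g).mdifferentiable (by simp) _) (hκm.symm.mdifferentiableAt hz₀t)
    have h3 := mfderiv_comp (I := 𝓘(ℝ, EG)) (I' := 𝓘(ℝ, EG)) (I'' := 𝓘(ℝ, EG)) z₀
      (g := κ.symm) (f := f g) (hκm.symm.mdifferentiableAt (by
        change κ (g * κ.symm z₀ * g⁻¹) ∈ κ.target
        rw [hκz, mul_one, mul_inv_cancel]
        exact hz₀t)) (ContMDiffAt.mdifferentiableAt (ContMDiffAt.comp z₀
          (g := Function.uncurry f) (f := fun z => (g, z)) (hf g)
          (contMDiffAt_const.prodMk contMDiffAt_id)) (by simp))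
    have h4 : (fun h : G => g * h * g⁻¹) ∘ κ.symm =ᶠ[nhds z₀] κ.symm ∘ f g := by
      have h5 : ContinuousAt (fun z => g * κ.symm z * g⁻¹) z₀ :=
        ((contMDiff_conj (EG := EG) g).continuous.continuousAt).comp (κ.continuousAt_symm hz₀t)
      filter_upwards [h5.preimage_mem_nhds (κ.open_source.mem_nhds (by
        rw [hκz, mul_one, mul_inv_cancel]
        exact hκs))] with z hz
      exact (κ.left_inv hz).symm
    have h5 : ∀ k : G, k = 1 → ∀ v : EG,
        (mfderiv 𝓘(ℝ, EG) 𝓘(ℝ, EG) (fun h : G => g * h * g⁻¹) k v : EG) =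
          (mfderiv 𝓘(ℝ, EG) 𝓘(ℝ, EG) (fun h : G => g * h * g⁻¹) 1 v : EG) := by
      rintro k rfl v; rfl
    have h6 : ∀ z : EG, z = z₀ → ∀ v : EG,
        (mfderiv 𝓘(ℝ, EG) 𝓘(ℝ, EG) κ.symm z v : EG) = mfderiv 𝓘(ℝ, EG) 𝓘(ℝ, EG) κ.symm z₀ v := by
      rintro k rfl v; rfl
    have h7 : f g z₀ = z₀ := by
      change κ (g * κ.symm z₀ * g⁻¹) = κ 1
      rw [hκz, mul_one, mul_inv_cancel]
    have h8 : (mfderiv 𝓘(ℝ, EG) 𝓘(ℝ, EG) κ.symm z₀ (mfderiv 𝓘(ℝ, EG) 𝓘(ℝ, EG) κ 1 ξ) : EG) = ξ :=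
      DFunLike.congr_fun (hκm.symm_comp_deriv hκs) ξ
    rw [mfderiv_eq_fderiv (f := f g)] at h3
    have h9 := DFunLike.congr_fun (h2.symm.trans (h4.mfderiv_eq.trans h3))
      (show EG from mfderiv 𝓘(ℝ, EG) 𝓘(ℝ, EG) κ 1 ξ)
    have h10 : (mfderiv 𝓘(ℝ, EG) 𝓘(ℝ, EG) (fun h : G => g * h * g⁻¹) (κ.symm z₀)
        (mfderiv 𝓘(ℝ, EG) 𝓘(ℝ, EG) κ.symm z₀ (mfderiv 𝓘(ℝ, EG) 𝓘(ℝ, EG) κ 1 ξ)) : EG) =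
        adjointAction g ξ :=
      (h5 _ hκz _).trans (congrArg (show EG →L[ℝ] EG from
        mfderiv 𝓘(ℝ, EG) 𝓘(ℝ, EG) (fun h : G => g * h * g⁻¹) 1) h8)
    exact h10.symm.trans (Eq.trans h9 (h6 _ h7 _))
  simp only [h1]
  refine (ContinuousLinearMap.continuous (show EG →L[ℝ] EG from
    mfderiv 𝓘(ℝ, EG) 𝓘(ℝ, EG) κ.symm z₀)).comp (continuous_iff_continuousAt.mpr fun g => ?_)
  have h2 : ContinuousAt (fun g => fderiv ℝ (f g) z₀) g :=
    (ContMDiffAt.fderiv_snd (f := f) (hf g)).continuousAt.comp (f := fun g : G => (g, z₀))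
      (by fun_prop)
  exact h2.clm_apply continuousAt_const

end AdjointContinuity

/-- A linear map `T` has a linear generalised inverse: a map `s` with `T s T = T`. -/
theorem LinearMap.exists_comp_comp_eq {K X Y : Type*} [Field K] [AddCommGroup X] [Module K X]
    [AddCommGroup Y] [Module K Y] (T : X →ₗ[K] Y) : ∃ s : Y →ₗ[K] X, ∀ x, T (s (T x)) = T x := by
  obtain ⟨s₀, hs₀⟩ := T.rangeRestrict.exists_rightInverse_of_surjective T.range_rangeRestrict
  obtain ⟨s, hs⟩ := s₀.exists_extend
  refine ⟨s, fun x => ?_⟩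
  have h1 : s (T x) = s₀ ⟨T x, ⟨x, rfl⟩⟩ := DFunLike.congr_fun hs ⟨T x, ⟨x, rfl⟩⟩
  rw [h1]
  exact congrArg Subtype.val (DFunLike.congr_fun hs₀ ⟨T x, ⟨x, rfl⟩⟩)

section Lift

open MeasureTheory

variable {E : Type*} [NormedAddCommGroup E] [NormedSpace ℝ E] [FiniteDimensional ℝ E]
  {M : Type*} [TopologicalSpace M] [ChartedSpace E M] [IsManifold 𝓘(ℝ, E) ∞ M] [T2Space M]
  {n : ℕ} {F : Foliation E M (2 * n)} {σ : KForm E M 2}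

section BasicAverage

variable {N : Type*} [MeasurableSpace N] {μ : Measure N} {f f' : N → F.basicForms}
  {a a' : F.basicForms}

theorem IsAverage.basic_unique {f : N → MForm E M} (h : IsAverage μ f a.1)
    (h' : IsAverage μ f a'.1) : a = a' :=
  Foliation.IsTransverselySymplectic.basic_ext fun x => (h x).unique (h' x)

theorem IsAverage.basic_const [IsProbabilityMeasure μ] (a : F.basicForms) :
    IsAverage μ (fun _ => a.1) a.1 := fun _ => hasGIntegral_const _

theorem IsAverage.basic_add (h : IsAverage μ (fun t => (f t).1) a.1)
    (h' : IsAverage μ (fun t => (f' t).1) a'.1) :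
    IsAverage μ (fun t => (f t + f' t).1) (a + a').1 := fun x => (h x).add (h' x)

theorem IsAverage.basic_smul (h : IsAverage μ (fun t => (f t).1) a.1) (r : ℝ) :
    IsAverage μ (fun t => (r • f t).1) (r • a).1 := fun x => (h x).smul r

theorem IsAverage.basic_sum {ι : Type*} {s : Finset ι} {f : ι → N → F.basicForms}
    {a : ι → F.basicForms} (h : ∀ i, IsAverage μ (fun t => (f i t).1) (a i).1) :
    IsAverage μ (fun t => (∑ i ∈ s, f i t).1) (∑ i ∈ s, a i).1 := by
  classical
  induction s using Finset.induction_on with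
  | empty =>
    simp only [Finset.sum_empty]
    exact fun x k => ⟨integrable_zero N (E [⋀^Fin k]→L[ℝ] ℝ) μ, (integral_zero N _).symm⟩
  | insert i s hi ih =>
    simp only [Finset.sum_insert hi]
    exact (h i).basic_add ih

theorem IsAverage.basic_Λ (hσ : F.IsTransverselySymplectic σ)
    (h : IsAverage μ (fun t => (f t).1) a.1) :
    IsAverage μ (fun t => (hσ.Λ (f t)).1) (hσ.Λ a).1 := by
  intro x
  obtain ⟨e, e', he⟩ := hσ.exists_isFrame x
  have h1 : ∀ b : F.basicForms, gVal (hσ.Λ b).1 x =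
      gΛ (show Fin (2 * n) → E from e) (show Fin (2 * n) → E from e') (gVal b.1 x) :=
    fun b => hσ.gAt_Λ b x he.dual
  simp only [h1]
  exact (h x).gΛ _ _

theorem IsAverage.basic_pull (hσ : F.IsTransverselySymplectic σ) {φ : M → M}
    (hφ : IsSymplecticMap σ φ) (h : IsAverage μ (fun t => (f t).1) a.1) :
    IsAverage μ (fun t => (hσ.pull hφ (f t)).1) (hσ.pull hφ a).1 := fun x =>
  (h (φ x)).gpull (show E →L[ℝ] E from mfderiv 𝓘(ℝ, E) 𝓘(ℝ, E) φ x)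

end BasicAverage

variable {EG : Type*} [NormedAddCommGroup EG] [NormedSpace ℝ EG]
  {G : Type*} [TopologicalSpace G] [ChartedSpace EG G] [Group G] [LieGroup 𝓘(ℝ, EG) ∞ G]
  [MulAction G M] [ContMDiffSMul 𝓘(ℝ, EG) 𝓘(ℝ, E) ∞ G M]
  [CompactSpace G] [MeasurableSpace G] [BorelSpace G]

/-- Transversality consists of linear conditions at each point on the form and its derivative, all
of which pass to integrals. -/
theorem IsTransverse.averageForm (EG : Type*) [NormedAddCommGroup EG] [NormedSpace ℝ EG]
    [ChartedSpace EG G] [LieGroup 𝓘(ℝ, EG) ∞ G] [ContMDiffSMul 𝓘(ℝ, EG) 𝓘(ℝ, E) ∞ G M]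
    (μ : Measure G) [IsFiniteMeasure μ] (hg : ∀ g : G, IsSymplecticMap σ (fun x : M => g • x))
    {c : G → ℝ} (hc : Continuous c) {b : MForm E M} (hb : IsTransverse σ b) :
    IsTransverse σ (averageForm μ c b) := by
  have key : ∀ b : MForm E M, b ∈ smoothForms E M → (∀ x, gAt b x ∈ gHor (σ x)) → ∀ x,
      gAt (_root_.averageForm μ c b) x ∈ gHor (σ x) := by
    intro b hb hor x u hu
    refine ((isAverage_averageForm μ EG hc hb x).gι u).unique ?_
    have h1 : ∀ g : G, gι (show E from u)
        (gVal (c g • _root_.pullbackForm (fun x : M => g • x) b) x) = 0 := by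
      intro g
      have h2 : gAt (_root_.pullbackForm (fun x : M => g • x) b) x ∈ gHor (σ x) := by
        rw [gAt_pullbackForm, ← (hg g).comp_eq x, gpull_mem_gHor ((hg g).surjective x)]
        exact hor _
      exact Submodule.smul_mem _ (c g) h2 u hu
    simp only [h1]
    exact fun k => ⟨integrable_zero G (E [⋀^Fin k]→L[ℝ] ℝ) μ, (integral_zero G _).symm⟩
  refine ⟨averageForm_mem_smoothForms μ EG hc hb.smooth, key b hb.smooth hb.hor, ?_⟩
  rw [extDer_averageForm μ EG hc hb.smooth]
  exact key _ (extDer_mem_smoothForms hb.smooth) hb.dhor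

variable (hσ : F.IsTransverselySymplectic σ) (hg : ∀ g : G, IsSymplecticMap σ (fun x : M => g • x))
  (μ : Measure G) [IsFiniteMeasure μ]

/-- The integrals of the forms `c g • g^* b` are basic, and taking them commutes with `d δ`, because
it commutes with `d` and `Λ`. -/
theorem exists_isAverage_basic (EG : Type*) [NormedAddCommGroup EG] [NormedSpace ℝ EG]
    [ChartedSpace EG G] [LieGroup 𝓘(ℝ, EG) ∞ G] [ContMDiffSMul 𝓘(ℝ, EG) 𝓘(ℝ, E) ∞ G M]
    {c : G → ℝ} (hc : Continuous c) (b : F.basicForms) :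
    ∃ a : F.basicForms, IsAverage μ (fun g => (c g • hσ.pull (hg g) b).1) a.1 ∧
      IsAverage μ (fun g => (c g • hσ.pull (hg g) (hσ.d (lefschetzDelta hσ.Λ hσ.d b))).1)
        (hσ.d (lefschetzDelta hσ.Λ hσ.d a)).1 := by
  let avg : F.basicForms → F.basicForms := fun b => ⟨averageForm μ c b.1,
    (Foliation.mem_basicForms_iff hσ).mpr ((hσ.isTransverse b).averageForm EG μ hg hc)⟩
  have havg : ∀ b, IsAverage μ (fun g => (c g • hσ.pull (hg g) b).1) (avg b).1 := fun b =>
    isAverage_averageForm μ EG hc (hσ.isTransverse b).smooth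
  have hd : ∀ b, hσ.d (avg b) = avg (hσ.d b) := fun b =>
    Subtype.ext (extDer_averageForm μ EG hc (hσ.isTransverse b).smooth)
  have hΛ : ∀ b, hσ.Λ (avg b) = avg (hσ.Λ b) := fun b => by
    refine ((havg b).basic_Λ hσ).basic_unique ?_
    simpa only [map_smul, ← hσ.pull_Λ] using havg (hσ.Λ b)
  have hsub : ∀ a b, avg (a - b) = avg a - avg b := fun a b => by
    refine eq_sub_of_add_eq (IsAverage.basic_unique ?_ (havg a))
    simpa only [← smul_add, ← map_add, sub_add_cancel] using (havg (a - b)).basic_add (havg b)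
  refine ⟨avg b, havg b, ?_⟩
  have h1 : hσ.d (lefschetzDelta hσ.Λ hσ.d (avg b)) =
      avg (hσ.d (lefschetzDelta hσ.Λ hσ.d b)) := by
    rw [lefschetzDelta_apply, lefschetzDelta_apply, hd, hΛ, hΛ, hd, ← hsub, hd]
  rw [h1]
  exact havg _

variable [FiniteDimensional ℝ EG]

/-- The family `ξ ↦ ∫ g^* β (Ad_g ξ)` is polynomial for polynomial `β`, since `Ad_g` enters a
polynomial through finitely many continuous functions of `g`. -/
theorem exists_isAverage_polyFamilies {β : GroupLieAlgebra 𝓘(ℝ, EG) G → F.basicForms}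
    (hβ : β ∈ polyFamilies _ F.basicForms) :
    ∃ γ ∈ polyFamilies _ F.basicForms, ∀ ξ,
      IsAverage μ (fun g => (hσ.pull (hg g) (β (adjointAction g ξ))).1) (γ ξ).1 ∧
        IsAverage μ (fun g => (hσ.pull (hg g) (hσ.d (lefschetzDelta hσ.Λ hσ.d
          (β (adjointAction g ξ))))).1) (hσ.d (lefschetzDelta hσ.Λ hσ.d (γ ξ))).1 := by
  refine polyFamilies_induction (P := fun β => ∃ γ ∈ polyFamilies _ F.basicForms, ∀ ξ,
      IsAverage μ (fun g => (hσ.pull (hg g) (β (adjointAction g ξ))).1) (γ ξ).1 ∧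
        IsAverage μ (fun g => (hσ.pull (hg g) (hσ.d (lefschetzDelta hσ.Λ hσ.d
          (β (adjointAction g ξ))))).1) (hσ.d (lefschetzDelta hσ.Λ hσ.d (γ ξ))).1) hβ ?_ ?_
  · intro p hp b
    have hA : ∀ (l : Module.Dual ℝ (GroupLieAlgebra 𝓘(ℝ, EG) G)) v,
        Continuous fun g : G => l (adjointLinear g v) := fun l v =>
      (LinearMap.toContinuousLinearMap (show EG →ₗ[ℝ] ℝ from l)).continuous.comp
        (continuous_adjointAction v)
    obtain ⟨N, c, r, hc, hr, hcr⟩ := exists_polyFunctions_comp hA hp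
    have hcr' : ∀ (g : G) ξ, p (adjointAction g ξ) = ∑ j, c j g * r j ξ := hcr
    choose a ha ha' using fun j => exists_isAverage_basic hσ hg μ EG (hc j) b
    refine ⟨∑ j, fun ξ => r j ξ • a j,
      Submodule.sum_mem _ fun j _ => smul_mem_polyFamilies (hr j) _, fun ξ => ?_⟩
    rw [Finset.sum_apply]
    have key : ∀ (g : G) (a : F.basicForms), p (adjointAction g ξ) • hσ.pull (hg g) a =
        ∑ j, r j ξ • c j g • hσ.pull (hg g) a := by
      intro g a
      rw [hcr', Finset.sum_smul]
      exact Finset.sum_congr rfl fun j _ => by rw [smul_smul, mul_comm (r j ξ)]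
    constructor
    · simp only [map_smul, key]
      exact IsAverage.basic_sum fun j => (ha j).basic_smul (r j ξ)
    · simp only [map_smul, map_sum, key]
      exact IsAverage.basic_sum fun j => (ha' j).basic_smul (r j ξ)
  · rintro α β ⟨γ, hγ, h⟩ ⟨γ', hγ', h'⟩
    refine ⟨γ + γ', add_mem hγ hγ', fun ξ => ⟨?_, ?_⟩⟩
    · simpa only [Pi.add_apply, map_add] using (h ξ).1.basic_add (h' ξ).1
    · simpa only [Pi.add_apply, map_add] using (h ξ).2.basic_add (h' ξ).2

/-- An equivariant family whose values are of the form `d δ x` is of the form `d δ β` for an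
equivariant family `β`: a linear section of `d δ` provides a polynomial family, which is averaged
over the group. -/
theorem exists_equivariant_lift [T2Space G] {α : GroupLieAlgebra 𝓘(ℝ, EG) G → F.basicForms}
    (hα : α ∈ equivariantFamilies EG hσ hg)
    (h : ∀ ξ, ∃ x, α ξ = hσ.d (lefschetzDelta hσ.Λ hσ.d x)) :
    ∃ β ∈ equivariantFamilies EG hσ hg, ∀ ξ, α ξ = hσ.d (lefschetzDelta hσ.Λ hσ.d (β ξ)) := by
  have : IsTopologicalGroup G := topologicalGroup_of_lieGroup 𝓘(ℝ, EG) ∞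
  let ν : Measure G := Measure.haarMeasure ⊤
  have hν : IsProbabilityMeasure ν := ⟨Measure.haarMeasure_self⟩
  -- `g ↦ g^*` reverses products, so a right invariant measure is needed: the inverse of the Haar
  -- measure, which is left invariant
  have hμ : IsProbabilityMeasure ν.inv := Measure.isProbabilityMeasure_map (by fun_prop)
  let T : F.basicForms →ₗ[ℝ] F.basicForms := hσ.d ∘ₗ lefschetzDelta hσ.Λ hσ.d
  obtain ⟨s, hs⟩ := T.exists_comp_comp_eq
  have hα' : ∀ ξ, T (s (α ξ)) = α ξ := fun ξ => by
    obtain ⟨x, hx⟩ := h ξ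
    rw [hx]
    exact hs x
  obtain ⟨β, hβ, hav⟩ := exists_isAverage_polyFamilies hσ hg ν.inv
    (map_mem_polyFamilies hα.1 s)
  refine ⟨β, ⟨hβ, fun k ξ => ?_⟩, fun ξ => ?_⟩
  · refine ((hav (adjointAction k ξ)).1.basic_pull hσ (hg k)).basic_unique fun x j => ?_
    obtain ⟨h1, h2⟩ := (hav ξ).1 x j
    simp only [hσ.pull_pull, ← adjointAction_mul]
    exact ⟨h1.comp_mul_right k, h2.trans (integral_mul_right_eq_self _ k).symm⟩
  · -- the integrand of `d δ (β ξ)` is `g^* α (Ad_g ξ) = α ξ`, which is constant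
    refine (IsAverage.basic_const (μ := ν.inv) (α ξ)).basic_unique ?_
    have h1 := (hav ξ).2
    have h2 : ∀ g : G, hσ.d (lefschetzDelta hσ.Λ hσ.d (s (α (adjointAction g ξ)))) =
      α (adjointAction g ξ) := fun g => hα' _
    simpa only [h2, hα.2] using h1

end Lift

/-! ### The equivariant basic forms -/

section EquivariantComplex

variable {E : Type*} [NormedAddCommGroup E] [NormedSpace ℝ E] [FiniteDimensional ℝ E]
  {M : Type*} [TopologicalSpace M] [ChartedSpace E M] [IsManifold 𝓘(ℝ, E) ∞ M] [T2Space M]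
  {EG : Type*} [NormedAddCommGroup EG] [NormedSpace ℝ EG] [FiniteDimensional ℝ EG]
  {G : Type*} [TopologicalSpace G] [ChartedSpace EG G] [Group G] [LieGroup 𝓘(ℝ, EG) ∞ G]
  [T2Space G] [CompactSpace G] [MulAction G M] [ContMDiffSMul 𝓘(ℝ, EG) 𝓘(ℝ, E) ∞ G M]
  {n : ℕ} {F : Foliation E M (2 * n)} {σ : KForm E M 2}

/-- `𝓛(ξ_M) (α ξ) = 0` for an equivariant family `α`, since `α ξ` is invariant under the stabiliser
of `ξ`. -/
theorem cartan_of_mem_equivariantFamilies {hσ : F.IsTransverselySymplectic σ}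
    {hg : ∀ g : G, IsSymplecticMap σ (fun x : M => g • x)}
    {f : GroupLieAlgebra 𝓘(ℝ, EG) G → M → ℝ}
    (hf : ∀ ξ, IsHamiltonianFunction σ (f ξ) (fundamentalField ξ))
    {α : GroupLieAlgebra 𝓘(ℝ, EG) G → F.basicForms} (hα : α ∈ equivariantFamilies EG hσ hg)
    (ξ : GroupLieAlgebra 𝓘(ℝ, EG) G) :
    hσ.d (hσ.contraction (hf ξ) (α ξ)) + hσ.contraction (hf ξ) (hσ.d (α ξ)) = 0 := by
  refine Subtype.ext ?_
  rw [Submodule.coe_add, hσ.d_val, hσ.contraction_val, hσ.contraction_val, hσ.d_val]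
  refine cartan_of_pullbackForm_eq (hσ.isTransverse _).smooth ?_ fun g h => ?_
  · rw [← hσ.contraction_val (hf ξ)]
    exact (hσ.isTransverse _).smooth
  · have h1 := congrArg Subtype.val (hα.2 g ξ)
    rw [h] at h1
    exact h1

/-- The hypotheses of the abstract equivariant `dδ`-lemma hold for the equivariant basic forms. -/
theorem isEquivariantComplex (hσ : F.IsTransverselySymplectic σ) (hL : F.HardLefschetz σ)
    (hg : ∀ g : G, IsSymplecticMap σ (fun x : M => g • x))
    {f : GroupLieAlgebra 𝓘(ℝ, EG) G → M → ℝ}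
    (hf : ∀ ξ, IsHamiltonianFunction σ (f ξ) (fundamentalField ξ)) :
    IsEquivariantComplex n F.basicDegree hσ.L hσ.Λ hσ.d hσ.part
      (fun ξ => hσ.contraction (hf ξ)) (equivariantFamilies EG hσ hg) where
  complex := hσ.isLefschetzComplex
  hardLefschetz := hσ.hasHardLefschetz hL
  grading := hσ.isGrading
  d_mem hα := map_mem_equivariantFamilies hα _ fun g a => hσ.pull_d (hg g) a
  delta_mem hα := map_mem_equivariantFamilies hα _ fun g a => hσ.pull_delta (hg g) a
  part_mem k hα := map_mem_equivariantFamilies hα _ fun g a => hσ.pull_part (hg g) k a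
  ι_mem hα := contraction_mem_equivariantFamilies hα hf
  ι_deg h := hσ.contraction_mem _ h
  ι_low h := hσ.contraction_eq_zero _ h
  ι_exact h := hσ.exists_contraction_eq_delta _ h
  delta_ι ξ a := hσ.delta_contraction _ a
  cartan hα ξ := cartan_of_mem_equivariantFamilies hf hα ξ
  lift hα h := by
    let : MeasurableSpace G := borel G
    have : BorelSpace G := ⟨rfl⟩
    exact exists_equivariant_lift hσ hg hα h

end EquivariantComplex

theorem mainTheorem2
    {E : Type*} [NormedAddCommGroup E] [NormedSpace ℝ E] [FiniteDimensional ℝ E]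
    {M : Type*} [TopologicalSpace M] [ChartedSpace E M] [IsManifold 𝓘(ℝ, E) ∞ M]
    [T2Space M] [CompactSpace M]
    {EG : Type*} [NormedAddCommGroup EG] [NormedSpace ℝ EG] [FiniteDimensional ℝ EG]
    {G : Type*} [TopologicalSpace G] [ChartedSpace EG G] [Group G] [LieGroup 𝓘(ℝ, EG) ∞ G]
    [T2Space G] [CompactSpace G] [ConnectedSpace G]
    [MulAction G M] [ContMDiffSMul 𝓘(ℝ, EG) 𝓘(ℝ, E) ∞ G M]
    {n : ℕ} (F : Foliation E M (2 * n)) (σ : KForm E M 2)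
    (hσ : F.IsTransverselySymplectic σ)
    (hL : F.HardLefschetz σ)
    (hG : IsHamiltonian EG G σ)
    (α : GroupLieAlgebra 𝓘(ℝ, EG) G → MForm E M)
    (hα : F.IsEquivariantBasic α)
    (hdα : equivariantD α = 0)
    (hδα : equivariantDelta n σ α = 0)
    (hex : (∃ γ : GroupLieAlgebra 𝓘(ℝ, EG) G → MForm E M,
        F.IsEquivariantBasic γ ∧ α = equivariantD γ) ∨
      (∃ γ : GroupLieAlgebra 𝓘(ℝ, EG) G → MForm E M,
        F.IsEquivariantBasic γ ∧ α = equivariantDelta n σ γ)) :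
    ∃ β : GroupLieAlgebra 𝓘(ℝ, EG) G → MForm E M,
      F.IsEquivariantBasic β ∧ α = equivariantD (equivariantDelta n σ β) := by
  obtain ⟨hinv, Φ, -, hΦ⟩ := hG
  have hg : ∀ g : G, IsSymplecticMap σ (fun x : M => g • x) := fun g =>
    ⟨contMDiff_smul_right EG g, surjective_mfderiv_smul EG g, hinv g⟩
  have hf : ∀ ξ : GroupLieAlgebra 𝓘(ℝ, EG) G,
      IsHamiltonianFunction σ (fun x => Φ x ξ) (fundamentalField ξ) := fun ξ =>
    ⟨(hΦ ξ).1, (hΦ ξ).2⟩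
  have hD : ∀ β : GroupLieAlgebra 𝓘(ℝ, EG) G → F.basicForms,
      equivariantD (fun ξ => (β ξ).1) =
        fun ξ => (cartanD hσ.d (fun ξ => hσ.contraction (hf ξ)) β ξ).1 := fun β =>
    funext fun ξ => by
      rw [cartanD_apply, Submodule.coe_sub, hσ.contraction_val, hσ.d_val]
      rfl
  have hΔ : ∀ β : GroupLieAlgebra 𝓘(ℝ, EG) G → F.basicForms,
      equivariantDelta n σ (fun ξ => (β ξ).1) =
        fun ξ => (lefschetzDelta hσ.Λ hσ.d (β ξ)).1 := fun β =>
    funext fun ξ => (hσ.delta_val (β ξ)).symm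
  obtain ⟨a, ha, rfl⟩ := (Foliation.isEquivariantBasic_iff (hσ := hσ) (hg := hg)).mp hα
  rw [hD] at hdα
  rw [hΔ] at hδα
  obtain ⟨b, hb, hab⟩ := (isEquivariantComplex hσ hL hg hf).exists_eq_cartanD_delta
    (fun ξ x => hσ.contraction_contraction (hf ξ) x) ha
    (funext fun ξ => Subtype.ext (congrFun hdα ξ)) (fun ξ => Subtype.ext (congrFun hδα ξ)) (by
      rcases hex with ⟨γ, hγ, h⟩ | ⟨γ, hγ, h⟩
      · obtain ⟨c, hc, rfl⟩ := (Foliation.isEquivariantBasic_iff (hσ := hσ) (hg := hg)).mp hγ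
        rw [hD] at h
        exact Or.inl ⟨c, hc, funext fun ξ => Subtype.ext (congrFun h ξ)⟩
      · obtain ⟨c, hc, rfl⟩ := (Foliation.isEquivariantBasic_iff (hσ := hσ) (hg := hg)).mp hγ
        rw [hΔ] at h
        exact Or.inr fun ξ => ⟨c ξ, Subtype.ext (congrFun h ξ)⟩)
  refine ⟨fun ξ => (b ξ).1,
    (Foliation.isEquivariantBasic_iff (hσ := hσ) (hg := hg)).mpr ⟨b, hb, rfl⟩, ?_⟩
  rw [hΔ, hD, ← hab]
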